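/- **Setting.** Let $\sigma=\pm1$, let $b,c$ be real constants with $b\neq0$, let $U\subseteq\mathbb R^2$ be open, and let $S(t,x)\neq0$, $F(x)>0$, $P(x)>0$ be smooth on $U$. On $U\times\mathbb R^2$ consider the diagonal metric of Lie algebra A $$ds^2=\frac1{S^2(t,x)}\Big[\sigma(-dt^2+dx^2)+\frac{F(x)}{P(x)}e^{-(b+c)t}dy^2+F(x)P(x)e^{(b-c)t}dz^2\Big].$$ For $\sigma=1$ the orbits of the three-dimensional conformal group generated by $\partial_y$, $\partial_z$ and $\vec k=\partial_t+\frac{c+b}2y\,\partial_y+\frac{c-b}2z\,\partial_z$ are timelike; for $\sigma=-1$ they are spacelike (renaming $t\leftrightarrow x$ gives the line-element with $t$ and $x$ interchanged in the metric functions). The metric is a *perfect fluid* at a point if its Einstein tensor there is $(\rho+p)u_\alpha u_\beta+p\,g_{\alpha\beta}$ with $u_\alpha u^\alpha=-1$ and $\rho+p\neq0$. Write $q=P'/(bP)$. In each of the following families, on an open set $V$ of values of $(t,x)$, one has $P'\neq0$ and $S=G(x)\,H(t+bK(x))$ with $K'=P/P'$ and $G,H$ smooth; a dot denotes the derivative of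 $H$ with respect to its argument. * **Solution A** ($n$ a constant, $n^2-2cn+b^2\ne0$, $q^2\neq1$): $q'=n(1-q^2)$, $\ F'/F=(2n-c)q$, $\ G'/G=\tfrac12(n-c)q+\tfrac12\frac{n+c}{q}$, $\ m_1+m_2\frac{\dot H}H+m_3\frac{\dot H^2}{H^2}+\frac{\ddot H}H=0$, where $$m_3=\tfrac{(c-n)^2}{n^2-2cn+b^2},\quad m_2=\tfrac{(n-c)^3+3c(n-c)^2+c(b^2-c^2)}{n^2-2cn+b^2},\quad m_1=\tfrac14\tfrac{(c^2-n^2)(c^2-2cn+b^2)}{n^2-2cn+b^2}.$$ * **Solution B** ($c=\sigma_1b$, $\sigma_1=\pm1$, $k_3\ne c$ a constant, $q^2\neq1$): $q'=c(1-q^2)$, $\ F'/F=\frac{2(k_3-c)+cq^2}{q}$, $\ G'/G=\frac{k_3}q$, and $H$ satisfies $$k_1+k_2\tfrac{\dot H}H+k_3\tfrac{\dot H^2}{H^2}+\tfrac{\dot H}H\tfrac{\ddot H}H+k_5\tfrac{\ddot H}H=0\qquad(*)$$ with $k_1=-\frac{3b^2}4(\sigma_1b-k_3)$, $k_2=\frac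 b2(-b+4\sigma_1k_3)$, $k_5=\frac32\sigma_1b$. * **Solution C** ($c\ne0$, $b^2+c^2=2ck_3$, $q^2\neq1$): $q'=\frac{b^2}c(1-q^2)$, $\ F'/F=\frac{b^2}cq$, $\ G'/G=\frac{k_3}q$, $\ k_3\frac{\dot H}H+\frac{\ddot H}H=0$. * **Solution D** ($c=\sigma_1b$, $\sigma_1=\pm1$, $k_3\neq c$ a constant): $q'=4k_3-3c-cq^2$, $\ F'/F=cq$, $\ G'/G=\frac{2k_3-c}q$, and $H$ satisfies $(*)$ with $k_1=0$, $k_2=\frac b2(2\sigma_1k_3-b)$, $k_5=k_3-\frac{\sigma_1b}2$. **Theorem.** 1. $\vec k$ is a conformal Killing vector with scale factor $-S_{,t}/S$. 2. If the metric is a perfect fluid at every point of $U\times\mathbb R^2$, then every nonempty open $V\subseteq U$ contains a nonempty open $W$ such that on $W\times\mathbb R^2$ the metric is (locally isometric to) an FLRW metric, or admits a homothetic vector field $\alpha\partial_t+\beta\partial_x+\mu y\,\partial_y+\nu z\,\partial_z$ with constants $(\alpha,\beta)\ne(0,0)$ and constant, possibly zero, scale factor (in particular this is so if $\vec k$ is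 not proper on $W\times\mathbb R^2$), or $(F,P,S)$ is over $W$ one of the Solutions A, B, C, D. 3. Conversely, for every one of the Solutions A–D, and for both signs $\sigma$, the Einstein tensor has at each point the form $\epsilon K_\alpha K_\beta+p\,g_{\alpha\beta}$ with $\epsilon=\pm1$ and $K$ in the span of $dt,dx$ (so the metric is a perfect fluid exactly where $K$ is timelike, the remaining points being of null or tachyonic fluid). 4. The four families are mutually exclusive: the same $(b,c,F,P,S)$ over a nonempty open set cannot belong to two of them. 5. For each of the four families there is a choice of $\sigma,b\ne0,c,F,P,S$ and of a nonempty connected open $U$ for which $(F,P,S)$ belongs to the family over $U$, the metric is a perfect fluid at every point of $U\times\mathbb R^2$, and the scale factor $-S_{,t}/S$ is not constant ($\vec k$ is proper). -/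

import Mathlib

open scoped ContDiff Matrix

noncomputable section

namespace G2Fluid

/-! ### Pseudo-Riemannian geometry in a coordinate chart of dimension four -/

/-- Coordinate space; a point is `(t, x, y, z)`. -/
abbrev Coord : Type := Fin 4 → ℝ

/-- The matrix of components `g_ij` of a metric, as a function of the point. -/
abbrev MetricField : Type := Coord → Matrix (Fin 4) (Fin 4) ℝ

/-- The partial derivative `∂_i f` at `X`. -/
def pd (i : Fin 4) (f : Coord → ℝ) (X : Coord) : ℝ :=
  fderiv ℝ f X (Pi.single i 1)

/-- Christoffel symbols `Γ^k_{ij}` of the Levi-Civita connection. -/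
def christoffel (g : MetricField) (k i j : Fin 4) (X : Coord) : ℝ :=
  (1 / 2) * ∑ l, (g X)⁻¹ k l *
    (pd i (fun Y => g Y j l) X + pd j (fun Y => g Y i l) X - pd l (fun Y => g Y i j) X)

/-- The Ricci tensor
`R_ij = ∂_k Γ^k_ij - ∂_j Γ^k_ik + Γ^k_kl Γ^l_ij - Γ^k_jl Γ^l_ik`. -/
def ricci (g : MetricField) (i j : Fin 4) (X : Coord) : ℝ :=
  (∑ k, (pd k (christoffel g k i j) X - pd j (christoffel g k i k) X)) +
    ∑ k, ∑ l, (christoffel g k k l X * christoffel g l i j X -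
      christoffel g k j l X * christoffel g l i k X)

/-- The scalar curvature. -/
def scalarCurv (g : MetricField) (X : Coord) : ℝ :=
  ∑ i, ∑ j, (g X)⁻¹ i j * ricci g i j X

/-- The Einstein tensor. -/
def einstein (g : MetricField) (i j : Fin 4) (X : Coord) : ℝ :=
  ricci g i j X - (1 / 2) * scalarCurv g X * g X i j

/-- The Lie derivative `(L_ξ g)_ij` of the metric along the vector field `ξ`. -/
def lieDerivMetric (g : MetricField) (ξ : Coord → Coord) (i j : Fin 4) (X : Coord) : ℝ :=
  ∑ k, (ξ X k * pd k (fun Y => g Y i j) X +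
    g X k j * pd i (fun Y => ξ Y k) X + g X i k * pd j (fun Y => ξ Y k) X)

/-- `ξ` is a conformal Killing vector of `g` on `D` with scale factor `Φ`. -/
def IsConformalKilling (g : MetricField) (D : Set Coord) (ξ : Coord → Coord)
    (Φ : Coord → ℝ) : Prop :=
  ∀ X ∈ D, ∀ i j, lieDerivMetric g ξ i j X = 2 * Φ X * g X i j

/-- Perfect fluid at `X` (units `c = 8πG = 1`): the Einstein tensor is
`(ρ + p) u_i u_j + p g_ij` with a unit timelike velocity `u` and `ρ + p ≠ 0`. -/
def IsPerfectFluidAt (g : MetricField) (X : Coord) : Prop :=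
  ∃ (ρ p : ℝ) (u : Coord), ρ + p ≠ 0 ∧ u ⬝ᵥ (g X *ᵥ u) = -1 ∧
    ∀ i j, einstein g i j X = (ρ + p) * (g X *ᵥ u) i * (g X *ᵥ u) j + p * g X i j

/-- The Einstein tensor at `X` is `ε K_i K_j + p g_ij` with `ε = ±1` and `K` a covector in the
span of `dt` and `dx`. This is the perfect-fluid form, except that `K` may have any causal
character: it is a perfect fluid if `K` is timelike, a null fluid if `K` is null and a tachyonic
fluid if `K` is spacelike. -/
def IsFluidFormAt (g : MetricField) (X : Coord) : Prop :=
  ∃ (ε p : ℝ) (K : Coord), (ε = 1 ∨ ε = -1) ∧ K 2 = 0 ∧ K 3 = 0 ∧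
    ∀ i j, einstein g i j X = ε * K i * K j + p * g X i j

/-- The Robertson-Walker metric in conformal time,
`a(η)² [ -dη² + (dX² + dY² + dZ²) / (1 + κ (X² + Y² + Z²) / 4)² ]`. -/
def robertsonWalker (κ : ℝ) (a : ℝ → ℝ) : MetricField := fun X =>
  (a (X 0)) ^ 2 • Matrix.diagonal (Fin.cons (-1) (fun _ : Fin 3 =>
    1 / (1 + κ / 4 * ((X 1) ^ 2 + (X 2) ^ 2 + (X 3) ^ 2)) ^ 2))

/-- `g` on `D` is a Friedmann-Lemaître-Robertson-Walker spacetime: it is the pull-back of a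
Robertson-Walker metric under a smooth map (a local diffeomorphism, as `g` is nondegenerate). -/
def IsFLRW (g : MetricField) (D : Set Coord) : Prop :=
  ∃ (κ : ℝ) (a : ℝ → ℝ) (φ : Coord → Coord), ContDiffOn ℝ ∞ φ D ∧ ∀ X ∈ D,
    ContDiffAt ℝ ∞ a (φ X 0) ∧ 0 < a (φ X 0) ∧
    0 < 1 + κ / 4 * ((φ X 1) ^ 2 + (φ X 2) ^ 2 + (φ X 3) ^ 2) ∧
    g X = (LinearMap.toMatrix' (fderiv ℝ φ X).toLinearMap)ᵀ * robertsonWalker κ a (φ X) *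
      LinearMap.toMatrix' (fderiv ℝ φ X).toLinearMap

/-! ### Diagonal metrics of Lie algebra A -/

/-- The part of coordinate space lying over a set of values of `(t, x)`. -/
def cylinder (U : Set (ℝ × ℝ)) : Set Coord := {X | (X 0, X 1) ∈ U}

/-- The metric
`S(t,x)⁻² [ σ (-dt² + dx²) + (F/P)(x) e^{-(b+c)t} dy² + (F P)(x) e^{(b-c)t} dz² ]`.
For `σ = 1` the coordinate `t` is timelike and the conformal orbits `x = const` are timelike.
For `σ = -1` the coordinate `x` is timelike and the conformal orbits are spacelike: after
renaming `t` and `x`, this is the line-element with `t` and `x` interchanged in all the metric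
functions. -/
def metricA (σ b c : ℝ) (F P : ℝ → ℝ) (S : ℝ → ℝ → ℝ) : MetricField := fun X =>
  (1 / (S (X 0) (X 1)) ^ 2) • Matrix.diagonal ![-σ, σ,
    F (X 1) / P (X 1) * Real.exp (-(b + c) * X 0),
    F (X 1) * P (X 1) * Real.exp ((b - c) * X 0)]

/-- Smooth, nondegenerate metric functions over the open set `U` of values of `(t, x)`. -/
structure Regular (F P : ℝ → ℝ) (S : ℝ → ℝ → ℝ) (U : Set (ℝ × ℝ)) : Prop where
  isOpen : IsOpen U
  smooth_S : ∀ w ∈ U, ContDiffAt ℝ ∞ (fun w' : ℝ × ℝ => S w'.1 w'.2) w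
  smooth_F : ∀ w ∈ U, ContDiffAt ℝ ∞ F w.2
  smooth_P : ∀ w ∈ U, ContDiffAt ℝ ∞ P w.2
  S_ne_zero : ∀ w ∈ U, S w.1 w.2 ≠ 0
  F_pos : ∀ w ∈ U, 0 < F w.2
  P_pos : ∀ w ∈ U, 0 < P w.2

/-- The vector field `α ∂_t + β ∂_x + μ y ∂_y + ν z ∂_z`. -/
def linField (α β μ ν : ℝ) : Coord → Coord := fun X => ![α, β, μ * X 2, ν * X 3]

/-- The conformal Killing vector `k = ∂_t + ((c+b)/2) y ∂_y + ((c-b)/2) z ∂_z`. -/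
def ckv (b c : ℝ) : Coord → Coord := linField 1 0 ((c + b) / 2) ((c - b) / 2)

/-- The scale factor `-S_{,t} / S`. -/
def scaleFactor (S : ℝ → ℝ → ℝ) (t x : ℝ) : ℝ := -(deriv (fun s => S s x) t / S t x)

/-- `k` is proper over `U`: its scale factor is not constant. -/
def IsProper (S : ℝ → ℝ → ℝ) (U : Set (ℝ × ℝ)) : Prop :=
  ¬ ∃ Φ₀ : ℝ, ∀ w ∈ U, scaleFactor S w.1 w.2 = Φ₀

/-- `g` admits on `D`, besides the Killing vectors `∂_y` and `∂_z`, a homothetic vector field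
`α ∂_t + β ∂_x + μ y ∂_y + ν z ∂_z` with `(α, β) ≠ (0, 0)` (its constant scale factor may be
zero; it may be `k` itself, if `k` is not proper). -/
def IsHomotheticSpacetime (g : MetricField) (D : Set Coord) : Prop :=
  ∃ α β μ ν Λ : ℝ, (α ≠ 0 ∨ β ≠ 0) ∧
    IsConformalKilling g D (linField α β μ ν) (fun _ => Λ)

/-! ### The four families

All relations below hold at every `(t, x) ∈ V`. A prime is `d/dx`, and a dot is the derivative
with respect to the argument `t + b K(x)` of `H`. -/

/-- `q = P' / (b P)`. -/
def qFun (b : ℝ) (P : ℝ → ℝ) (x : ℝ) : ℝ := logDeriv P x / b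

/-- `Ḣ / H`. -/
def dotLog (H : ℝ → ℝ) (u : ℝ) : ℝ := deriv H u / H u

/-- `Ḧ / H`. -/
def ddotLog (H : ℝ → ℝ) (u : ℝ) : ℝ := deriv (deriv H) u / H u

/-- `S = G(x) H(t + b K(x))` with `P' ≠ 0` and `K' = P / P'`. -/
structure Separated (b : ℝ) (P : ℝ → ℝ) (S : ℝ → ℝ → ℝ) (V : Set (ℝ × ℝ))
    (G H K : ℝ → ℝ) : Prop where
  deriv_P_ne : ∀ w ∈ V, deriv P w.2 ≠ 0
  hasDerivAt_K : ∀ w ∈ V, HasDerivAt K (P w.2 / deriv P w.2) w.2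
  smooth_G : ∀ w ∈ V, ContDiffAt ℝ ∞ G w.2
  smooth_H : ∀ w ∈ V, ContDiffAt ℝ ∞ H (w.1 + b * K w.2)
  S_eq : ∀ w ∈ V, S w.1 w.2 = G w.2 * H (w.1 + b * K w.2)

/-- Solution A: `q' = n (1 - q²)`, `F'/F = (2n - c) q`,
`G'/G = (n - c) q / 2 + (n + c) / (2 q)` and `m₁ + m₂ Ḣ/H + m₃ (Ḣ/H)² + Ḧ/H = 0`. -/
def SolutionA (b c : ℝ) (F P : ℝ → ℝ) (S : ℝ → ℝ → ℝ) (V : Set (ℝ × ℝ)) : Prop :=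
  ∃ (n m₁ m₂ m₃ : ℝ) (G H K : ℝ → ℝ),
    n ^ 2 - 2 * c * n + b ^ 2 ≠ 0 ∧
    m₃ = (c - n) ^ 2 / (n ^ 2 - 2 * c * n + b ^ 2) ∧
    m₂ = ((n - c) ^ 3 + 3 * c * (n - c) ^ 2 + c * (b ^ 2 - c ^ 2)) /
      (n ^ 2 - 2 * c * n + b ^ 2) ∧
    m₁ = 1 / 4 * ((c ^ 2 - n ^ 2) * (c ^ 2 - 2 * c * n + b ^ 2) /
      (n ^ 2 - 2 * c * n + b ^ 2)) ∧
    Separated b P S V G H K ∧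
    ∀ w ∈ V,
      qFun b P w.2 ^ 2 ≠ 1 ∧
      deriv (qFun b P) w.2 = n * (1 - qFun b P w.2 ^ 2) ∧
      logDeriv F w.2 = (2 * n - c) * qFun b P w.2 ∧
      logDeriv G w.2 = 1 / 2 * (n - c) * qFun b P w.2 + 1 / 2 * ((n + c) / qFun b P w.2) ∧
      m₁ + m₂ * dotLog H (w.1 + b * K w.2) + m₃ * dotLog H (w.1 + b * K w.2) ^ 2 +
        ddotLog H (w.1 + b * K w.2) = 0

/-- The equation `k₁ + k₂ Ḣ/H + k₃ (Ḣ/H)² + (Ḣ/H)(Ḧ/H) + k₅ Ḧ/H = 0` at the argument `u`. -/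
def quadraticODE (k₁ k₂ k₃ k₅ : ℝ) (H : ℝ → ℝ) (u : ℝ) : Prop :=
  k₁ + k₂ * dotLog H u + k₃ * dotLog H u ^ 2 + dotLog H u * ddotLog H u + k₅ * ddotLog H u = 0

/-- Solution B: `c = σ₁ b`, `q' = c (1 - q²)`, `G'/G = k₃ / q`,
`F'/F = (2 (k₃ - c) + c q²) / q`, with the quadratic equation for `H`.
(In the variables `q' = (q² - 1)(χ - k₃)`, `G'/G = (ω - χ + 2 k₃) / (2 q)` and
`F'/F = 2 G'/G - (c + q') / q`, this is `χ = ω = k₃ - σ₁ b`.) -/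
def SolutionB (b c : ℝ) (F P : ℝ → ℝ) (S : ℝ → ℝ → ℝ) (V : Set (ℝ × ℝ)) : Prop :=
  ∃ (σ₁ k₃ : ℝ) (G H K : ℝ → ℝ), (σ₁ = 1 ∨ σ₁ = -1) ∧ c = σ₁ * b ∧ k₃ ≠ c ∧
    Separated b P S V G H K ∧
    ∀ w ∈ V,
      qFun b P w.2 ^ 2 ≠ 1 ∧
      deriv (qFun b P) w.2 = c * (1 - qFun b P w.2 ^ 2) ∧
      logDeriv F w.2 = (2 * (k₃ - c) + c * qFun b P w.2 ^ 2) / qFun b P w.2 ∧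
      logDeriv G w.2 = k₃ / qFun b P w.2 ∧
      quadraticODE (-(3 * b ^ 2 / 4) * (σ₁ * b - k₃)) (b / 2 * (-b + 4 * σ₁ * k₃)) k₃
        (3 / 2 * σ₁ * b) H (w.1 + b * K w.2)

/-- Solution C: `b² + c² = 2 c k₃`, `q' = (b²/c) (1 - q²)`, `F'/F = (b²/c) q`,
`G'/G = k₃ / q` and `k₃ Ḣ/H + Ḧ/H = 0`. (In the variables above, `χ = ω = c - k₃`.) -/
def SolutionC (b c : ℝ) (F P : ℝ → ℝ) (S : ℝ → ℝ → ℝ) (V : Set (ℝ × ℝ)) : Prop :=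
  ∃ (k₃ : ℝ) (G H K : ℝ → ℝ), c ≠ 0 ∧ b ^ 2 + c ^ 2 - 2 * c * k₃ = 0 ∧
    Separated b P S V G H K ∧
    ∀ w ∈ V,
      qFun b P w.2 ^ 2 ≠ 1 ∧
      deriv (qFun b P) w.2 = b ^ 2 / c * (1 - qFun b P w.2 ^ 2) ∧
      logDeriv F w.2 = b ^ 2 / c * qFun b P w.2 ∧
      logDeriv G w.2 = k₃ / qFun b P w.2 ∧
      k₃ * dotLog H (w.1 + b * K w.2) + ddotLog H (w.1 + b * K w.2) = 0

/-- Solution D: `c = σ₁ b`, `q' = 4 k₃ - 3 c - c q²`, `F'/F = c q`, `G'/G = (2 k₃ - c) / q`,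
with the quadratic equation for `H`. (In the variables above, `ω = χ - 2 σ₁ b + 2 k₃` and
`q² = (ω² - (c - k₃)²) / (χ² - (c - k₃)²)`, `χ` non-constant; that is,
`χ (1 - q²) = (c - k₃)(3 + q²)` and `k₃ ≠ c`.) -/
def SolutionD (b c : ℝ) (F P : ℝ → ℝ) (S : ℝ → ℝ → ℝ) (V : Set (ℝ × ℝ)) : Prop :=
  ∃ (σ₁ k₃ : ℝ) (G H K : ℝ → ℝ), (σ₁ = 1 ∨ σ₁ = -1) ∧ c = σ₁ * b ∧ k₃ ≠ c ∧
    Separated b P S V G H K ∧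
    ∀ w ∈ V,
      deriv (qFun b P) w.2 = 4 * k₃ - 3 * c - c * qFun b P w.2 ^ 2 ∧
      logDeriv F w.2 = c * qFun b P w.2 ∧
      logDeriv G w.2 = (2 * k₃ - c) / qFun b P w.2 ∧
      quadraticODE 0 (b / 2 * (2 * σ₁ * k₃ - b)) k₃ (k₃ - σ₁ * b / 2) H (w.1 + b * K w.2)

/-- The four families of solutions. -/
inductive Family
  | A | B | C | D

/-- The metric functions `F, P, S` of the Lie algebra with constants `b, c` belong, over `V`, to
the given family. -/
def Family.Holds (f : Family) (b c : ℝ) (F P : ℝ → ℝ) (S : ℝ → ℝ → ℝ)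
    (V : Set (ℝ × ℝ)) : Prop :=
  match f with
  | .A => SolutionA b c F P S V
  | .B => SolutionB b c F P S V
  | .C => SolutionC b c F P S V
  | .D => SolutionD b c F P S V

end G2Fluid

end

noncomputable section

namespace G2Fluid

open Filter Topology

/-! ### Partial derivatives of functions of `(t, x)` -/

/-- `f` is differentiable at `X` with `∂_t f = a`, `∂_x f = d` and `∂_y f = ∂_z f = 0`. -/
def HasPd (f : Coord → ℝ) (X : Coord) (a d : ℝ) : Prop :=
  HasFDerivAt f (a • (ContinuousLinearMap.proj (R := ℝ) (φ := fun _ : Fin 4 => ℝ) 0) +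
    d • (ContinuousLinearMap.proj (R := ℝ) (φ := fun _ : Fin 4 => ℝ) 1)) X

/-- The components of a gradient with `∂_y f = ∂_z f = 0`. -/
def grad2 (a d : ℝ) : Fin 4 → ℝ := ![a, d, 0, 0]

theorem HasPd.pd {f : Coord → ℝ} {X : Coord} {a d : ℝ} (h : HasPd f X a d) (i : Fin 4) :
    pd i f X = grad2 a d i := by
  unfold G2Fluid.pd
  rw [HasFDerivAt.fderiv h]
  fin_cases i <;> simp [grad2]

theorem HasPd.congr_values {f : Coord → ℝ} {X : Coord} {a d a' d' : ℝ} (h : HasPd f X a d)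
    (ha : a = a') (hd : d = d') : HasPd f X a' d' := by
  subst ha hd; exact h

theorem HasPd.congr {f g : Coord → ℝ} {X : Coord} {a d : ℝ} (h : HasPd f X a d)
    (hg : g =ᶠ[𝓝 X] f) : HasPd g X a d :=
  HasFDerivAt.congr_of_eventuallyEq h hg

theorem HasPd.const (k : ℝ) (X : Coord) : HasPd (fun _ => k) X 0 0 := by
  have := hasFDerivAt_const (𝕜 := ℝ) k X
  exact this.congr_fderiv (by ext v; simp)

theorem HasPd.add {f g : Coord → ℝ} {X : Coord} {a d a' d' : ℝ} (hf : HasPd f X a d)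
    (hg : HasPd g X a' d') : HasPd (fun Y => f Y + g Y) X (a + a') (d + d') := by
  have := HasFDerivAt.add hf hg
  exact this.congr_fderiv (by ext v; simp; ring)

theorem HasPd.neg {f : Coord → ℝ} {X : Coord} {a d : ℝ} (hf : HasPd f X a d) :
    HasPd (fun Y => - f Y) X (-a) (-d) := by
  have := HasFDerivAt.neg hf
  exact this.congr_fderiv (by ext v; simp; ring)

theorem HasPd.mul {f g : Coord → ℝ} {X : Coord} {a d a' d' : ℝ} (hf : HasPd f X a d)
    (hg : HasPd g X a' d') :
    HasPd (fun Y => f Y * g Y) X (a * g X + f X * a') (d * g X + f X * d') := by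
  have := HasFDerivAt.mul hf hg
  exact this.congr_fderiv (by ext v; simp; ring)

theorem HasPd.comp {f : Coord → ℝ} {X : Coord} {a d φ' : ℝ} {φ : ℝ → ℝ}
    (hφ : HasDerivAt φ φ' (f X)) (hf : HasPd f X a d) :
    HasPd (fun Y => φ (f Y)) X (φ' * a) (φ' * d) := by
  have := hφ.comp_hasFDerivAt X hf
  exact this.congr_fderiv (by ext v; simp; ring)

theorem HasPd.coord0 (X : Coord) : HasPd (fun Y => Y 0) X 1 0 := by
  unfold HasPd
  have := (ContinuousLinearMap.proj (R := ℝ) (φ := fun _ : Fin 4 => ℝ) 0).hasFDerivAt (x := X)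
  exact this.congr_fderiv (by ext v; simp)

theorem HasPd.coord1 (X : Coord) : HasPd (fun Y => Y 1) X 0 1 := by
  unfold HasPd
  have := (ContinuousLinearMap.proj (R := ℝ) (φ := fun _ : Fin 4 => ℝ) 1).hasFDerivAt (x := X)
  exact this.congr_fderiv (by ext v; simp)

theorem HasPd.of_deriv {φ : ℝ → ℝ} {φ' : ℝ} {X : Coord} (h : HasDerivAt φ φ' (X 1)) :
    HasPd (fun Y => φ (Y 1)) X 0 φ' :=
  (HasPd.comp h (HasPd.coord1 X)).congr_values (by simp) (by simp)

/-- The derivative of a function of `(t, x)` with respect to `t`. -/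
def dt (φ : ℝ × ℝ → ℝ) (w : ℝ × ℝ) : ℝ := fderiv ℝ φ w (1, 0)

/-- The derivative of a function of `(t, x)` with respect to `x`. -/
def dx (φ : ℝ × ℝ → ℝ) (w : ℝ × ℝ) : ℝ := fderiv ℝ φ w (0, 1)

theorem HasPd.of_differentiableAt {φ : ℝ × ℝ → ℝ} {X : Coord}
    (h : DifferentiableAt ℝ φ (X 0, X 1)) :
    HasPd (fun Y => φ (Y 0, Y 1)) X (dt φ (X 0, X 1)) (dx φ (X 0, X 1)) := by
  have h1 : HasFDerivAt (fun Y : Coord => (Y 0, Y 1))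
      ((ContinuousLinearMap.proj (R := ℝ) (φ := fun _ : Fin 4 => ℝ) 0).prod
        (ContinuousLinearMap.proj (R := ℝ) (φ := fun _ : Fin 4 => ℝ) 1)) X :=
    ((ContinuousLinearMap.proj (R := ℝ) (φ := fun _ : Fin 4 => ℝ) 0).prod
        (ContinuousLinearMap.proj (R := ℝ) (φ := fun _ : Fin 4 => ℝ) 1)).hasFDerivAt
  have := (h.hasFDerivAt).comp X h1
  refine this.congr_fderiv ?_
  ext v
  have hv : (v 0, v 1) = v 0 • ((1, 0) : ℝ × ℝ) + v 1 • ((0, 1) : ℝ × ℝ) := by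
    ext <;> simp
  simp only [_root_.add_apply, _root_.smul_apply,
    ContinuousLinearMap.proj_apply, ContinuousLinearMap.comp_apply,
    ContinuousLinearMap.prod_apply, hv, map_add, map_smul, dt, dx, smul_eq_mul]
  ring

theorem contDiffAt_dt {φ : ℝ × ℝ → ℝ} {w : ℝ × ℝ} (h : ContDiffAt ℝ ∞ φ w) :
    ContDiffAt ℝ ∞ (dt φ) w :=
  (h.fderiv_right (m := ∞) (by simp)).clm_apply contDiffAt_const

theorem contDiffAt_dx {φ : ℝ × ℝ → ℝ} {w : ℝ × ℝ} (h : ContDiffAt ℝ ∞ φ w) :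
    ContDiffAt ℝ ∞ (dx φ) w :=
  (h.fderiv_right (m := ∞) (by simp)).clm_apply contDiffAt_const

theorem dt_dx_comm {φ : ℝ × ℝ → ℝ} {w : ℝ × ℝ} (h : ContDiffAt ℝ ∞ φ w) :
    dx (dt φ) w = dt (dx φ) w := by
  have hs := h.isSymmSndFDerivAt (by simp; exact WithTop.coe_le_coe.2 le_top)
  have hd : DifferentiableAt ℝ (fderiv ℝ φ) w :=
    (h.fderiv_right (m := ∞) (by simp)).differentiableAt (by simp)
  have e1 : ∀ u v : ℝ × ℝ, fderiv ℝ (fun z => fderiv ℝ φ z u) w v =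
      fderiv ℝ (fderiv ℝ φ) w v u := by
    intro u v
    rw [fderiv_clm_apply hd (differentiableAt_const _)]; simp
  unfold dx dt
  rw [e1, e1]; exact hs _ _

theorem dt_eq_deriv {φ : ℝ × ℝ → ℝ} {t x : ℝ} (h : DifferentiableAt ℝ φ (t, x)) :
    HasDerivAt (fun s => φ (s, x)) (dt φ (t, x)) t := by
  have h1 : HasDerivAt (fun s : ℝ => (s, x)) ((1 : ℝ), (0 : ℝ)) t :=
    (hasDerivAt_id t).prodMk (hasDerivAt_const t x)
  exact h.hasFDerivAt.comp_hasDerivAt t h1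

theorem dx_eq_deriv {φ : ℝ × ℝ → ℝ} {t x : ℝ} (h : DifferentiableAt ℝ φ (t, x)) :
    HasDerivAt (fun y => φ (t, y)) (dx φ (t, x)) x := by
  have h1 : HasDerivAt (fun y : ℝ => (t, y)) ((0 : ℝ), (1 : ℝ)) x :=
    (hasDerivAt_const x t).prodMk (hasDerivAt_id x)
  exact h.hasFDerivAt.comp_hasDerivAt x h1

theorem isOpen_cylinder {U : Set (ℝ × ℝ)} (hU : IsOpen U) : IsOpen (cylinder U) :=
  hU.preimage (by fun_prop : Continuous fun X : Coord => (X 0, X 1))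

/-- The conformal factor as a function on the plane. -/
def plane (S : ℝ → ℝ → ℝ) : ℝ × ℝ → ℝ := fun w => S w.1 w.2

theorem hasDerivAt_logDeriv_self {F : ℝ → ℝ} {x : ℝ} (h : ContDiffAt ℝ ∞ F x) (h0 : F x ≠ 0) :
    HasDerivAt F (logDeriv F x * F x) x := by
  have := (h.differentiableAt (by simp)).hasDerivAt
  rwa [logDeriv_apply, div_mul_cancel₀ _ h0]

theorem contDiffAt_deriv {F : ℝ → ℝ} {x : ℝ} (h : ContDiffAt ℝ ∞ F x) :
    ContDiffAt ℝ ∞ (deriv F) x := by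
  have := (h.fderiv_right (m := ∞) (by simp)).clm_apply (contDiffAt_const (c := (1 : ℝ)))
  exact this

theorem contDiffAt_logDeriv {F : ℝ → ℝ} {x : ℝ} (h : ContDiffAt ℝ ∞ F x) (h0 : F x ≠ 0) :
    ContDiffAt ℝ ∞ (logDeriv F) x :=
  (contDiffAt_deriv h).div h h0

end G2Fluid
end

noncomputable section

namespace G2Fluid

open Filter Topology

/-! ### The Ricci tensor of the metric -/

/-- The diagonal of the metric, without the conformal factor. -/
def diagA (σ b c : ℝ) (F P : ℝ → ℝ) (X : Coord) : Fin 4 → ℝ :=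
  ![-σ, σ, F (X 1) / P (X 1) * Real.exp (-(b + c) * X 0),
    F (X 1) * P (X 1) * Real.exp ((b - c) * X 0)]

/-- Half the logarithmic `t`-derivative of the conformal factor `S⁻²`. -/
def confT (S : ℝ → ℝ → ℝ) (w : ℝ × ℝ) : ℝ := -(dt (plane S) w / plane S w)

/-- Half the logarithmic `x`-derivative of the conformal factor `S⁻²`. -/
def confX (S : ℝ → ℝ → ℝ) (w : ℝ × ℝ) : ℝ := -(dx (plane S) w / plane S w)

/-- Half the logarithmic gradients of the diagonal components of the metric. -/
def logGrad (b c : ℝ) (F P : ℝ → ℝ) (S : ℝ → ℝ → ℝ) (w : ℝ × ℝ) : Fin 4 → Fin 4 → ℝ :=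
  ![grad2 (confT S w) (confX S w), grad2 (confT S w) (confX S w),
    grad2 (confT S w - (b + c) / 2) (confX S w + (logDeriv F w.2 - logDeriv P w.2) / 2),
    grad2 (confT S w + (b - c) / 2) (confX S w + (logDeriv F w.2 + logDeriv P w.2) / 2)]

variable {σ b c : ℝ} {F P : ℝ → ℝ} {S : ℝ → ℝ → ℝ} {U : Set (ℝ × ℝ)}

theorem Regular.contDiffAt_plane (hR : Regular F P S U) {w : ℝ × ℝ} (hw : w ∈ U) :
    ContDiffAt ℝ ∞ (plane S) w := hR.smooth_S w hw

theorem Regular.plane_ne (hR : Regular F P S U) {w : ℝ × ℝ} (hw : w ∈ U) : plane S w ≠ 0 :=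
  hR.S_ne_zero w hw

theorem Regular.hasPd_S (hR : Regular F P S U) {X : Coord} (hX : X ∈ cylinder U) :
    HasPd (fun Y => S (Y 0) (Y 1)) X (dt (plane S) (X 0, X 1)) (dx (plane S) (X 0, X 1)) :=
  HasPd.of_differentiableAt (φ := plane S) ((hR.contDiffAt_plane hX).differentiableAt (by simp))

theorem Regular.hasPd_W (hR : Regular F P S U) {X : Coord} (hX : X ∈ cylinder U) :
    HasPd (fun Y => 1 / (S (Y 0) (Y 1)) ^ 2) X
      (2 * confT S (X 0, X 1) * (1 / (S (X 0) (X 1)) ^ 2))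
      (2 * confX S (X 0, X 1) * (1 / (S (X 0) (X 1)) ^ 2)) := by
  have h0 : S (X 0) (X 1) ≠ 0 := hR.S_ne_zero _ hX
  have h1 : HasDerivAt (fun s : ℝ => 1 / s ^ 2) (-2 / (S (X 0) (X 1)) ^ 3) (S (X 0) (X 1)) := by
    have := ((hasDerivAt_id (S (X 0) (X 1))).pow 2).inv (pow_ne_zero 2 h0)
    refine (this.congr_of_eventuallyEq (Eventually.of_forall fun s => ?_)).congr_deriv ?_
    · simp
    · simp only [Pi.pow_apply, id]; norm_num; field_simp
  refine (HasPd.comp h1 (hR.hasPd_S hX)).congr_values ?_ ?_ <;>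
  · simp only [confT, confX, plane]; field_simp

theorem hasPd_exp (k : ℝ) (X : Coord) :
    HasPd (fun Y => Real.exp (k * Y 0)) X (k * Real.exp (k * X 0)) 0 := by
  have h1 : HasDerivAt (fun s : ℝ => Real.exp (k * s)) (k * Real.exp (k * X 0)) (X 0) := by
    have := (((hasDerivAt_id (X 0)).const_mul k).exp)
    refine this.congr_deriv ?_
    simp; ring
  exact (HasPd.comp (f := fun Y : Coord => Y 0) h1 (HasPd.coord0 X)).congr_values
    (by simp) (by simp)

theorem Regular.hasPd_M2 (hR : Regular F P S U) {X : Coord} (hX : X ∈ cylinder U) :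
    HasPd (fun Y => F (Y 1) / P (Y 1) * Real.exp (-(b + c) * Y 0)) X
      (-(b + c) * (F (X 1) / P (X 1) * Real.exp (-(b + c) * X 0)))
      ((logDeriv F (X 1) - logDeriv P (X 1)) *
        (F (X 1) / P (X 1) * Real.exp (-(b + c) * X 0))) := by
  have hF := hasDerivAt_logDeriv_self (hR.smooth_F _ hX) (hR.F_pos _ hX).ne'
  have hP0 := (hR.P_pos _ hX).ne'
  have hP := hasDerivAt_logDeriv_self (hR.smooth_P _ hX) hP0
  have h1 := HasPd.of_deriv (X := X) (hF.div hP hP0)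
  refine (h1.mul (hasPd_exp (-(b + c)) X)).congr_values ?_ ?_
  · simp; ring
  · simp only at hP0 ⊢
    simp
    field_simp

theorem Regular.hasPd_M3 (hR : Regular F P S U) {X : Coord} (hX : X ∈ cylinder U) :
    HasPd (fun Y => F (Y 1) * P (Y 1) * Real.exp ((b - c) * Y 0)) X
      ((b - c) * (F (X 1) * P (X 1) * Real.exp ((b - c) * X 0)))
      ((logDeriv F (X 1) + logDeriv P (X 1)) *
        (F (X 1) * P (X 1) * Real.exp ((b - c) * X 0))) := by
  have hF := hasDerivAt_logDeriv_self (hR.smooth_F _ hX) (hR.F_pos _ hX).ne'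
  have hP := hasDerivAt_logDeriv_self (hR.smooth_P _ hX) (hR.P_pos _ hX).ne'
  have h1 := HasPd.of_deriv (X := X) (hF.mul hP)
  refine (h1.mul (hasPd_exp (b - c) X)).congr_values ?_ ?_ <;>
  · simp; ring

theorem metricA_apply (X : Coord) (i j : Fin 4) : metricA σ b c F P S X i j =
    (1 / (S (X 0) (X 1)) ^ 2) * Matrix.diagonal (diagA σ b c F P X) i j := rfl

theorem Regular.pd_metricA (hR : Regular F P S U) {X : Coord} (hX : X ∈ cylinder U)
    (k i j : Fin 4) : pd k (fun Y => metricA σ b c F P S Y i j) X =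
      2 * logGrad b c F P S (X 0, X 1) i k * metricA σ b c F P S X i j := by
  have hz : pd k (fun _ : Coord => (0 : ℝ)) X = 0 := by
    rw [(HasPd.const 0 X).pd]; fin_cases k <;> simp [grad2]
  by_cases hij : i = j
  · subst hij
    simp only [metricA_apply, Matrix.diagonal_apply_eq]
    have h0 := (hR.hasPd_W hX).mul (HasPd.const (-σ) X)
    have h1 := (hR.hasPd_W hX).mul (HasPd.const σ X)
    have h2 := (hR.hasPd_W hX).mul (hR.hasPd_M2 (b := b) (c := c) hX)
    have h3 := (hR.hasPd_W hX).mul (hR.hasPd_M3 (b := b) (c := c) hX)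
    have e : ∀ {f : Coord → ℝ} {a d a' d' m : ℝ}, HasPd f X a d → a = 2 * a' * m →
        d = 2 * d' * m → pd k f X = 2 * grad2 a' d' k * m := by
      intro f a d a' d' m h ha hd
      rw [h.pd, ha, hd]; fin_cases k <;> simp [grad2]
    fin_cases i
    · exact e h0 (by simp [diagA]; ring) (by simp [diagA]; ring)
    · exact e h1 (by simp [diagA]; ring) (by simp [diagA]; ring)
    · exact e h2 (by simp [diagA]; ring) (by simp [diagA]; ring)
    · exact e h3 (by simp [diagA]; ring) (by simp [diagA]; ring)
  · simp only [metricA_apply, Matrix.diagonal_apply_ne _ hij, mul_zero, hz]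

theorem Regular.diagA_ne (hR : Regular F P S U) (hσ : σ = 1 ∨ σ = -1) {X : Coord}
    (hX : X ∈ cylinder U) (i : Fin 4) : diagA σ b c F P X i ≠ 0 := by
  have hF := (hR.F_pos _ hX).ne'
  have hP := (hR.P_pos _ hX).ne'
  have hs : σ ≠ 0 := by rcases hσ with h | h <;> simp [h]
  simp only at hF hP
  fin_cases i <;> simp [diagA, hs, hF, hP]

theorem Regular.metricA_inv (hR : Regular F P S U) (hσ : σ = 1 ∨ σ = -1) {X : Coord}
    (hX : X ∈ cylinder U) : (metricA σ b c F P S X)⁻¹ =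
      Matrix.diagonal fun i => (S (X 0) (X 1)) ^ 2 * (diagA σ b c F P X i)⁻¹ := by
  apply Matrix.inv_eq_right_inv
  have h0 : S (X 0) (X 1) ≠ 0 := hR.S_ne_zero _ hX
  have h : metricA σ b c F P S X =
      Matrix.diagonal fun i => (1 / (S (X 0) (X 1)) ^ 2) * diagA σ b c F P X i := by
    ext i j
    rw [metricA_apply]
    by_cases hij : i = j
    · subst hij; simp
    · simp [Matrix.diagonal_apply_ne _ hij]
  rw [h, Matrix.diagonal_mul_diagonal, ← Matrix.diagonal_one]
  congr 1; ext i
  have := hR.diagA_ne (b := b) (c := c) hσ hX i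
  field_simp

/-- The Christoffel symbols of a diagonal metric in terms of half the logarithmic gradients `φ` and
the diagonal `m`. -/
def gammaForm (φ : Fin 4 → Fin 4 → ℝ) (m : Fin 4 → ℝ) (k i j : Fin 4) : ℝ :=
  (if j = k then φ j i else 0) + (if i = k then φ i j else 0) -
    (if i = j then m i * (m k)⁻¹ * φ i k else 0)

theorem Regular.christoffel_eq (hR : Regular F P S U) (hσ : σ = 1 ∨ σ = -1) {X : Coord}
    (hX : X ∈ cylinder U) (k i j : Fin 4) : christoffel (metricA σ b c F P S) k i j X =
      gammaForm (logGrad b c F P S (X 0, X 1)) (diagA σ b c F P X) k i j := by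
  have h0 : S (X 0) (X 1) ≠ 0 := hR.S_ne_zero _ hX
  have hk := hR.diagA_ne (b := b) (c := c) hσ hX k
  unfold christoffel gammaForm
  rw [hR.metricA_inv hσ hX, Finset.sum_eq_single k]
  · simp only [hR.pd_metricA hX]
    simp only [metricA_apply, Matrix.diagonal_apply]
    have e1 : ∀ l, (if l = k then diagA σ b c F P X l else 0) =
        (if l = k then 1 else 0) * diagA σ b c F P X k := by
      intro l; split_ifs with h <;> simp [h]
    rw [e1, e1]
    have e2 : ∀ (p : Prop) [Decidable p] (y : ℝ), (if p then y else 0) =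
      (if p then 1 else 0) * y := by intro p _ y; split_ifs <;> simp
    rw [e2 (j = k) (logGrad _ _ _ _ _ _ _ _), e2 (i = k) (logGrad _ _ _ _ _ _ _ _),
      e2 (i = j) (_ * _), e2 (i = j) (diagA _ _ _ _ _ _ _)]
    simp only [if_true]
    field_simp
  · intro l _ hl
    rw [Matrix.diagonal_apply_ne _ (Ne.symm hl), zero_mul]
  · simp

theorem Regular.hasPd_diagA (hR : Regular F P S U) {X : Coord} (hX : X ∈ cylinder U)
    (i : Fin 4) : HasPd (fun Y => diagA σ b c F P Y i) X
      (2 * (logGrad b c F P S (X 0, X 1) i 0 - logGrad b c F P S (X 0, X 1) 0 0) *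
        diagA σ b c F P X i)
      (2 * (logGrad b c F P S (X 0, X 1) i 1 - logGrad b c F P S (X 0, X 1) 0 1) *
        diagA σ b c F P X i) := by
  fin_cases i
  · exact (HasPd.const _ X).congr_values (by simp) (by simp)
  · exact (HasPd.const _ X).congr_values (by simp [logGrad]) (by simp [logGrad])
  · refine (hR.hasPd_M2 (b := b) (c := c) hX).congr_values ?_ ?_
    · change _ = 2 * ((confT S (X 0, X 1) - (b + c) / 2) - confT S (X 0, X 1)) *
        (F (X 1) / P (X 1) * Real.exp (-(b + c) * X 0))
      ring
    · change _ = 2 * ((confX S (X 0, X 1) + (logDeriv F (X 1) - logDeriv P (X 1)) / 2) -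
        confX S (X 0, X 1)) * (F (X 1) / P (X 1) * Real.exp (-(b + c) * X 0))
      ring
  · refine (hR.hasPd_M3 (b := b) (c := c) hX).congr_values ?_ ?_
    · change _ = 2 * ((confT S (X 0, X 1) + (b - c) / 2) - confT S (X 0, X 1)) *
        (F (X 1) * P (X 1) * Real.exp ((b - c) * X 0))
      ring
    · change _ = 2 * ((confX S (X 0, X 1) + (logDeriv F (X 1) + logDeriv P (X 1)) / 2) -
        confX S (X 0, X 1)) * (F (X 1) * P (X 1) * Real.exp ((b - c) * X 0))
      ring

theorem HasPd.gammaForm {φ φt φx : Fin 4 → Fin 4 → ℝ} {Φ : Coord → Fin 4 → Fin 4 → ℝ}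
    {m μt μx : Fin 4 → ℝ} {M : Coord → Fin 4 → ℝ} {X : Coord} (hφX : Φ X = φ) (hmX : M X = m)
    (hm : ∀ i, m i ≠ 0) (hφ : ∀ i j, HasPd (fun Y => Φ Y i j) X (φt i j) (φx i j))
    (hM : ∀ i, HasPd (fun Y => M Y i) X (μt i * m i) (μx i * m i)) (k i j : Fin 4) :
    HasPd (fun Y => gammaForm (Φ Y) (M Y) k i j) X
      ((if j = k then φt j i else 0) + (if i = k then φt i j else 0) -
        (if i = j then m i * (m k)⁻¹ * (φt i k + (μt i - μt k) * φ i k) else 0))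
      ((if j = k then φx j i else 0) + (if i = k then φx i j else 0) -
        (if i = j then m i * (m k)⁻¹ * (φx i k + (μx i - μx k) * φ i k) else 0)) := by
  subst hφX hmX
  have hite : ∀ (p : Prop) [Decidable p] {f : Coord → ℝ} {a d : ℝ}, HasPd f X a d →
      HasPd (fun Y => if p then f Y else 0) X (if p then a else 0) (if p then d else 0) := by
    intro p _ f a d h
    split_ifs
    · exact h
    · exact HasPd.const 0 X
  have hinv : HasPd (fun Y => (M Y k)⁻¹) X (-μt k * (M X k)⁻¹) (-μx k * (M X k)⁻¹) := by
    have h1 := HasPd.comp (f := fun Y => M Y k) (hasDerivAt_inv (hm k)) (hM k)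
    have := hm k
    refine h1.congr_values ?_ ?_ <;> field_simp
  have h3 := ((hM i).mul hinv).mul (hφ i k)
  refine (((hite (j = k) (hφ j i)).add (hite (i = k) (hφ i j))).add
    (hite (i = j) h3).neg).congr_values ?_ ?_ <;>
  · rw [sub_eq_add_neg]
    congr 2
    split_ifs <;> ring

/-- The Ricci tensor of a diagonal metric in terms of half the logarithmic gradients `φ` of its
components, their derivatives `dφ` and the diagonal `m`. -/
def ricciForm (φ : Fin 4 → Fin 4 → ℝ) (dφ : Fin 4 → Fin 4 → Fin 4 → ℝ) (m : Fin 4 → ℝ)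
    (i j : Fin 4) : ℝ :=
  let dg : Fin 4 → Fin 4 → Fin 4 → Fin 4 → ℝ := fun l k i j =>
    (if j = k then dφ l j i else 0) + (if i = k then dφ l i j else 0) -
      (if i = j then m i * (m k)⁻¹ * (dφ l i k + 2 * (φ i l - φ k l) * φ i k) else 0)
  (∑ k, (dg k k i j - dg j k i k)) +
    ∑ k, ∑ l, (gammaForm φ m k k l * gammaForm φ m l i j -
      gammaForm φ m k j l * gammaForm φ m l i k)

/-- The derivatives in the direction `l` of the logarithmic gradients. -/
def dlogGrad (F P : ℝ → ℝ) (S : ℝ → ℝ → ℝ) (w : ℝ × ℝ) (l i j : Fin 4) : ℝ :=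
  let f₁ := deriv (logDeriv F) w.2
  let l₁ := deriv (logDeriv P) w.2
  grad2
    (![grad2 (dt (confT S) w) (dt (confX S) w), grad2 (dt (confT S) w) (dt (confX S) w),
      grad2 (dt (confT S) w) (dt (confX S) w), grad2 (dt (confT S) w) (dt (confX S) w)] i j)
    (![grad2 (dx (confT S) w) (dx (confX S) w), grad2 (dx (confT S) w) (dx (confX S) w),
      grad2 (dx (confT S) w) (dx (confX S) w + (f₁ - l₁) / 2),
      grad2 (dx (confT S) w) (dx (confX S) w + (f₁ + l₁) / 2)] i j) l

theorem Regular.contDiffAt_confT (hR : Regular F P S U) {w : ℝ × ℝ} (hw : w ∈ U) :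
    ContDiffAt ℝ ∞ (confT S) w :=
  ((contDiffAt_dt (hR.contDiffAt_plane hw)).div (hR.contDiffAt_plane hw) (hR.plane_ne hw)).neg

theorem Regular.contDiffAt_confX (hR : Regular F P S U) {w : ℝ × ℝ} (hw : w ∈ U) :
    ContDiffAt ℝ ∞ (confX S) w :=
  ((contDiffAt_dx (hR.contDiffAt_plane hw)).div (hR.contDiffAt_plane hw) (hR.plane_ne hw)).neg

theorem Regular.hasPd_logGrad (hR : Regular F P S U) {X : Coord} (hX : X ∈ cylinder U)
    (i j : Fin 4) : HasPd (fun Y => logGrad b c F P S (Y 0, Y 1) i j) X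
      (dlogGrad F P S (X 0, X 1) 0 i j) (dlogGrad F P S (X 0, X 1) 1 i j) := by
  have hT := HasPd.of_differentiableAt (φ := confT S) (X := X)
    ((hR.contDiffAt_confT hX).differentiableAt (by simp))
  have hXx := HasPd.of_differentiableAt (φ := confX S) (X := X)
    ((hR.contDiffAt_confX hX).differentiableAt (by simp))
  have hF := HasPd.of_deriv (X := X) ((contDiffAt_logDeriv (hR.smooth_F _ hX)
    (hR.F_pos _ hX).ne').differentiableAt (by simp)).hasDerivAt
  have hP := HasPd.of_deriv (X := X) ((contDiffAt_logDeriv (hR.smooth_P _ hX)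
    (hR.P_pos _ hX).ne').differentiableAt (by simp)).hasDerivAt
  have h0 : HasPd (fun _ : Coord => (0 : ℝ)) X 0 0 := HasPd.const 0 X
  have h20 : HasPd (fun Y => confT S (Y 0, Y 1) - (b + c) / 2) X _ _ :=
    (hT.add (HasPd.const (-((b + c) / 2)) X)).congr_values (add_zero _) (add_zero _)
  have h30 : HasPd (fun Y => confT S (Y 0, Y 1) + (b - c) / 2) X _ _ :=
    (hT.add (HasPd.const ((b - c) / 2) X)).congr_values (add_zero _) (add_zero _)
  have h21 : HasPd (fun Y => confX S (Y 0, Y 1) + (logDeriv F (Y 1) - logDeriv P (Y 1)) / 2) X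
      (dt (confX S) (X 0, X 1)) (dx (confX S) (X 0, X 1) +
        (deriv (logDeriv F) (X 1) - deriv (logDeriv P) (X 1)) / 2) :=
    (hXx.add ((hF.add hP.neg).mul (HasPd.const (1 / 2) X))).congr
      (Eventually.of_forall fun Y => by ring) |>.congr_values (by simp) (by simp; ring)
  have h31 : HasPd (fun Y => confX S (Y 0, Y 1) + (logDeriv F (Y 1) + logDeriv P (Y 1)) / 2) X
      (dt (confX S) (X 0, X 1)) (dx (confX S) (X 0, X 1) +
        (deriv (logDeriv F) (X 1) + deriv (logDeriv P) (X 1)) / 2) :=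
    (hXx.add ((hF.add hP).mul (HasPd.const (1 / 2) X))).congr
      (Eventually.of_forall fun Y => by ring) |>.congr_values (by simp) (by simp; ring)
  fin_cases i <;> fin_cases j
  exacts [hT, hXx, h0, h0, hT, hXx, h0, h0, h20, h21, h0, h0, h30, h31, h0, h0]

theorem Regular.ricci_eq (hR : Regular F P S U) (hσ : σ = 1 ∨ σ = -1) {X : Coord}
    (hX : X ∈ cylinder U) (i j : Fin 4) : ricci (metricA σ b c F P S) i j X =
      ricciForm (logGrad b c F P S (X 0, X 1)) (dlogGrad F P S (X 0, X 1))
        (diagA σ b c F P X) i j := by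
  have hg : ∀ k i j, HasPd (christoffel (metricA σ b c F P S) k i j) X _ _ := fun k i j =>
    (HasPd.gammaForm (Φ := fun Y => logGrad b c F P S (Y 0, Y 1))
      (M := fun Y => diagA σ b c F P Y) (X := X) rfl rfl (hR.diagA_ne hσ hX)
      (hR.hasPd_logGrad hX) (hR.hasPd_diagA hX) k i j).congr
      (((isOpen_cylinder hR.isOpen).mem_nhds hX |> mem_of_superset) fun Y hY =>
        hR.christoffel_eq hσ hY k i j)
  have hl : ∀ l i j, dlogGrad F P S (X 0, X 1) l i j =
      grad2 (dlogGrad F P S (X 0, X 1) 0 i j) (dlogGrad F P S (X 0, X 1) 1 i j) l := by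
    intro l i j; fin_cases l <;> rfl
  have hφ : ∀ i l, logGrad b c F P S (X 0, X 1) i l =
      grad2 (logGrad b c F P S (X 0, X 1) i 0) (logGrad b c F P S (X 0, X 1) i 1) l := by
    intro i l; fin_cases l <;> fin_cases i <;> rfl
  have key : ∀ l k i j, pd l (christoffel (metricA σ b c F P S) k i j) X =
      (if j = k then dlogGrad F P S (X 0, X 1) l j i else 0) +
        (if i = k then dlogGrad F P S (X 0, X 1) l i j else 0) -
        (if i = j then diagA σ b c F P X i * (diagA σ b c F P X k)⁻¹ *
          (dlogGrad F P S (X 0, X 1) l i k +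
          2 * (logGrad b c F P S (X 0, X 1) i l - logGrad b c F P S (X 0, X 1) k l) *
          logGrad b c F P S (X 0, X 1) i k) else 0) := by
    intro l k i j
    rw [(hg k i j).pd l, hl l j i, hl l i j, hl l i k, hφ i l, hφ k l]
    fin_cases l <;> simp only [grad2, Fin.zero_eta, Fin.mk_one, Fin.reduceFinMk,
      Matrix.cons_val_zero, Matrix.cons_val_one, Matrix.cons_val] <;> split_ifs <;> ring
  unfold ricci ricciForm
  congr 1
  · exact Finset.sum_congr rfl fun k _ => by rw [key, key]
  · simp only [hR.christoffel_eq hσ hX]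

end G2Fluid
end

noncomputable section

namespace G2Fluid

open Filter Topology

variable {σ b c : ℝ} {F P : ℝ → ℝ} {S : ℝ → ℝ → ℝ} {U : Set (ℝ × ℝ)}

section RicciForm

variable (a d p u r v tt tx xx f₂ f₃ σ m₂ m₃ : ℝ)

/-- `ricciForm` with the derivatives of the logarithmic gradients written out. -/
def ricciExplicit : Fin 4 → Fin 4 → ℝ :=
  ricciForm ![grad2 a d, grad2 a d, grad2 p u, grad2 r v]
    (fun l i j => grad2 (![grad2 tt tx, grad2 tt tx, grad2 tt tx, grad2 tt tx] i j)
      (![grad2 tx xx, grad2 tx xx, grad2 tx (xx + f₂), grad2 tx (xx + f₃)] i j) l)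
    ![-σ, σ, m₂, m₃]

theorem ricciExplicit_tt (h : σ ≠ 0) :
    ricciExplicit a d p u r v tt tx xx f₂ f₃ σ m₂ m₃ 0 0 =
      -(tt * 3) + xx + a * p + a * r + d * u + d * v - p ^ 2 - r ^ 2 := by
  simp [ricciExplicit, ricciForm, gammaForm, Fin.sum_univ_four, grad2]
  field_simp
  ring

theorem ricciExplicit_tx (h : σ ≠ 0) :
    ricciExplicit a d p u r v tt tx xx f₂ f₃ σ m₂ m₃ 0 1 =
      -(tx * 2) + a * u + a * v + d * p + d * r - p * u - r * v := by
  simp [ricciExplicit, ricciForm, gammaForm, Fin.sum_univ_four, grad2]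
  field_simp
  ring

theorem ricciExplicit_xt (h : σ ≠ 0) :
    ricciExplicit a d p u r v tt tx xx f₂ f₃ σ m₂ m₃ 1 0 =
      -(tx * 2) + a * u + a * v + d * p + d * r - p * u - r * v := by
  simp [ricciExplicit, ricciForm, gammaForm, Fin.sum_univ_four, grad2]
  field_simp
  ring

theorem ricciExplicit_xx (h : σ ≠ 0) :
    ricciExplicit a d p u r v tt tx xx f₂ f₃ σ m₂ m₃ 1 1 =
      -(xx * 3) + tt - f₂ - f₃ + a * p + a * r + d * u + d * v - u ^ 2 - v ^ 2 := by
  simp [ricciExplicit, ricciForm, gammaForm, Fin.sum_univ_four, grad2]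
  field_simp
  ring

theorem ricciExplicit_yy (h : σ ≠ 0) (h2 : m₂ ≠ 0) :
    ricciExplicit a d p u r v tt tx xx f₂ f₃ σ m₂ m₃ 2 2 =
      m₂ * σ⁻¹ * (tt + p * r + p ^ 2 - xx - f₂ - u * v - u ^ 2) := by
  simp [ricciExplicit, ricciForm, gammaForm, Fin.sum_univ_four, grad2]
  field_simp
  ring

theorem ricciExplicit_zz (h : σ ≠ 0) (h3 : m₃ ≠ 0) :
    ricciExplicit a d p u r v tt tx xx f₂ f₃ σ m₂ m₃ 3 3 =
      m₃ * σ⁻¹ * (tt + r * p + r ^ 2 - xx - f₃ - v * u - v ^ 2) := by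
  simp [ricciExplicit, ricciForm, gammaForm, Fin.sum_univ_four, grad2]
  field_simp
  ring

theorem ricciExplicit_yt : ricciExplicit a d p u r v tt tx xx f₂ f₃ σ m₂ m₃ 2 0 = 0 := by
  simp [ricciExplicit, ricciForm, gammaForm, Fin.sum_univ_four, grad2]
theorem ricciExplicit_yx : ricciExplicit a d p u r v tt tx xx f₂ f₃ σ m₂ m₃ 2 1 = 0 := by
  simp [ricciExplicit, ricciForm, gammaForm, Fin.sum_univ_four, grad2]
theorem ricciExplicit_yz : ricciExplicit a d p u r v tt tx xx f₂ f₃ σ m₂ m₃ 2 3 = 0 := by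
  simp [ricciExplicit, ricciForm, gammaForm, Fin.sum_univ_four, grad2]
theorem ricciExplicit_zt : ricciExplicit a d p u r v tt tx xx f₂ f₃ σ m₂ m₃ 3 0 = 0 := by
  simp [ricciExplicit, ricciForm, gammaForm, Fin.sum_univ_four, grad2]
theorem ricciExplicit_zx : ricciExplicit a d p u r v tt tx xx f₂ f₃ σ m₂ m₃ 3 1 = 0 := by
  simp [ricciExplicit, ricciForm, gammaForm, Fin.sum_univ_four, grad2]
theorem ricciExplicit_zy : ricciExplicit a d p u r v tt tx xx f₂ f₃ σ m₂ m₃ 3 2 = 0 := by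
  simp [ricciExplicit, ricciForm, gammaForm, Fin.sum_univ_four, grad2]
theorem ricciExplicit_ty : ricciExplicit a d p u r v tt tx xx f₂ f₃ σ m₂ m₃ 0 2 = 0 := by
  simp [ricciExplicit, ricciForm, gammaForm, Fin.sum_univ_four, grad2]
theorem ricciExplicit_xy : ricciExplicit a d p u r v tt tx xx f₂ f₃ σ m₂ m₃ 1 2 = 0 := by
  simp [ricciExplicit, ricciForm, gammaForm, Fin.sum_univ_four, grad2]
theorem ricciExplicit_tz : ricciExplicit a d p u r v tt tx xx f₂ f₃ σ m₂ m₃ 0 3 = 0 := by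
  simp [ricciExplicit, ricciForm, gammaForm, Fin.sum_univ_four, grad2]
theorem ricciExplicit_xz : ricciExplicit a d p u r v tt tx xx f₂ f₃ σ m₂ m₃ 1 3 = 0 := by
  simp [ricciExplicit, ricciForm, gammaForm, Fin.sum_univ_four, grad2]

end RicciForm

/-- The data entering the field equations at a point `(t, x)`: `f = F'/F`, `l = P'/P`, their
derivatives `f₁`, `l₁`, and the derivatives of `S` divided by `S`. -/
structure Jet where
  (f f₁ l l₁ st sx stt stx sxx : ℝ)

namespace Jet

/-- The combination of the Ricci components that vanishes if the pressures in the directions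
`y` and `z` are equal. -/
def aniso (b c : ℝ) (j : Jet) : ℝ :=
  j.l₁ + b * c + j.l * j.f - 2 * (-b * j.st + j.l * j.sx)

/-- The conformally rescaled pressure. -/
def press (c : ℝ) (j : Jet) : ℝ :=
  -(j.f₁ - c ^ 2 + j.f ^ 2) / 2 + c * j.st + j.f * j.sx

/-- The `tt` component of the trace-adjusted Ricci tensor. -/
def Y (b c : ℝ) (j : Jet) : ℝ := 2 * j.stt - (b ^ 2 + c ^ 2) / 2 + press c j

/-- The `tx` component of the trace-adjusted Ricci tensor. -/
def X (b c : ℝ) (j : Jet) : ℝ := 2 * j.stx + (c * j.f - b * j.l) / 2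

/-- The `xx` component of the trace-adjusted Ricci tensor. -/
def Z (c : ℝ) (j : Jet) : ℝ := 2 * j.sxx - j.f₁ - (j.f ^ 2 + j.l ^ 2) / 2 - press c j

/-- The trace part of the Ricci tensor. -/
def trc (c : ℝ) (j : Jet) : ℝ :=
  press c j + (-j.stt + j.sxx + c * j.st + j.f * j.sx) - 3 * (j.sx ^ 2 - j.st ^ 2)

end Jet

/-- The jet of the metric functions at `(t, x)`. -/
def jetAt (F P : ℝ → ℝ) (S : ℝ → ℝ → ℝ) (w : ℝ × ℝ) : Jet where
  f := logDeriv F w.2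
  f₁ := deriv (logDeriv F) w.2
  l := logDeriv P w.2
  l₁ := deriv (logDeriv P) w.2
  st := dt (plane S) w / plane S w
  sx := dx (plane S) w / plane S w
  stt := dt (dt (plane S)) w / plane S w
  stx := dt (dx (plane S)) w / plane S w
  sxx := dx (dx (plane S)) w / plane S w

theorem dt_div {φ ψ : ℝ × ℝ → ℝ} {w : ℝ × ℝ} (hφ : DifferentiableAt ℝ φ w)
    (hψ : DifferentiableAt ℝ ψ w) (h : ψ w ≠ 0) :
    dt (fun z => -(φ z / ψ z)) w = -(dt φ w / ψ w - φ w * dt ψ w / ψ w ^ 2) ∧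
    dx (fun z => -(φ z / ψ z)) w = -(dx φ w / ψ w - φ w * dx ψ w / ψ w ^ 2) := by
  obtain ⟨t, x⟩ := w
  have hd : DifferentiableAt ℝ (fun z => -(φ z / ψ z)) (t, x) := by
    fun_prop (disch := assumption)
  constructor
  · refine (dt_eq_deriv hd).unique ?_
    refine (((dt_eq_deriv hφ).fun_div (dt_eq_deriv hψ) h).fun_neg).congr_deriv ?_
    field_simp
  · refine (dx_eq_deriv hd).unique ?_
    refine (((dx_eq_deriv hφ).fun_div (dx_eq_deriv hψ) h).fun_neg).congr_deriv ?_
    field_simp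

theorem Regular.ricci_explicit (hR : Regular F P S U) (hσ : σ = 1 ∨ σ = -1) {X : Coord}
    (hX : X ∈ cylinder U) :
    let j := jetAt F P S (X 0, X 1)
    let R := fun i k => ricci (metricA σ b c F P S) i k X
    R 0 0 = j.Y b c - j.trc c ∧ R 0 1 = j.X b c ∧ R 1 0 = j.X b c ∧
    R 1 1 = j.Z c + j.trc c ∧
    R 2 2 = diagA σ b c F P X 2 * σ * (j.trc c + j.aniso b c / 2) ∧
    R 3 3 = diagA σ b c F P X 3 * σ * (j.trc c - j.aniso b c / 2) ∧
    R 2 0 = 0 ∧ R 2 1 = 0 ∧ R 2 3 = 0 ∧ R 3 0 = 0 ∧ R 3 1 = 0 ∧ R 3 2 = 0 ∧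
    R 0 2 = 0 ∧ R 1 2 = 0 ∧ R 0 3 = 0 ∧ R 1 3 = 0 := by
  intro j R
  have hs := hR.contDiffAt_plane hX
  have h0 := hR.plane_ne hX
  have hS1 := hs.differentiableAt (by simp)
  have hS2 := (contDiffAt_dt hs).differentiableAt (by simp)
  have hS3 := (contDiffAt_dx hs).differentiableAt (by simp)
  have e1 : dt (confT S) (X 0, X 1) = -(j.stt - j.st ^ 2) := by
    have := (dt_div hS2 hS1 h0).1
    refine this.trans ?_
    simp only [j, jetAt]; field_simp
  have e2 : dx (confT S) (X 0, X 1) = -(j.stx - j.st * j.sx) := by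
    have := (dt_div hS2 hS1 h0).2
    refine this.trans ?_
    rw [dt_dx_comm hs]
    simp only [j, jetAt]; field_simp
  have e3 : dt (confX S) (X 0, X 1) = -(j.stx - j.st * j.sx) := by
    have := (dt_div hS3 hS1 h0).1
    refine this.trans ?_
    simp only [j, jetAt]; field_simp
  have e4 : dx (confX S) (X 0, X 1) = -(j.sxx - j.sx ^ 2) := by
    have := (dt_div hS3 hS1 h0).2
    refine this.trans ?_
    simp only [j, jetAt]; field_simp
  have hRe : ∀ i k, R i k = ricciExplicit (-j.st) (-j.sx) (-j.st - (b + c) / 2)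
      (-j.sx + (j.f - j.l) / 2) (-j.st + (b - c) / 2) (-j.sx + (j.f + j.l) / 2)
      (-(j.stt - j.st ^ 2)) (-(j.stx - j.st * j.sx)) (-(j.sxx - j.sx ^ 2))
      ((j.f₁ - j.l₁) / 2) ((j.f₁ + j.l₁) / 2) σ (diagA σ b c F P X 2)
      (diagA σ b c F P X 3) i k := by
    intro i k
    simp only [R]
    rw [hR.ricci_eq hσ hX, ricciExplicit]
    have hd : diagA σ b c F P X = ![-σ, σ, diagA σ b c F P X 2, diagA σ b c F P X 3] := by
      ext i; fin_cases i <;> rfl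
    have hφ : dlogGrad F P S (X 0, X 1) = (fun l i k => grad2
        (![grad2 (-(j.stt - j.st ^ 2)) (-(j.stx - j.st * j.sx)),
          grad2 (-(j.stt - j.st ^ 2)) (-(j.stx - j.st * j.sx)),
          grad2 (-(j.stt - j.st ^ 2)) (-(j.stx - j.st * j.sx)),
          grad2 (-(j.stt - j.st ^ 2)) (-(j.stx - j.st * j.sx))] i k)
        (![grad2 (-(j.stx - j.st * j.sx)) (-(j.sxx - j.sx ^ 2)),
          grad2 (-(j.stx - j.st * j.sx)) (-(j.sxx - j.sx ^ 2)),
          grad2 (-(j.stx - j.st * j.sx)) (-(j.sxx - j.sx ^ 2) + (j.f₁ - j.l₁) / 2),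
          grad2 (-(j.stx - j.st * j.sx)) (-(j.sxx - j.sx ^ 2) + (j.f₁ + j.l₁) / 2)] i k) l) := by
      funext l i k
      unfold dlogGrad
      rw [e1, e2, e3, e4]
      rfl
    rw [hφ, hd]
    rfl
  have hσ0 : σ ≠ 0 := by rcases hσ with h | h <;> simp [h]
  have hσi : σ⁻¹ = σ := by rcases hσ with h | h <;> norm_num [h]
  have h2 := hR.diagA_ne (b := b) (c := c) hσ hX 2
  have h3 := hR.diagA_ne (b := b) (c := c) hσ hX 3
  simp only [hRe]
  refine ⟨?_, ?_, ?_, ?_, ?_, ?_, ricciExplicit_yt .., ricciExplicit_yx .., ricciExplicit_yz ..,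
    ricciExplicit_zt .., ricciExplicit_zx .., ricciExplicit_zy .., ricciExplicit_ty ..,
    ricciExplicit_xy .., ricciExplicit_tz .., ricciExplicit_xz ..⟩
  · rw [ricciExplicit_tt _ _ _ _ _ _ _ _ _ _ _ _ _ _ hσ0]
    simp only [Jet.Y, Jet.trc, Jet.press]; ring
  · rw [ricciExplicit_tx _ _ _ _ _ _ _ _ _ _ _ _ _ _ hσ0]
    simp only [Jet.X]; ring
  · rw [ricciExplicit_xt _ _ _ _ _ _ _ _ _ _ _ _ _ _ hσ0]
    simp only [Jet.X]; ring
  · rw [ricciExplicit_xx _ _ _ _ _ _ _ _ _ _ _ _ _ _ hσ0]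
    simp only [Jet.Z, Jet.trc, Jet.press]; ring
  · rw [ricciExplicit_yy _ _ _ _ _ _ _ _ _ _ _ _ _ _ hσ0 h2, hσi]
    simp only [Jet.trc, Jet.press, Jet.aniso]; ring
  · rw [ricciExplicit_zz _ _ _ _ _ _ _ _ _ _ _ _ _ _ hσ0 h3, hσi]
    simp only [Jet.trc, Jet.press, Jet.aniso]; ring

end G2Fluid
end

noncomputable section

namespace G2Fluid

open Filter Topology

variable {σ b c : ℝ} {F P : ℝ → ℝ} {S : ℝ → ℝ → ℝ} {U : Set (ℝ × ℝ)}

/-! ### The field equations of a perfect fluid -/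

theorem Regular.diagA_pos (hR : Regular F P S U) {X : Coord} (hX : X ∈ cylinder U) :
    0 < diagA σ b c F P X 2 ∧ 0 < diagA σ b c F P X 3 := by
  have hF := hR.F_pos _ hX
  have hP := hR.P_pos _ hX
  simp only at hF hP
  constructor
  · change 0 < F (X 1) / P (X 1) * Real.exp (-(b + c) * X 0)
    positivity
  · change 0 < F (X 1) * P (X 1) * Real.exp ((b - c) * X 0)
    positivity

theorem metricA_mulVec (X : Coord) (u : Coord) (i : Fin 4) :
    (metricA σ b c F P S X *ᵥ u) i =
      (1 / (S (X 0) (X 1)) ^ 2) * diagA σ b c F P X i * u i := by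
  have : metricA σ b c F P S X = (1 / (S (X 0) (X 1)) ^ 2) •
    Matrix.diagonal (diagA σ b c F P X) := rfl
  rw [this, Matrix.smul_mulVec, Pi.smul_apply, Matrix.mulVec_diagonal, smul_eq_mul]
  ring

/-- The field equations satisfied by a perfect fluid. -/
structure FluidEq (σ b c : ℝ) (j : Jet) (m wt wx : ℝ) : Prop where
  aniso : j.aniso b c = 0
  m_ne : m ≠ 0
  Y_eq : j.Y b c = m * wt ^ 2
  X_eq : j.X b c = m * wt * wx
  Z_eq : j.Z c = m * wx ^ 2
  timelike : σ * (wx ^ 2 - wt ^ 2) < 0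

theorem Regular.fluidEq (hR : Regular F P S U) (hσ : σ = 1 ∨ σ = -1) {X : Coord}
    (hX : X ∈ cylinder U) (h : IsPerfectFluidAt (metricA σ b c F P S) X) :
    ∃ m wt wx, FluidEq σ b c (jetAt F P S (X 0, X 1)) m wt wx := by
  obtain ⟨ρ, p, u, hm, hu, hE⟩ := h
  obtain ⟨r00, r01, -, r11, r22, r33, r20, r21, r23, r30, r31, -⟩ :=
    hR.ricci_explicit (b := b) (c := c) hσ hX
  beta_reduce at r00 r01 r11 r22 r33 r20 r21 r23 r30 r31
  obtain ⟨m2, m3⟩ := hR.diagA_pos (σ := σ) (b := b) (c := c) hX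
  have h0 : S (X 0) (X 1) ≠ 0 := hR.S_ne_zero _ hX
  set j := jetAt F P S (X 0, X 1)
  set w : Coord := metricA σ b c F P S X *ᵥ u with hw
  set W := 1 / (S (X 0) (X 1)) ^ 2 with hW
  have hWpos : 0 < W := by positivity
  have hwi : ∀ i, w i = W * diagA σ b c F P X i * u i := metricA_mulVec X u
  set p' := p + 1 / 2 * scalarCurv (metricA σ b c F P S) X with hp'
  have hRic : ∀ i k, ricci (metricA σ b c F P S) i k X =
      (ρ + p) * w i * w k + p' * metricA σ b c F P S X i k := by
    intro i k
    have := hE i k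
    unfold einstein at this
    rw [hp']; linear_combination this
  have hd : ∀ i, metricA σ b c F P S X i i = W * diagA σ b c F P X i := by
    intro i; simp [metricA_apply, hW]
  have ho : ∀ i k, i ≠ k → metricA σ b c F P S X i k = 0 := by
    intro i k hik; simp [metricA_apply, Matrix.diagonal_apply_ne _ hik]
  have z20 := hRic 2 0
  have z21 := hRic 2 1
  have z23 := hRic 2 3
  have z30 := hRic 3 0
  have z31 := hRic 3 1
  rw [r20, ho 2 0 (by decide), mul_zero, add_zero] at z20
  rw [r21, ho 2 1 (by decide), mul_zero, add_zero] at z21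
  rw [r23, ho 2 3 (by decide), mul_zero, add_zero] at z23
  rw [r30, ho 3 0 (by decide), mul_zero, add_zero] at z30
  rw [r31, ho 3 1 (by decide), mul_zero, add_zero] at z31
  have hdot : u 0 * w 0 + u 1 * w 1 + u 2 * w 2 + u 3 * w 3 = -1 := by
    rw [← hu]; simp [dotProduct, Fin.sum_univ_four]
  have hd0 : diagA σ b c F P X 0 = -σ := rfl
  have hd1 : diagA σ b c F P X 1 = σ := rfl
  have mz : ∀ {x y : ℝ}, (0 : ℝ) = (ρ + p) * x * y → x ≠ 0 → y = 0 := by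
    intro x y h hx
    rcases mul_eq_zero.1 h.symm with h | h
    · rcases mul_eq_zero.1 h with h | h
      · exact absurd h hm
      · exact absurd h hx
    · exact h
  have u0 : ∀ i, diagA σ b c F P X i ≠ 0 → w i = 0 → u i = 0 := by
    intro i hi h
    rw [hwi] at h
    simpa [hWpos.ne', hi] using h
  have hw2 : w 2 = 0 := by
    by_contra h2
    have hw0 := mz z20 h2
    have hw1 := mz z21 h2
    have hw3 := mz z23 h2
    rw [hw0, hw1, hw3, hwi 2] at hdot
    nlinarith [mul_nonneg (mul_pos hWpos m2).le (sq_nonneg (u 2))]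
  have hw3 : w 3 = 0 := by
    by_contra h2
    have hw0 := mz z30 h2
    have hw1 := mz z31 h2
    rw [hw0, hw1, hw2, hwi 3] at hdot
    nlinarith [mul_nonneg (mul_pos hWpos m3).le (sq_nonneg (u 3))]
  have z22 := hRic 2 2
  have z33 := hRic 3 3
  rw [r22, hd, hw2] at z22
  rw [r33, hd, hw3] at z33
  have hσ2 : σ * σ = 1 := by rcases hσ with h | h <;> norm_num [h]
  have e2 : σ * (j.trc c + j.aniso b c / 2) = p' * W := by
    apply mul_left_cancel₀ m2.ne'; linear_combination z22
  have e3 : σ * (j.trc c - j.aniso b c / 2) = p' * W := by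
    apply mul_left_cancel₀ m3.ne'; linear_combination z33
  have ha : j.aniso b c = 0 := by linear_combination σ * (e2 - e3) - hσ2 * j.aniso b c
  have hp : p' * W = σ * j.trc c := by linear_combination -(e2 + e3) / 2
  refine ⟨ρ + p, w 0, w 1, ha, hm, ?_, ?_, ?_, ?_⟩
  · have := hRic 0 0
    rw [r00, hd, hd0] at this
    linear_combination this - σ * hp - hσ2 * j.trc c
  · have := hRic 0 1
    rw [r01, ho 0 1 (by decide)] at this
    linear_combination this
  · have := hRic 1 1
    rw [r11, hd, hd1] at this
    linear_combination this + σ * hp + hσ2 * j.trc c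
  · rw [hw2, hw3, hwi 0, hwi 1, hd0, hd1] at hdot
    rw [hwi 0, hwi 1, hd0, hd1]
    have : σ * ((W * σ * u 1) ^ 2 - (W * -σ * u 0) ^ 2) = -W := by
      linear_combination W * hdot + W ^ 2 * σ * (u 1 ^ 2 - u 0 ^ 2) * hσ2
    rw [this]; linarith

theorem Regular.einstein_eq_of_aniso (hR : Regular F P S U) (hσ : σ = 1 ∨ σ = -1) {X : Coord}
    (hX : X ∈ cylinder U) (ha : (jetAt F P S (X 0, X 1)).aniso b c = 0) {m wt wx : ℝ}
    (hY : (jetAt F P S (X 0, X 1)).Y b c = m * wt ^ 2)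
    (hXx : (jetAt F P S (X 0, X 1)).X b c = m * wt * wx)
    (hZ : (jetAt F P S (X 0, X 1)).Z c = m * wx ^ 2) :
    ∃ p, ∀ i k, einstein (metricA σ b c F P S) i k X =
      m * (![wt, wx, 0, 0] : Coord) i * (![wt, wx, 0, 0] : Coord) k +
        p * metricA σ b c F P S X i k := by
  obtain ⟨r00, r01, r10, r11, r22, r33, r20, r21, r23, r30, r31, r32, r02, r12, r03, r13⟩ :=
    hR.ricci_explicit (b := b) (c := c) hσ hX
  beta_reduce at r00 r01 r10 r11 r22 r33 r20 r21 r23 r30 r31 r32 r02 r12 r03 r13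
  have h0 : S (X 0) (X 1) ≠ 0 := hR.S_ne_zero _ hX
  set j := jetAt F P S (X 0, X 1)
  have hσ2 : σ * σ = 1 := by rcases hσ with h | h <;> norm_num [h]
  have hd : ∀ i, metricA σ b c F P S X i i =
      1 / (S (X 0) (X 1)) ^ 2 * diagA σ b c F P X i := by
    intro i; simp [metricA_apply]
  have ho : ∀ i k, i ≠ k → metricA σ b c F P S X i k = 0 := by
    intro i k hik; simp [metricA_apply, Matrix.diagonal_apply_ne _ hik]
  have hW : (S (X 0) (X 1)) ^ 2 * (1 / (S (X 0) (X 1)) ^ 2) = 1 := by field_simp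
  have hd0 : diagA σ b c F P X 0 = -σ := rfl
  have hd1 : diagA σ b c F P X 1 = σ := rfl
  refine ⟨(S (X 0) (X 1)) ^ 2 * σ * j.trc c -
    1 / 2 * scalarCurv (metricA σ b c F P S) X, fun i k => ?_⟩
  have key : ricci (metricA σ b c F P S) i k X =
      m * (![wt, wx, 0, 0] : Coord) i * (![wt, wx, 0, 0] : Coord) k +
        (S (X 0) (X 1)) ^ 2 * σ * j.trc c * metricA σ b c F P S X i k := by
    fin_cases i <;> fin_cases k <;>
      simp only [Fin.zero_eta, Fin.mk_one, Fin.reduceFinMk, Matrix.cons_val_zero,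
        Matrix.cons_val_one, Matrix.cons_val, Fin.isValue]
    · rw [r00, hd, hd0, hY]; linear_combination j.trc c * hσ2 + j.trc c * hW * σ * σ
    · rw [r01, ho _ _ (by decide), hXx]; ring
    · rw [r02, ho _ _ (by decide)]; ring
    · rw [r03, ho _ _ (by decide)]; ring
    · rw [r10, ho _ _ (by decide), hXx]; ring
    · rw [r11, hd, hd1, hZ]; linear_combination -j.trc c * hσ2 - j.trc c * hW * σ * σ
    · rw [r12, ho _ _ (by decide)]; ring
    · rw [r13, ho _ _ (by decide)]; ring
    · rw [r20, ho _ _ (by decide)]; ring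
    · rw [r21, ho _ _ (by decide)]; ring
    · rw [r22, hd, ha]
      linear_combination -diagA σ b c F P X 2 * σ * j.trc c * hW
    · rw [r23, ho _ _ (by decide)]; ring
    · rw [r30, ho _ _ (by decide)]; ring
    · rw [r31, ho _ _ (by decide)]; ring
    · rw [r32, ho _ _ (by decide)]; ring
    · rw [r33, hd, ha]
      linear_combination -diagA σ b c F P X 3 * σ * j.trc c * hW
  unfold einstein
  rw [key]; ring

/-- A real quadratic form in two variables of vanishing determinant is `± K²`. -/
theorem exists_rank_one {Y X Z : ℝ} (h : Y * Z = X ^ 2) :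
    ∃ ε kt kx : ℝ, (ε = 1 ∨ ε = -1) ∧ Y = ε * kt ^ 2 ∧ X = ε * kt * kx ∧ Z = ε * kx ^ 2 := by
  have pos : ∀ {Y X Z : ℝ}, Y * Z = X ^ 2 → 0 ≤ Y → 0 ≤ Z →
      ∃ kt kx : ℝ, Y = kt ^ 2 ∧ X = kt * kx ∧ Z = kx ^ 2 := by
    intro Y X Z h hY hZ
    have hs : √Y * √Z = |X| := by rw [← Real.sqrt_mul hY, h, Real.sqrt_sq_eq_abs]
    rcases le_total 0 X with hX | hX
    · exact ⟨√Y, √Z, (Real.sq_sqrt hY).symm, by rw [hs, abs_of_nonneg hX],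
        (Real.sq_sqrt hZ).symm⟩
    · exact ⟨√Y, -√Z, (Real.sq_sqrt hY).symm, by rw [mul_neg, hs, abs_of_nonpos hX, neg_neg],
        by rw [neg_sq, Real.sq_sqrt hZ]⟩
  by_cases hY : 0 ≤ Y ∧ 0 ≤ Z
  · obtain ⟨kt, kx, h1, h2, h3⟩ := pos h hY.1 hY.2
    exact ⟨1, kt, kx, Or.inl rfl, by linarith, by linarith, by linarith⟩
  · have hneg : Y ≤ 0 ∧ Z ≤ 0 := by
      rw [not_and_or, not_le, not_le] at hY
      have := sq_nonneg X
      rcases hY with h1 | h1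
      · exact ⟨h1.le, by nlinarith⟩
      · exact ⟨by nlinarith, h1.le⟩
    obtain ⟨kt, kx, h1, h2, h3⟩ := pos (Y := -Y) (X := -X) (Z := -Z) (by linarith)
      (by linarith [hneg.1]) (by linarith [hneg.2])
    exact ⟨-1, kt, kx, Or.inr rfl, by linarith, by linarith, by linarith⟩

theorem Regular.isFluidFormAt (hR : Regular F P S U) (hσ : σ = 1 ∨ σ = -1) {X : Coord}
    (hX : X ∈ cylinder U) (ha : (jetAt F P S (X 0, X 1)).aniso b c = 0)
    (hdet : (jetAt F P S (X 0, X 1)).Y b c * (jetAt F P S (X 0, X 1)).Z c =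
      (jetAt F P S (X 0, X 1)).X b c ^ 2) : IsFluidFormAt (metricA σ b c F P S) X := by
  obtain ⟨ε, kt, kx, hε, hY, hXx, hZ⟩ := exists_rank_one hdet
  obtain ⟨p, hp⟩ := hR.einstein_eq_of_aniso hσ hX ha hY hXx hZ
  exact ⟨ε, p, ![kt, kx, 0, 0], hε, rfl, rfl, hp⟩

theorem Regular.isPerfectFluidAt (hR : Regular F P S U) (hσ : σ = 1 ∨ σ = -1) {X : Coord}
    (hX : X ∈ cylinder U)
    (h : ∃ m wt wx, FluidEq σ b c (jetAt F P S (X 0, X 1)) m wt wx) :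
    IsPerfectFluidAt (metricA σ b c F P S) X := by
  obtain ⟨m, wt, wx, h⟩ := h
  have h0 : S (X 0) (X 1) ≠ 0 := hR.S_ne_zero _ hX
  have hσ2 : σ * σ = 1 := by rcases hσ with h | h <;> norm_num [h]
  set W := 1 / (S (X 0) (X 1)) ^ 2 with hW
  have hWpos : 0 < W := by positivity
  set n := -(σ * (wx ^ 2 - wt ^ 2)) with hn
  have hnpos : 0 < n := by have := h.timelike; linarith
  obtain ⟨p, hp⟩ := hR.einstein_eq_of_aniso hσ hX h.aniso h.Y_eq h.X_eq h.Z_eq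
  set r := √(W / n) with hr
  have hr2 : r ^ 2 = W / n := Real.sq_sqrt (by positivity)
  have hrpos : 0 < r := Real.sqrt_pos.2 (by positivity)
  have hd0 : diagA σ b c F P X 0 = -σ := rfl
  have hd1 : diagA σ b c F P X 1 = σ := rfl
  set u : Coord := ![-(σ * (r * wt) / W), σ * (r * wx) / W, 0, 0] with hu
  have hw : metricA σ b c F P S X *ᵥ u = r • (![wt, wx, 0, 0] : Coord) := by
    ext i
    rw [metricA_mulVec, ← hW]
    fin_cases i
    · simp only [Fin.zero_eta, hd0, hu, Matrix.cons_val_zero, Pi.smul_apply, smul_eq_mul]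
      field_simp
      linear_combination wt * hσ2
    · simp only [Fin.mk_one, hd1, hu, Matrix.cons_val_one, Matrix.cons_val_zero, Pi.smul_apply,
        smul_eq_mul]
      field_simp
      linear_combination wx * hσ2
    · simp [hu]
    · simp [hu]
  refine ⟨m / r ^ 2 - p, p, u, ?_, ?_, ?_⟩
  · have := h.m_ne
    simp only [sub_add_cancel]
    positivity
  · rw [hw]
    simp only [hu, dotProduct, Fin.sum_univ_four, Pi.smul_apply, smul_eq_mul, Matrix.cons_val_zero,
      Matrix.cons_val_one, Matrix.cons_val, mul_zero, add_zero]
    have : -(σ * (r * wt) / W) * (r * wt) + σ * (r * wx) / W * (r * wx) =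
      r ^ 2 * (-n) / W := by rw [hn]; field_simp; ring
    rw [this, hr2]; field_simp
  · intro i k
    rw [hp i k, hw]
    simp only [Pi.smul_apply, smul_eq_mul]
    field_simp
    ring

/-! ### Conformal Killing vectors -/

theorem lieDerivMetric_linField (hR : Regular F P S U) {X : Coord} (hX : X ∈ cylinder U)
    (α β μ ν : ℝ) (i k : Fin 4) :
    lieDerivMetric (metricA σ b c F P S) (linField α β μ ν) i k X =
      2 * (α * logGrad b c F P S (X 0, X 1) i 0 + β * logGrad b c F P S (X 0, X 1) i 1 +
        (![0, 0, μ, ν] : Coord) i) * metricA σ b c F P S X i k := by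
  have hξ : ∀ l n, pd n (fun Y => linField α β μ ν Y l) X =
      if n = l then (![0, 0, μ, ν] : Coord) l else 0 := by
    intro l n
    have hc : ∀ k : ℝ, pd n (fun _ : Coord => k) X = 0 := by
      intro k; rw [(HasPd.const k X).pd]; fin_cases n <;> rfl
    have hp : ∀ (m : Fin 4) (k : ℝ), pd n (fun Y : Coord => k * Y m) X =
        if n = m then k else 0 := by
      intro m k
      have h1 : HasFDerivAt (fun Y : Coord => k * Y m)
          (k • (ContinuousLinearMap.proj (R := ℝ) (φ := fun _ : Fin 4 => ℝ) m)) X :=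
        (ContinuousLinearMap.proj (R := ℝ) (φ := fun _ : Fin 4 => ℝ) m).hasFDerivAt.const_mul k
      unfold pd
      rw [h1.fderiv]
      simp [Pi.single_apply, eq_comm]
    fin_cases l
    · refine (hc α).trans ?_; simp
    · refine (hc β).trans ?_; simp
    · exact hp 2 μ
    · exact hp 3 ν
  have hφ2 : ∀ i, logGrad b c F P S (X 0, X 1) i 2 = 0 := by intro i; fin_cases i <;> rfl
  have hφ3 : ∀ i, logGrad b c F P S (X 0, X 1) i 3 = 0 := by intro i; fin_cases i <;> rfl
  unfold lieDerivMetric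
  simp only [hR.pd_metricA hX, hξ]
  by_cases hik : i = k
  · subst hik
    rw [Finset.sum_add_distrib, Finset.sum_add_distrib]
    have e1 : ∑ l, metricA σ b c F P S X l i * (if i = l then (![0, 0, μ, ν] : Coord) l else 0) =
        metricA σ b c F P S X i i * (![0, 0, μ, ν] : Coord) i := by simp
    have e2 : ∑ l, metricA σ b c F P S X i l * (if i = l then (![0, 0, μ, ν] : Coord) l else 0) =
        metricA σ b c F P S X i i * (![0, 0, μ, ν] : Coord) i := by simp
    rw [e1, e2, Fin.sum_univ_four, hφ2, hφ3]
    simp only [linField, Matrix.cons_val_zero, Matrix.cons_val_one, Matrix.cons_val]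
    ring
  · have ho : ∀ i k, i ≠ k → metricA σ b c F P S X i k = 0 := by
      intro i k hik; simp [metricA_apply, Matrix.diagonal_apply_ne _ hik]
    rw [ho i k hik]
    have e1 : ∀ l, metricA σ b c F P S X l k *
        (if i = l then (![0, 0, μ, ν] : Coord) l else 0) = 0 := by
      intro l
      split_ifs with h
      · subst h; rw [ho _ _ hik, zero_mul]
      · simp
    have e2 : ∀ l, metricA σ b c F P S X i l *
        (if k = l then (![0, 0, μ, ν] : Coord) l else 0) = 0 := by
      intro l
      split_ifs with h
      · subst h; rw [ho _ _ hik, zero_mul]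
      · simp
    simp [e1, e2]

theorem scaleFactor_eq (hR : Regular F P S U) {w : ℝ × ℝ} (hw : w ∈ U) :
    scaleFactor S w.1 w.2 = confT S w := by
  have := (dt_eq_deriv (φ := plane S) (t := w.1) (x := w.2)
    ((hR.contDiffAt_plane hw).differentiableAt (by simp))).deriv
  unfold scaleFactor confT
  rw [← this]; rfl

/-- `k` is a conformal Killing vector. -/
theorem Regular.isConformalKilling_ckv (hR : Regular F P S U) :
    IsConformalKilling (metricA σ b c F P S) (cylinder U) (ckv b c)
      (fun X => scaleFactor S (X 0) (X 1)) := by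
  intro X hX i k
  unfold ckv
  rw [lieDerivMetric_linField hR hX]
  have := scaleFactor_eq hR hX
  simp only at this
  beta_reduce
  rw [this]
  congr 2
  fin_cases i
  · simp [logGrad, grad2]
  · simp [logGrad, grad2]
  · simp [logGrad, grad2]; ring
  · simp [logGrad, grad2]; ring

end G2Fluid
end

noncomputable section

namespace G2Fluid

open Filter Topology

variable {σ b c : ℝ} {F P : ℝ → ℝ} {S : ℝ → ℝ → ℝ} {U : Set (ℝ × ℝ)} {G H K : ℝ → ℝ}

/-! ### The field equations of a separated conformal factor -/

/-- The jet of the metric functions if `S = G(x) H(t + b K(x))`. -/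
def sepJet (b f f₁ q q₁ γ γ₁ h e : ℝ) : Jet where
  f := f
  f₁ := f₁
  l := b * q
  l₁ := b * q₁
  st := h
  sx := γ + h / q
  stt := e
  stx := γ * h + e / q
  sxx := γ₁ + γ ^ 2 + 2 * γ * h / q - q₁ * h / q ^ 2 + e / q ^ 2

theorem IsOpen.eventually_snd (hU : IsOpen U) {w : ℝ × ℝ} (hw : w ∈ U) :
    ∀ᶠ y in 𝓝 w.2, (w.1, y) ∈ U :=
  (Continuous.prodMk_right w.1).continuousAt.eventually (hU.mem_nhds hw)

theorem IsOpen.eventually_fst (hU : IsOpen U) {w : ℝ × ℝ} (hw : w ∈ U) :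
    ∀ᶠ s in 𝓝 w.1, (s, w.2) ∈ U :=
  (Continuous.prodMk_left w.2).continuousAt.eventually (hU.mem_nhds hw)

theorem Regular.contDiffAt_qFun (hR : Regular F P S U) {w : ℝ × ℝ} (hw : w ∈ U) :
    ContDiffAt ℝ ∞ (qFun b P) w.2 :=
  (contDiffAt_logDeriv (hR.smooth_P w hw) (hR.P_pos w hw).ne').div_const b

theorem logDeriv_eq_mul_qFun (hb : b ≠ 0) (P : ℝ → ℝ) : logDeriv P = fun x => b * qFun b P x := by
  funext x; unfold qFun; field_simp

theorem Separated.qFun_ne (hS : Separated b P S U G H K) (hR : Regular F P S U) (hb : b ≠ 0)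
    {w : ℝ × ℝ} (hw : w ∈ U) : qFun b P w.2 ≠ 0 := by
  have h1 := hS.deriv_P_ne w hw
  have h2 := (hR.P_pos w hw).ne'
  simp [qFun, logDeriv_apply, h1, h2, hb]

theorem Separated.hasDerivAt_arg (hS : Separated b P S U G H K) (hb : b ≠ 0)
    {w : ℝ × ℝ} (hw : w ∈ U) :
    HasDerivAt (fun y => w.1 + b * K y) (1 / qFun b P w.2) w.2 := by
  refine (((hS.hasDerivAt_K w hw).const_mul b).const_add w.1).congr_deriv ?_
  have h1 := hS.deriv_P_ne w hw
  simp only [qFun, logDeriv_apply]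
  field_simp

theorem Separated.hasDerivAt_mul (hS : Separated b P S U G H K) (hb : b ≠ 0)
    {w : ℝ × ℝ} (hw : w ∈ U) {A A' B B' : _} {a β : ℝ → ℝ} (ha : HasDerivAt a A' w.2)
    (hβ : HasDerivAt β B' (w.1 + b * K w.2)) (hA : a w.2 = A) (hB : β (w.1 + b * K w.2) = B) :
    HasDerivAt (fun y => a y * β (w.1 + b * K y)) (A' * B + A * (B' / qFun b P w.2)) w.2 := by
  refine (ha.fun_mul (HasDerivAt.scomp (h := fun y => w.1 + b * K y) w.2 hβ
    (hS.hasDerivAt_arg hb hw))).congr_deriv ?_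
  simp only [hA, Function.comp, hB, smul_eq_mul]; ring

theorem hasDerivAt_mul_shift {β : ℝ → ℝ} {B' a k t : ℝ} (hβ : HasDerivAt β B' (t + k)) :
    HasDerivAt (fun s => a * β (s + k)) (a * B') t :=
  (hβ.comp_add_const t k).const_mul a

theorem Separated.factors_ne (hS : Separated b P S U G H K) (hR : Regular F P S U)
    {w : ℝ × ℝ} (hw : w ∈ U) : G w.2 ≠ 0 ∧ H (w.1 + b * K w.2) ≠ 0 := by
  have := hR.S_ne_zero w hw
  rw [hS.S_eq w hw] at this
  exact mul_ne_zero_iff.1 this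

theorem Separated.dt_plane (hS : Separated b P S U G H K) (hR : Regular F P S U)
    {w : ℝ × ℝ} (hw : w ∈ U) :
    dt (plane S) w = G w.2 * deriv H (w.1 + b * K w.2) := by
  refine (dt_eq_deriv (t := w.1) (x := w.2)
    ((hR.contDiffAt_plane hw).differentiableAt (by simp))).unique ?_
  have h1 := ((hS.smooth_H w hw).differentiableAt (by simp)).hasDerivAt
  refine (hasDerivAt_mul_shift (a := G w.2) h1).congr_of_eventuallyEq ?_
  filter_upwards [IsOpen.eventually_fst hR.isOpen hw] with s hs
  exact hS.S_eq _ hs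

theorem Separated.dx_plane (hS : Separated b P S U G H K) (hR : Regular F P S U) (hb : b ≠ 0)
    {w : ℝ × ℝ} (hw : w ∈ U) :
    dx (plane S) w = deriv G w.2 * H (w.1 + b * K w.2) +
      G w.2 * (deriv H (w.1 + b * K w.2) / qFun b P w.2) := by
  refine (dx_eq_deriv (t := w.1) (x := w.2)
    ((hR.contDiffAt_plane hw).differentiableAt (by simp))).unique ?_
  have h1 := ((hS.smooth_H w hw).differentiableAt (by simp)).hasDerivAt
  have h2 := ((hS.smooth_G w hw).differentiableAt (by simp)).hasDerivAt
  refine (hS.hasDerivAt_mul hb hw h2 h1 rfl rfl).congr_of_eventuallyEq ?_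
  filter_upwards [IsOpen.eventually_snd hR.isOpen hw] with y hy
  exact hS.S_eq _ hy

theorem Separated.jetAt_eq (hS : Separated b P S U G H K) (hR : Regular F P S U) (hb : b ≠ 0)
    {w : ℝ × ℝ} (hw : w ∈ U) :
    jetAt F P S w = sepJet b (logDeriv F w.2) (deriv (logDeriv F) w.2) (qFun b P w.2)
      (deriv (qFun b P) w.2) (logDeriv G w.2) (deriv (logDeriv G) w.2)
      (dotLog H (w.1 + b * K w.2)) (ddotLog H (w.1 + b * K w.2)) := by
  obtain ⟨hG, hH⟩ := hS.factors_ne hR hw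
  have hq := hS.qFun_ne hR hb hw
  have hpl : plane S w = G w.2 * H (w.1 + b * K w.2) := hS.S_eq w hw
  have dH := ((hS.smooth_H w hw).differentiableAt (by simp)).hasDerivAt
  have ddH := ((contDiffAt_deriv (hS.smooth_H w hw)).differentiableAt (by simp)).hasDerivAt
  have dG := ((hS.smooth_G w hw).differentiableAt (by simp)).hasDerivAt
  have ddG := ((contDiffAt_deriv (hS.smooth_G w hw)).differentiableAt (by simp)).hasDerivAt
  have dq := ((hR.contDiffAt_qFun (b := b) hw).differentiableAt (by simp)).hasDerivAt
  have hsm := hR.contDiffAt_plane hw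
  have htt : dt (dt (plane S)) w = G w.2 * deriv (deriv H) (w.1 + b * K w.2) := by
    refine (dt_eq_deriv (t := w.1) (x := w.2)
      ((contDiffAt_dt hsm).differentiableAt (by simp))).unique ?_
    refine (hasDerivAt_mul_shift (a := G w.2) ddH).congr_of_eventuallyEq ?_
    filter_upwards [IsOpen.eventually_fst hR.isOpen hw] with s hs
    exact hS.dt_plane hR hs
  have htx : dt (dx (plane S)) w = deriv G w.2 * deriv H (w.1 + b * K w.2) +
      G w.2 * (deriv (deriv H) (w.1 + b * K w.2) / qFun b P w.2) := by
    rw [← dt_dx_comm hsm]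
    refine (dx_eq_deriv (t := w.1) (x := w.2)
      ((contDiffAt_dt hsm).differentiableAt (by simp))).unique ?_
    refine (hS.hasDerivAt_mul hb hw dG ddH rfl rfl).congr_of_eventuallyEq ?_
    filter_upwards [IsOpen.eventually_snd hR.isOpen hw] with y hy
    exact hS.dt_plane hR hy
  have hxx : dx (dx (plane S)) w =
      (deriv (deriv G) w.2 * H (w.1 + b * K w.2) +
        deriv G w.2 * (deriv H (w.1 + b * K w.2) / qFun b P w.2)) +
      ((deriv G w.2 * qFun b P w.2 - G w.2 * deriv (qFun b P) w.2) / qFun b P w.2 ^ 2 *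
          deriv H (w.1 + b * K w.2) +
        G w.2 / qFun b P w.2 * (deriv (deriv H) (w.1 + b * K w.2) / qFun b P w.2)) := by
    refine (dx_eq_deriv (t := w.1) (x := w.2)
      ((contDiffAt_dx hsm).differentiableAt (by simp))).unique ?_
    refine ((hS.hasDerivAt_mul hb hw ddG dH rfl rfl).fun_add
      (hS.hasDerivAt_mul hb hw (dG.fun_div dq hq) ddH rfl rfl)).congr_of_eventuallyEq ?_
    filter_upwards [IsOpen.eventually_snd hR.isOpen hw] with y hy
    rw [hS.dx_plane hR hb hy]
    ring
  have hγ : deriv (logDeriv G) w.2 =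
      (deriv (deriv G) w.2 * G w.2 - deriv G w.2 * deriv G w.2) / G w.2 ^ 2 :=
    (ddG.fun_div dG hG).deriv
  have hl : deriv (logDeriv P) w.2 = b * deriv (qFun b P) w.2 := by
    rw [logDeriv_eq_mul_qFun hb]; exact (dq.const_mul b).deriv
  unfold jetAt sepJet
  rw [Jet.mk.injEq]
  refine ⟨rfl, rfl, by rw [logDeriv_eq_mul_qFun hb], hl, ?_, ?_, ?_, ?_, ?_⟩
  · rw [hS.dt_plane hR hw, hpl, dotLog]; field_simp
  · rw [hS.dx_plane hR hb hw, hpl, dotLog, logDeriv_apply]; field_simp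
  · rw [htt, hpl, ddotLog]; field_simp
  · rw [htx, hpl, dotLog, ddotLog, logDeriv_apply]; field_simp
  · rw [hxx, hpl, dotLog, ddotLog, hγ, logDeriv_apply]; field_simp; ring

theorem deriv_of_eq_comp (hU : IsOpen U) {g q φ : ℝ → ℝ} {φ' : ℝ} {w : ℝ × ℝ} (hw : w ∈ U)
    (h : ∀ w ∈ U, g w.2 = φ (q w.2)) (hφ : HasDerivAt φ φ' (q w.2))
    (hq : DifferentiableAt ℝ q w.2) : deriv g w.2 = φ' * deriv q w.2 := by
  refine HasDerivAt.deriv ?_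
  refine (hφ.comp w.2 hq.hasDerivAt).congr_of_eventuallyEq ?_
  filter_upwards [IsOpen.eventually_snd hU hw] with y hy
  exact h _ hy

/-- If `q`, `F'/F = φ(q)` and `G'/G = ψ(q)` satisfy autonomous equations, the jet is a function
of `q`, `Ḣ/H` and `Ḧ/H`. -/
theorem Separated.jetAt_of_comp (hS : Separated b P S U G H K) (hR : Regular F P S U) (hb : b ≠ 0)
    {φ ψ χ : ℝ → ℝ} {φ' ψ' : ℝ} {w : ℝ × ℝ} (hw : w ∈ U)
    (hχ : ∀ w ∈ U, deriv (qFun b P) w.2 = χ (qFun b P w.2))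
    (hφ : ∀ w ∈ U, logDeriv F w.2 = φ (qFun b P w.2))
    (hψ : ∀ w ∈ U, logDeriv G w.2 = ψ (qFun b P w.2))
    (hφ' : HasDerivAt φ φ' (qFun b P w.2)) (hψ' : HasDerivAt ψ ψ' (qFun b P w.2)) :
    jetAt F P S w = sepJet b (φ (qFun b P w.2)) (φ' * χ (qFun b P w.2)) (qFun b P w.2)
      (χ (qFun b P w.2)) (ψ (qFun b P w.2)) (ψ' * χ (qFun b P w.2))
      (dotLog H (w.1 + b * K w.2)) (ddotLog H (w.1 + b * K w.2)) := by
  have dq := (hR.contDiffAt_qFun (b := b) hw).differentiableAt (by simp)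
  rw [hS.jetAt_eq hR hb hw, deriv_of_eq_comp hR.isOpen hw hφ hφ' dq,
    deriv_of_eq_comp hR.isOpen hw hψ hψ' dq, hφ w hw, hψ w hw, hχ w hw]

theorem hasDerivAt_const_div (k : ℝ) {q : ℝ} (hq : q ≠ 0) :
    HasDerivAt (fun q => k / q) (-k / q ^ 2) q := by
  refine ((hasDerivAt_const q k).fun_div (hasDerivAt_id' q) hq).congr_deriv ?_
  ring

theorem hasDerivAt_lin_add_div (k l : ℝ) {q : ℝ} (hq : q ≠ 0) :
    HasDerivAt (fun q => k * q + l / q) (k - l / q ^ 2) q := by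
  refine (((hasDerivAt_id' q).const_mul k).fun_add (hasDerivAt_const_div l hq)).congr_deriv ?_
  ring

/-- The jet with `q' = ρ + ρ₂ q²`, `F'/F = φ₁ q + φ₂ / q` and `G'/G = γ₁ q + γ₂ / q`. -/
def laurentJet (b ρ ρ₂ φ₁ φ₂ γ₁ γ₂ q h e : ℝ) : Jet :=
  sepJet b (φ₁ * q + φ₂ / q) ((φ₁ - φ₂ / q ^ 2) * (ρ + ρ₂ * q ^ 2)) q (ρ + ρ₂ * q ^ 2)
    (γ₁ * q + γ₂ / q) ((γ₁ - γ₂ / q ^ 2) * (ρ + ρ₂ * q ^ 2)) h e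

theorem Separated.jetAt_laurent (hS : Separated b P S U G H K) (hR : Regular F P S U) (hb : b ≠ 0)
    {ρ ρ₂ φ₁ φ₂ γ₁ γ₂ : ℝ} {w : ℝ × ℝ} (hw : w ∈ U)
    (hχ : ∀ w ∈ U, deriv (qFun b P) w.2 = ρ + ρ₂ * qFun b P w.2 ^ 2)
    (hφ : ∀ w ∈ U, logDeriv F w.2 = φ₁ * qFun b P w.2 + φ₂ / qFun b P w.2)
    (hψ : ∀ w ∈ U, logDeriv G w.2 = γ₁ * qFun b P w.2 + γ₂ / qFun b P w.2) :
    jetAt F P S w = laurentJet b ρ ρ₂ φ₁ φ₂ γ₁ γ₂ (qFun b P w.2)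
      (dotLog H (w.1 + b * K w.2)) (ddotLog H (w.1 + b * K w.2)) := by
  have hq := hS.qFun_ne hR hb hw
  exact hS.jetAt_of_comp hR hb hw (χ := fun q => ρ + ρ₂ * q ^ 2) hχ hφ hψ
    (hasDerivAt_lin_add_div φ₁ φ₂ hq) (hasDerivAt_lin_add_div γ₁ γ₂ hq)

theorem laurentJet_aniso {ρ ρ₂ φ₁ φ₂ γ₁ γ₂ q h e : ℝ} (hq : q ≠ 0)
    (h1 : 2 * γ₁ = ρ₂ + φ₁) (h2 : 2 * γ₂ = ρ + c + φ₂) :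
    (laurentJet b ρ ρ₂ φ₁ φ₂ γ₁ γ₂ q h e).aniso b c = 0 := by
  simp only [Jet.aniso, laurentJet, sepJet]
  field_simp
  linear_combination -b * q ^ 2 * h1 - b * h2

section LaurentJet

variable {ρ ρ₂ φ₁ φ₂ γ₁ γ₂ q h e : ℝ}

theorem laurentJet_Y (hq : q ≠ 0) : q ^ 2 * (laurentJet b ρ ρ₂ φ₁ φ₂ γ₁ γ₂ q h e).Y b c =
    q ^ 2 * (2 * e + c * h - b ^ 2 / 2) + (φ₁ * q ^ 2 + φ₂) * h -
      ((φ₁ * q ^ 2 - φ₂) * (ρ + ρ₂ * q ^ 2) + (φ₁ * q ^ 2 + φ₂) ^ 2) / 2 +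
      (φ₁ * q ^ 2 + φ₂) * (γ₁ * q ^ 2 + γ₂) := by
  simp only [Jet.Y, Jet.press, laurentJet, sepJet]
  field_simp
  ring

theorem laurentJet_X (hq : q ≠ 0) : q * (laurentJet b ρ ρ₂ φ₁ φ₂ γ₁ γ₂ q h e).X b c =
    2 * e + 2 * (γ₁ * q ^ 2 + γ₂) * h + (c * (φ₁ * q ^ 2 + φ₂) - b ^ 2 * q ^ 2) / 2 := by
  simp only [Jet.X, laurentJet, sepJet]
  field_simp
  ring

theorem laurentJet_Z (hq : q ≠ 0) : q ^ 2 * (laurentJet b ρ ρ₂ φ₁ φ₂ γ₁ γ₂ q h e).Z c =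
    2 * e + h * (4 * (γ₁ * q ^ 2 + γ₂) - 2 * (ρ + ρ₂ * q ^ 2) - c * q ^ 2 - (φ₁ * q ^ 2 + φ₂)) +
      2 * (γ₁ * q ^ 2 - γ₂) * (ρ + ρ₂ * q ^ 2) + 2 * (γ₁ * q ^ 2 + γ₂) ^ 2 -
      (φ₁ * q ^ 2 - φ₂) * (ρ + ρ₂ * q ^ 2) / 2 - b ^ 2 * q ^ 4 / 2 - c ^ 2 * q ^ 2 / 2 -
      (φ₁ * q ^ 2 + φ₂) * (γ₁ * q ^ 2 + γ₂) := by
  simp only [Jet.Z, Jet.press, laurentJet, sepJet]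
  field_simp
  ring

end LaurentJet

theorem mul_eq_sq_of_scaled {q X Y Z x y z : ℝ} (hq : q ≠ 0) (hY : q ^ 2 * Y = y)
    (hX : q * X = x) (hZ : q ^ 2 * Z = z) (h : y * z = q ^ 2 * x ^ 2) : Y * Z = X ^ 2 := by
  subst hY hX hZ
  have : q ^ 4 ≠ 0 := by positivity
  apply mul_left_cancel₀ this
  linear_combination h

/-- The fluid equation `Y Z = X²` for Solution A. -/
theorem laurentJet_A {n q h e : ℝ} (hq : q ≠ 0)
    (hN : n ^ 2 - 2 * c * n + b ^ 2 ≠ 0)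
    (hode : 1 / 4 * ((c ^ 2 - n ^ 2) * (c ^ 2 - 2 * c * n + b ^ 2) /
      (n ^ 2 - 2 * c * n + b ^ 2)) + ((n - c) ^ 3 + 3 * c * (n - c) ^ 2 + c * (b ^ 2 - c ^ 2)) /
      (n ^ 2 - 2 * c * n + b ^ 2) * h + (c - n) ^ 2 / (n ^ 2 - 2 * c * n + b ^ 2) * h ^ 2 +
      e = 0) :
    (laurentJet b n (-n) (2 * n - c) 0 (1 / 2 * (n - c)) (1 / 2 * (n + c)) q h e).Y b c *
      (laurentJet b n (-n) (2 * n - c) 0 (1 / 2 * (n - c)) (1 / 2 * (n + c)) q h e).Z c =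
      (laurentJet b n (-n) (2 * n - c) 0 (1 / 2 * (n - c)) (1 / 2 * (n + c)) q h e).X b c ^ 2 := by
  have hode' : (c ^ 2 - n ^ 2) * (c ^ 2 - 2 * c * n + b ^ 2) +
      4 * ((n - c) ^ 3 + 3 * c * (n - c) ^ 2 + c * (b ^ 2 - c ^ 2)) * h +
      4 * (c - n) ^ 2 * h ^ 2 + 4 * (n ^ 2 - 2 * c * n + b ^ 2) * e = 0 := by
    generalize hM : n ^ 2 - 2 * c * n + b ^ 2 = M at *
    field_simp at hode
    linear_combination hode
  refine mul_eq_sq_of_scaled hq (laurentJet_Y hq) (laurentJet_X hq) (laurentJet_Z hq) ?_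
  linear_combination (-(q ^ 2 * (1 - q ^ 2) ^ 2) / 4) * hode'

/-- The fluid equation `Y Z = X²` for Solution B. -/
theorem laurentJet_B {k q h e : ℝ} (hq : q ≠ 0) (hc : b ^ 2 = c ^ 2)
    (hode : -(3 * c ^ 2 / 4) * (c - k) + c / 2 * (-c + 4 * k) * h + k * h ^ 2 + h * e +
      3 / 2 * c * e = 0) :
    (laurentJet b c (-c) c (2 * (k - c)) 0 k q h e).Y b c *
      (laurentJet b c (-c) c (2 * (k - c)) 0 k q h e).Z c =
      (laurentJet b c (-c) c (2 * (k - c)) 0 k q h e).X b c ^ 2 := by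
  refine mul_eq_sq_of_scaled hq (laurentJet_Y hq) (laurentJet_X hq) (laurentJet_Z hq) ?_
  rw [hc]
  linear_combination (4 * (1 - q ^ 2) * (k - c)) * hode

/-- The fluid equation `Y Z = X²` for Solution C. -/
theorem laurentJet_C {k q h e : ℝ} (hq : q ≠ 0) (hc : c ≠ 0) (hk : b ^ 2 + c ^ 2 - 2 * c * k = 0)
    (hode : k * h + e = 0) :
    (laurentJet b (b ^ 2 / c) (-(b ^ 2 / c)) (b ^ 2 / c) 0 0 k q h e).Y b c *
      (laurentJet b (b ^ 2 / c) (-(b ^ 2 / c)) (b ^ 2 / c) 0 0 k q h e).Z c =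
      (laurentJet b (b ^ 2 / c) (-(b ^ 2 / c)) (b ^ 2 / c) 0 0 k q h e).X b c ^ 2 := by
  refine mul_eq_sq_of_scaled hq (laurentJet_Y hq) (laurentJet_X hq) (laurentJet_Z hq) ?_
  have hb2 : b ^ 2 = c * (2 * k - c) := by linear_combination hk
  have hbc : b ^ 2 / c = 2 * k - c := by rw [hb2]; field_simp
  have he : e = -(k * h) := by linear_combination hode
  rw [hbc, hb2, he]
  ring

/-- The fluid equation `Y Z = X²` for Solution D. -/
theorem laurentJet_D {k q h e : ℝ} (hq : q ≠ 0) (hc : b ^ 2 = c ^ 2)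
    (hode : c / 2 * (2 * k - c) * h + k * h ^ 2 + h * e + (k - c / 2) * e = 0) :
    (laurentJet b (4 * k - 3 * c) (-c) c 0 0 (2 * k - c) q h e).Y b c *
      (laurentJet b (4 * k - 3 * c) (-c) c 0 0 (2 * k - c) q h e).Z c =
      (laurentJet b (4 * k - 3 * c) (-c) c 0 0 (2 * k - c) q h e).X b c ^ 2 := by
  refine mul_eq_sq_of_scaled hq (laurentJet_Y hq) (laurentJet_X hq) (laurentJet_Z hq) ?_
  rw [hc]
  linear_combination (16 * q ^ 2 * (c - k)) * hode

end G2Fluid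
end

noncomputable section

namespace G2Fluid

open Filter Topology

variable {σ b c : ℝ} {F P : ℝ → ℝ} {S : ℝ → ℝ → ℝ} {U : Set (ℝ × ℝ)}

/-! ### The families solve the field equations -/

theorem SolutionA.isFluidFormAt (hσ : σ = 1 ∨ σ = -1) (hb : b ≠ 0) (hR : Regular F P S U)
    (h : SolutionA b c F P S U) {X : Coord} (hX : X ∈ cylinder U) :
    IsFluidFormAt (metricA σ b c F P S) X := by
  obtain ⟨n, m₁, m₂, m₃, G, H, K, hN, rfl, rfl, rfl, hS, hw⟩ := h
  have hq := hS.qFun_ne hR hb hX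
  have hj := hS.jetAt_laurent hR hb (ρ := n) (ρ₂ := -n) (φ₁ := 2 * n - c) (φ₂ := 0)
    (γ₁ := 1 / 2 * (n - c)) (γ₂ := 1 / 2 * (n + c)) hX
    (fun w h => by rw [(hw w h).2.1]; ring)
    (fun w h => by rw [(hw w h).2.2.1]; ring)
    (fun w h => by rw [(hw w h).2.2.2.1]; ring)
  refine hR.isFluidFormAt hσ hX ?_ ?_ <;> rw [hj]
  · exact laurentJet_aniso hq (by ring) (by ring)
  · exact laurentJet_A hq hN (hw _ hX).2.2.2.2

theorem sq_eq_of_sign {σ₁ : ℝ} (h : σ₁ = 1 ∨ σ₁ = -1) : σ₁ ^ 2 = 1 := by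
  rcases h with h | h <;> norm_num [h]

theorem SolutionB.isFluidFormAt (hσ : σ = 1 ∨ σ = -1) (hb : b ≠ 0) (hR : Regular F P S U)
    (h : SolutionB b c F P S U) {X : Coord} (hX : X ∈ cylinder U) :
    IsFluidFormAt (metricA σ b c F P S) X := by
  obtain ⟨σ₁, k, G, H, K, hσ₁, hc, hk, hS, hw⟩ := h
  have hq := hS.qFun_ne hR hb hX
  have h1 := sq_eq_of_sign hσ₁
  have hj := hS.jetAt_laurent hR hb (ρ := c) (ρ₂ := -c) (φ₁ := c) (φ₂ := 2 * (k - c))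
    (γ₁ := 0) (γ₂ := k) hX
    (fun w h => by rw [(hw w h).2.1]; ring)
    (fun w h => by
      have hq := hS.qFun_ne hR hb h
      rw [(hw w h).2.2.1]; field_simp; ring)
    (fun w h => by rw [(hw w h).2.2.2.1]; ring)
  refine hR.isFluidFormAt hσ hX ?_ ?_ <;> rw [hj]
  · exact laurentJet_aniso hq (by ring) (by ring)
  · refine laurentJet_B hq (by rw [hc, mul_pow, h1, one_mul]) ?_
    have := (hw _ hX).2.2.2.2
    unfold quadraticODE at this
    rw [hc]
    set h := dotLog H _
    set e := ddotLog H _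
    linear_combination this + (-(3 * b ^ 2 / 4) * (σ₁ * b - k) - b ^ 2 / 2 * h) * h1

theorem SolutionC.isFluidFormAt (hσ : σ = 1 ∨ σ = -1) (hb : b ≠ 0) (hR : Regular F P S U)
    (h : SolutionC b c F P S U) {X : Coord} (hX : X ∈ cylinder U) :
    IsFluidFormAt (metricA σ b c F P S) X := by
  obtain ⟨k, G, H, K, hc, hk, hS, hw⟩ := h
  have hq := hS.qFun_ne hR hb hX
  have hj := hS.jetAt_laurent hR hb (ρ := b ^ 2 / c) (ρ₂ := -(b ^ 2 / c)) (φ₁ := b ^ 2 / c)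
    (φ₂ := 0) (γ₁ := 0) (γ₂ := k) hX
    (fun w h => by rw [(hw w h).2.1]; ring)
    (fun w h => by rw [(hw w h).2.2.1]; ring)
    (fun w h => by rw [(hw w h).2.2.2.1]; ring)
  refine hR.isFluidFormAt hσ hX ?_ ?_ <;> rw [hj]
  · exact laurentJet_aniso hq (by ring) (by field_simp; linear_combination -hk)
  · exact laurentJet_C hq hc hk (hw _ hX).2.2.2.2

theorem SolutionD.isFluidFormAt (hσ : σ = 1 ∨ σ = -1) (hb : b ≠ 0) (hR : Regular F P S U)
    (h : SolutionD b c F P S U) {X : Coord} (hX : X ∈ cylinder U) :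
    IsFluidFormAt (metricA σ b c F P S) X := by
  obtain ⟨σ₁, k, G, H, K, hσ₁, hc, hk, hS, hw⟩ := h
  have hq := hS.qFun_ne hR hb hX
  have h1 := sq_eq_of_sign hσ₁
  have hj := hS.jetAt_laurent hR hb (ρ := 4 * k - 3 * c) (ρ₂ := -c) (φ₁ := c) (φ₂ := 0)
    (γ₁ := 0) (γ₂ := 2 * k - c) hX
    (fun w h => by rw [(hw w h).1]; ring)
    (fun w h => by rw [(hw w h).2.1]; ring)
    (fun w h => by rw [(hw w h).2.2.1]; ring)
  refine hR.isFluidFormAt hσ hX ?_ ?_ <;> rw [hj]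
  · exact laurentJet_aniso hq (by ring) (by ring)
  · refine laurentJet_D hq (by rw [hc, mul_pow, h1, one_mul]) ?_
    have := (hw _ hX).2.2.2
    unfold quadraticODE at this
    rw [hc]
    set h := dotLog H _
    set e := ddotLog H _
    linear_combination this - b ^ 2 / 2 * h * h1

theorem Family.Holds.isFluidFormAt {f : Family} (hσ : σ = 1 ∨ σ = -1) (hb : b ≠ 0)
    (hR : Regular F P S U) (h : f.Holds b c F P S U) {X : Coord} (hX : X ∈ cylinder U) :
    IsFluidFormAt (metricA σ b c F P S) X := by
  cases f
  · exact SolutionA.isFluidFormAt hσ hb hR h hX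
  · exact SolutionB.isFluidFormAt hσ hb hR h hX
  · exact SolutionC.isFluidFormAt hσ hb hR h hX
  · exact SolutionD.isFluidFormAt hσ hb hR h hX

/-! ### The families are mutually exclusive -/

theorem SolutionA.not_B (hb : b ≠ 0) (hR : Regular F P S U) (hU : U.Nonempty)
    (h : SolutionA b c F P S U) : ¬ SolutionB b c F P S U := by
  obtain ⟨n, m₁, m₂, m₃, G, H, K, hN, -, -, -, hS, hw⟩ := h
  rintro ⟨σ₁, k, G', H', K', hσ₁, hc, hk, hS', hw'⟩
  obtain ⟨w, hwU⟩ := hU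
  have hq := hS.qFun_ne hR hb hwU
  obtain ⟨hq1, e1, e2, -⟩ := hw w hwU
  obtain ⟨-, e1', e2', -⟩ := hw' w hwU
  have hn : n = c := by
    apply mul_right_cancel₀ (sub_ne_zero.2 hq1.symm); rw [← e1, ← e1']
  rw [e2, hn, eq_div_iff hq] at e2'
  exact hk (by linear_combination -e2' / 2)

theorem SolutionA.not_C (hb : b ≠ 0) (hR : Regular F P S U) (hU : U.Nonempty)
    (h : SolutionA b c F P S U) : ¬ SolutionC b c F P S U := by
  obtain ⟨n, m₁, m₂, m₃, G, H, K, hN, -, -, -, hS, hw⟩ := h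
  rintro ⟨k, G', H', K', hc, hk, hS', hw'⟩
  obtain ⟨w, hwU⟩ := hU
  have hq := hS.qFun_ne hR hb hwU
  obtain ⟨hq1, e1, e2, -⟩ := hw w hwU
  obtain ⟨-, e1', e2', -⟩ := hw' w hwU
  have hn : n = b ^ 2 / c := by
    apply mul_right_cancel₀ (sub_ne_zero.2 hq1.symm); rw [← e1, ← e1']
  have hn' : 2 * n - c = b ^ 2 / c := by
    apply mul_right_cancel₀ hq; rw [← e2, ← e2']
  have h3 : n = c := by linarith
  rw [h3, eq_div_iff hc] at hn
  exact hN (by rw [h3]; linear_combination -hn)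

theorem SolutionA.not_D (hb : b ≠ 0) (hR : Regular F P S U) (hU : U.Nonempty)
    (h : SolutionA b c F P S U) : ¬ SolutionD b c F P S U := by
  obtain ⟨n, m₁, m₂, m₃, G, H, K, hN, -, -, -, hS, hw⟩ := h
  rintro ⟨σ₁, k, G', H', K', hσ₁, hc, hk, hS', hw'⟩
  obtain ⟨w, hwU⟩ := hU
  have hq := hS.qFun_ne hR hb hwU
  obtain ⟨hq1, e1, e2, -⟩ := hw w hwU
  obtain ⟨e1', e2', -⟩ := hw' w hwU
  have hn : 2 * n - c = c := by
    apply mul_right_cancel₀ hq; rw [← e2, ← e2']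
  have h3 : n = c := by linarith
  rw [e1, h3] at e1'
  exact hk (by linear_combination -e1' / 4)

theorem SolutionB.not_C (hb : b ≠ 0) (hR : Regular F P S U) (hU : U.Nonempty)
    (h : SolutionB b c F P S U) : ¬ SolutionC b c F P S U := by
  obtain ⟨σ₁, k, G, H, K, hσ₁, hc, hk, hS, hw⟩ := h
  rintro ⟨k', G', H', K', hc0, hk', hS', hw'⟩
  obtain ⟨w, hwU⟩ := hU
  have hq := hS.qFun_ne hR hb hwU
  obtain ⟨hq1, e1, e2, -⟩ := hw w hwU
  obtain ⟨-, e1', e2', -⟩ := hw' w hwU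
  have hn : c = b ^ 2 / c := by
    apply mul_right_cancel₀ (sub_ne_zero.2 hq1.symm); rw [← e1, ← e1']
  rw [e2', ← hn, eq_div_iff hq] at e2
  exact hk (by linear_combination -e2 / 2)

theorem SolutionB.not_D (hb : b ≠ 0) (hR : Regular F P S U) (hU : U.Nonempty)
    (h : SolutionB b c F P S U) : ¬ SolutionD b c F P S U := by
  obtain ⟨σ₁, k, G, H, K, hσ₁, hc, hk, hS, hw⟩ := h
  rintro ⟨σ₂, k', G', H', K', hσ₂, hc', hk', hS', hw'⟩
  obtain ⟨w, hwU⟩ := hU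
  have hq := hS.qFun_ne hR hb hwU
  obtain ⟨hq1, e1, e2, -⟩ := hw w hwU
  obtain ⟨e1', e2', -⟩ := hw' w hwU
  rw [e2', eq_div_iff hq] at e2
  exact hk (by linear_combination -e2 / 2)

theorem SolutionC.not_D (hb : b ≠ 0) (hR : Regular F P S U) (hU : U.Nonempty)
    (h : SolutionC b c F P S U) : ¬ SolutionD b c F P S U := by
  obtain ⟨k', G, H, K, hc0, hk', hS, hw⟩ := h
  rintro ⟨σ₁, k, G', H', K', hσ₁, hc, hk, hS', hw'⟩
  obtain ⟨w, hwU⟩ := hU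
  have hq := hS.qFun_ne hR hb hwU
  obtain ⟨hq1, e1, e2, -⟩ := hw w hwU
  obtain ⟨e1', e2', -⟩ := hw' w hwU
  have hn : b ^ 2 / c = c := by
    apply mul_right_cancel₀ hq; rw [← e2, ← e2']
  rw [e1, hn] at e1'
  exact hk (by linear_combination -e1' / 4)

theorem Family.Holds.unique {f f' : Family} (hb : b ≠ 0) (hR : Regular F P S U) (hU : U.Nonempty)
    (h : f.Holds b c F P S U) (h' : f'.Holds b c F P S U) : f = f' := by
  cases f <;> cases f' <;> first | rfl | exfalso
  · exact SolutionA.not_B hb hR hU h h'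
  · exact SolutionA.not_C hb hR hU h h'
  · exact SolutionA.not_D hb hR hU h h'
  · exact SolutionA.not_B hb hR hU h' h
  · exact SolutionB.not_C hb hR hU h h'
  · exact SolutionB.not_D hb hR hU h h'
  · exact SolutionA.not_C hb hR hU h' h
  · exact SolutionB.not_C hb hR hU h' h
  · exact SolutionC.not_D hb hR hU h h'
  · exact SolutionA.not_D hb hR hU h' h
  · exact SolutionB.not_D hb hR hU h' h
  · exact SolutionC.not_D hb hR hU h' h

end G2Fluid
end

noncomputable section

namespace G2Fluid

open Filter Topology

/-! ### Perfect fluids with a proper conformal Killing vector in each family -/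

/-- The values `t` arbitrary, `x ∈ I`. -/
def strip (I : Set ℝ) : Set (ℝ × ℝ) := {w | w.2 ∈ I}

theorem isOpen_strip {I : Set ℝ} (hI : IsOpen I) : IsOpen (strip I) := hI.preimage continuous_snd

theorem isConnected_strip {I : Set ℝ} (hI : IsConnected I) : IsConnected (strip I) := by
  have : strip I = Set.univ ×ˢ I := by ext; simp [strip]
  rw [this]; exact isConnected_univ.prod hI

theorem regular_of_product {F P G H K : ℝ → ℝ} {b : ℝ} {I : Set ℝ} (hI : IsOpen I)
    (hF : ∀ x ∈ I, ContDiffAt ℝ ∞ F x ∧ 0 < F x) (hP : ∀ x ∈ I, ContDiffAt ℝ ∞ P x ∧ 0 < P x)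
    (hG : ∀ x ∈ I, ContDiffAt ℝ ∞ G x ∧ G x ≠ 0) (hH : ContDiff ℝ ∞ H) (hH0 : ∀ u, H u ≠ 0)
    (hK : ∀ x ∈ I, ContDiffAt ℝ ∞ K x) :
    Regular F P (fun t x => G x * H (t + b * K x)) (strip I) where
  isOpen := isOpen_strip hI
  smooth_S := by
    intro w hw
    have h1 : ContDiffAt ℝ ∞ (fun w' : ℝ × ℝ => G w'.2) w :=
      (hG _ hw).1.comp w contDiffAt_snd
    have h2 : ContDiffAt ℝ ∞ (fun w' : ℝ × ℝ => K w'.2) w := (hK _ hw).comp w contDiffAt_snd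
    exact h1.mul (hH.contDiffAt.comp w (contDiffAt_fst.add (contDiffAt_const.mul h2)))
  smooth_F := fun w hw => (hF _ hw).1
  smooth_P := fun w hw => (hP _ hw).1
  S_ne_zero := fun w hw => mul_ne_zero (hG _ hw).2 (hH0 _)
  F_pos := fun w hw => (hF _ hw).2
  P_pos := fun w hw => (hP _ hw).2

theorem Separated.isProper {b : ℝ} {F P G H K : ℝ → ℝ} {S : ℝ → ℝ → ℝ} {I : Set ℝ}
    (hR : Regular F P S (strip I)) (hS : Separated b P S (strip I) G H K) (hI : I.Nonempty)
    {u v : ℝ} (h : dotLog H u ≠ dotLog H v) : IsProper S (strip I) := by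
  rintro ⟨Φ, hΦ⟩
  obtain ⟨x, hx⟩ := hI
  have key : ∀ u, dotLog H u = -Φ := by
    intro u
    have hw : (u - b * K x, x) ∈ strip I := hx
    have h1 := hΦ _ hw
    have h2 := hS.factors_ne hR hw
    rw [scaleFactor_eq hR hw, confT, hS.dt_plane hR hw] at h1
    have h3 : plane S (u - b * K x, x) = _ := hS.S_eq _ hw
    rw [h3] at h1
    simp only [sub_add_cancel] at h1 h2
    rw [dotLog, ← h1]
    field_simp [h2.1, h2.2]
  exact h ((key u).trans (key v).symm)

/-- `1 + e^{-k u}`. -/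
def expH (k : ℝ) : ℝ → ℝ := fun u => 1 + Real.exp (-(k * u))

theorem contDiff_expH (k : ℝ) : ContDiff ℝ ∞ (expH k) := by unfold expH; fun_prop

theorem expH_pos (k u : ℝ) : 0 < expH k u := by unfold expH; positivity

theorem hasDerivAt_exp_neg (k u : ℝ) :
    HasDerivAt (fun u => Real.exp (-(k * u))) (-(k * Real.exp (-(k * u)))) u := by
  refine (((hasDerivAt_id' u).const_mul k).fun_neg.exp).congr_deriv ?_
  ring

theorem deriv_expH (k : ℝ) : deriv (expH k) = fun u => -(k * Real.exp (-(k * u))) := by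
  funext u; exact ((hasDerivAt_exp_neg k u).const_add 1).deriv

theorem deriv_deriv_expH (k : ℝ) :
    deriv (deriv (expH k)) = fun u => k ^ 2 * Real.exp (-(k * u)) := by
  rw [deriv_expH]
  funext u
  refine (((hasDerivAt_exp_neg k u).const_mul k).fun_neg).deriv.trans ?_
  ring

theorem ddotLog_expH (k u : ℝ) : ddotLog (expH k) u = -(k * dotLog (expH k) u) := by
  rw [ddotLog, dotLog, deriv_deriv_expH, deriv_expH]; ring

theorem dotLog_expH {k : ℝ} (u : ℝ) :
    dotLog (expH k) u = -(k * (1 - 1 / expH k u)) := by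
  have := expH_pos k u
  rw [dotLog, deriv_expH]
  field_simp
  simp [expH]

theorem dotLog_expH_ne {k : ℝ} (hk : 0 < k) : dotLog (expH k) 0 ≠ dotLog (expH k) 1 := by
  have h : expH k 1 < expH k 0 := by
    simp only [expH, mul_one, mul_zero, neg_zero, add_lt_add_iff_left]
    exact Real.exp_lt_exp.2 (by linarith)
  rw [dotLog_expH, dotLog_expH]
  intro h'
  have h0 := expH_pos k 0
  have h1 := expH_pos k 1
  have h2 : 1 / expH k 0 = 1 / expH k 1 := by
    have := mul_left_cancel₀ hk.ne' (neg_injective h')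
    linarith
  rw [div_eq_div_iff h0.ne' h1.ne'] at h2
  linarith

theorem dotLog_expH_bounds {k : ℝ} (hk : 0 < k) (u : ℝ) :
    -k < dotLog (expH k) u ∧ dotLog (expH k) u < 0 := by
  have h1 := expH_pos k u
  have h2 : 1 < expH k u := by unfold expH; linarith [Real.exp_pos (-(k * u))]
  have h3 : 0 < 1 / expH k u := by positivity
  have h4 : 1 / expH k u < 1 := by rw [div_lt_one h1]; exact h2
  rw [dotLog_expH]
  constructor <;> nlinarith

section Hyperbolic

theorem qFun_cosh_pow {m : ℕ} (hm : m ≠ 0) :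
    qFun m (fun x => Real.cosh x ^ m) = fun x => Real.sinh x / Real.cosh x := by
  funext x
  have h := (Real.hasDerivAt_cosh x).fun_pow m
  have h0 := (Real.cosh_pos x).ne'
  have hm' : (m : ℝ) ≠ 0 := by exact_mod_cast hm
  rw [qFun, logDeriv_apply, h.deriv, div_div, div_eq_div_iff (by positivity) h0]
  obtain ⟨k, rfl⟩ := Nat.exists_eq_succ_of_ne_zero hm
  simp only [Nat.succ_eq_add_one, Nat.add_sub_cancel, pow_succ]
  ring

theorem hasDerivAt_tanh (x : ℝ) : HasDerivAt (fun x => Real.sinh x / Real.cosh x)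
    (1 - (Real.sinh x / Real.cosh x) ^ 2) x := by
  have h0 := (Real.cosh_pos x).ne'
  refine ((Real.hasDerivAt_sinh x).fun_div (Real.hasDerivAt_cosh x) h0).congr_deriv ?_
  field_simp

theorem deriv_qFun_cosh_pow {m : ℕ} (hm : m ≠ 0) (x : ℝ) :
    deriv (qFun m (fun x => Real.cosh x ^ m)) x =
      1 - qFun m (fun x => Real.cosh x ^ m) x ^ 2 := by
  rw [qFun_cosh_pow hm]; exact (hasDerivAt_tanh x).deriv

theorem qFun_cosh_pow_bounds {m : ℕ} (hm : m ≠ 0) {x : ℝ} (hx : 0 < x) :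
    0 < qFun m (fun x => Real.cosh x ^ m) x ∧ qFun m (fun x => Real.cosh x ^ m) x < 1 := by
  rw [qFun_cosh_pow hm]
  have h0 := Real.cosh_pos x
  have h1 := Real.sinh_pos_iff.2 hx
  exact ⟨by positivity, by rw [div_lt_one h0]; exact Real.sinh_lt_cosh x⟩

theorem hasDerivAt_log_sinh {x : ℝ} (hx : 0 < x) :
    HasDerivAt (fun x => Real.log (Real.sinh x)) (Real.cosh x / Real.sinh x) x :=
  (Real.hasDerivAt_sinh x).log (Real.sinh_pos_iff.2 hx).ne'

theorem separated_cosh_pow {m : ℕ} (hm : m ≠ 0) {G H : ℝ → ℝ}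
    (hG : ∀ x, 0 < x → ContDiffAt ℝ ∞ G x) (hH : ContDiff ℝ ∞ H) :
    Separated m (fun x => Real.cosh x ^ m)
      (fun t x => G x * H (t + m * (Real.log (Real.sinh x) / m))) (strip (Set.Ioi 0)) G H
      (fun x => Real.log (Real.sinh x) / m) := by
  have hm' : (m : ℝ) ≠ 0 := by exact_mod_cast hm
  have hP : ∀ x, deriv (fun x => Real.cosh x ^ m) x = m * Real.cosh x ^ (m - 1) * Real.sinh x :=
    fun x => ((Real.hasDerivAt_cosh x).fun_pow m).deriv
  refine ⟨?_, ?_, fun w hw => hG _ hw, fun w hw => hH.contDiffAt, fun w hw => rfl⟩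
  · intro w hw
    have h1 := Real.sinh_pos_iff.2 hw
    have h2 := Real.cosh_pos w.2
    rw [hP]; positivity
  · intro w hw
    have h1 := Real.sinh_pos_iff.2 hw
    have h2 := Real.cosh_pos w.2
    refine ((hasDerivAt_log_sinh hw).div_const (m : ℝ)).congr_deriv ?_
    rw [hP]
    obtain ⟨k, rfl⟩ := Nat.exists_eq_succ_of_ne_zero hm
    simp only [Nat.succ_eq_add_one, Nat.add_sub_cancel, pow_succ]
    field_simp

theorem regular_cosh_pow (m : ℕ) {F G H : ℝ → ℝ}
    (hF : ∀ x, 0 < x → ContDiffAt ℝ ∞ F x ∧ 0 < F x)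
    (hG : ∀ x, 0 < x → ContDiffAt ℝ ∞ G x ∧ G x ≠ 0) (hH : ContDiff ℝ ∞ H)
    (hH0 : ∀ u, H u ≠ 0) :
    Regular F (fun x => Real.cosh x ^ m)
      (fun t x => G x * H (t + m * (Real.log (Real.sinh x) / m))) (strip (Set.Ioi 0)) := by
  refine regular_of_product isOpen_Ioi hF ?_ hG hH hH0 ?_
  · intro x _
    exact ⟨(Real.contDiff_cosh.pow m).contDiffAt, pow_pos (Real.cosh_pos x) m⟩
  · intro x hx
    exact (Real.contDiff_sinh.contDiffAt.log (Real.sinh_pos_iff.2 hx).ne').div_const _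

theorem logDeriv_cosh (x : ℝ) : logDeriv Real.cosh x = Real.sinh x / Real.cosh x := by
  rw [logDeriv_apply, (Real.hasDerivAt_cosh x).deriv]

theorem exists_properFluid_A : ∃ (σ b c : ℝ) (F P : ℝ → ℝ) (S : ℝ → ℝ → ℝ) (U : Set (ℝ × ℝ)),
    (σ = 1 ∨ σ = -1) ∧ b ≠ 0 ∧ Regular F P S U ∧ IsConnected U ∧ SolutionA b c F P S U ∧
    (∀ X ∈ cylinder U, IsPerfectFluidAt (metricA σ b c F P S) X) ∧ IsProper S U := by
  have hR := regular_cosh_pow 2 (F := Real.cosh) (G := Real.sinh) (H := expH 1)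
    (fun x _ => ⟨Real.contDiff_cosh.contDiffAt, Real.cosh_pos x⟩)
    (fun x hx => ⟨Real.contDiff_sinh.contDiffAt, (Real.sinh_pos_iff.2 hx).ne'⟩)
    (contDiff_expH 1) (fun u => (expH_pos 1 u).ne')
  have hS := separated_cosh_pow (m := 2) (by norm_num) (G := Real.sinh) (H := expH 1)
    (fun x _ => Real.contDiff_sinh.contDiffAt) (contDiff_expH 1)
  have hb : ((2 : ℕ) : ℝ) ≠ 0 := by norm_num
  have dq : ∀ x, _ := deriv_qFun_cosh_pow (m := 2) (by norm_num)
  have bq : ∀ x : ℝ, 0 < x → _ := fun x hx =>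
    qFun_cosh_pow_bounds (m := 2) (by norm_num) (x := x) hx
  have eF : ∀ x, logDeriv Real.cosh x = qFun (2 : ℕ) (fun x => Real.cosh x ^ 2) x := by
    intro x; rw [qFun_cosh_pow (by norm_num), logDeriv_cosh]
  have eG : ∀ x, logDeriv Real.sinh x = 1 / qFun (2 : ℕ) (fun x => Real.cosh x ^ 2) x := by
    intro x
    rw [qFun_cosh_pow (by norm_num), logDeriv_apply, (Real.hasDerivAt_sinh x).deriv, one_div_div]
  refine ⟨1, (2 : ℕ), 1, _, _, _, _, Or.inl rfl, hb, hR, isConnected_strip isConnected_Ioi,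
    ⟨1, 0, 1, 0, _, _, _, by norm_num, by norm_num, by norm_num, by norm_num, hS, ?_⟩, ?_,
    hS.isProper hR ⟨1, Set.mem_Ioi.2 one_pos⟩ (dotLog_expH_ne one_pos)⟩
  · intro w hw
    obtain ⟨h0, h1⟩ := bq w.2 hw
    refine ⟨by nlinarith, by rw [dq]; ring, by rw [eF]; ring, by rw [eG]; ring, ?_⟩
    rw [ddotLog_expH]; ring
  · intro X hX
    obtain ⟨h0, h1⟩ := bq (X 1) hX
    have hj := hS.jetAt_laurent hR hb (ρ := 1) (ρ₂ := -1) (φ₁ := 1) (φ₂ := 0)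
      (γ₁ := 0) (γ₂ := 1) hX (fun w h => by rw [dq]; ring) (fun w h => by rw [eF]; ring)
      (fun w h => by rw [eG]; ring)
    have he := ddotLog_expH 1 (X 0 + (2 : ℕ) * (Real.log (Real.sinh (X 1)) / (2 : ℕ)))
    refine hR.isPerfectFluidAt (Or.inl rfl) hX ?_
    rw [hj]
    simp only at h0 h1 ⊢
    generalize qFun (2 : ℕ) (fun x => Real.cosh x ^ 2) (X 1) = q at h0 h1 ⊢
    rw [he]
    refine ⟨-3 / 2, 1, q, laurentJet_aniso h0.ne' (by norm_num) (by norm_num), by norm_num,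
      ?_, ?_, ?_, ?_⟩
    · apply mul_left_cancel₀ (pow_ne_zero 2 h0.ne')
      rw [laurentJet_Y h0.ne']; push_cast; ring
    · apply mul_left_cancel₀ h0.ne'
      rw [laurentJet_X h0.ne']; push_cast; ring
    · apply mul_left_cancel₀ (pow_ne_zero 2 h0.ne')
      rw [laurentJet_Z h0.ne']; push_cast; ring
    · nlinarith

theorem exists_properFluid_C : ∃ (σ b c : ℝ) (F P : ℝ → ℝ) (S : ℝ → ℝ → ℝ) (U : Set (ℝ × ℝ)),
    (σ = 1 ∨ σ = -1) ∧ b ≠ 0 ∧ Regular F P S U ∧ IsConnected U ∧ SolutionC b c F P S U ∧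
    (∀ X ∈ cylinder U, IsPerfectFluidAt (metricA σ b c F P S) X) ∧ IsProper S U := by
  have sG : ∀ x : ℝ, ContDiffAt ℝ ∞ (fun x => Real.sinh x ^ 5) x :=
    fun x => (Real.contDiff_sinh.pow 5).contDiffAt
  have hR := regular_cosh_pow 3 (F := Real.cosh) (G := fun x => Real.sinh x ^ 5) (H := expH 5)
    (fun x _ => ⟨Real.contDiff_cosh.contDiffAt, Real.cosh_pos x⟩)
    (fun x hx => ⟨sG x, pow_ne_zero 5 (Real.sinh_pos_iff.2 hx).ne'⟩)
    (contDiff_expH 5) (fun u => (expH_pos 5 u).ne')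
  have hS := separated_cosh_pow (m := 3) (by norm_num) (G := fun x => Real.sinh x ^ 5)
    (H := expH 5) (fun x _ => sG x) (contDiff_expH 5)
  have hb : ((3 : ℕ) : ℝ) ≠ 0 := by norm_num
  have dq : ∀ x, _ := deriv_qFun_cosh_pow (m := 3) (by norm_num)
  have bq : ∀ x : ℝ, 0 < x → _ := fun x hx =>
    qFun_cosh_pow_bounds (m := 3) (by norm_num) (x := x) hx
  have eF : ∀ x, logDeriv Real.cosh x = qFun (3 : ℕ) (fun x => Real.cosh x ^ 3) x := by
    intro x; rw [qFun_cosh_pow (by norm_num), logDeriv_cosh]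
  have eG : ∀ x, 0 < x → logDeriv (fun x => Real.sinh x ^ 5) x =
      5 / qFun (3 : ℕ) (fun x => Real.cosh x ^ 3) x := by
    intro x hx
    have h1 := Real.sinh_pos_iff.2 hx
    have h2 := Real.cosh_pos x
    rw [qFun_cosh_pow (by norm_num), logDeriv_apply, ((Real.hasDerivAt_sinh x).fun_pow 5).deriv]
    field_simp
    norm_num
    ring
  refine ⟨-1, (3 : ℕ), 9, _, _, _, _, Or.inr rfl, hb, hR, isConnected_strip isConnected_Ioi,
    ⟨5, _, _, _, by norm_num, by norm_num, hS, ?_⟩, ?_,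
    hS.isProper hR ⟨1, Set.mem_Ioi.2 one_pos⟩ (dotLog_expH_ne (by norm_num))⟩
  · intro w hw
    obtain ⟨h0, h1⟩ := bq w.2 hw
    refine ⟨by nlinarith, by rw [dq]; norm_num, by rw [eF]; norm_num, by rw [eG _ hw], ?_⟩
    rw [ddotLog_expH]; ring
  · intro X hX
    obtain ⟨h0, h1⟩ := bq (X 1) hX
    have hj := hS.jetAt_laurent hR hb (ρ := 1) (ρ₂ := -1) (φ₁ := 1) (φ₂ := 0)
      (γ₁ := 0) (γ₂ := 5) hX (fun w h => by rw [dq]; ring) (fun w h => by rw [eF]; ring)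
      (fun w h => by rw [eG _ h]; ring)
    have he := ddotLog_expH 5 (X 0 + (3 : ℕ) * (Real.log (Real.sinh (X 1)) / (3 : ℕ)))
    have hh := dotLog_expH_bounds (k := 5) (by norm_num)
      (X 0 + (3 : ℕ) * (Real.log (Real.sinh (X 1)) / (3 : ℕ)))
    refine hR.isPerfectFluidAt (Or.inr rfl) hX ?_
    rw [hj]
    simp only at h0 h1 ⊢
    generalize qFun (3 : ℕ) (fun x => Real.cosh x ^ 3) (X 1) = q at h0 h1 ⊢
    rw [he]
    generalize dotLog (expH 5) _ = h at hh ⊢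
    have hZ := laurentJet_Z (b := (3 : ℕ)) (c := 9) (ρ := 1) (ρ₂ := -1) (φ₁ := 1) (φ₂ := 0)
      (γ₁ := 0) (γ₂ := 5) (h := h) (e := -(5 * h)) h0.ne'
    have hZ' : q ^ 2 * (laurentJet (3 : ℕ) 1 (-1) 1 0 0 5 q h (-(5 * h))).Z 9 =
        8 * (1 - q ^ 2) * (h + 5 + q ^ 2 / 2) := by
      rw [hZ]; push_cast; ring
    refine ⟨_, 0, 1, laurentJet_aniso h0.ne' (by norm_num) (by norm_num), ?_, ?_, ?_,
      (by ring : _ = (laurentJet (3 : ℕ) 1 (-1) 1 0 0 5 q h (-(5 * h))).Z 9 * 1 ^ 2), by norm_num⟩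
    · intro h2
      rw [h2, mul_zero] at hZ'
      have h3 : 0 < 1 - q ^ 2 := by nlinarith
      have h4 : 0 < h + 5 + q ^ 2 / 2 := by nlinarith
      have := mul_pos h3 h4
      linarith
    · apply mul_left_cancel₀ (pow_ne_zero 2 h0.ne')
      rw [laurentJet_Y h0.ne']; push_cast; ring
    · apply mul_left_cancel₀ h0.ne'
      rw [laurentJet_X h0.ne']; push_cast; ring

/-- `cosh (u / √2)`. -/
def coshH : ℝ → ℝ := fun u => Real.cosh (u / √2)

theorem contDiff_coshH : ContDiff ℝ ∞ coshH :=
  Real.contDiff_cosh.comp (contDiff_id.div_const _)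

theorem deriv_coshH : deriv coshH = fun u => Real.sinh (u / √2) / √2 := by
  funext u
  refine (((hasDerivAt_id' u).div_const √2).cosh).deriv.trans ?_
  ring

theorem ddotLog_coshH (u : ℝ) : ddotLog coshH u = 1 / 2 := by
  have h : deriv (fun u => Real.sinh (u / √2) / √2) u = Real.cosh (u / √2) / 2 := by
    refine ((((hasDerivAt_id' u).div_const √2).sinh).div_const √2).deriv.trans ?_
    have : √2 * √2 = (2 : ℝ) := Real.mul_self_sqrt (by norm_num)
    field_simp
    nlinarith
  rw [ddotLog, deriv_coshH, h, coshH]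
  have := Real.cosh_pos (u / √2)
  field_simp

theorem dotLog_coshH_gt (u : ℝ) : -(3 / 2) < dotLog coshH u := by
  have h1 := Real.cosh_pos (u / √2)
  have h2 : -Real.cosh (u / √2) < Real.sinh (u / √2) := by
    have := Real.sinh_lt_cosh (-(u / √2))
    rw [Real.sinh_neg, Real.cosh_neg] at this
    linarith
  have h3 : (1 : ℝ) ≤ √2 := by rw [Real.one_le_sqrt]; norm_num
  rw [dotLog, deriv_coshH, coshH, div_div, lt_div_iff₀ (by positivity)]
  nlinarith

theorem dotLog_coshH_ne : dotLog coshH 0 ≠ dotLog coshH 1 := by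
  have h1 := Real.cosh_pos (1 / √2)
  have h2 : 0 < Real.sinh (1 / √2) := Real.sinh_pos_iff.2 (by positivity)
  rw [dotLog, dotLog, deriv_coshH, coshH]
  simp only [zero_div, Real.sinh_zero]
  positivity

theorem exists_properFluid_B : ∃ (σ b c : ℝ) (F P : ℝ → ℝ) (S : ℝ → ℝ → ℝ) (U : Set (ℝ × ℝ)),
    (σ = 1 ∨ σ = -1) ∧ b ≠ 0 ∧ Regular F P S U ∧ IsConnected U ∧ SolutionB b c F P S U ∧
    (∀ X ∈ cylinder U, IsPerfectFluidAt (metricA σ b c F P S) X) ∧ IsProper S U := by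
  have hR := regular_cosh_pow 1 (F := fun x => Real.cosh x / Real.sinh x ^ 2) (G := fun _ => 1)
    (H := coshH)
    (fun x hx => ⟨Real.contDiff_cosh.contDiffAt.div (Real.contDiff_sinh.pow 2).contDiffAt
      (pow_ne_zero 2 (Real.sinh_pos_iff.2 hx).ne'),
      div_pos (Real.cosh_pos x) (pow_pos (Real.sinh_pos_iff.2 hx) 2)⟩)
    (fun x hx => ⟨contDiffAt_const, one_ne_zero⟩)
    contDiff_coshH (fun u => (Real.cosh_pos _).ne')
  have hS := separated_cosh_pow (m := 1) (by norm_num) (G := fun _ => 1)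
    (H := coshH) (fun x _ => contDiffAt_const) contDiff_coshH
  have hb : ((1 : ℕ) : ℝ) ≠ 0 := by norm_num
  have dq : ∀ x, _ := deriv_qFun_cosh_pow (m := 1) (by norm_num)
  have bq : ∀ x : ℝ, 0 < x → _ := fun x hx =>
    qFun_cosh_pow_bounds (m := 1) (by norm_num) (x := x) hx
  have eF : ∀ x, 0 < x → logDeriv (fun x => Real.cosh x / Real.sinh x ^ 2) x =
      (-2 + qFun (1 : ℕ) (fun x => Real.cosh x ^ 1) x ^ 2) /
        qFun (1 : ℕ) (fun x => Real.cosh x ^ 1) x := by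
    intro x hx
    have h1 := Real.sinh_pos_iff.2 hx
    have h2 := Real.cosh_pos x
    rw [qFun_cosh_pow (by norm_num), logDeriv_apply,
      ((Real.hasDerivAt_cosh x).fun_div ((Real.hasDerivAt_sinh x).fun_pow 2)
        (pow_ne_zero 2 h1.ne')).deriv]
    field_simp
    push_cast
    ring
  have eG : ∀ x, logDeriv (fun _ : ℝ => (1 : ℝ)) x = 0 := by intro x; simp [logDeriv_apply]
  refine ⟨1, (1 : ℕ), 1, _, _, _, _, Or.inl rfl, hb, hR, isConnected_strip isConnected_Ioi,
    ⟨1, 0, _, _, _, Or.inl rfl, by norm_num, by norm_num, hS, ?_⟩, ?_,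
    hS.isProper hR ⟨1, Set.mem_Ioi.2 one_pos⟩ dotLog_coshH_ne⟩
  · intro w hw
    obtain ⟨h0, h1⟩ := bq w.2 hw
    refine ⟨by nlinarith, by rw [dq]; norm_num, by rw [eF _ hw]; ring, by rw [eG]; simp, ?_⟩
    rw [quadraticODE, ddotLog_coshH]; push_cast; ring
  · intro X hX
    obtain ⟨h0, h1⟩ := bq (X 1) hX
    have hj := hS.jetAt_laurent hR hb (ρ := 1) (ρ₂ := -1) (φ₁ := 1) (φ₂ := -2)
      (γ₁ := 0) (γ₂ := 0) hX (fun w h => by rw [dq]; ring)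
      (fun w h => by
        have := (bq w.2 h).1
        rw [eF _ h]; field_simp; ring)
      (fun w h => by rw [eG]; simp)
    have hh := dotLog_coshH_gt (X 0 + (1 : ℕ) * (Real.log (Real.sinh (X 1)) / (1 : ℕ)))
    refine hR.isPerfectFluidAt (Or.inl rfl) hX ?_
    rw [hj, ddotLog_coshH]
    simp only at h0 h1 ⊢
    generalize qFun (1 : ℕ) (fun x => Real.cosh x ^ 1) (X 1) = q at h0 h1 ⊢
    generalize dotLog coshH _ = h at hh ⊢
    have hY := laurentJet_Y (b := (1 : ℕ)) (c := 1) (ρ := 1) (ρ₂ := -1) (φ₁ := 1) (φ₂ := -2)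
      (γ₁ := 0) (γ₂ := 0) (h := h) (e := 1 / 2) h0.ne'
    have hY' : q ^ 2 * (laurentJet (1 : ℕ) 1 (-1) 1 (-2) 0 0 q h (1 / 2)).Y (1 : ℕ) 1 =
        -2 * (1 - q ^ 2) * (h + 3 / 2) := by
      rw [hY]; push_cast; ring
    refine ⟨_, 1, 0, laurentJet_aniso h0.ne' (by norm_num) (by norm_num), ?_,
      (by ring : _ = (laurentJet (1 : ℕ) 1 (-1) 1 (-2) 0 0 q h (1 / 2)).Y (1 : ℕ) 1 * 1 ^ 2),
      ?_, ?_, by norm_num⟩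
    · intro h2
      rw [h2, mul_zero] at hY'
      have h3 : 0 < 1 - q ^ 2 := by nlinarith
      have h4 : 0 < h + 3 / 2 := by linarith
      have := mul_pos h3 h4
      linarith
    · apply mul_left_cancel₀ h0.ne'
      rw [laurentJet_X h0.ne']; push_cast; ring
    · apply mul_left_cancel₀ (pow_ne_zero 2 h0.ne')
      rw [laurentJet_Z h0.ne']; push_cast; ring

end Hyperbolic

theorem qFun_sin : qFun 1 Real.sin = fun x => Real.cos x / Real.sin x := by
  funext x; rw [qFun, logDeriv_apply, (Real.hasDerivAt_sin x).deriv, div_one]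

theorem exists_properFluid_D : ∃ (σ b c : ℝ) (F P : ℝ → ℝ) (S : ℝ → ℝ → ℝ) (U : Set (ℝ × ℝ)),
    (σ = 1 ∨ σ = -1) ∧ b ≠ 0 ∧ Regular F P S U ∧ IsConnected U ∧ SolutionD b c F P S U ∧
    (∀ X ∈ cylinder U, IsPerfectFluidAt (metricA σ b c F P S) X) ∧ IsProper S U := by
  have hπ := Real.pi_pos
  have sp : ∀ x ∈ Set.Ioo 0 (Real.pi / 4), 0 < Real.sin x :=
    fun x hx => Real.sin_pos_of_pos_of_lt_pi hx.1 (by linarith [hx.2])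
  have cp : ∀ x ∈ Set.Ioo 0 (Real.pi / 4), 0 < Real.cos x :=
    fun x hx => Real.cos_pos_of_mem_Ioo ⟨by linarith [hx.1], by linarith [hx.2]⟩
  have hlt : ∀ x ∈ Set.Ioo 0 (Real.pi / 4), Real.sin x < Real.cos x := by
    intro x hx
    rw [← Real.sin_pi_div_two_sub]
    exact Real.sin_lt_sin_of_lt_of_le_pi_div_two (by linarith [hx.1]) (by linarith [hx.1])
      (by linarith [hx.2])
  have hR : Regular Real.sin Real.sin
      (fun t x => (fun _ : ℝ => (1 : ℝ)) x *
        expH (1 / 2) (t + 1 * (fun x => -Real.log (Real.cos x)) x))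
      (strip (Set.Ioo 0 (Real.pi / 4))) :=
    regular_of_product (G := fun _ => 1) (K := fun x => -Real.log (Real.cos x)) isOpen_Ioo
    (fun x hx => ⟨Real.contDiff_sin.contDiffAt, sp x hx⟩)
    (fun x hx => ⟨Real.contDiff_sin.contDiffAt, sp x hx⟩)
    (fun x _ => ⟨contDiffAt_const, one_ne_zero⟩) (contDiff_expH (1 / 2))
    (fun u => (expH_pos _ u).ne')
    (fun x hx => (Real.contDiff_cos.contDiffAt.log (cp x hx).ne').neg)
  have hS : Separated 1 Real.sin
      (fun t x => (fun _ : ℝ => (1 : ℝ)) x *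
        expH (1 / 2) (t + 1 * (fun x => -Real.log (Real.cos x)) x))
      (strip (Set.Ioo 0 (Real.pi / 4))) (fun _ => 1) (expH (1 / 2))
      (fun x => -Real.log (Real.cos x)) := by
    refine ⟨?_, ?_, fun w _ => contDiffAt_const, fun w _ => (contDiff_expH _).contDiffAt,
      fun w _ => rfl⟩
    · intro w hw
      rw [(Real.hasDerivAt_sin _).deriv]; exact (cp _ hw).ne'
    · intro w hw
      refine (((Real.hasDerivAt_cos w.2).log (cp _ hw).ne').fun_neg).congr_deriv ?_
      rw [(Real.hasDerivAt_sin _).deriv]; ring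
  have dq : ∀ x ∈ Set.Ioo 0 (Real.pi / 4),
      deriv (qFun 1 Real.sin) x = -1 - qFun 1 Real.sin x ^ 2 := by
    intro x hx
    have h0 := (sp x hx).ne'
    rw [qFun_sin]
    refine ((Real.hasDerivAt_cos x).fun_div (Real.hasDerivAt_sin x) h0).deriv.trans ?_
    field_simp
  have bq : ∀ x ∈ Set.Ioo 0 (Real.pi / 4), 1 < qFun 1 Real.sin x := by
    intro x hx
    rw [qFun_sin]
    simp only
    rw [one_lt_div (sp x hx)]
    exact hlt x hx
  have eF : ∀ x, logDeriv Real.sin x = qFun 1 Real.sin x := by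
    intro x; rw [qFun, div_one]
  have eG : ∀ x, logDeriv (fun _ : ℝ => (1 : ℝ)) x = 0 := by intro x; simp [logDeriv_apply]
  refine ⟨1, 1, 1, _, _, _, _, Or.inl rfl, one_ne_zero, hR,
    isConnected_strip (isConnected_Ioo (by positivity)),
    ⟨1, 1 / 2, _, _, _, Or.inl rfl, by norm_num, by norm_num, hS, ?_⟩, ?_,
    hS.isProper hR ⟨Real.pi / 8, by constructor <;> linarith⟩ (dotLog_expH_ne (by norm_num))⟩
  · intro w hw
    refine ⟨by rw [dq _ hw]; ring, by rw [eF, one_mul], by rw [eG]; norm_num, ?_⟩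
    rw [quadraticODE, ddotLog_expH]; ring
  · intro X hX
    have h1 := bq (X 1) hX
    have hj := hS.jetAt_laurent hR one_ne_zero (ρ := -1) (ρ₂ := -1) (φ₁ := 1) (φ₂ := 0)
      (γ₁ := 0) (γ₂ := 0) hX (fun w h => by rw [dq _ h]; ring) (fun w h => by rw [eF]; ring)
      (fun w h => by rw [eG]; simp)
    have he := ddotLog_expH (1 / 2) (X 0 + 1 * -Real.log (Real.cos (X 1)))
    have hh := (dotLog_expH_bounds (k := 1 / 2) (by norm_num)
      (X 0 + 1 * -Real.log (Real.cos (X 1)))).2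
    refine hR.isPerfectFluidAt (Or.inl rfl) hX ?_
    rw [hj]
    simp only at h1 ⊢
    generalize qFun 1 Real.sin (X 1) = q at h1 ⊢
    rw [he]
    generalize dotLog (expH (1 / 2)) _ = h at hh ⊢
    have h0 : 0 < q := by linarith
    refine ⟨h, 1, -1 / q, laurentJet_aniso h0.ne' (by norm_num) (by norm_num), hh.ne,
      ?_, ?_, ?_, ?_⟩
    · apply mul_left_cancel₀ (pow_ne_zero 2 h0.ne')
      rw [laurentJet_Y h0.ne']; ring
    · apply mul_left_cancel₀ h0.ne'
      rw [laurentJet_X h0.ne']; field_simp; ring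
    · apply mul_left_cancel₀ (pow_ne_zero 2 h0.ne')
      rw [laurentJet_Z h0.ne']; field_simp; ring
    · have : (-1 / q) ^ 2 < 1 := by
        rw [div_pow, div_lt_one (by positivity)]; nlinarith
      linarith

theorem Family.exists_properFluid (f : Family) :
    ∃ (σ b c : ℝ) (F P : ℝ → ℝ) (S : ℝ → ℝ → ℝ) (U : Set (ℝ × ℝ)),
      (σ = 1 ∨ σ = -1) ∧ b ≠ 0 ∧ Regular F P S U ∧ IsConnected U ∧ f.Holds b c F P S U ∧
      (∀ X ∈ cylinder U, IsPerfectFluidAt (metricA σ b c F P S) X) ∧ IsProper S U := by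
  cases f
  · exact exists_properFluid_A
  · exact exists_properFluid_B
  · exact exists_properFluid_C
  · exact exists_properFluid_D

end G2Fluid
end

noncomputable section

namespace G2Fluid

open Filter Topology

/-! ### Open intervals and functions on them -/

/-- A nonempty open interval. -/
structure OpenInterval (I : Set ℝ) : Prop where
  isOpen : IsOpen I
  isConnected : IsConnected I

theorem exists_openInterval_subset {I : Set ℝ} (hI : IsOpen I) {x : ℝ} (hx : x ∈ I) :
    ∃ I' ⊆ I, OpenInterval I' ∧ x ∈ I' := by
  obtain ⟨ε, hε, h⟩ := Metric.isOpen_iff.1 hI x hx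
  exact ⟨Metric.ball x ε, h, ⟨Metric.isOpen_ball,
    ⟨⟨x, Metric.mem_ball_self hε⟩, (convex_ball x ε).isPreconnected⟩⟩, Metric.mem_ball_self hε⟩

theorem OpenInterval.zero_or_ne {I : Set ℝ} (hI : OpenInterval I) {φ : ℝ → ℝ}
    (hφ : ContinuousOn φ I) :
    (∀ x ∈ I, φ x = 0) ∨ ∃ I' ⊆ I, OpenInterval I' ∧ ∀ x ∈ I', φ x ≠ 0 := by
  by_cases h : ∀ x ∈ I, φ x = 0
  · exact Or.inl h
  · push Not at h
    obtain ⟨x, hx, hne⟩ := h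
    have ho : IsOpen (I ∩ φ ⁻¹' {0}ᶜ) := hφ.isOpen_inter_preimage hI.isOpen isOpen_compl_singleton
    obtain ⟨I', hs, h', -⟩ := exists_openInterval_subset ho ⟨hx, hne⟩
    exact Or.inr ⟨I', fun y hy => (hs hy).1, h', fun y hy => (hs hy).2⟩

theorem const_or_infinite {I : Set ℝ} (hI : IsConnected I) {φ : ℝ → ℝ} (hφ : ContinuousOn φ I) :
    (∃ k, ∀ x ∈ I, φ x = k) ∨ (φ '' I).Infinite := by
  by_cases h : (φ '' I).Nontrivial
  · exact Or.inr ((hI.image φ hφ).isPreconnected.infinite_of_nontrivial h)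
  · rw [Set.not_nontrivial_iff] at h
    obtain ⟨x, hx⟩ := hI.nonempty
    exact Or.inl ⟨φ x, fun y hy => h (Set.mem_image_of_mem φ hy) (Set.mem_image_of_mem φ hx)⟩

/-- A polynomial with infinitely many zeros vanishes. -/
theorem coeff_eq_zero_of_infinite {Z : Set ℝ} (hZ : Z.Infinite) {n : ℕ} {a : ℕ → ℝ}
    (h : ∀ z ∈ Z, ∑ i ∈ Finset.range n, a i * z ^ i = 0) {i : ℕ} (hi : i < n) : a i = 0 := by
  set p : Polynomial ℝ := ∑ i ∈ Finset.range n, Polynomial.monomial i (a i) with hp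
  have h0 : p = 0 := by
    refine Polynomial.eq_zero_of_infinite_isRoot p (hZ.mono fun z hz => ?_)
    rw [Set.mem_ofPred_eq, Polynomial.IsRoot, hp, Polynomial.eval_finsetSum]
    simpa using h z hz
  have := congrArg (fun r => Polynomial.coeff r i) h0
  simpa [hp, Polynomial.finsetSum_coeff, Polynomial.coeff_monomial, hi] using this

theorem cubic_coeff_eq_zero {Z : Set ℝ} (hZ : Z.Infinite) {a₀ a₁ a₂ a₃ : ℝ}
    (h : ∀ z ∈ Z, a₀ + a₁ * z + a₂ * z ^ 2 + a₃ * z ^ 3 = 0) :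
    a₀ = 0 ∧ a₁ = 0 ∧ a₂ = 0 ∧ a₃ = 0 := by
  have key := fun i hi => coeff_eq_zero_of_infinite hZ (n := 4)
    (a := fun i => if i = 0 then a₀ else if i = 1 then a₁ else if i = 2 then a₂ else a₃)
    (fun z hz => by
      rw [← h z hz]; simp [Finset.sum_range_succ]) (i := i) hi
  exact ⟨by simpa using key 0 (by norm_num), by simpa using key 1 (by norm_num),
    by simpa using key 2 (by norm_num), by simpa using key 3 (by norm_num)⟩

/-- A continuous function on an interval which satisfies a nontrivial cubic equation is
constant. -/
theorem const_of_cubic {I : Set ℝ} (hI : IsConnected I) {φ : ℝ → ℝ} (hφ : ContinuousOn φ I)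
    {a₀ a₁ a₂ a₃ : ℝ} (h : ∀ x ∈ I, a₀ + a₁ * φ x + a₂ * φ x ^ 2 + a₃ * φ x ^ 3 = 0)
    (hne : ¬ (a₀ = 0 ∧ a₁ = 0 ∧ a₂ = 0 ∧ a₃ = 0)) : ∃ k, ∀ x ∈ I, φ x = k := by
  refine (const_or_infinite hI hφ).resolve_right fun hinf => hne (cubic_coeff_eq_zero hinf ?_)
  rintro _ ⟨x, hx, rfl⟩
  exact h x hx

theorem OpenInterval.eventually {I : Set ℝ} (hI : OpenInterval I) {x : ℝ} (hx : x ∈ I) :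
    ∀ᶠ y in 𝓝 x, y ∈ I := hI.isOpen.mem_nhds hx

/-- The derivative of a function which is constant on an interval vanishes. -/
theorem OpenInterval.hasDerivAt_zero {I : Set ℝ} (hI : OpenInterval I) {φ : ℝ → ℝ} {φ' k x : ℝ}
    (hx : x ∈ I) (h : ∀ y ∈ I, φ y = k) (hd : HasDerivAt φ φ' x) : φ' = 0 := by
  refine hd.unique ((hasDerivAt_const x k).congr_of_eventuallyEq ?_)
  filter_upwards [hI.eventually hx] with y hy using h y hy

end G2Fluid
end

noncomputable section

namespace G2Fluid

open Filter Topology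

variable {b c : ℝ}

/-! ### The fluid equation in adapted variables

With `q' = (1 - q²)(c - C)` and `F'/F = (A + (c - C) q²) / q`, the dot product structure of the
fluid equation is expressed by `E = A + q² C`; the letters `a` and `d` stand for `q A'` and
`q C'`. -/

/-- `q E'` for `E = A + q² C`. -/
def flowE (c q C a d : ℝ) : ℝ := a + 2 * q ^ 2 * (1 - q ^ 2) * (c - C) * C + q ^ 2 * d

/-- The coefficient `T` in the fluid equation. -/
def coeffT (b c q A C a d : ℝ) : ℝ :=
  -flowE c q C a d + (3 * c - 2 * C) * (A + q ^ 2 * C) -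
    q ^ 2 * (1 - q ^ 2) * (C ^ 2 + b ^ 2 - c ^ 2)

/-- The coefficient `(1 - q²) δ` in the fluid equation. -/
def coeffQδ (b c q C a d : ℝ) : ℝ :=
  flowE c q C a d + q ^ 2 * (1 - q ^ 2) * (C ^ 2 + b ^ 2 - c ^ 2) - 2 * d +
    (1 - q ^ 2) * (2 * c * C - C ^ 2)

/-- The inhomogeneous term of `q X`. -/
def coeffX (b c q A C : ℝ) : ℝ :=
  (c * (A + q ^ 2 * C) - q ^ 2 * (b ^ 2 - c ^ 2 + 2 * c * C)) / 2

/-- The jet in adapted variables. -/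
def redJet (b c q A C a d h e : ℝ) : Jet :=
  sepJet b ((A + (c - C) * q ^ 2) / q)
    ((a - d * q ^ 2 + 2 * q ^ 2 * (1 - q ^ 2) * (c - C) ^ 2 -
      (A + (c - C) * q ^ 2) * (1 - q ^ 2) * (c - C)) / q ^ 2) q ((1 - q ^ 2) * (c - C))
    ((A + 2 * c - C) / (2 * q))
    (((a - d) / 2 - (A + 2 * c - C) / 2 * (1 - q ^ 2) * (c - C)) / q ^ 2) h e

section RedJet

variable {q A C a d h e : ℝ}

theorem redJet_X (hq : q ≠ 0) : q * (redJet b c q A C a d h e).X b c =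
    2 * e + (A + q ^ 2 * C + 2 * c - C - q ^ 2 * C) * h + coeffX b c q A C := by
  simp only [Jet.X, redJet, sepJet, coeffX]
  field_simp
  ring

theorem redJet_Z (hq : q ≠ 0) : q ^ 2 * (redJet b c q A C a d h e).Z c =
    q * (redJet b c q A C a d h e).X b c +
      (2 * (1 - q ^ 2) * C * h + coeffQδ b c q C a d) / 2 := by
  rw [redJet_X hq]
  simp only [Jet.Z, Jet.press, redJet, sepJet, coeffX, coeffQδ, flowE]
  field_simp
  ring

theorem redJet_Y (hq : q ≠ 0) : q ^ 2 * (redJet b c q A C a d h e).Y b c =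
    q ^ 2 * (q * (redJet b c q A C a d h e).X b c) +
      ((1 - q ^ 2) * (2 * (A + q ^ 2 * C) * h + coeffT b c q A C a d) -
        q ^ 2 * (2 * (1 - q ^ 2) * C * h + coeffQδ b c q C a d)) / 2 := by
  rw [redJet_X hq]
  simp only [Jet.Y, Jet.press, redJet, sepJet, coeffX, coeffQδ, flowE, coeffT]
  field_simp
  ring

/-- The fluid equation. -/
theorem redJet_main (hq : q ≠ 0) (hQ : 1 - q ^ 2 ≠ 0)
    (h0 : (redJet b c q A C a d h e).Y b c * (redJet b c q A C a d h e).Z c =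
      (redJet b c q A C a d h e).X b c ^ 2) :
    2 * (1 - q ^ 2) * (2 * (A + q ^ 2 * C) * h + coeffT b c q A C a d) *
      (2 * e + (A + q ^ 2 * C + 2 * c - 2 * q ^ 2 * C) * h + coeffX b c q A C +
        coeffQδ b c q C a d / 2) =
      q ^ 2 * (2 * (1 - q ^ 2) * C * h + coeffQδ b c q C a d) ^ 2 := by
  have hX := redJet_X (b := b) (c := c) (A := A) (C := C) (a := a) (d := d) (h := h) (e := e) hq
  have hY := redJet_Y (b := b) (c := c) (A := A) (C := C) (a := a) (d := d) (h := h) (e := e) hq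
  have hZ := redJet_Z (b := b) (c := c) (A := A) (C := C) (a := a) (d := d) (h := h) (e := e) hq
  generalize (redJet b c q A C a d h e).X b c = x at *
  generalize (redJet b c q A C a d h e).Y b c = y at *
  generalize (redJet b c q A C a d h e).Z c = z at *
  generalize coeffQδ b c q C a d = D at *
  generalize coeffT b c q A C a d = T at *
  generalize coeffX b c q A C = X₀ at *
  have h1 : (q ^ 2 * y) * (q ^ 2 * z) = q ^ 2 * (q * x) ^ 2 := by linear_combination q ^ 4 * h0
  rw [hY, hZ] at h1
  apply mul_left_cancel₀ hQ
  have h2 : 2 * e + (A + q ^ 2 * C + 2 * c - 2 * q ^ 2 * C) * h + X₀ + D / 2 =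
      q * x + (2 * (1 - q ^ 2) * C * h + D) / 2 := by rw [hX]; ring
  rw [h2]
  generalize q * x = x' at *
  linear_combination (4 * (1 - q ^ 2)) * h1

end RedJet

end G2Fluid
end

noncomputable section

namespace G2Fluid

open Filter Topology

variable {b c : ℝ} {I J I' J' : Set ℝ} {q f h e A C : ℝ → ℝ}

/-! ### The reduced system -/

/-- `G'/G`, as determined by isotropy of the pressure. -/
def gam (c : ℝ) (q f : ℝ → ℝ) (x : ℝ) : ℝ := (deriv q x + c + q x * f x) / (2 * q x)

/-- The field equations for `q = P'/(bP)`, `f = F'/F`, `h = Ḣ/H` and `e = Ḧ/H`. -/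
structure Reduced (b c : ℝ) (I J : Set ℝ) (q f h e : ℝ → ℝ) : Prop where
  hI : OpenInterval I
  hJ : OpenInterval J
  smooth_q : ∀ x ∈ I, ContDiffAt ℝ ∞ q x
  smooth_f : ∀ x ∈ I, ContDiffAt ℝ ∞ f x
  cont_h : ContinuousOn h J
  q_ne : ∀ x ∈ I, q x ≠ 0
  fluid : ∀ x ∈ I, ∀ u ∈ J, ∀ j, j = sepJet b (f x) (deriv f x) (q x) (deriv q x) (gam c q f x)
    (deriv (gam c q f) x) (h u) (e u) → j.Y b c * j.Z c = j.X b c ^ 2 ∧ j.Y b c ≠ j.Z c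

/-- The possible forms of the solutions of the reduced system. -/
inductive Outcome (b c : ℝ) (I J : Set ℝ) (q f h e : ℝ → ℝ) : Prop
  | const_h (k : ℝ) (hk : ∀ u ∈ J, h u = k)
  | const_q (k l : ℝ) (hk : ∀ x ∈ I, q x = k ∧ f x = l)
  | flrw (hb : b ^ 2 = c ^ 2) (hx : ∀ x ∈ I, 1 - q x ^ 2 ≠ 0 ∧ deriv q x = c * (1 - q x ^ 2) ∧
      f x = c * q x)
  | solA (n : ℝ) (hn : n ^ 2 - 2 * c * n + b ^ 2 ≠ 0)
      (hx : ∀ x ∈ I, 1 - q x ^ 2 ≠ 0 ∧ deriv q x = n * (1 - q x ^ 2) ∧ f x = (2 * n - c) * q x)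
      (hu : ∀ u ∈ J, (c ^ 2 - n ^ 2) * (c ^ 2 - 2 * c * n + b ^ 2) +
        4 * ((n - c) ^ 3 + 3 * c * (n - c) ^ 2 + c * (b ^ 2 - c ^ 2)) * h u +
        4 * (c - n) ^ 2 * h u ^ 2 + 4 * (n ^ 2 - 2 * c * n + b ^ 2) * e u = 0)
  | solB (k : ℝ) (hb : b ^ 2 = c ^ 2) (hk : k ≠ c)
      (hx : ∀ x ∈ I, 1 - q x ^ 2 ≠ 0 ∧ deriv q x = c * (1 - q x ^ 2) ∧
        f x = (2 * (k - c) + c * q x ^ 2) / q x)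
      (hu : ∀ u ∈ J, -(3 * c ^ 2 / 4) * (c - k) + c / 2 * (-c + 4 * k) * h u + k * h u ^ 2 +
        h u * e u + 3 / 2 * c * e u = 0)
  | solC (k : ℝ) (hc : c ≠ 0) (hk : b ^ 2 + c ^ 2 - 2 * c * k = 0)
      (hx : ∀ x ∈ I, 1 - q x ^ 2 ≠ 0 ∧ deriv q x = b ^ 2 / c * (1 - q x ^ 2) ∧
        f x = b ^ 2 / c * q x)
      (hu : ∀ u ∈ J, k * h u + e u = 0)
  | solD (k : ℝ) (hb : b ^ 2 = c ^ 2) (hk : k ≠ c)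
      (hx : ∀ x ∈ I, deriv q x = 4 * k - 3 * c - c * q x ^ 2 ∧ f x = c * q x)
      (hu : ∀ u ∈ J, c / 2 * (2 * k - c) * h u + k * h u ^ 2 + h u * e u +
        (k - c / 2) * e u = 0)

/-- The solution takes one of the possible forms on subintervals. -/
def LocalOutcome (b c : ℝ) (I J : Set ℝ) (q f h e : ℝ → ℝ) : Prop :=
  ∃ I' ⊆ I, ∃ J' ⊆ J, OpenInterval I' ∧ OpenInterval J' ∧ Outcome b c I' J' q f h e

theorem LocalOutcome.mono (hI : I' ⊆ I) (hJ : J' ⊆ J) (H : LocalOutcome b c I' J' q f h e) :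
    LocalOutcome b c I J q f h e := by
  obtain ⟨I'', h1, J'', h2, h3, h4, h5⟩ := H
  exact ⟨I'', h1.trans hI, J'', h2.trans hJ, h3, h4, h5⟩

/-- The reduced system in adapted variables. -/
structure Flow (b c : ℝ) (I J : Set ℝ) (q A C h e : ℝ → ℝ) : Prop where
  hI : OpenInterval I
  hJ : OpenInterval J
  smooth_A : ∀ x ∈ I, ContDiffAt ℝ ∞ A x
  smooth_C : ∀ x ∈ I, ContDiffAt ℝ ∞ C x
  cont_h : ContinuousOn h J
  q_ne : ∀ x ∈ I, q x ≠ 0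
  q_sq_ne : ∀ x ∈ I, 1 - q x ^ 2 ≠ 0
  dq : ∀ x ∈ I, HasDerivAt q ((1 - q x ^ 2) * (c - C x)) x
  fluid : ∀ x ∈ I, ∀ u ∈ J, ∀ j, j = redJet b c (q x) (A x) (C x) (q x * deriv A x)
    (q x * deriv C x) (h u) (e u) → j.Y b c * j.Z c = j.X b c ^ 2 ∧ j.Y b c ≠ j.Z c

theorem Flow.mono (H : Flow b c I J q A C h e) (hI : I' ⊆ I) (hJ : J' ⊆ J)
    (hI' : OpenInterval I') (hJ' : OpenInterval J') : Flow b c I' J' q A C h e where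
  hI := hI'
  hJ := hJ'
  smooth_A := fun x hx => H.smooth_A x (hI hx)
  smooth_C := fun x hx => H.smooth_C x (hI hx)
  cont_h := H.cont_h.mono hJ
  q_ne := fun x hx => H.q_ne x (hI hx)
  q_sq_ne := fun x hx => H.q_sq_ne x (hI hx)
  dq := fun x hx => H.dq x (hI hx)
  fluid := fun x hx u hu => H.fluid x (hI hx) u (hJ hu)

theorem Flow.hasDerivAt_A (H : Flow b c I J q A C h e) {x : ℝ} (hx : x ∈ I) :
    HasDerivAt A (deriv A x) x := ((H.smooth_A x hx).differentiableAt (by simp)).hasDerivAt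

theorem Flow.hasDerivAt_C (H : Flow b c I J q A C h e) {x : ℝ} (hx : x ∈ I) :
    HasDerivAt C (deriv C x) x := ((H.smooth_C x hx).differentiableAt (by simp)).hasDerivAt

theorem Flow.cont_A (H : Flow b c I J q A C h e) : ContinuousOn A I :=
  fun x hx => (H.smooth_A x hx).continuousAt.continuousWithinAt

theorem Flow.cont_C (H : Flow b c I J q A C h e) : ContinuousOn C I :=
  fun x hx => (H.smooth_C x hx).continuousAt.continuousWithinAt

theorem Flow.cont_q (H : Flow b c I J q A C h e) : ContinuousOn q I :=
  fun x hx => (H.dq x hx).continuousAt.continuousWithinAt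

/-- `F'/F` in adapted variables. -/
def adaptedF (c : ℝ) (q A C : ℝ → ℝ) (x : ℝ) : ℝ := (A x + (c - C x) * q x ^ 2) / q x

/-- `q² = 1` is impossible. -/
theorem Reduced.q_sq_ne (H : Reduced b c I J q f h e) : ¬ ∀ x ∈ I, 1 - q x ^ 2 = 0 := by
  intro h1
  obtain ⟨x, hx⟩ := H.hI.isConnected.nonempty
  obtain ⟨u, hu⟩ := H.hJ.isConnected.nonempty
  have dq := ((H.smooth_q x hx).differentiableAt (by simp)).hasDerivAt
  have df := ((H.smooth_f x hx).differentiableAt (by simp)).hasDerivAt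
  have hq := H.q_ne x hx
  have hq1 : q x ^ 2 = 1 := by linear_combination -(h1 x hx)
  have dq0 : ∀ y ∈ I, deriv q y = 0 := by
    intro y hy
    have dy := ((H.smooth_q y hy).differentiableAt (by simp)).hasDerivAt
    have := H.hI.hasDerivAt_zero hy (k := 1) (φ := fun y => q y ^ 2)
      (fun z hz => by linear_combination -(h1 z hz)) (dy.fun_pow 2)
    simpa [H.q_ne y hy] using this
  have hg : deriv (gam c q f) x = deriv f x / 2 := by
    have h2 : HasDerivAt (fun y => (c + q y * f y) / (2 * q y))
        (((deriv q x * f x + q x * deriv f x) * (2 * q x) -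
          (c + q x * f x) * (2 * deriv q x)) / (2 * q x) ^ 2) x :=
      ((dq.fun_mul df).const_add c).fun_div (dq.const_mul 2) (by simpa using hq)
    have h3 : HasDerivAt (gam c q f) _ x := h2.congr_of_eventuallyEq (by
      filter_upwards [H.hI.eventually hx] with y hy
      rw [gam, dq0 y hy, zero_add])
    rw [h3.deriv, dq0 x hx]
    field_simp
    ring
  obtain ⟨h2, h3⟩ := H.fluid x hx u hu _ rfl
  rw [hg, dq0 x hx] at h2 h3
  have hγ : gam c q f x = (c * q x + f x) / 2 := by
    rw [gam, dq0 x hx]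
    field_simp
    linear_combination -(c * hq1)
  have hi : ∀ k, k / q x = k * q x := by intro k; field_simp; rw [hq1]; ring
  set M := 2 * e u + h u * (c + f x * q x) + c * q x * f x / 2 - b ^ 2 / 2 with hM
  have hY : (sepJet b (f x) (deriv f x) (q x) 0 (gam c q f x) (deriv f x / 2) (h u) (e u)).Y b c =
      M - deriv f x / 2 := by
    simp only [Jet.Y, Jet.press, sepJet, hM, hγ, hi]
    ring
  have hZ : (sepJet b (f x) (deriv f x) (q x) 0 (gam c q f x) (deriv f x / 2) (h u) (e u)).Z c =
      M + deriv f x / 2 := by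
    simp only [Jet.Z, Jet.press, sepJet, hM, hγ, hi, hq1]
    linear_combination (c ^ 2 / 2 + 2 * c * h u - b ^ 2 / 2) * hq1
  have hX : (sepJet b (f x) (deriv f x) (q x) 0 (gam c q f x) (deriv f x / 2) (h u) (e u)).X b c =
      q x * M := by
    simp only [Jet.X, sepJet, hM, hγ, hi]
    linear_combination (-(h u * f x) - c * f x / 2) * hq1
  rw [hY, hZ, hX] at h2
  rw [hY, hZ] at h3
  have : deriv f x ^ 2 = 0 := by linear_combination -4 * h2 - 4 * M ^ 2 * hq1
  exact h3 (by rw [pow_eq_zero_iff (by norm_num)] at this; rw [this]; ring)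

theorem Reduced.exists_flow (H : Reduced b c I J q f h e) :
    ∃ I' ⊆ I, ∃ A C, Flow b c I' J q A C h e ∧ ∀ x ∈ I', f x = adaptedF c q A C x := by
  have cq : ContinuousOn q I := fun x hx => (H.smooth_q x hx).continuousAt.continuousWithinAt
  obtain ⟨I', hI', hI'o, hQ⟩ := (H.hI.zero_or_ne (φ := fun x => 1 - q x ^ 2)
    (by fun_prop)).resolve_left H.q_sq_ne
  set C : ℝ → ℝ := fun x => c - deriv q x / (1 - q x ^ 2) with hC
  set A : ℝ → ℝ := fun x => q x * f x - (c - C x) * q x ^ 2 with hA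
  have sC : ∀ x ∈ I', ContDiffAt ℝ ∞ C x := fun x hx =>
    contDiffAt_const.sub ((contDiffAt_deriv (H.smooth_q x (hI' hx))).div
      (contDiffAt_const.sub ((H.smooth_q x (hI' hx)).pow 2)) (hQ x hx))
  have sA : ∀ x ∈ I', ContDiffAt ℝ ∞ A x := fun x hx =>
    ((H.smooth_q x (hI' hx)).mul (H.smooth_f x (hI' hx))).sub
      ((contDiffAt_const.sub (sC x hx)).mul ((H.smooth_q x (hI' hx)).pow 2))
  have hq' : ∀ x ∈ I', deriv q x = (1 - q x ^ 2) * (c - C x) := by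
    intro x hx
    have := hQ x hx
    simp only [hC]
    field_simp
    ring
  have hf : ∀ x ∈ I', f x = adaptedF c q A C x := by
    intro x hx
    have := H.q_ne x (hI' hx)
    simp only [adaptedF, hA]
    field_simp
    ring
  have hg : ∀ x ∈ I', gam c q f x = (A x + 2 * c - C x) / (2 * q x) := by
    intro x hx
    have := H.q_ne x (hI' hx)
    rw [gam, hq' x hx]
    simp only [hA]
    field_simp
    ring
  refine ⟨I', hI', A, C, ⟨hI'o, H.hJ, sA, sC, H.cont_h, fun x hx => H.q_ne x (hI' hx), hQ,
    fun x hx => ?_, fun x hx u hu j hj => ?_⟩, hf⟩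
  · rw [← hq' x hx]
    exact ((H.smooth_q x (hI' hx)).differentiableAt (by simp)).hasDerivAt
  · refine H.fluid x (hI' hx) u hu j (hj.trans ?_)
    have hq := H.q_ne x (hI' hx)
    have dA := ((sA x hx).differentiableAt (by simp)).hasDerivAt
    have dC := ((sC x hx).differentiableAt (by simp)).hasDerivAt
    have dq := ((H.smooth_q x (hI' hx)).differentiableAt (by simp)).hasDerivAt
    rw [hq' x hx] at dq
    have hf' : deriv f x = (q x * deriv A x - q x * deriv C x * q x ^ 2 +
        2 * q x ^ 2 * (1 - q x ^ 2) * (c - C x) ^ 2 -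
        (A x + (c - C x) * q x ^ 2) * (1 - q x ^ 2) * (c - C x)) / q x ^ 2 := by
      have h1 := (dA.fun_add ((dC.const_sub c).fun_mul (dq.fun_pow 2))).fun_div dq hq
      have h2 : HasDerivAt f _ x := h1.congr_of_eventuallyEq (by
        filter_upwards [hI'o.eventually hx] with y hy using hf y hy)
      rw [h2.deriv]
      field_simp
      push_cast
      ring
    have hg' : deriv (gam c q f) x = ((q x * deriv A x - q x * deriv C x) / 2 -
        (A x + 2 * c - C x) / 2 * (1 - q x ^ 2) * (c - C x)) / q x ^ 2 := by
      have h1 := ((dA.add_const (2 * c)).fun_sub dC).fun_div (dq.const_mul 2) (by simpa using hq)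
      have h2 : HasDerivAt (gam c q f) _ x := h1.congr_of_eventuallyEq (by
        filter_upwards [hI'o.eventually hx] with y hy using hg y hy)
      rw [h2.deriv]
      field_simp
    rw [hf', hg', hf x hx, hg x hx, hq' x hx]
    rfl

end G2Fluid
end

noncomputable section

namespace G2Fluid

open Filter Topology

variable {b c : ℝ} {I J I' J' : Set ℝ} {q f h e A C : ℝ → ℝ}

/-! ### The first case distinction: `E = A + q² C` -/

theorem Flow.hasDerivAt_E (H : Flow b c I J q A C h e) {x : ℝ} (hx : x ∈ I) :
    HasDerivAt (fun y => A y + q y ^ 2 * C y)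
      (flowE c (q x) (C x) (q x * deriv A x) (q x * deriv C x) / q x) x := by
  have hq := H.q_ne x hx
  refine ((H.hasDerivAt_A hx).fun_add
    (((H.dq x hx).fun_pow 2).fun_mul (H.hasDerivAt_C hx))).congr_deriv ?_
  rw [flowE]
  field_simp
  push_cast
  ring

/-- The coefficient `δ` in the fluid equation. -/
def coeffδ (b c : ℝ) (q A C : ℝ → ℝ) (x : ℝ) : ℝ :=
  coeffQδ b c (q x) (C x) (q x * deriv A x) (q x * deriv C x) / (1 - q x ^ 2)

theorem Flow.main (H : Flow b c I J q A C h e) {x u : ℝ} (hx : x ∈ I) (hu : u ∈ J) :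
    2 * (2 * (A x + q x ^ 2 * C x) * h u +
        coeffT b c (q x) (A x) (C x) (q x * deriv A x) (q x * deriv C x)) *
      (2 * e u + (A x + q x ^ 2 * C x + 2 * c - 2 * q x ^ 2 * C x) * h u +
        coeffX b c (q x) (A x) (C x) + (1 - q x ^ 2) * coeffδ b c q A C x / 2) =
      q x ^ 2 * (1 - q x ^ 2) * (2 * C x * h u + coeffδ b c q A C x) ^ 2 := by
  have hQ := H.q_sq_ne x hx
  have h1 := redJet_main (H.q_ne x hx) hQ (H.fluid x hx u hu _ rfl).1
  have h2 : coeffQδ b c (q x) (C x) (q x * deriv A x) (q x * deriv C x) =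
      (1 - q x ^ 2) * coeffδ b c q A C x := by rw [coeffδ]; field_simp
  rw [h2] at h1
  apply mul_left_cancel₀ hQ
  linear_combination h1

/-- A quadratic polynomial identity satisfied by the values of `h` has constant coefficients. -/
theorem quadratic_coeff_const {Z : Set ℝ} (hZ : Z.Infinite) {a₀ a₁ a₂ a₀' a₁' a₂' : ℝ}
    (h : ∀ z ∈ Z, a₀ + a₁ * z + a₂ * z ^ 2 = a₀' + a₁' * z + a₂' * z ^ 2) :
    a₀ = a₀' ∧ a₁ = a₁' ∧ a₂ = a₂' := by
  obtain ⟨h0, h1, h2, -⟩ := cubic_coeff_eq_zero hZ (a₀ := a₀ - a₀') (a₁ := a₁ - a₁')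
    (a₂ := a₂ - a₂') (a₃ := 0) (fun z hz => by linear_combination h z hz)
  exact ⟨by linarith, by linarith, by linarith⟩

/-- If `E = 0`, the values of `h` satisfy a quadratic equation with coefficients depending
on `x`. -/
theorem Flow.main_of_E_zero (H : Flow b c I J q A C h e)
    (hE : ∀ x ∈ I, A x + q x ^ 2 * C x = 0) {x u : ℝ} (hx : x ∈ I) (hu : u ∈ J) :
    (2 * C x * h u + coeffδ b c q A C x) ^ 2 + 2 * (C x ^ 2 + b ^ 2 - c ^ 2) *
      (2 * e u + 2 * (c - q x ^ 2 * C x) * h u - q x ^ 2 * (b ^ 2 - c ^ 2 + 2 * c * C x) / 2 +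
        (1 - q x ^ 2) * coeffδ b c q A C x / 2) = 0 := by
  have hq := H.q_ne x hx
  have hQ := H.q_sq_ne x hx
  have h0 : flowE c (q x) (C x) (q x * deriv A x) (q x * deriv C x) = 0 := by
    have := H.hI.hasDerivAt_zero hx hE (H.hasDerivAt_E hx)
    simpa [hq] using this
  have h1 := H.main hx hu
  rw [coeffT, coeffX, h0, hE x hx] at h1
  apply mul_left_cancel₀ (mul_ne_zero (pow_ne_zero 2 hq) hQ)
  linear_combination -h1

theorem Flow.flow_of_E_zero (H : Flow b c I J q A C h e)
    (hE : ∀ x ∈ I, A x + q x ^ 2 * C x = 0) {x : ℝ} (hx : x ∈ I) :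
    2 * (q x * deriv C x) = (1 - q x ^ 2) * (q x ^ 2 * (C x ^ 2 + b ^ 2 - c ^ 2) +
      2 * c * C x - C x ^ 2 - coeffδ b c q A C x) := by
  have hq := H.q_ne x hx
  have hQ := H.q_sq_ne x hx
  have h0 : flowE c (q x) (C x) (q x * deriv A x) (q x * deriv C x) = 0 := by
    have := H.hI.hasDerivAt_zero hx hE (H.hasDerivAt_E hx)
    simpa [hq] using this
  rw [coeffδ, coeffQδ, h0]
  field_simp
  ring

/-- If `E = 0` and `N = C² + b² - c² ≠ 0`, then `C` is constant. -/
theorem Flow.const_C_of_E_zero (H : Flow b c I J q A C h e)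
    (hE : ∀ x ∈ I, A x + q x ^ 2 * C x = 0) (hN : ∀ x ∈ I, C x ^ 2 + b ^ 2 - c ^ 2 ≠ 0)
    (hh : (h '' J).Infinite) : ∃ k, ∀ x ∈ I, C x = k := by
  obtain ⟨x₀, hx₀⟩ := H.hI.isConnected.nonempty
  set δ := coeffδ b c q A C with hδ
  have key : ∀ x ∈ I, ∀ u ∈ J,
      (δ x ^ 2 / (2 * (C x ^ 2 + b ^ 2 - c ^ 2)) -
        q x ^ 2 * (b ^ 2 - c ^ 2 + 2 * c * C x) / 2 + (1 - q x ^ 2) * δ x / 2) +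
      (2 * C x * δ x / (C x ^ 2 + b ^ 2 - c ^ 2) + 2 * (c - q x ^ 2 * C x)) * h u +
      (2 * C x ^ 2 / (C x ^ 2 + b ^ 2 - c ^ 2)) * h u ^ 2 = -2 * e u := by
    intro x hx u hu
    have h1 := H.main_of_E_zero hE hx hu
    have h2 := hN x hx
    rw [← hδ] at h1
    generalize C x ^ 2 + b ^ 2 - c ^ 2 = N at *
    field_simp
    linear_combination h1
  have hc : ∀ x ∈ I, _ := fun x hx => quadratic_coeff_const hh (by
    rintro _ ⟨u, hu, rfl⟩
    exact (key x hx u hu).trans (key x₀ hx₀ u hu).symm)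
  set k₀ := δ x₀ ^ 2 / (2 * (C x₀ ^ 2 + b ^ 2 - c ^ 2)) -
        q x₀ ^ 2 * (b ^ 2 - c ^ 2 + 2 * c * C x₀) / 2 + (1 - q x₀ ^ 2) * δ x₀ / 2
  set k₁ := 2 * C x₀ * δ x₀ / (C x₀ ^ 2 + b ^ 2 - c ^ 2) + 2 * (c - q x₀ ^ 2 * C x₀)
  set k₂ := 2 * C x₀ ^ 2 / (C x₀ ^ 2 + b ^ 2 - c ^ 2)
  have e2 : ∀ x ∈ I, 2 * C x ^ 2 = k₂ * (C x ^ 2 + b ^ 2 - c ^ 2) := by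
    intro x hx
    have := (hc x hx).2.2
    rwa [div_eq_iff (hN x hx)] at this
  by_cases hB : k₂ = 2 ∧ b ^ 2 - c ^ 2 = 0
  swap
  · refine const_of_cubic H.hI.isConnected H.cont_C (a₀ := -k₂ * (b ^ 2 - c ^ 2)) (a₁ := 0)
      (a₂ := 2 - k₂) (a₃ := 0) (fun x hx => by linear_combination e2 x hx) ?_
    rintro ⟨h0, -, h2, -⟩
    have hk : k₂ = 2 := by linarith
    exact hB ⟨hk, by rw [hk] at h0; linarith⟩
  obtain ⟨-, hB⟩ := hB
  have hb2 : b ^ 2 = c ^ 2 := by linarith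
  have hC0 : ∀ x ∈ I, C x ≠ 0 := by
    intro x hx h0
    exact hN x hx (by rw [h0]; linarith)
  set μ := k₁ / 2 - c with hμ
  have e1 : ∀ x ∈ I, δ x = C x * (μ + q x ^ 2 * C x) := by
    intro x hx
    have h1 := (hc x hx).2.1
    have := hC0 x hx
    have hN' : C x ^ 2 + b ^ 2 - c ^ 2 = C x ^ 2 := by linarith
    rw [hN'] at h1
    rw [hμ, ← h1]
    field_simp
    ring
  set K := 2 * k₀ - μ ^ 2 with hK
  have e0 : ∀ x ∈ I, C x * μ + q x ^ 2 * C x * (C x + μ - 2 * c) = K := by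
    intro x hx
    have h1 := (hc x hx).1
    have := hC0 x hx
    have hN' : C x ^ 2 + b ^ 2 - c ^ 2 = C x ^ 2 := by linarith
    rw [hN', e1 x hx, hB] at h1
    rw [hK, ← h1]
    field_simp
    ring
  have ed : ∀ x ∈ I, q x * deriv C x = -(1 - q x ^ 2) * C x * (C x + μ - 2 * c) / 2 := by
    intro x hx
    have h1 := H.flow_of_E_zero hE hx
    rw [← hδ, e1 x hx, hb2] at h1
    linear_combination h1 / 2
  have eD : ∀ x ∈ I, (C x + μ - 2 * c) * (μ + q x ^ 2 * (6 * C x + μ - 6 * c)) = 0 := by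
    intro x hx
    have dC := H.hasDerivAt_C hx
    have dq := H.dq x hx
    have h1 := H.hI.hasDerivAt_zero hx e0 ((dC.mul_const μ).fun_add
      (((dq.fun_pow 2).fun_mul dC).fun_mul ((dC.add_const μ).sub_const (2 * c))))
    have h2 := hC0 x hx
    have h3 := H.q_sq_ne x hx
    have h4 : (1 - q x ^ 2) * C x / 2 ≠ 0 := by positivity
    apply mul_left_cancel₀ h4
    push_cast at h1
    linear_combination -q x * h1 + (μ + q x ^ 2 * (C x + μ - 2 * c) + q x ^ 2 * C x) * ed x hx
  by_cases h0 : μ = 0 ∧ K = 0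
  · refine ⟨2 * c, fun x hx => ?_⟩
    have h1 := e0 x hx
    rw [h0.1, h0.2] at h1
    have h2 := H.q_ne x hx
    have h3 := hC0 x hx
    have : C x - 2 * c = 0 := by
      apply mul_left_cancel₀ (mul_ne_zero (pow_ne_zero 2 h2) h3)
      linear_combination h1
    linarith
  · refine const_of_cubic H.hI.isConnected H.cont_C (a₀ := (μ - 2 * c) * (K * (μ - 6 * c)))
      (a₁ := K * (μ - 6 * c) + (μ - 2 * c) * (4 * c * μ + 6 * K))
      (a₂ := 4 * c * μ + 6 * K - 5 * μ * (μ - 2 * c)) (a₃ := -5 * μ) (fun x hx => ?_) ?_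
    · have h1 := e0 x hx
      have h2 := eD x hx
      linear_combination C x * (C x + μ - 2 * c) * h2 -
        (C x + μ - 2 * c) * (6 * C x + μ - 6 * c) * h1
    · rintro ⟨-, -, h2, h3⟩
      have hμ0 : μ = 0 := by linarith
      refine h0 ⟨hμ0, ?_⟩
      rw [hμ0] at h2
      linarith

theorem Flow.outcome_of_E_zero (H : Flow b c I J q A C h e)
    (hE : ∀ x ∈ I, A x + q x ^ 2 * C x = 0) :
    LocalOutcome b c I J q (adaptedF c q A C) h e := by
  rcases const_or_infinite H.hJ.isConnected H.cont_h with ⟨k, hk⟩ | hh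
  · exact ⟨I, subset_rfl, J, subset_rfl, H.hI, H.hJ, .const_h k hk⟩
  have cC := H.cont_C
  rcases H.hI.zero_or_ne (φ := fun x => C x ^ 2 + b ^ 2 - c ^ 2) (by fun_prop) with hN |
    ⟨I', hI', hI'o, hN⟩
  · have hC : ∀ x ∈ I, C x = 0 := by
      intro x hx
      obtain ⟨-, -, h2, -⟩ := cubic_coeff_eq_zero hh (a₀ := coeffδ b c q A C x ^ 2)
        (a₁ := 4 * C x * coeffδ b c q A C x) (a₂ := 4 * C x ^ 2) (a₃ := 0) (by
          rintro _ ⟨u, hu, rfl⟩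
          have := H.main_of_E_zero hE hx hu
          rw [hN x hx] at this
          linear_combination this)
      simpa using h2
    obtain ⟨x₀, hx₀⟩ := H.hI.isConnected.nonempty
    refine ⟨I, subset_rfl, J, subset_rfl, H.hI, H.hJ, .flrw ?_ fun x hx => ⟨H.q_sq_ne x hx, ?_, ?_⟩⟩
    · have := hN x₀ hx₀
      simp only [hC x₀ hx₀] at this
      linarith
    · rw [(H.dq x hx).deriv, hC x hx]; ring
    · have h1 := hE x hx
      have := H.q_ne x hx
      rw [hC x hx] at h1
      rw [adaptedF, hC x hx]
      field_simp
      linear_combination h1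
  · have H' := H.mono hI' subset_rfl hI'o H.hJ
    have hE' : ∀ x ∈ I', A x + q x ^ 2 * C x = 0 := fun x hx => hE x (hI' hx)
    obtain ⟨k, hk⟩ := H'.const_C_of_E_zero hE' hN hh
    obtain ⟨x₀, hx₀⟩ := hI'o.isConnected.nonempty
    refine ⟨I', hI', J, subset_rfl, hI'o, H.hJ, .solA (c - k) ?_ (fun x hx =>
      ⟨H'.q_sq_ne x hx, ?_, ?_⟩) fun u hu => ?_⟩
    · have := hN x₀ hx₀
      rw [hk x₀ hx₀] at this
      intro h0; exact this (by linear_combination h0)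
    · rw [(H'.dq x hx).deriv, hk x hx]; ring
    · have h1 := hE' x hx
      have := H'.q_ne x hx
      rw [adaptedF, hk x hx]
      rw [hk x hx] at h1
      field_simp
      linear_combination h1
    · have h1 := H'.main_of_E_zero hE' hx₀ hu
      have h2 := H'.flow_of_E_zero hE' hx₀
      have h3 : deriv C x₀ = 0 := H'.hI.hasDerivAt_zero hx₀ hk (H'.hasDerivAt_C hx₀)
      have hQ := H'.q_sq_ne x₀ hx₀
      have h4 : coeffδ b c q A C x₀ = q x₀ ^ 2 * (k ^ 2 + b ^ 2 - c ^ 2) + 2 * c * k - k ^ 2 := by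
        rw [h3, hk x₀ hx₀] at h2
        apply mul_left_cancel₀ hQ
        linear_combination h2
      rw [h4, hk x₀ hx₀] at h1
      linear_combination h1

end G2Fluid
end

noncomputable section

namespace G2Fluid

open Filter Topology

variable {b c : ℝ} {I J I' J' : Set ℝ} {q f h e A C : ℝ → ℝ}

/-! ### The case `E ≠ 0` -/

/-- An equation `h e + τ e + β₂ h² + β₁ h + β₀ = 0` whose coefficients depend on `x` while `h` and
`e` depend on `u` either has constant coefficients, or is a multiple of a linear equation. -/
theorem const_coeff_or_linear {τ β₂ β₁ β₀ : ℝ → ℝ} (hI : I.Nonempty) (hh : (h '' J).Infinite)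
    (H : ∀ x ∈ I, ∀ u ∈ J, h u * e u + τ x * e u + β₂ x * h u ^ 2 + β₁ x * h u + β₀ x = 0) :
    (∃ t k₂ k₁ k₀, ∀ x ∈ I, τ x = t ∧ β₂ x = k₂ ∧ β₁ x = k₁ ∧ β₀ x = k₀) ∨
    ∃ m₂ m₁, (∀ u ∈ J, e u + m₂ * h u + m₁ = 0) ∧
      ∀ x ∈ I, β₂ x = m₂ ∧ β₁ x = τ x * m₂ + m₁ ∧ β₀ x = τ x * m₁ := by
  obtain ⟨x₀, hx₀⟩ := hI
  by_cases ht : ∀ x ∈ I, τ x = τ x₀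
  · refine Or.inl ⟨τ x₀, β₂ x₀, β₁ x₀, β₀ x₀, fun x hx => ?_⟩
    obtain ⟨h0, h1, h2⟩ := quadratic_coeff_const hh (a₀ := β₀ x) (a₁ := β₁ x) (a₂ := β₂ x)
      (a₀' := β₀ x₀) (a₁' := β₁ x₀) (a₂' := β₂ x₀) (by
        rintro _ ⟨u, hu, rfl⟩
        have h1 := H x hx u hu
        rw [ht x hx] at h1
        linear_combination h1 - H x₀ hx₀ u hu)
    exact ⟨ht x hx, h2, h1, h0⟩
  · push Not at ht
    obtain ⟨x₁, hx₁, hne⟩ := ht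
    have hne' : τ x₁ - τ x₀ ≠ 0 := sub_ne_zero.2 hne
    set n := (β₂ x₁ - β₂ x₀) / (τ x₁ - τ x₀) with hn
    set m₂ := (β₁ x₁ - β₁ x₀) / (τ x₁ - τ x₀) with hm₂
    set m₁ := (β₀ x₁ - β₀ x₀) / (τ x₁ - τ x₀) with hm₁
    have he : ∀ u ∈ J, e u = -(n * h u ^ 2 + m₂ * h u + m₁) := by
      intro u hu
      rw [hn, hm₂, hm₁]
      field_simp
      linear_combination H x₁ hx₁ u hu - H x₀ hx₀ u hu
    have key : ∀ x ∈ I, _ := fun x hx => cubic_coeff_eq_zero hh (a₀ := β₀ x - τ x * m₁)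
      (a₁ := β₁ x - m₁ - τ x * m₂) (a₂ := β₂ x - m₂ - τ x * n) (a₃ := -n) (by
        rintro _ ⟨u, hu, rfl⟩
        have h1 := H x hx u hu
        rw [he u hu] at h1
        linear_combination h1)
    have hn0 : n = 0 := by linarith [(key x₀ hx₀).2.2.2]
    refine Or.inr ⟨m₂, m₁, fun u hu => by rw [he u hu, hn0]; ring, fun x hx => ?_⟩
    obtain ⟨h0, h1, h2, -⟩ := key x hx
    rw [hn0] at h2
    exact ⟨by linarith, by linarith, by linarith⟩

/-- The equations for `A`, `C` and the auxiliary functions `λ = T/E` and `η = δ - C λ`. -/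
structure Branch (b c κ : ℝ) (I : Set ℝ) (q A C lam η : ℝ → ℝ) : Prop where
  E_ne : ∀ x ∈ I, A x + q x ^ 2 * C x ≠ 0
  flow_E : ∀ x ∈ I, flowE c (q x) (C x) (q x * deriv A x) (q x * deriv C x) =
    (3 * c - lam x - 2 * C x) * (A x + q x ^ 2 * C x) -
      q x ^ 2 * (1 - q x ^ 2) * (C x ^ 2 + b ^ 2 - c ^ 2)
  flow_C : ∀ x ∈ I, 2 * (q x * deriv C x) =
    (3 * c - lam x - 2 * C x) * (A x + q x ^ 2 * C x) -
      (1 - q x ^ 2) * (η x + C x * (lam x - 2 * c + C x))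
  quad : ∀ x ∈ I, A x ^ 2 + 2 * κ * A x = q x ^ 2 * C x * (C x - 2 * κ)

/-- The branch with `η = 0`; the equation for `h` is linear. -/
structure LinearBranch (b c κ m : ℝ) (I J : Set ℝ) (q A C lam h e : ℝ → ℝ) : Prop
    extends Branch b c κ I q A C lam (fun _ => 0) where
  lin : ∀ x ∈ I, c * A x - q x ^ 2 * (b ^ 2 - c ^ 2 + c * C x) +
    lam x * (C x - A x - 2 * κ) = 4 * m
  ode : ∀ u ∈ J, e u + (c - κ) * h u + m = 0

/-- The branch with constant `λ` and `η ≠ 0`. -/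
structure QuadraticBranch (b c κ l κ₀ K : ℝ) (I J : Set ℝ) (q A C η h e : ℝ → ℝ) : Prop
    extends Branch b c κ I q A C (fun _ => l) η where
  κ₀_ne : κ₀ ≠ 0
  eta_sq : ∀ x ∈ I, q x ^ 2 * (1 - q x ^ 2) * η x ^ 2 = 8 * κ₀ * (A x + q x ^ 2 * C x)
  lin : ∀ x ∈ I, C x * (c * A x - q x ^ 2 * (b ^ 2 - c ^ 2 + c * C x) +
    l * (C x - A x - 2 * κ)) + C x * (1 - q x ^ 2) * η x -
    2 * η x * (A x - q x ^ 2 * C x + 2 * κ) = C x * K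
  ode : ∀ u ∈ J, h u * e u + l / 2 * e u + (c - κ) * h u ^ 2 +
    (K + 2 * l * (c - κ)) / 4 * h u + (l / 2 * ((K + 2 * l * (c - κ)) / 4) -
      (c - κ) * (l / 2) ^ 2 - κ₀) = 0

section Coefficients

variable (b c : ℝ) (q A C : ℝ → ℝ) (x : ℝ)

/-- `λ = T / E`. -/
def coeffLam : ℝ :=
  coeffT b c (q x) (A x) (C x) (q x * deriv A x) (q x * deriv C x) / (A x + q x ^ 2 * C x)

/-- `η = δ - C λ`. -/
def coeffEta : ℝ := coeffδ b c q A C x - C x * coeffLam b c q A C x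

/-- The coefficient of `h²` in the normalized fluid equation. -/
def coeff₂ : ℝ := (A x + q x ^ 2 * C x + 2 * c - 2 * q x ^ 2 * C x) / 2 -
  q x ^ 2 * (1 - q x ^ 2) * C x ^ 2 / (2 * (A x + q x ^ 2 * C x))

/-- Half of the inhomogeneous term of the second factor of the fluid equation. -/
def coeffβ : ℝ := (coeffX b c (q x) (A x) (C x) + (1 - q x ^ 2) * coeffδ b c q A C x / 2) / 2

/-- The coefficient of `h` in the normalized fluid equation. -/
def coeff₁ : ℝ := coeffβ b c q A C x + coeffLam b c q A C x / 2 *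
    ((A x + q x ^ 2 * C x + 2 * c - 2 * q x ^ 2 * C x) / 2) -
  q x ^ 2 * (1 - q x ^ 2) * C x * coeffδ b c q A C x / (2 * (A x + q x ^ 2 * C x))

/-- The inhomogeneous term of the normalized fluid equation. -/
def coeff₀ : ℝ := coeffLam b c q A C x / 2 * coeffβ b c q A C x -
  q x ^ 2 * (1 - q x ^ 2) * coeffδ b c q A C x ^ 2 / (8 * (A x + q x ^ 2 * C x))

end Coefficients

theorem Flow.main_normalized (H : Flow b c I J q A C h e)
    (hE : ∀ x ∈ I, A x + q x ^ 2 * C x ≠ 0) {x u : ℝ} (hx : x ∈ I) (hu : u ∈ J) :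
    h u * e u + coeffLam b c q A C x / 2 * e u + coeff₂ c q A C x * h u ^ 2 +
      coeff₁ b c q A C x * h u + coeff₀ b c q A C x = 0 := by
  have h1 := H.main hx hu
  have h2 := hE x hx
  have h3 : coeffT b c (q x) (A x) (C x) (q x * deriv A x) (q x * deriv C x) =
    coeffLam b c q A C x * (A x + q x ^ 2 * C x) := by rw [coeffLam]; field_simp
  rw [h3] at h1
  rw [coeff₁, coeff₀, coeff₂, coeffβ]
  generalize hE' : A x + q x ^ 2 * C x = E at *
  generalize coeffLam b c q A C x = l at *
  generalize coeffδ b c q A C x = δ at *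
  field_simp
  linear_combination 8 * h1

theorem Flow.branch_of_coeff₂ (H : Flow b c I J q A C h e)
    (hE : ∀ x ∈ I, A x + q x ^ 2 * C x ≠ 0) {m₂ : ℝ} (h2 : ∀ x ∈ I, coeff₂ c q A C x = m₂) :
    Branch b c (c - m₂) I q A C (coeffLam b c q A C) (coeffEta b c q A C) := by
  have hT : ∀ x ∈ I, coeffT b c (q x) (A x) (C x) (q x * deriv A x) (q x * deriv C x) =
      coeffLam b c q A C x * (A x + q x ^ 2 * C x) := by
    intro x hx
    have := hE x hx
    rw [coeffLam]; field_simp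
  refine ⟨hE, fun x hx => ?_, fun x hx => ?_, fun x hx => ?_⟩
  · have h1 := hT x hx
    rw [coeffT] at h1
    linear_combination -h1
  · have h1 := hT x hx
    have hQ := H.q_sq_ne x hx
    have h3 : coeffQδ b c (q x) (C x) (q x * deriv A x) (q x * deriv C x) =
      (1 - q x ^ 2) * coeffδ b c q A C x := by rw [coeffδ]; field_simp
    rw [coeffT] at h1
    rw [coeffQδ] at h3
    rw [coeffEta]
    linear_combination -h1 - h3
  · have h1 := h2 x hx
    have h3 := hE x hx
    rw [coeff₂] at h1
    field_simp at h1
    linear_combination h1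

theorem coeffEta_sq (hE : ∀ x ∈ I, A x + q x ^ 2 * C x ≠ 0) {x : ℝ} (hx : x ∈ I) :
    q x ^ 2 * (1 - q x ^ 2) * coeffEta b c q A C x ^ 2 = 8 * (coeffLam b c q A C x / 2 *
      coeff₁ b c q A C x - coeff₂ c q A C x * (coeffLam b c q A C x / 2) ^ 2 -
      coeff₀ b c q A C x) * (A x + q x ^ 2 * C x) := by
  have h3 := hE x hx
  rw [coeff₁, coeff₀, coeff₂, coeffEta]
  generalize hE' : A x + q x ^ 2 * C x = E at *
  field_simp
  ring

theorem Flow.coeff₁_eq (H : Flow b c I J q A C h e)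
    (hE : ∀ x ∈ I, A x + q x ^ 2 * C x ≠ 0) {m₂ : ℝ} (h2 : ∀ x ∈ I, coeff₂ c q A C x = m₂)
    {x : ℝ} (hx : x ∈ I) :
    C x * (c * A x - q x ^ 2 * (b ^ 2 - c ^ 2 + c * C x) +
      coeffLam b c q A C x * (C x - A x - 2 * (c - m₂))) +
      C x * (1 - q x ^ 2) * coeffEta b c q A C x -
      2 * coeffEta b c q A C x * (A x - q x ^ 2 * C x + 2 * (c - m₂)) =
      C x * (4 * coeff₁ b c q A C x - 2 * coeffLam b c q A C x * m₂) := by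
  have h3 := hE x hx
  have h4 := (H.branch_of_coeff₂ hE h2).quad x hx
  rw [coeff₁, coeffEta, coeffβ, coeffX]
  generalize coeffLam b c q A C x = l at *
  generalize coeffδ b c q A C x = δ at *
  generalize hE' : A x + q x ^ 2 * C x = E at *
  have hA : A x = E - q x ^ 2 * C x := by linarith
  rw [hA] at h4 ⊢
  field_simp
  linear_combination (-8 * δ) * h4

theorem Flow.branch (H : Flow b c I J q A C h e) (hE : ∀ x ∈ I, A x + q x ^ 2 * C x ≠ 0) :
    LocalOutcome b c I J q (adaptedF c q A C) h e ∨
    (∃ J' ⊆ J, OpenInterval J' ∧ ∃ κ m lam, LinearBranch b c κ m I J' q A C lam h e) ∨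
    ∃ κ l κ₀ K η, QuadraticBranch b c κ l κ₀ K I J q A C η h e := by
  rcases const_or_infinite H.hJ.isConnected H.cont_h with ⟨k, hk⟩ | hh
  · exact Or.inl ⟨I, subset_rfl, J, subset_rfl, H.hI, H.hJ, .const_h k hk⟩
  have linear : ∀ J' ⊆ J, OpenInterval J' → ∀ m₂ m₁, (∀ u ∈ J', e u + m₂ * h u + m₁ = 0) →
      (∀ x ∈ I, coeff₂ c q A C x = m₂ ∧
        coeff₁ b c q A C x = coeffLam b c q A C x / 2 * m₂ + m₁ ∧
        coeff₀ b c q A C x = coeffLam b c q A C x / 2 * m₁) →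
      ∃ J' ⊆ J, OpenInterval J' ∧ ∃ κ m lam, LinearBranch b c κ m I J' q A C lam h e := by
    intro J' hJ' hJ'o m₂ m₁ hu hc
    have h2 : ∀ x ∈ I, coeff₂ c q A C x = m₂ := fun x hx => (hc x hx).1
    have hη : ∀ x ∈ I, coeffEta b c q A C x = 0 := by
      intro x hx
      have h1 := coeffEta_sq (b := b) (c := c) hE hx
      rw [(hc x hx).1, (hc x hx).2.1, (hc x hx).2.2] at h1
      have h3 : q x ^ 2 * (1 - q x ^ 2) * coeffEta b c q A C x ^ 2 = 0 := by
        rw [h1]; ring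
      simpa [H.q_ne x hx, H.q_sq_ne x hx] using h3
    have hb := H.branch_of_coeff₂ hE h2
    refine ⟨J', hJ', hJ'o, c - m₂, m₁, coeffLam b c q A C, ⟨⟨hE, hb.flow_E, fun x hx => ?_,
      hb.quad⟩, fun x hx => ?_, fun u hu' => ?_⟩⟩
    · have := hb.flow_C x hx
      rwa [hη x hx] at this
    · have h3 := hE x hx
      have h4 := hb.quad x hx
      have h5 := (hc x hx).2.1
      have h6 := hη x hx
      have h7 : coeffδ b c q A C x = C x * coeffLam b c q A C x := by
        rw [coeffEta] at h6; linarith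
      rw [coeff₁, coeffβ, coeffX, h7] at h5
      generalize coeffLam b c q A C x = l at *
      generalize hE' : A x + q x ^ 2 * C x = E at *
      have hA : A x = E - q x ^ 2 * C x := by linarith
      rw [hA] at h4 ⊢
      field_simp at h5
      apply mul_left_cancel₀ h3
      linear_combination h5 - 2 * l * h4
    · have := hu u hu'
      linear_combination this
  rcases const_coeff_or_linear H.hI.isConnected.nonempty hh
    (fun x hx u hu => H.main_normalized hE hx hu) with ⟨t, k₂, k₁, k₀, hc⟩ | ⟨m₂, m₁, hu, hc⟩
  swap
  · exact Or.inr (Or.inl (linear J subset_rfl H.hJ m₂ m₁ hu hc))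
  have hode : ∀ u ∈ J, h u * e u + t * e u + k₂ * h u ^ 2 + k₁ * h u + k₀ = 0 := by
    intro u hu
    obtain ⟨x, hx⟩ := H.hI.isConnected.nonempty
    have := H.main_normalized hE hx hu
    obtain ⟨h1, h2, h3, h4⟩ := hc x hx
    rwa [h1, h2, h3, h4] at this
  by_cases hκ : t * k₁ - k₂ * t ^ 2 - k₀ = 0
  · have ch := H.cont_h
    rcases H.hJ.zero_or_ne (φ := fun u => h u + t) (by fun_prop) with h0 | ⟨J', hJ', hJ'o, h0⟩
    · exact Or.inl ⟨I, subset_rfl, J, subset_rfl, H.hI, H.hJ,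
        .const_h (-t) fun u hu => by linarith [h0 u hu]⟩
    · refine Or.inr (Or.inl (linear J' hJ' hJ'o k₂ (k₁ - t * k₂) (fun u hu => ?_) fun x hx => ?_))
      · apply mul_left_cancel₀ (h0 u hu)
        linear_combination hode u (hJ' hu) + hκ
      · obtain ⟨h1, h2, h3, h4⟩ := hc x hx
        exact ⟨h2, by rw [h3, h1]; ring, by rw [h4, h1]; linear_combination -hκ⟩
  · have h2 : ∀ x ∈ I, coeff₂ c q A C x = k₂ := fun x hx => (hc x hx).2.1
    have hb := H.branch_of_coeff₂ hE h2
    have hl : ∀ x ∈ I, coeffLam b c q A C x = 2 * t := fun x hx => by linarith [(hc x hx).1]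
    refine Or.inr (Or.inr ⟨c - k₂, 2 * t, t * k₁ - k₂ * t ^ 2 - k₀, 4 * k₁ - 4 * t * k₂,
      coeffEta b c q A C, ⟨⟨hE, fun x hx => ?_, fun x hx => ?_, hb.quad⟩, hκ, fun x hx => ?_,
        fun x hx => ?_, fun u hu => ?_⟩⟩)
    · have := hb.flow_E x hx
      rwa [hl x hx] at this
    · have := hb.flow_C x hx
      rwa [hl x hx] at this
    · have := coeffEta_sq (b := b) (c := c) hE hx
      obtain ⟨h1, h2, h3, h4⟩ := hc x hx
      rwa [h1, h2, h3, h4] at this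
    · have := H.coeff₁_eq hE h2 hx
      rw [hl x hx, (hc x hx).2.2.1] at this
      linear_combination this
    · linear_combination hode u hu

end G2Fluid
end

noncomputable section

namespace G2Fluid

open Filter Topology

variable {b c κ m l κ₀ K : ℝ} {I J I' J' : Set ℝ} {q f h e A C lam η : ℝ → ℝ}

/-! ### The degenerate cases `A = 0`, `C = 0` and `C = 2κ` -/

theorem Branch.mono (B : Branch b c κ I q A C lam η) (hI : I' ⊆ I) :
    Branch b c κ I' q A C lam η :=
  ⟨fun x hx => B.E_ne x (hI hx), fun x hx => B.flow_E x (hI hx), fun x hx => B.flow_C x (hI hx),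
    fun x hx => B.quad x (hI hx)⟩

theorem LinearBranch.mono (B : LinearBranch b c κ m I J q A C lam h e) (hI : I' ⊆ I)
    (hJ : J' ⊆ J) : LinearBranch b c κ m I' J' q A C lam h e :=
  ⟨B.toBranch.mono hI, fun x hx => B.lin x (hI hx), fun u hu => B.ode u (hJ hu)⟩

theorem QuadraticBranch.mono (B : QuadraticBranch b c κ l κ₀ K I J q A C η h e) (hI : I' ⊆ I)
    (hJ : J' ⊆ J) : QuadraticBranch b c κ l κ₀ K I' J' q A C η h e :=
  ⟨B.toBranch.mono hI, B.κ₀_ne, fun x hx => B.eta_sq x (hI hx), fun x hx => B.lin x (hI hx),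
    fun u hu => B.ode u (hJ hu)⟩

/-- The derivative of the quadratic relation. -/
theorem Branch.second (H : Flow b c I J q A C h e) (B : Branch b c κ I q A C lam η) {x : ℝ}
    (hx : x ∈ I) : (3 * c - 2 * C x - lam x) * A x ^ 2 + q x ^ 2 *
      ((C x ^ 2 - 3 * c * C x - 2 * (b ^ 2 - c ^ 2)) * A x + C x ^ 3 - c * C x ^ 2 -
        2 * κ * C x ^ 2 - 2 * κ * (b ^ 2 - c ^ 2)) + q x ^ 2 * (A x + C x) * η x = 0 := by
  have dA := H.hasDerivAt_A hx
  have dC := H.hasDerivAt_C hx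
  have dq := H.dq x hx
  have h1 := H.hI.hasDerivAt_zero (k := 0) hx
    (φ := fun x => A x ^ 2 + 2 * κ * A x - q x ^ 2 * C x * (C x - 2 * κ))
    (fun y hy => by linear_combination B.quad y hy)
    (((dA.fun_pow 2).fun_add (dA.const_mul (2 * κ))).fun_sub
      (((dq.fun_pow 2).fun_mul dC).fun_mul (dC.sub_const (2 * κ))))
  have h2 := B.flow_E x hx
  have h3 := B.flow_C x hx
  have h4 := B.quad x hx
  rw [flowE] at h2
  push_cast at h1
  apply mul_left_cancel₀ (H.q_sq_ne x hx)
  linear_combination q x * h1 - (2 * A x + 2 * κ) * h2 + q x ^ 2 * (A x + C x) * h3 -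
    (3 * c - lam x - 2 * C x) * h4

theorem const_of_sq_const (hI : IsConnected I) (hq : ContinuousOn q I) {k : ℝ}
    (h : ∀ x ∈ I, q x ^ 2 = k) : ∃ k, ∀ x ∈ I, q x = k :=
  const_of_cubic hI hq (a₀ := -k) (a₁ := 0) (a₂ := 1) (a₃ := 0)
    (fun x hx => by linear_combination h x hx) (by norm_num)

theorem Flow.outcome_of_const (H : Flow b c I J q A C h e) {k k' k'' : ℝ}
    (hA : ∀ x ∈ I, A x = k) (hC : ∀ x ∈ I, C x = k') (hq : ∀ x ∈ I, q x ^ 2 = k'') :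
    LocalOutcome b c I J q (adaptedF c q A C) h e := by
  obtain ⟨q₀, hq₀⟩ := const_of_sq_const H.hI.isConnected H.cont_q hq
  refine ⟨I, subset_rfl, J, subset_rfl, H.hI, H.hJ, .const_q q₀ ((k + (c - k') * q₀ ^ 2) / q₀)
    fun x hx => ⟨hq₀ x hx, ?_⟩⟩
  rw [adaptedF, hA x hx, hC x hx, hq₀ x hx]

/-- If `C = c`, then `q` is constant. -/
theorem Flow.sq_const_of_C_eq (H : Flow b c I J q A C h e) (hC : ∀ x ∈ I, C x = c) :
    ∃ k, ∀ x ∈ I, q x ^ 2 = k := by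
  obtain ⟨x₀, hx₀⟩ := H.hI.isConnected.nonempty
  have h0 : ∀ x ∈ I, q x = q x₀ := fun x hx =>
    H.hI.isOpen.is_const_of_deriv_eq_zero H.hI.isConnected.isPreconnected
      (fun y hy => (H.dq y hy).differentiableAt.differentiableWithinAt)
      (fun y hy => by rw [(H.dq y hy).deriv, hC y hy]; simp) hx hx₀
  exact ⟨q x₀ ^ 2, fun x hx => by rw [h0 x hx]⟩

theorem Flow.deriv_eq_zero_of_const (H : Flow b c I J q A C h e) {k : ℝ}
    (hC : ∀ x ∈ I, C x = k) : ∀ x ∈ I, deriv C x = 0 :=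
  fun _ hx => H.hI.hasDerivAt_zero hx hC (H.hasDerivAt_C hx)

theorem Flow.deriv_A_eq_zero_of_const (H : Flow b c I J q A C h e) {k : ℝ}
    (hA : ∀ x ∈ I, A x = k) : ∀ x ∈ I, deriv A x = 0 :=
  fun _ hx => H.hI.hasDerivAt_zero hx hA (H.hasDerivAt_A hx)

section AZero

theorem Branch.C_eq_of_A_zero (H : Flow b c I J q A C h e) (B : Branch b c κ I q A C lam η)
    (hA : ∀ x ∈ I, A x = 0) : κ ≠ 0 ∧ (∀ x ∈ I, C x = 2 * κ) ∧
      ∀ x ∈ I, η x = c * (2 * κ) + (b ^ 2 - c ^ 2) := by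
  have hC0 : ∀ x ∈ I, C x ≠ 0 := by
    intro x hx h0
    exact B.E_ne x hx (by rw [hA x hx, h0]; ring)
  have hC : ∀ x ∈ I, C x = 2 * κ := by
    intro x hx
    have h1 := B.quad x hx
    rw [hA x hx] at h1
    have : C x - 2 * κ = 0 := by
      apply mul_left_cancel₀ (mul_ne_zero (pow_ne_zero 2 (H.q_ne x hx)) (hC0 x hx))
      linear_combination -h1
    linarith
  obtain ⟨x₀, hx₀⟩ := H.hI.isConnected.nonempty
  have hκ : κ ≠ 0 := by
    intro h0
    exact hC0 x₀ hx₀ (by rw [hC x₀ hx₀, h0, mul_zero])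
  refine ⟨hκ, hC, fun x hx => ?_⟩
  have h1 := B.second H hx
  have hq := H.q_ne x hx
  rw [hA x hx, hC x hx] at h1
  have h2 : 2 * κ * q x ^ 2 ≠ 0 := by positivity
  apply mul_left_cancel₀ h2
  linear_combination h1

theorem LinearBranch.outcome_of_A_zero (H : Flow b c I J q A C h e) (hb : b ≠ 0)
    (B : LinearBranch b c κ m I J q A C lam h e) (hA : ∀ x ∈ I, A x = 0) :
    LocalOutcome b c I J q (adaptedF c q A C) h e := by
  obtain ⟨hκ, hC, hη⟩ := B.toBranch.C_eq_of_A_zero H hA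
  obtain ⟨x₀, hx₀⟩ := H.hI.isConnected.nonempty
  have hη₀ := hη x₀ hx₀
  have hc : c ≠ 0 := by
    rintro rfl
    have : b ^ 2 = 0 := by linarith
    exact hb (by simpa using this)
  have hm : m = 0 := by
    have h1 := B.lin x₀ hx₀
    rw [hA x₀ hx₀, hC x₀ hx₀] at h1
    linear_combination -h1 / 4 + q x₀ ^ 2 * hη₀ / 4
  have hbc : b ^ 2 / c = c - 2 * κ := by field_simp; linear_combination -hη₀
  refine ⟨I, subset_rfl, J, subset_rfl, H.hI, H.hJ, .solC (c - κ) hc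
    (by linear_combination -hη₀) (fun x hx => ⟨H.q_sq_ne x hx, ?_, ?_⟩) fun u hu => ?_⟩
  · rw [(H.dq x hx).deriv, hC x hx, hbc]; ring
  · have := H.q_ne x hx
    rw [adaptedF, hA x hx, hC x hx, hbc]
    field_simp
    ring
  · have := B.ode u hu
    rw [hm] at this
    linear_combination this

theorem QuadraticBranch.outcome_of_A_zero (H : Flow b c I J q A C h e)
    (B : QuadraticBranch b c κ l κ₀ K I J q A C η h e) (hA : ∀ x ∈ I, A x = 0) :
    LocalOutcome b c I J q (adaptedF c q A C) h e := by
  obtain ⟨hκ, hC, hη⟩ := B.toBranch.C_eq_of_A_zero H hA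
  have h1 : ∀ x ∈ I, (1 - q x ^ 2) * (c * (2 * κ) + (b ^ 2 - c ^ 2)) ^ 2 = 8 * κ₀ * (2 * κ) := by
    intro x hx
    have h1 := B.eta_sq x hx
    rw [hA x hx, hC x hx, hη x hx] at h1
    apply mul_left_cancel₀ (pow_ne_zero 2 (H.q_ne x hx))
    linear_combination h1
  have h2 : (c * (2 * κ) + (b ^ 2 - c ^ 2)) ^ 2 ≠ 0 := by
    obtain ⟨x₀, hx₀⟩ := H.hI.isConnected.nonempty
    intro h0
    have h3 := h1 x₀ hx₀
    have := B.κ₀_ne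
    rw [h0, mul_zero] at h3
    have : 8 * κ₀ * (2 * κ) ≠ 0 := by positivity
    exact this h3.symm
  refine H.outcome_of_const hA hC
    (k'' := 1 - 8 * κ₀ * (2 * κ) / (c * (2 * κ) + (b ^ 2 - c ^ 2)) ^ 2) fun x hx => ?_
  have h3 := h1 x hx
  generalize (c * (2 * κ) + (b ^ 2 - c ^ 2)) ^ 2 = N at *
  field_simp
  linear_combination -h3

end AZero

section CZero

theorem Branch.A_eq_of_C_zero (H : Flow b c I J q A C h e) (B : Branch b c κ I q A C lam η)
    (hC : ∀ x ∈ I, C x = 0) : κ ≠ 0 ∧ (∀ x ∈ I, A x = -2 * κ) ∧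
      (∀ x ∈ I, η x = q x ^ 2 * (b ^ 2 - c ^ 2)) ∧
      ∀ x ∈ I, (3 * c - lam x) * (-2 * κ) = q x ^ 2 * (1 - q x ^ 2) * (b ^ 2 - c ^ 2) := by
  have hA0 : ∀ x ∈ I, A x ≠ 0 := by
    intro x hx h0
    exact B.E_ne x hx (by rw [hC x hx, h0]; ring)
  have hA : ∀ x ∈ I, A x = -2 * κ := by
    intro x hx
    have h1 := B.quad x hx
    rw [hC x hx] at h1
    have : A x + 2 * κ = 0 := by
      apply mul_left_cancel₀ (hA0 x hx)
      linear_combination h1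
    linarith
  obtain ⟨x₀, hx₀⟩ := H.hI.isConnected.nonempty
  have hκ : κ ≠ 0 := by
    intro h0
    exact hA0 x₀ hx₀ (by rw [hA x₀ hx₀, h0, mul_zero])
  have h1 : ∀ x ∈ I, (3 * c - lam x) * (-2 * κ) =
      q x ^ 2 * (1 - q x ^ 2) * (b ^ 2 - c ^ 2) := by
    intro x hx
    have h1 := B.flow_E x hx
    rw [flowE, H.deriv_eq_zero_of_const hC x hx, H.deriv_A_eq_zero_of_const hA x hx, hA x hx,
      hC x hx] at h1
    linear_combination -h1
  refine ⟨hκ, hA, fun x hx => ?_, h1⟩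
  have h2 := B.flow_C x hx
  rw [H.deriv_eq_zero_of_const hC x hx, hA x hx, hC x hx] at h2
  apply mul_left_cancel₀ (H.q_sq_ne x hx)
  linear_combination h2 + h1 x hx

theorem LinearBranch.outcome_of_C_zero (H : Flow b c I J q A C h e)
    (B : LinearBranch b c κ m I J q A C lam h e) (hC : ∀ x ∈ I, C x = 0) :
    LocalOutcome b c I J q (adaptedF c q A C) h e := by
  obtain ⟨hκ, hA, hη, hl⟩ := B.toBranch.A_eq_of_C_zero H hC
  obtain ⟨x₀, hx₀⟩ := H.hI.isConnected.nonempty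
  have hB : b ^ 2 - c ^ 2 = 0 := by
    apply mul_left_cancel₀ (pow_ne_zero 2 (H.q_ne x₀ hx₀))
    linear_combination -(hη x₀ hx₀)
  have hm : m = -c * κ / 2 := by
    have h1 := B.lin x₀ hx₀
    rw [hA x₀ hx₀, hC x₀ hx₀, hB] at h1
    linear_combination -h1 / 4
  refine ⟨I, subset_rfl, J, subset_rfl, H.hI, H.hJ, .solB (c - κ) (by linarith)
    (by simpa using hκ) (fun x hx => ⟨H.q_sq_ne x hx, ?_, ?_⟩) fun u hu => ?_⟩
  · rw [(H.dq x hx).deriv, hC x hx]; ring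
  · rw [adaptedF, hA x hx, hC x hx]; ring
  · have := B.ode u hu
    rw [hm] at this
    linear_combination (h u + 3 / 2 * c) * this

theorem QuadraticBranch.outcome_of_C_zero (H : Flow b c I J q A C h e)
    (B : QuadraticBranch b c κ l κ₀ K I J q A C η h e) (hC : ∀ x ∈ I, C x = 0) :
    LocalOutcome b c I J q (adaptedF c q A C) h e := by
  obtain ⟨hκ, hA, hη, hl⟩ := B.toBranch.A_eq_of_C_zero H hC
  have hB : b ^ 2 - c ^ 2 ≠ 0 := by
    intro h0
    obtain ⟨x₀, hx₀⟩ := H.hI.isConnected.nonempty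
    have h1 := B.eta_sq x₀ hx₀
    rw [hη x₀ hx₀, h0, hA x₀ hx₀, hC x₀ hx₀] at h1
    have := B.κ₀_ne
    have : κ₀ * κ ≠ 0 := by positivity
    exact this (by linear_combination h1 / 16)
  have cq := H.cont_q
  obtain ⟨k, hk⟩ := const_of_cubic H.hI.isConnected (φ := fun x => q x ^ 2) (by fun_prop)
    (a₀ := -((3 * c - l) * (-2 * κ))) (a₁ := b ^ 2 - c ^ 2) (a₂ := -(b ^ 2 - c ^ 2)) (a₃ := 0)
    (fun x hx => by linear_combination -(hl x hx)) (fun h0 => hB h0.2.1)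
  exact H.outcome_of_const hA hC hk

end CZero

section CTwoκ

theorem Branch.A_eq_of_C_eq (H : Flow b c I J q A C h e) (B : Branch b c κ I q A C lam η)
    (hC : ∀ x ∈ I, C x = 2 * κ) (hA0 : ∀ x ∈ I, A x ≠ 0) : (∀ x ∈ I, A x = -2 * κ) ∧
      κ ≠ 0 ∧ ∀ x ∈ I, η x = (2 * κ) ^ 2 - c * (2 * κ) := by
  have hA : ∀ x ∈ I, A x = -2 * κ := by
    intro x hx
    have h1 := B.quad x hx
    rw [hC x hx] at h1
    have : A x + 2 * κ = 0 := by
      apply mul_left_cancel₀ (hA0 x hx)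
      linear_combination h1
    linarith
  obtain ⟨x₀, hx₀⟩ := H.hI.isConnected.nonempty
  have hκ : κ ≠ 0 := by
    intro h0
    exact hA0 x₀ hx₀ (by rw [hA x₀ hx₀, h0, mul_zero])
  refine ⟨hA, hκ, fun x hx => ?_⟩
  have h2 := B.flow_C x hx
  rw [H.deriv_eq_zero_of_const hC x hx, hA x hx, hC x hx] at h2
  apply mul_left_cancel₀ (H.q_sq_ne x hx)
  linear_combination h2

theorem LinearBranch.outcome_of_C_eq (H : Flow b c I J q A C h e)
    (B : LinearBranch b c κ m I J q A C lam h e) (hC : ∀ x ∈ I, C x = 2 * κ)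
    (hA0 : ∀ x ∈ I, A x ≠ 0) : LocalOutcome b c I J q (adaptedF c q A C) h e := by
  obtain ⟨hA, hκ, hη⟩ := B.toBranch.A_eq_of_C_eq H hC hA0
  obtain ⟨x₀, hx₀⟩ := H.hI.isConnected.nonempty
  have hc : 2 * κ = c := by
    have : 2 * κ - c = 0 := by
      apply mul_left_cancel₀ hκ
      linear_combination -(hη x₀ hx₀) / 2
    linarith
  rw [hc] at hC
  obtain ⟨k, hk⟩ := H.sq_const_of_C_eq hC
  exact H.outcome_of_const hA hC hk

theorem QuadraticBranch.outcome_of_C_eq (H : Flow b c I J q A C h e)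
    (B : QuadraticBranch b c κ l κ₀ K I J q A C η h e) (hC : ∀ x ∈ I, C x = 2 * κ)
    (hA0 : ∀ x ∈ I, A x ≠ 0) : LocalOutcome b c I J q (adaptedF c q A C) h e := by
  obtain ⟨hA, hκ, hη⟩ := B.toBranch.A_eq_of_C_eq H hC hA0
  have h1 : ∀ x ∈ I, q x ^ 2 * ((2 * κ) ^ 2 - c * (2 * κ)) ^ 2 = -16 * κ₀ * κ := by
    intro x hx
    have h1 := B.eta_sq x hx
    rw [hA x hx, hC x hx, hη x hx] at h1
    apply mul_left_cancel₀ (H.q_sq_ne x hx)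
    linear_combination h1
  have h2 : ((2 * κ) ^ 2 - c * (2 * κ)) ^ 2 ≠ 0 := by
    obtain ⟨x₀, hx₀⟩ := H.hI.isConnected.nonempty
    intro h0
    have h3 := h1 x₀ hx₀
    have := B.κ₀_ne
    rw [h0, mul_zero] at h3
    have : -16 * κ₀ * κ ≠ 0 := by
      have : 16 * κ₀ * κ ≠ 0 := by positivity
      intro h4; exact this (by linarith)
    exact this h3.symm
  refine H.outcome_of_const hA hC
    (k'' := -16 * κ₀ * κ / ((2 * κ) ^ 2 - c * (2 * κ)) ^ 2) fun x hx => ?_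
  rw [eq_div_iff h2]
  exact h1 x hx

end CTwoκ

/-- Either the solution is one of the special ones, or `A`, `C` and `C - 2κ` do not vanish on a
subinterval. -/
theorem LinearBranch.outcome_or_generic (H : Flow b c I J q A C h e) (hb : b ≠ 0)
    (B : LinearBranch b c κ m I J q A C lam h e) :
    LocalOutcome b c I J q (adaptedF c q A C) h e ∨
      ∃ I' ⊆ I, OpenInterval I' ∧ ∀ x ∈ I', A x ≠ 0 ∧ C x ≠ 0 ∧ C x - 2 * κ ≠ 0 := by
  rcases H.hI.zero_or_ne H.cont_A with hA | ⟨I₁, h₁, o₁, hA⟩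
  · exact Or.inl (B.outcome_of_A_zero H hb hA)
  have H₁ := H.mono h₁ subset_rfl o₁ H.hJ
  have B₁ := B.mono h₁ (subset_rfl : J ⊆ J)
  rcases H₁.hI.zero_or_ne H₁.cont_C with hC | ⟨I₂, h₂, o₂, hC⟩
  · exact Or.inl ((B₁.outcome_of_C_zero H₁ hC).mono h₁ subset_rfl)
  have H₂ := H₁.mono h₂ subset_rfl o₂ H.hJ
  have B₂ := B₁.mono h₂ (subset_rfl : J ⊆ J)
  have cC := H₂.cont_C
  rcases H₂.hI.zero_or_ne (φ := fun x => C x - 2 * κ) (by fun_prop) with hC' | ⟨I₃, h₃, o₃, hC'⟩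
  · exact Or.inl ((B₂.outcome_of_C_eq H₂ (fun x hx => by linarith [hC' x hx])
      fun x hx => hA x (h₂ hx)).mono (h₂.trans h₁) subset_rfl)
  · exact Or.inr ⟨I₃, h₃.trans (h₂.trans h₁), o₃, fun x hx =>
      ⟨hA x (h₂ (h₃ hx)), hC x (h₃ hx), hC' x hx⟩⟩

theorem QuadraticBranch.outcome_or_generic (H : Flow b c I J q A C h e)
    (B : QuadraticBranch b c κ l κ₀ K I J q A C η h e) :
    LocalOutcome b c I J q (adaptedF c q A C) h e ∨
      ∃ I' ⊆ I, OpenInterval I' ∧ ∀ x ∈ I', A x ≠ 0 ∧ C x ≠ 0 ∧ C x - 2 * κ ≠ 0 := by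
  rcases H.hI.zero_or_ne H.cont_A with hA | ⟨I₁, h₁, o₁, hA⟩
  · exact Or.inl (B.outcome_of_A_zero H hA)
  have H₁ := H.mono h₁ subset_rfl o₁ H.hJ
  have B₁ := B.mono h₁ (subset_rfl : J ⊆ J)
  rcases H₁.hI.zero_or_ne H₁.cont_C with hC | ⟨I₂, h₂, o₂, hC⟩
  · exact Or.inl ((B₁.outcome_of_C_zero H₁ hC).mono h₁ subset_rfl)
  have H₂ := H₁.mono h₂ subset_rfl o₂ H.hJ
  have B₂ := B₁.mono h₂ (subset_rfl : J ⊆ J)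
  have cC := H₂.cont_C
  rcases H₂.hI.zero_or_ne (φ := fun x => C x - 2 * κ) (by fun_prop) with hC' | ⟨I₃, h₃, o₃, hC'⟩
  · exact Or.inl ((B₂.outcome_of_C_eq H₂ (fun x hx => by linarith [hC' x hx])
      fun x hx => hA x (h₂ hx)).mono (h₂.trans h₁) subset_rfl)
  · exact Or.inr ⟨I₃, h₃.trans (h₂.trans h₁), o₃, fun x hx =>
      ⟨hA x (h₂ (h₃ hx)), hC x (h₃ hx), hC' x hx⟩⟩

end G2Fluid
end

noncomputable section

namespace G2Fluid

open Filter Topology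

/-! ### Places

A function with infinitely many values is turned into a transcendental element of the field of
hyperreal numbers, and a place with values in a field containing the reals is chosen at which this
element is infinite. -/

section Lim

variable {K : Type*} [Field K] {V : ValuationSubring K}

/-- The place belonging to the valuation ring `V` maps `a` to `r`. -/
def Lim (V : ValuationSubring K) (a : K) (r : IsLocalRing.ResidueField V) : Prop :=
  ∃ h : a ∈ V, IsLocalRing.residue V ⟨a, h⟩ = r

variable {a a' : K} {r r' : IsLocalRing.ResidueField V}

theorem Lim.add (h : Lim V a r) (h' : Lim V a' r') : Lim V (a + a') (r + r') := by
  obtain ⟨h, rfl⟩ := h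
  obtain ⟨h', rfl⟩ := h'
  exact ⟨add_mem h h', map_add (IsLocalRing.residue V) ⟨a, h⟩ ⟨a', h'⟩⟩

theorem Lim.mul (h : Lim V a r) (h' : Lim V a' r') : Lim V (a * a') (r * r') := by
  obtain ⟨h, rfl⟩ := h
  obtain ⟨h', rfl⟩ := h'
  exact ⟨mul_mem h h', map_mul (IsLocalRing.residue V) ⟨a, h⟩ ⟨a', h'⟩⟩

theorem Lim.neg (h : Lim V a r) : Lim V (-a) (-r) := by
  obtain ⟨h, rfl⟩ := h
  exact ⟨neg_mem h, map_neg (IsLocalRing.residue V) ⟨a, h⟩⟩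

theorem Lim.sub (h : Lim V a r) (h' : Lim V a' r') : Lim V (a - a') (r - r') := by
  rw [sub_eq_add_neg, sub_eq_add_neg]; exact h.add h'.neg

theorem Lim.pow (h : Lim V a r) (n : ℕ) : Lim V (a ^ n) (r ^ n) := by
  obtain ⟨h, rfl⟩ := h
  exact ⟨pow_mem h n, map_pow (IsLocalRing.residue V) ⟨a, h⟩ n⟩

theorem Lim.zero : Lim V 0 0 := ⟨zero_mem V, map_zero (IsLocalRing.residue V)⟩

theorem Lim.one : Lim V 1 1 := ⟨one_mem V, map_one (IsLocalRing.residue V)⟩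

theorem Lim.natCast (n : ℕ) : Lim V n n := ⟨natCast_mem V n, map_natCast (IsLocalRing.residue V) n⟩

theorem Lim.ofNat (n : ℕ) [n.AtLeastTwo] :
    Lim V (OfNat.ofNat n) (OfNat.ofNat n) := Lim.natCast (V := V) n

theorem Lim.unique (h : Lim V a r) (h' : Lim V a r') : r = r' := by
  obtain ⟨h, rfl⟩ := h
  obtain ⟨h', rfl⟩ := h'
  rfl

theorem Lim.eq_of_eq (h : Lim V a r) (h' : Lim V a' r') (e : a = a') : r = r' := by
  subst e; exact h.unique h'

theorem Lim.ne_zero (h : Lim V a r) (hr : r ≠ 0) : a ≠ 0 := by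
  rintro rfl; exact hr (h.unique Lim.zero)

theorem Lim.inv (h : Lim V a r) (hr : r ≠ 0) : Lim V a⁻¹ r⁻¹ := by
  have ha := h.ne_zero hr
  obtain ⟨h, rfl⟩ := h
  have hu : IsUnit (⟨a, h⟩ : V) := by
    rwa [← IsLocalRing.residue_ne_zero_iff_isUnit]
  obtain ⟨b, hb⟩ := hu.exists_right_inv
  have hb' : a * (b : K) = 1 := congrArg Subtype.val hb
  have hba : a⁻¹ = b := by rw [← mul_left_cancel₀ ha (hb'.trans (mul_inv_cancel₀ ha).symm)]
  refine ⟨hba ▸ b.2, ?_⟩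
  have : (⟨a⁻¹, hba ▸ b.2⟩ : V) = b := Subtype.ext hba
  rw [this]
  apply eq_inv_of_mul_eq_one_right
  rw [← map_mul, hb, map_one]

theorem Lim.div (h : Lim V a r) (h' : Lim V a' r') (hr : r' ≠ 0) : Lim V (a / a') (r / r') := by
  rw [div_eq_mul_inv, div_eq_mul_inv]; exact h.mul (h'.inv hr)

/-- Each element is either finite or infinite at a place. -/
theorem Lim.total (V : ValuationSubring K) (a : K) : (∃ r, Lim V a r) ∨ a ≠ 0 ∧ Lim V a⁻¹ 0 := by
  by_cases h : a ∈ V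
  · exact Or.inl ⟨_, h, rfl⟩
  · refine Or.inr ⟨fun h0 => h (h0 ▸ zero_mem V), (V.mem_or_inv_mem a).resolve_left h, ?_⟩
    rw [IsLocalRing.residue_eq_zero_iff, IsLocalRing.mem_maximalIdeal, mem_nonunits_iff]
    intro hu
    obtain ⟨b, hb⟩ := hu.exists_right_inv
    have hb' : a⁻¹ * (b : K) = 1 := congrArg Subtype.val hb
    have ha : a ≠ 0 := fun h0 => h (h0 ▸ zero_mem V)
    apply h
    have : a = b := by
      field_simp at hb'
      exact hb'.symm
    rw [this]; exact b.2

theorem Lim.not_infinite (h : Lim V a r) (h0 : a ≠ 0) : ¬ Lim V a⁻¹ 0 := by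
  intro h'
  have := (h.mul h').eq_of_eq Lim.one (mul_inv_cancel₀ h0)
  simp at this

end Lim

/-- A place of a field of functions on `I`, at which the real constants are finite. -/
structure FunctionPlace (I : Set ℝ) where
  /-- The field. -/
  K : Type
  [field : Field K]
  /-- The evaluation of functions. -/
  ev : (ℝ → ℝ) →+* K
  /-- The valuation ring. -/
  V : ValuationSubring K
  ev_zero : ∀ φ : ℝ → ℝ, (∀ x ∈ I, φ x = 0) → ev φ = 0
  ev_ne_zero : ∀ φ : ℝ → ℝ, (∀ x ∈ I, φ x ≠ 0) → ev φ ≠ 0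
  ev_const_mem : ∀ k : ℝ, ev (fun _ => k) ∈ V

attribute [instance] FunctionPlace.field

namespace FunctionPlace

variable {I : Set ℝ} (p : FunctionPlace I)

/-- The real constants in the field. -/
def i : ℝ →+* p.K := p.ev.comp (Pi.constRingHom ℝ ℝ)

/-- The real constants in the residue field. -/
def j : ℝ →+* IsLocalRing.ResidueField p.V :=
  (IsLocalRing.residue p.V).comp (p.i.codRestrict p.V.toSubring p.ev_const_mem)

theorem lim_const (k : ℝ) : Lim p.V (p.i k) (p.j k) := ⟨p.ev_const_mem k, rfl⟩

theorem ev_eq {φ ψ : ℝ → ℝ} (h : ∀ x ∈ I, φ x = ψ x) : p.ev φ = p.ev ψ := by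
  rw [← sub_eq_zero, ← map_sub]
  exact p.ev_zero _ fun x hx => sub_eq_zero.2 (h x hx)

instance : CharZero (IsLocalRing.ResidueField p.V) := charZero_of_injective_ringHom p.j.injective

end FunctionPlace

theorem exists_functionPlace {I : Set ℝ} {δ : ℝ → ℝ} (h : (δ '' I).Infinite) :
    ∃ p : FunctionPlace I, p.ev δ ≠ 0 ∧ Lim p.V (p.ev δ)⁻¹ 0 := by
  have hx : ∃ x : ℕ → ℝ, (∀ n, x n ∈ I) ∧ Function.Injective fun n => δ (x n) := by
    choose g hg hg' using fun n => (Set.Infinite.natEmbedding _ h n).2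
    refine ⟨g, hg, fun n m hnm => ?_⟩
    simp only [hg'] at hnm
    exact (Set.Infinite.natEmbedding _ h).injective (Subtype.ext hnm)
  obtain ⟨x, hxI, hinj⟩ := hx
  set l : Filter ℕ := (hyperfilter ℕ : Filter ℕ) with hl
  let K := Germ l ℝ
  let ev : (ℝ → ℝ) →+* K := (Germ.coeRingHom l).comp
    (RingHom.pi fun n => Pi.evalRingHom (fun _ : ℝ => ℝ) (x n))
  have ev_apply : ∀ φ, ev φ = ((fun n => φ (x n) : ℕ → ℝ) : Germ l ℝ) := fun φ => rfl
  have ev0 : ∀ φ : ℝ → ℝ, (∀ x ∈ I, φ x = 0) → ev φ = 0 := by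
    intro φ hφ
    rw [ev_apply]
    exact Germ.coe_eq.2 (Eventually.of_forall fun n => hφ _ (hxI n))
  have evne : ∀ φ : ℝ → ℝ, (∀ᶠ n in l, φ (x n) ≠ 0) → ev φ ≠ 0 := by
    intro φ hφ h0
    have h1 : ∀ᶠ n in l, φ (x n) = 0 := Germ.coe_eq.1 h0
    obtain ⟨n, h2, h3⟩ := (hφ.and h1).exists
    exact h2 h3
  let c : ℝ →+* K := ev.comp (Pi.constRingHom ℝ ℝ)
  have trans : ∀ P : Polynomial ℝ, P ≠ 0 → P.eval₂ c (ev δ) ≠ 0 := by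
    intro P hP
    have h1 : P.eval₂ c (ev δ) = ev (fun y => P.eval (δ y)) := by
      have : (fun y => P.eval (δ y)) = P.eval₂ (Pi.constRingHom ℝ ℝ) δ := by
        funext y
        have := Polynomial.hom_eval₂ P (Pi.constRingHom ℝ ℝ) (Pi.evalRingHom (fun _ : ℝ => ℝ) y) δ
        rw [Pi.evalRingHom_apply] at this
        rw [this]
        rfl
      rw [this, Polynomial.hom_eval₂]
    rw [h1]
    apply evne
    have hfin : {n : ℕ | P.eval (δ (x n)) = 0}.Finite := by
      have := (Polynomial.finite_setOfPred_isRoot hP).preimage (f := fun n => δ (x n)) hinj.injOn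
      exact this
    exact hyperfilter_le_cofinite hfin.compl_mem_cofinite
  have hδ0 : ev δ ≠ 0 := by simpa using trans Polynomial.X Polynomial.X_ne_zero
  let _ : Algebra ℝ K := c.toAlgebra
  set A : Subring K := (Algebra.adjoin ℝ {(ev δ)⁻¹}).toSubring with hA
  have hmem : (ev δ)⁻¹ ∈ A := Algebra.self_mem_adjoin_singleton ℝ _
  have hI : Ideal.span {(⟨(ev δ)⁻¹, hmem⟩ : A)} ≠ ⊤ := by
    intro htop
    rw [Ideal.eq_top_iff_one, Ideal.mem_span_singleton'] at htop
    obtain ⟨⟨a, ha⟩, h1⟩ := htop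
    have h2 : a * (ev δ)⁻¹ = 1 := congrArg Subtype.val h1
    have ha' : a ∈ Algebra.adjoin ℝ {(ev δ)⁻¹} := ha
    rw [Algebra.adjoin_singleton_eq_range_aeval] at ha'
    obtain ⟨P, hP⟩ := ha'
    have h4 : Polynomial.aeval (ev δ)⁻¹ (P * Polynomial.X - 1) = 0 := by
      rw [map_sub, map_mul, Polynomial.aeval_X, map_one, sub_eq_zero]
      exact (congrArg (· * (ev δ)⁻¹) hP).trans h2
    have h5 : (P * Polynomial.X - 1 : Polynomial ℝ) ≠ 0 := by
      intro h0
      have := congrArg (Polynomial.eval 0) h0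
      simp at this
    have h6 : (P * Polynomial.X - 1 : Polynomial ℝ).reverse ≠ 0 := by
      simpa using h5
    refine trans _ h6 ?_
    let _ := invertibleOfNonzero (inv_ne_zero hδ0)
    have h7 := Polynomial.eval₂_reverse_eq_zero_iff c ((ev δ)⁻¹) (P * Polynomial.X - 1)
    rw [invOf_eq_inv, inv_inv] at h7
    exact h7.2 h4
  obtain ⟨V, hV, hV'⟩ := Ideal.image_subset_nonunits_valuationSubring _ hI
  refine ⟨⟨K, ev, V, ev0, fun φ hφ => evne φ (Eventually.of_forall fun n => hφ _ (hxI n)),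
    fun k => hV ((Algebra.adjoin ℝ {(ev δ)⁻¹}).algebraMap_mem k)⟩, hδ0, hV hmem, ?_⟩
  have h1 : (ev δ)⁻¹ ∈ (V.nonunits : Set K) := hV' ⟨_, Ideal.mem_span_singleton_self _, rfl⟩
  rw [IsLocalRing.residue_eq_zero_iff]
  rw [← V.image_maximalIdeal] at h1
  obtain ⟨y, hy, hy'⟩ := h1
  have : (⟨(ev δ)⁻¹, hV hmem⟩ : V) = y := Subtype.ext hy'.symm
  rw [this]; exact hy

end G2Fluid
end

noncomputable section

namespace G2Fluid

open Filter Topology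

variable {b c κ m l κ₀ K : ℝ} {I J I' J' : Set ℝ} {q f h e A C lam η : ℝ → ℝ}

/-! ### The generic case of the linear branch -/

/-- None of `A`, `C` and `C - 2κ` vanishes. -/
def Generic (κ : ℝ) (I : Set ℝ) (A C : ℝ → ℝ) : Prop :=
  ∀ x ∈ I, A x ≠ 0 ∧ C x ≠ 0 ∧ C x - 2 * κ ≠ 0

theorem Branch.sq_eq (B : Branch b c κ I q A C lam η) (G : Generic κ I A C) {x : ℝ}
    (hx : x ∈ I) : q x ^ 2 = A x * (A x + 2 * κ) / (C x * (C x - 2 * κ)) := by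
  obtain ⟨h1, h2, h3⟩ := G x hx
  rw [eq_div_iff (by positivity)]
  linear_combination -(B.quad x hx)

theorem Branch.A_add_C_ne (B : Branch b c κ I q A C lam η) (G : Generic κ I A C) {x : ℝ}
    (hx : x ∈ I) : A x + C x ≠ 0 := by
  intro h0
  obtain ⟨h1, h2, h3⟩ := G x hx
  apply B.E_ne x hx
  rw [B.sq_eq G hx]
  field_simp
  linear_combination A x * h0

theorem Branch.C_sub_A_ne (H : Flow b c I J q A C h e) (B : Branch b c κ I q A C lam η)
    (G : Generic κ I A C) {x : ℝ} (hx : x ∈ I) : C x - A x - 2 * κ ≠ 0 := by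
  intro h0
  obtain ⟨h1, h2, h3⟩ := G x hx
  apply H.q_sq_ne x hx
  rw [B.sq_eq G hx]
  field_simp
  linear_combination (A x + C x) * h0

/-- The derivative of the quadratic relation, after elimination of `q²`. -/
theorem Branch.second_generic (H : Flow b c I J q A C h e) (B : Branch b c κ I q A C lam η)
    (G : Generic κ I A C) {x : ℝ} (hx : x ∈ I) :
    (3 * c - 2 * C x - lam x) * (A x * (C x * (C x - 2 * κ))) + (A x + 2 * κ) *
      (((C x ^ 2 - 3 * c * C x - 2 * (b ^ 2 - c ^ 2)) * A x + C x ^ 3 - c * C x ^ 2 -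
        2 * κ * C x ^ 2 - 2 * κ * (b ^ 2 - c ^ 2)) + (A x + C x) * η x) = 0 := by
  obtain ⟨h1, h2, h3⟩ := G x hx
  apply mul_left_cancel₀ h1
  linear_combination (C x * (C x - 2 * κ)) * B.second H hx +
    (((C x ^ 2 - 3 * c * C x - 2 * (b ^ 2 - c ^ 2)) * A x + C x ^ 3 - c * C x ^ 2 -
        2 * κ * C x ^ 2 - 2 * κ * (b ^ 2 - c ^ 2)) + (A x + C x) * η x) * B.quad x hx

/-! #### The polynomials -/

section Polynomials

variable {R S : Type*} [CommRing R] [CommRing S] (φ : R →+* S) (c κ B C t A μ : R)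

/-- Coefficient of `A⁰` in the first integral. -/
def polyF₀ : R := κ * (2 * C ^ 4 - 2 * C ^ 3 * c - 8 * C ^ 3 * κ + 4 * C ^ 2 * c * κ +
  8 * C ^ 2 * κ ^ 2 - 4 * C * B * κ + 8 * B * κ ^ 2)

/-- Coefficient of `A` in the first integral. -/
def polyF₁ : R := -C ^ 4 + 2 * C ^ 3 * c + 4 * C ^ 3 * κ - 14 * C ^ 2 * c * κ -
  4 * C ^ 2 * κ ^ 2 + 24 * C * c * κ ^ 2 - 6 * C * B * κ + 16 * B * κ ^ 2

/-- Coefficient of `A²` in the first integral. -/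
def polyF₂ : R := 2 * C ^ 3 - 4 * C ^ 2 * c - 6 * C ^ 2 * κ + 14 * C * c * κ - 2 * C * B + 8 * B * κ

/-- Coefficient of `A³` in the first integral. -/
def polyF₃ : R := -C ^ 2 + 2 * c * C + B

/-- Coefficient of `A⁰` in the compatibility condition. -/
def polyR₀ : R := κ * (-C ^ 6 * c + C ^ 5 * c ^ 2 + 2 * C ^ 5 * c * κ - 6 * C ^ 4 * B * κ +
  8 * C ^ 3 * c * B * κ + 20 * C ^ 3 * B * κ ^ 2 - 8 * C ^ 2 * c * B * κ ^ 2 -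
  16 * C ^ 2 * B * κ ^ 3 + 12 * C * B ^ 2 * κ ^ 2 - 16 * B ^ 2 * κ ^ 3)

/-- Coefficient of `A` in the compatibility condition. -/
def polyR₁ : R := 2 * C ^ 7 - 4 * C ^ 6 * c - 12 * C ^ 6 * κ + 2 * C ^ 5 * c ^ 2 +
  19 * C ^ 5 * c * κ + 24 * C ^ 5 * κ ^ 2 - 4 * C ^ 4 * c ^ 2 * κ - 32 * C ^ 4 * c * κ ^ 2 -
  5 * C ^ 4 * B * κ - 16 * C ^ 4 * κ ^ 3 + 8 * C ^ 3 * c ^ 2 * κ ^ 2 + 8 * C ^ 3 * c * B * κ +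
  16 * C ^ 3 * c * κ ^ 3 + 14 * C ^ 3 * B * κ ^ 2 + 6 * C ^ 2 * c * B * κ ^ 2 -
  12 * C ^ 2 * B * κ ^ 3 - 16 * C * c * B * κ ^ 3 + 20 * C * B ^ 2 * κ ^ 2 - 28 * B ^ 2 * κ ^ 3

/-- Coefficient of `A²` in the compatibility condition. -/
def polyR₂ : R := -2 * C ^ 6 + 2 * C ^ 5 * c + 8 * C ^ 5 * κ + C ^ 4 * c ^ 2 - 9 * C ^ 4 * c * κ -
  C ^ 4 * B - 8 * C ^ 4 * κ ^ 2 + 3 * C ^ 3 * c ^ 2 * κ + 2 * C ^ 3 * c * B +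
  6 * C ^ 3 * c * κ ^ 2 + 13 * C ^ 2 * c * B * κ - 18 * C * c * B * κ ^ 2 + 11 * C * B ^ 2 * κ -
  16 * B ^ 2 * κ ^ 2

/-- Coefficient of `A³` in the compatibility condition. -/
def polyR₃ : R := C ^ 3 * c ^ 2 - C ^ 3 * c * κ - C ^ 3 * B + 4 * C ^ 2 * c * B + C ^ 2 * B * κ -
  5 * C * c * B * κ + 2 * C * B ^ 2 - 3 * B ^ 2 * κ

/-- The first integral. -/
def polyF : R := A ^ 3 * polyF₃ c B C + A ^ 2 * polyF₂ c κ B C + A * polyF₁ c κ B C +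
  polyF₀ c κ B C - μ * (A * C * (C - 2 * κ))

/-- The compatibility condition. -/
def polyR : R := A ^ 3 * polyR₃ c κ B C + A ^ 2 * polyR₂ c κ B C + A * polyR₁ c κ B C +
  polyR₀ c κ B C

theorem map_polyF : φ (polyF c κ B C A μ) = polyF (φ c) (φ κ) (φ B) (φ C) (φ A) (φ μ) := by
  simp only [polyF, polyF₀, polyF₁, polyF₂, polyF₃, map_add, map_sub, map_mul, map_neg, map_pow,
    map_ofNat]

theorem map_polyR : φ (polyR c κ B C A) = polyR (φ c) (φ κ) (φ B) (φ C) (φ A) := by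
  simp only [polyR, polyR₀, polyR₁, polyR₂, polyR₃, map_add, map_sub, map_mul, map_neg, map_pow,
    map_ofNat]

end Polynomials

theorem LinearBranch.polyF_eq_zero (H : Flow b c I J q A C h e)
    (B : LinearBranch b c κ m I J q A C lam h e) (G : Generic κ I A C) {x : ℝ} (hx : x ∈ I) :
    polyF c κ (b ^ 2 - c ^ 2) (C x) (A x) (4 * m) = 0 := by
  obtain ⟨h1, h2, h3⟩ := G x hx
  have h4 := B.lin x hx
  have h5 := B.toBranch.second_generic H G hx
  have h6 := B.quad x hx
  simp only [polyF, polyF₀, polyF₁, polyF₂, polyF₃]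
  linear_combination A x * C x * (C x - 2 * κ) * h4 + (C x - A x - 2 * κ) * h5 -
    A x * (b ^ 2 - c ^ 2 + c * C x) * h6

theorem LinearBranch.polyR_eq_zero (H : Flow b c I J q A C h e)
    (B : LinearBranch b c κ m I J q A C lam h e) (G : Generic κ I A C) (hκ : κ ≠ 0) {x : ℝ}
    (hx : x ∈ I) : polyR c κ (b ^ 2 - c ^ 2) (C x) (A x) = 0 := by
  obtain ⟨hA, hC, hC'⟩ := G x hx
  have hAC := B.toBranch.A_add_C_ne G hx
  have hCA := B.toBranch.C_sub_A_ne H G hx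
  have hq := H.q_ne x hx
  have dA := H.hasDerivAt_A hx
  have dC := H.hasDerivAt_C hx
  have h5 := B.toBranch.second_generic H G hx
  have hd := B.flow_C x hx
  have ha := B.flow_E x hx
  have hF := B.polyF_eq_zero H G hx
  have hD := H.hI.hasDerivAt_zero (k := 0) hx
    (φ := fun x => polyF c κ (b ^ 2 - c ^ 2) (C x) (A x) (4 * m))
    (fun y hy => B.polyF_eq_zero H G hy) (by
      simp only [polyF, polyF₀, polyF₁, polyF₂, polyF₃]
      repeat first
        | exact dA
        | exact dC
        | exact hasDerivAt_const _ _
        | apply HasDerivAt.fun_pow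
        | apply HasDerivAt.fun_sub
        | apply HasDerivAt.fun_neg
        | apply HasDerivAt.fun_add
        | apply HasDerivAt.fun_mul)
  have hX := B.quad x hx
  rw [flowE, add_sub_assoc] at ha
  generalize lam x = l at *
  generalize deriv A x = A' at *
  generalize deriv C x = C' at *
  generalize A x = A at *
  generalize C x = C at *
  generalize q x = q at *
  generalize b ^ 2 - c ^ 2 = B at *
  have hd' : q * C' * (A * C * (C - 2 * κ)) = (A + C) * (-A ^ 2 * (C ^ 2 - 2 * c * C - B) -
      κ * A * (C ^ 2 - 4 * c * C - 3 * B) - κ * (C ^ 2 * (C - 2 * κ - c) - 2 * κ * B)) := by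
    apply mul_left_cancel₀ (two_ne_zero (α := ℝ))
    linear_combination (A * (C * (C - 2 * κ))) * hd + (A + C) * h5 - A * C * (c - C) * hX
  have ha' : q * A' * (C ^ 2 * (C - 2 * κ) ^ 2) = (A + C) * (A + 2 * κ) *
      (A * ((c - κ) * C ^ 2 + B * (C - κ)) -
        (C - κ) * (C ^ 2 * (C - 2 * κ - c) - 2 * κ * B)) := by
    linear_combination (C ^ 2 * (C - 2 * κ) ^ 2) * ha - (A + 2 * κ) * hd' +
      C * (C - 2 * κ) * (q * C') * hX + (2 * (c - C) * C + C ^ 2 + B) *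
      (C * (C - 2 * κ) - q ^ 2 * (C * (C - 2 * κ)) - A * (A + 2 * κ)) * hX -
      C * (C - 2 * κ) * (3 * c - l - 2 * C) * C * hX + C * (A + C) * h5
  have key : 2 * κ * (A + C) * (A * C * (C - 2 * κ)) * (C - A - 2 * κ) * polyR c κ B C A = 0 := by
    simp only [polyF, polyF₀, polyF₁, polyF₂, polyF₃] at hF
    simp only [polyR, polyR₀, polyR₁, polyR₂, polyR₃]
    push_cast at hD
    obtain ⟨FA, hFA⟩ : ∃ y, y = 3 * A ^ 2 * (-C ^ 2 + 2 * c * C + B) + 2 * A * (2 * C ^ 3 -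
      4 * C ^ 2 * c - 6 * C ^ 2 * κ + 14 * C * c * κ - 2 * C * B + 8 * B * κ) + (-C ^ 4 +
      2 * C ^ 3 * c + 4 * C ^ 3 * κ - 14 * C ^ 2 * c * κ - 4 * C ^ 2 * κ ^ 2 +
      24 * C * c * κ ^ 2 - 6 * C * B * κ + 16 * B * κ ^ 2) := ⟨_, rfl⟩
    obtain ⟨FC, hFC⟩ : ∃ y, y = A ^ 3 * (-2 * C + 2 * c) + A ^ 2 * (6 * C ^ 2 - 8 * C * c -
      12 * C * κ + 14 * c * κ - 2 * B) + A * (-4 * C ^ 3 + 6 * C ^ 2 * c + 12 * C ^ 2 * κ -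
      28 * C * c * κ - 8 * C * κ ^ 2 + 24 * c * κ ^ 2 - 6 * B * κ) + κ * (8 * C ^ 3 -
      6 * C ^ 2 * c - 24 * C ^ 2 * κ + 8 * C * c * κ + 16 * C * κ ^ 2 - 4 * B * κ) := ⟨_, rfl⟩
    obtain ⟨F, hFe⟩ : ∃ y, y = A ^ 3 * (-C ^ 2 + 2 * c * C + B) + A ^ 2 * (2 * C ^ 3 -
      4 * C ^ 2 * c - 6 * C ^ 2 * κ + 14 * C * c * κ - 2 * C * B + 8 * B * κ) + A * (-C ^ 4 +
      2 * C ^ 3 * c + 4 * C ^ 3 * κ - 14 * C ^ 2 * c * κ - 4 * C ^ 2 * κ ^ 2 +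
      24 * C * c * κ ^ 2 - 6 * C * B * κ + 16 * B * κ ^ 2) + κ * (2 * C ^ 4 - 2 * C ^ 3 * c -
      8 * C ^ 3 * κ + 4 * C ^ 2 * c * κ + 8 * C ^ 2 * κ ^ 2 - 4 * C * B * κ + 8 * B * κ ^ 2) :=
      ⟨_, rfl⟩
    have hF' : F = 4 * m * (A * C * (C - 2 * κ)) := by rw [hFe]; linear_combination hF
    have hD' : FA * A' + FC * C' = 4 * m * (C * (C - 2 * κ) * A' + A * (2 * C - 2 * κ) * C') := by
      rw [hFA, hFC]; linear_combination hD
    have h0 : (FA * (A * C * (C - 2 * κ)) - F * (C * (C - 2 * κ))) * A' +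
        (FC * (A * C * (C - 2 * κ)) - F * (A * (2 * C - 2 * κ))) * C' = 0 := by
      linear_combination (A * C * (C - 2 * κ)) * hD' -
        (C * (C - 2 * κ) * A' + A * (2 * C - 2 * κ) * C') * hF'
    have h1 : (FA * (A * C * (C - 2 * κ)) - F * (C * (C - 2 * κ))) * (A * ((A + C) * (A + 2 * κ) *
        (A * ((c - κ) * C ^ 2 + B * (C - κ)) -
        (C - κ) * (C ^ 2 * (C - 2 * κ - c) - 2 * κ * B)))) +
        (FC * (A * C * (C - 2 * κ)) - F * (A * (2 * C - 2 * κ))) * (C * (C - 2 * κ) *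
        ((A + C) * (-A ^ 2 * (C ^ 2 - 2 * c * C - B) -
        κ * A * (C ^ 2 - 4 * c * C - 3 * B) - κ * (C ^ 2 * (C - 2 * κ - c) - 2 * κ * B)))) = 0 := by
      rw [← ha', ← hd']
      linear_combination q * A * (C ^ 2 * (C - 2 * κ) ^ 2) * h0
    rw [← h1, hFA, hFC, hFe]
    ring
  have : 2 * κ * (A + C) * (A * C * (C - 2 * κ)) * (C - A - 2 * κ) ≠ 0 := by positivity
  exact (mul_eq_zero.1 key).resolve_left this

end G2Fluid
end

noncomputable section

namespace G2Fluid

open Filter Topology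

variable {b c κ m l κ₀ K : ℝ} {I J I' J' : Set ℝ} {q f h e A C lam η : ℝ → ℝ}

section Lim

variable {F : Type*} [Field F] {V : ValuationSubring F} {c κ B C : F}
  {c₀ κ₀ B₀ C₀ : IsLocalRing.ResidueField V}

theorem Lim.polyF₀ (hc : Lim V c c₀) (hκ : Lim V κ κ₀) (hB : Lim V B B₀) (hC : Lim V C C₀) :
    Lim V (polyF₀ c κ B C) (polyF₀ c₀ κ₀ B₀ C₀) := by
  simp only [G2Fluid.polyF₀]
  repeat' first
      | assumption | exact Lim.ofNat _ | apply Lim.add | apply Lim.sub | apply Lim.neg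
      | apply Lim.mul | apply Lim.pow

theorem Lim.polyF₁ (hc : Lim V c c₀) (hκ : Lim V κ κ₀) (hB : Lim V B B₀) (hC : Lim V C C₀) :
    Lim V (polyF₁ c κ B C) (polyF₁ c₀ κ₀ B₀ C₀) := by
  simp only [G2Fluid.polyF₁]
  repeat' first
      | assumption | exact Lim.ofNat _ | apply Lim.add | apply Lim.sub | apply Lim.neg
      | apply Lim.mul | apply Lim.pow

theorem Lim.polyF₂ (hc : Lim V c c₀) (hκ : Lim V κ κ₀) (hB : Lim V B B₀) (hC : Lim V C C₀) :
    Lim V (polyF₂ c κ B C) (polyF₂ c₀ κ₀ B₀ C₀) := by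
  simp only [G2Fluid.polyF₂]
  repeat' first
      | assumption | exact Lim.ofNat _ | apply Lim.add | apply Lim.sub | apply Lim.neg
      | apply Lim.mul | apply Lim.pow

theorem Lim.polyF₃ (hc : Lim V c c₀) (hB : Lim V B B₀) (hC : Lim V C C₀) :
    Lim V (polyF₃ c B C) (polyF₃ c₀ B₀ C₀) := by
  simp only [G2Fluid.polyF₃]
  repeat' first
      | assumption | exact Lim.ofNat _ | apply Lim.add | apply Lim.sub | apply Lim.neg
      | apply Lim.mul | apply Lim.pow

theorem Lim.polyR₀ (hc : Lim V c c₀) (hκ : Lim V κ κ₀) (hB : Lim V B B₀) (hC : Lim V C C₀) :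
    Lim V (polyR₀ c κ B C) (polyR₀ c₀ κ₀ B₀ C₀) := by
  simp only [G2Fluid.polyR₀]
  repeat' first
      | assumption | exact Lim.ofNat _ | apply Lim.add | apply Lim.sub | apply Lim.neg
      | apply Lim.mul | apply Lim.pow

theorem Lim.polyR₁ (hc : Lim V c c₀) (hκ : Lim V κ κ₀) (hB : Lim V B B₀) (hC : Lim V C C₀) :
    Lim V (polyR₁ c κ B C) (polyR₁ c₀ κ₀ B₀ C₀) := by
  simp only [G2Fluid.polyR₁]
  repeat' first
      | assumption | exact Lim.ofNat _ | apply Lim.add | apply Lim.sub | apply Lim.neg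
      | apply Lim.mul | apply Lim.pow

theorem Lim.polyR₂ (hc : Lim V c c₀) (hκ : Lim V κ κ₀) (hB : Lim V B B₀) (hC : Lim V C C₀) :
    Lim V (polyR₂ c κ B C) (polyR₂ c₀ κ₀ B₀ C₀) := by
  simp only [G2Fluid.polyR₂]
  repeat' first
      | assumption | exact Lim.ofNat _ | apply Lim.add | apply Lim.sub | apply Lim.neg
      | apply Lim.mul | apply Lim.pow

theorem Lim.polyR₃ (hc : Lim V c c₀) (hκ : Lim V κ κ₀) (hB : Lim V B B₀) (hC : Lim V C C₀) :
    Lim V (polyR₃ c κ B C) (polyR₃ c₀ κ₀ B₀ C₀) := by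
  simp only [G2Fluid.polyR₃]
  repeat' first
      | assumption | exact Lim.ofNat _ | apply Lim.add | apply Lim.sub | apply Lim.neg
      | apply Lim.mul | apply Lim.pow

end Lim

namespace FunctionPlace

variable (p : FunctionPlace I) {c κ B μ : ℝ} {A C : p.K}

theorem j_eq {x y : ℝ} (h : p.j x = p.j y) : x = y := p.j.injective h

theorem polyF_eq_zero {A C : ℝ → ℝ} (h : ∀ x ∈ I, polyF c κ B (C x) (A x) μ = 0) :
    polyF (p.i c) (p.i κ) (p.i B) (p.ev C) (p.ev A) (p.i μ) = 0 := by
  have : polyF (p.i c) (p.i κ) (p.i B) (p.ev C) (p.ev A) (p.i μ) = p.ev (polyF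
    (Pi.constRingHom ℝ ℝ c) (Pi.constRingHom ℝ ℝ κ) (Pi.constRingHom ℝ ℝ B) C A
    (Pi.constRingHom ℝ ℝ μ)) := (map_polyF _ _ _ _ _ _ _).symm
  rw [this]
  refine p.ev_zero _ fun x hx => ?_
  rw [← h x hx]
  exact map_polyF (Pi.evalRingHom (fun _ : ℝ => ℝ) x) _ _ _ _ _ _

theorem polyR_eq_zero {A C : ℝ → ℝ} (h : ∀ x ∈ I, polyR c κ B (C x) (A x) = 0) :
    polyR (p.i c) (p.i κ) (p.i B) (p.ev C) (p.ev A) = 0 := by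
  have : polyR (p.i c) (p.i κ) (p.i B) (p.ev C) (p.ev A) = p.ev (polyR
    (Pi.constRingHom ℝ ℝ c) (Pi.constRingHom ℝ ℝ κ) (Pi.constRingHom ℝ ℝ B) C A) :=
    (map_polyR _ _ _ _ _ _).symm
  rw [this]
  refine p.ev_zero _ fun x hx => ?_
  rw [← h x hx]
  exact map_polyR (Pi.evalRingHom (fun _ : ℝ => ℝ) x) _ _ _ _ _

/-- The case of a finite limit of `C`. -/
theorem false_of_C_finite (hκ : κ ≠ 0) (hB : B + c ^ 2 ≠ 0) (hC0 : C ≠ 0) (hA0 : A ≠ 0)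
    (hF : polyF (p.i c) (p.i κ) (p.i B) C A (p.i μ) = 0)
    (hR : polyR (p.i c) (p.i κ) (p.i B) C A = 0) (ha : Lim p.V A⁻¹ 0)
    {C₀ : IsLocalRing.ResidueField p.V} (hC : Lim p.V C C₀) : False := by
  have lc := p.lim_const c
  have lκ := p.lim_const κ
  have lB := p.lim_const B
  have lμ := p.lim_const μ
  have e1 : polyF₃ (p.i c) (p.i B) C + A⁻¹ * polyF₂ (p.i c) (p.i κ) (p.i B) C +
      A⁻¹ ^ 2 * (polyF₁ (p.i c) (p.i κ) (p.i B) C - p.i μ * (C * (C - 2 * p.i κ))) +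
      A⁻¹ ^ 3 * polyF₀ (p.i c) (p.i κ) (p.i B) C = 0 := by
    rw [polyF] at hF
    field_simp
    linear_combination hF
  have e2 : polyR₃ (p.i c) (p.i κ) (p.i B) C + A⁻¹ * polyR₂ (p.i c) (p.i κ) (p.i B) C +
      A⁻¹ ^ 2 * polyR₁ (p.i c) (p.i κ) (p.i B) C +
      A⁻¹ ^ 3 * polyR₀ (p.i c) (p.i κ) (p.i B) C = 0 := by
    rw [polyR] at hR
    field_simp
    linear_combination hR
  have l1 := ((((lc.polyF₃ lB hC).add (ha.mul (lc.polyF₂ lκ lB hC))).add ((ha.pow 2).mul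
    ((lc.polyF₁ lκ lB hC).sub (lμ.mul (hC.mul (hC.sub ((Lim.ofNat 2).mul lκ))))))).add
    ((ha.pow 3).mul (lc.polyF₀ lκ lB hC))).eq_of_eq Lim.zero e1
  have l2 := ((((lc.polyR₃ lκ lB hC).add (ha.mul (lc.polyR₂ lκ lB hC))).add ((ha.pow 2).mul
    (lc.polyR₁ lκ lB hC))).add ((ha.pow 3).mul (lc.polyR₀ lκ lB hC))).eq_of_eq Lim.zero e2
  have hB0 : p.j B = C₀ ^ 2 - 2 * p.j c * C₀ := by
    rw [polyF₃] at l1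
    linear_combination l1
  have h3 : C₀ ^ 2 * (C₀ - 2 * p.j κ) * (C₀ - p.j c) ^ 2 = 0 := by
    rw [polyR₃, hB0] at l2
    linear_combination l2
  have hcase : C₀ ≠ p.j c := by
    intro h
    refine hB ((map_eq_zero p.j).1 ?_)
    rw [map_add, map_pow, hB0, h]
    ring
  have hκ' : p.j κ ≠ 0 := (map_ne_zero p.j).2 hκ
  rcases mul_eq_zero.1 h3 with h4 | h4
  swap
  · exact hcase (by simpa [sub_eq_zero] using h4)
  rcases mul_eq_zero.1 h4 with h5 | h5
  · have h0 : C₀ = 0 := by simpa using h5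
    have hB' : B = 0 := (map_eq_zero p.j).1 (by rw [hB0, h0]; ring)
    have e3 : 2 * p.i c - C + A⁻¹ * (2 * C ^ 2 - 4 * C * p.i c - 6 * C * p.i κ +
        14 * p.i c * p.i κ) + A⁻¹ ^ 2 * (-C ^ 3 + 2 * C ^ 2 * p.i c + 4 * C ^ 2 * p.i κ -
        14 * C * p.i c * p.i κ - 4 * C * p.i κ ^ 2 + 24 * p.i c * p.i κ ^ 2 -
        p.i μ * (C - 2 * p.i κ)) + A⁻¹ ^ 3 * (p.i κ * (2 * C ^ 3 - 2 * C ^ 2 * p.i c -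
        8 * C ^ 2 * p.i κ + 4 * C * p.i c * p.i κ + 8 * C * p.i κ ^ 2)) = 0 := by
      apply mul_left_cancel₀ hC0
      rw [hB', map_zero, polyF₀, polyF₁, polyF₂, polyF₃] at e1
      linear_combination e1
    have l3 : 2 * p.j c - C₀ + 0 * (2 * C₀ ^ 2 - 4 * C₀ * p.j c - 6 * C₀ * p.j κ +
        14 * p.j c * p.j κ) + 0 ^ 2 * (-C₀ ^ 3 + 2 * C₀ ^ 2 * p.j c + 4 * C₀ ^ 2 * p.j κ -
        14 * C₀ * p.j c * p.j κ - 4 * C₀ * p.j κ ^ 2 + 24 * p.j c * p.j κ ^ 2 -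
        p.j μ * (C₀ - 2 * p.j κ)) + 0 ^ 3 * (p.j κ * (2 * C₀ ^ 3 - 2 * C₀ ^ 2 * p.j c -
        8 * C₀ ^ 2 * p.j κ + 4 * C₀ * p.j c * p.j κ + 8 * C₀ * p.j κ ^ 2)) = 0 := by
      refine Lim.eq_of_eq ?_ Lim.zero e3
      repeat' first
      | assumption | exact Lim.ofNat _ | apply Lim.add | apply Lim.sub | apply Lim.neg
      | apply Lim.mul | apply Lim.pow
    have hc0 : p.j c = 0 := by
      rw [h0] at l3
      linear_combination l3 / 2
    exact hcase (by rw [h0, hc0])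
  · have h0 : C₀ = 2 * p.j κ := by linear_combination h5
    have hB' : B = 4 * κ ^ 2 - 4 * c * κ := p.j_eq (by
      rw [hB0, h0]; simp only [map_sub, map_mul, map_pow, map_ofNat]; ring)
    have hne : C₀ - 2 * p.j κ + 4 * p.j κ - 2 * p.j c ≠ 0 := by
      intro h6
      exact hcase (by linear_combination h6 / 2 + h5 / 2)
    have hBi : p.i B = 4 * p.i κ ^ 2 - 4 * p.i c * p.i κ := by
      rw [hB']; simp only [map_sub, map_mul, map_pow, map_ofNat]
    have hζ : Lim p.V (C - 2 * p.i κ + 4 * p.i κ - 2 * p.i c)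
        (C₀ - 2 * p.j κ + 4 * p.j κ - 2 * p.j c) := by
      repeat' first
      | assumption | exact Lim.ofNat _ | apply Lim.add | apply Lim.sub
      | apply Lim.mul
    have hζ0 := hζ.ne_zero hne
    have ly := (((lc.polyF₂ lκ lB hC).add (ha.mul ((lc.polyF₁ lκ lB hC).sub
      (lμ.mul (hC.mul (hC.sub ((Lim.ofNat 2).mul lκ))))))).add
      ((ha.pow 2).mul (lc.polyF₀ lκ lB hC))).div hζ hne
    have hy : (polyF₂ (p.i c) (p.i κ) (p.i B) C + A⁻¹ * (polyF₁ (p.i c) (p.i κ) (p.i B) C -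
        p.i μ * (C * (C - 2 * p.i κ))) + A⁻¹ ^ 2 * polyF₀ (p.i c) (p.i κ) (p.i B) C) /
        (C - 2 * p.i κ + 4 * p.i κ - 2 * p.i c) = A * (C - 2 * p.i κ) := by
      rw [div_eq_iff hζ0]
      have h7 : polyF₃ (p.i c) (p.i B) C =
        -(C - 2 * p.i κ) * (C - 2 * p.i κ + 4 * p.i κ - 2 * p.i c) := by
        rw [polyF₃, hBi]; ring
      rw [h7] at e1
      field_simp at e1 ⊢
      linear_combination e1
    rw [hy] at ly
    obtain ⟨y₀, ly⟩ : ∃ y, Lim p.V (A * (C - 2 * p.i κ)) y := ⟨_, ly⟩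
    have e4 : A * (C - 2 * p.i κ) * ((C - 2 * p.i κ) * (C * p.i c ^ 2 + 3 * C * p.i c * p.i κ -
        4 * C * p.i κ ^ 2 - 12 * p.i c ^ 2 * p.i κ + 24 * p.i c * p.i κ ^ 2 - 12 * p.i κ ^ 3)) +
        polyR₂ (p.i c) (p.i κ) (p.i B) C + A⁻¹ * polyR₁ (p.i c) (p.i κ) (p.i B) C +
        A⁻¹ ^ 2 * polyR₀ (p.i c) (p.i κ) (p.i B) C = 0 := by
      have h7 : polyR₃ (p.i c) (p.i κ) (p.i B) C =
        (C - 2 * p.i κ) ^ 2 * (C * p.i c ^ 2 + 3 * C * p.i c * p.i κ -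
        4 * C * p.i κ ^ 2 - 12 * p.i c ^ 2 * p.i κ + 24 * p.i c * p.i κ ^ 2 - 12 * p.i κ ^ 3) := by
        rw [polyR₃, hBi]; ring
      rw [h7] at e2
      field_simp at e2 ⊢
      linear_combination e2
    have lρ : Lim p.V ((C - 2 * p.i κ) * (C * p.i c ^ 2 + 3 * C * p.i c * p.i κ -
        4 * C * p.i κ ^ 2 - 12 * p.i c ^ 2 * p.i κ + 24 * p.i c * p.i κ ^ 2 - 12 * p.i κ ^ 3))
        ((C₀ - 2 * p.j κ) * (C₀ * p.j c ^ 2 + 3 * C₀ * p.j c * p.j κ -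
        4 * C₀ * p.j κ ^ 2 - 12 * p.j c ^ 2 * p.j κ + 24 * p.j c * p.j κ ^ 2 -
        12 * p.j κ ^ 3)) := by
      repeat' first
      | assumption | exact Lim.ofNat _ | apply Lim.add | apply Lim.sub | apply Lim.neg
      | apply Lim.mul | apply Lim.pow
    have l4 := ((((ly.mul lρ).add (lc.polyR₂ lκ lB hC)).add (ha.mul (lc.polyR₁ lκ lB hC))).add
      ((ha.pow 2).mul (lc.polyR₀ lκ lB hC))).eq_of_eq Lim.zero e4
    rw [h5, zero_mul, mul_zero, polyR₂, hB0, h0] at l4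
    have h8 : 8 * p.j κ ^ 4 * (2 * p.j κ - p.j c) ^ 2 = 0 := by linear_combination l4
    have h9 : 2 * p.j κ - p.j c ≠ 0 := by
      intro h6
      exact hcase (by linear_combination h6 + h0)
    have : 8 * p.j κ ^ 4 * (2 * p.j κ - p.j c) ^ 2 ≠ 0 :=
      mul_ne_zero (mul_ne_zero (by norm_num) (pow_ne_zero 4 hκ')) (pow_ne_zero 2 h9)
    exact this h8

/-- The case in which `C` is infinite and `A / C` is infinitesimal. -/
theorem false_of_ratio_zero {z t : p.K} (hκ : κ ≠ 0) (hz0 : z ≠ 0) (hz : Lim p.V z 0)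
    (hAt : A = t / z)
    (hF' : polyF (z * p.i c) (z * p.i κ) (z ^ 2 * p.i B) 1 t (z ^ 2 * p.i μ) = 0)
    (hR' : polyR (z * p.i c) (z * p.i κ) (z ^ 2 * p.i B) 1 t = 0) (ht : Lim p.V t 0) : False := by
  have lc := p.lim_const c
  have lκ := p.lim_const κ
  have lB := p.lim_const B
  have lμ := p.lim_const μ
  have lc' : Lim p.V (z * p.i c) 0 := by simpa using hz.mul lc
  have lκ' : Lim p.V (z * p.i κ) 0 := by simpa using hz.mul lκ
  have lB' : Lim p.V (z ^ 2 * p.i B) 0 := by simpa using (hz.pow 2).mul lB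
  have lμ' : Lim p.V (z ^ 2 * p.i μ) 0 := by simpa using (hz.pow 2).mul lμ
  have l1 : Lim p.V (1 : p.K) 1 := Lim.one
  have lb := (((ht.pow 2).mul (lc'.polyR₃ lκ' lB' l1)).add
    (ht.mul (lc'.polyR₂ lκ' lB' l1))).add (lc'.polyR₁ lκ' lB' l1)
  have hb : (0 : IsLocalRing.ResidueField p.V) ^ 2 * polyR₃ 0 0 0 1 + 0 * polyR₂ 0 0 0 1 +
      polyR₁ 0 0 0 1 = 2 := by
    rw [polyR₃, polyR₂, polyR₁]; ring
  rw [hb] at lb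
  have lr : Lim p.V (-(p.i κ * (-(z * p.i c) + (z * p.i c) ^ 2 +
      2 * (z * p.i c) * (z * p.i κ) - 6 * (z ^ 2 * p.i B) * (z * p.i κ) +
      8 * (z * p.i c) * (z ^ 2 * p.i B) * (z * p.i κ) +
      20 * (z ^ 2 * p.i B) * (z * p.i κ) ^ 2 -
      8 * (z * p.i c) * (z ^ 2 * p.i B) * (z * p.i κ) ^ 2 -
      16 * (z ^ 2 * p.i B) * (z * p.i κ) ^ 3 + 12 * (z ^ 2 * p.i B) ^ 2 * (z * p.i κ) ^ 2 -
      16 * (z ^ 2 * p.i B) ^ 2 * (z * p.i κ) ^ 3)))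
      (-(p.j κ * (-0 + 0 ^ 2 + 2 * 0 * 0 - 6 * 0 * 0 + 8 * 0 * 0 * 0 + 20 * 0 * 0 ^ 2 -
        8 * 0 * 0 * 0 ^ 2 - 16 * 0 * 0 ^ 3 + 12 * 0 ^ 2 * 0 ^ 2 - 16 * 0 ^ 2 * 0 ^ 3))) := by
    repeat' first
  | assumption | exact Lim.ofNat _ | apply Lim.add | apply Lim.sub | apply Lim.neg
  | apply Lim.mul | apply Lim.pow
  have hA := lr.div lb two_ne_zero
  have hb0 := lb.ne_zero two_ne_zero
  rw [show -(p.i κ * (-(z * p.i c) + (z * p.i c) ^ 2 +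
      2 * (z * p.i c) * (z * p.i κ) - 6 * (z ^ 2 * p.i B) * (z * p.i κ) +
      8 * (z * p.i c) * (z ^ 2 * p.i B) * (z * p.i κ) +
      20 * (z ^ 2 * p.i B) * (z * p.i κ) ^ 2 -
      8 * (z * p.i c) * (z ^ 2 * p.i B) * (z * p.i κ) ^ 2 -
      16 * (z ^ 2 * p.i B) * (z * p.i κ) ^ 3 + 12 * (z ^ 2 * p.i B) ^ 2 * (z * p.i κ) ^ 2 -
      16 * (z ^ 2 * p.i B) ^ 2 * (z * p.i κ) ^ 3)) /
      (t ^ 2 * polyR₃ (z * p.i c) (z * p.i κ) (z ^ 2 * p.i B) 1 +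
        t * polyR₂ (z * p.i c) (z * p.i κ) (z ^ 2 * p.i B) 1 +
        polyR₁ (z * p.i c) (z * p.i κ) (z ^ 2 * p.i B) 1) = A by
      rw [div_eq_iff hb0]
      apply mul_left_cancel₀ hz0
      rw [polyR, polyR₀] at hR'
      rw [hAt]
      field_simp
      linear_combination -hR'] at hA
  have hA' : Lim p.V A 0 := by
    convert hA using 1
    ring
  have lf := ((hA'.mul ((((ht.pow 2).mul (lc'.polyF₃ lB' l1)).add
    (ht.mul (lc'.polyF₂ lκ' lB' l1))).add ((lc'.polyF₁ lκ' lB' l1).sub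
    (lμ'.mul (l1.sub ((Lim.ofNat 2).mul lκ')))))).add (lκ.mul (show Lim p.V (2 -
    2 * (z * p.i c) - 8 * (z * p.i κ) + 4 * (z * p.i c) * (z * p.i κ) +
    8 * (z * p.i κ) ^ 2 - 4 * (z ^ 2 * p.i B) * (z * p.i κ) +
    8 * (z ^ 2 * p.i B) * (z * p.i κ) ^ 2) (2 - 2 * 0 - 8 * 0 + 4 * 0 * 0 +
    8 * 0 ^ 2 - 4 * 0 * 0 + 8 * 0 * 0 ^ 2) by
    repeat' first
  | assumption | exact Lim.ofNat _ | apply Lim.add | apply Lim.sub | apply Lim.neg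
  | apply Lim.mul | apply Lim.pow))).eq_of_eq Lim.zero (by
      apply mul_left_cancel₀ hz0
      rw [polyF, polyF₀] at hF'
      rw [hAt]
      field_simp
      linear_combination hF')
  have : 2 * p.j κ = 0 := by linear_combination lf
  simp [hκ] at this

/-- The case in which `C` is infinite and `A / C` is infinitely close to `1`. -/
theorem finite_of_ratio_one {z t : p.K} (hz0 : z ≠ 0) (hz : Lim p.V z 0)
    (hR' : polyR (z * p.i c) (z * p.i κ) (z ^ 2 * p.i B) 1 t = 0) (ht : Lim p.V t 1) :
    ∃ r, Lim p.V (z⁻¹ - t / z) r := by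
  obtain ⟨mc, -⟩ := p.lim_const c
  obtain ⟨mκ, -⟩ := p.lim_const κ
  obtain ⟨mB, -⟩ := p.lim_const B
  obtain ⟨mz, -⟩ := hz
  obtain ⟨mt, -⟩ := id ht
  set c' : p.V := ⟨_, mc⟩
  set κ' : p.V := ⟨_, mκ⟩
  set B' : p.V := ⟨_, mB⟩
  set z' : p.V := ⟨_, mz⟩
  set t' : p.V := ⟨_, mt⟩
  set P : Polynomial p.V := polyR (Polynomial.X * Polynomial.C c') (Polynomial.X * Polynomial.C κ')
    (Polynomial.X ^ 2 * Polynomial.C B') 1 (Polynomial.C t') with hP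
  have heval : ∀ y, P.eval y = polyR (y * c') (y * κ') (y ^ 2 * B') 1 t' := by
    intro y
    rw [hP, ← Polynomial.coe_evalRingHom, map_polyR]
    simp only [map_mul, map_pow, map_one, Polynomial.coe_evalRingHom, Polynomial.eval_X,
      Polynomial.eval_C]
  obtain ⟨w, hw⟩ := Polynomial.sub_dvd_eval_sub z' 0 P
  rw [heval, heval] at hw
  have hw' := congrArg p.V.subtype hw
  rw [map_sub, map_polyR, map_polyR] at hw'
  simp only [map_mul, map_pow, map_one, map_zero, map_sub] at hw'
  have hw'' : polyR (z * p.i c) (z * p.i κ) (z ^ 2 * p.i B) 1 t -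
    polyR (0 * p.i c) (0 * p.i κ) (0 ^ 2 * p.i B) 1 t = (z - 0) * (w : p.K) := hw'
  rw [hR'] at hw''
  rw [polyR, polyR₀, polyR₁, polyR₂, polyR₃] at hw''
  have l2t := (Lim.ofNat 2).mul ht
  have hne : (OfNat.ofNat 2 : IsLocalRing.ResidueField p.V) * 1 ≠ 0 := by
    rw [mul_one]; exact two_ne_zero
  have l3 := (Lim.neg ⟨w.2, rfl⟩).div l2t hne
  have hne' := l2t.ne_zero hne
  have h4 : z⁻¹ - t / z = -(w : p.K) / (OfNat.ofNat 2 * t) := by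
    rw [eq_div_iff hne']
    apply mul_left_cancel₀ hz0
    field_simp
    linear_combination -hw''
  exact ⟨_, h4 ▸ l3⟩

/-- The case of an infinite limit of `C`. -/
theorem false_of_C_infinite (hκ : κ ≠ 0) (hC0 : C ≠ 0) (hA0 : A ≠ 0)
    (hF : polyF (p.i c) (p.i κ) (p.i B) C A (p.i μ) = 0)
    (hR : polyR (p.i c) (p.i κ) (p.i B) C A = 0) (hδ0 : C - A ≠ 0) (hδ : Lim p.V (C - A)⁻¹ 0)
    (hz : Lim p.V C⁻¹ 0) : False := by
  have lc := p.lim_const c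
  have lκ := p.lim_const κ
  have lB := p.lim_const B
  have lμ := p.lim_const μ
  obtain ⟨z, hze⟩ : ∃ z, z = C⁻¹ := ⟨_, rfl⟩
  obtain ⟨t, hte⟩ : ∃ t, t = A * z := ⟨_, rfl⟩
  have hz0 : z ≠ 0 := hze ▸ inv_ne_zero hC0
  have ht0 : t ≠ 0 := hte ▸ mul_ne_zero hA0 hz0
  have hCz : C = z⁻¹ := by rw [hze, inv_inv]
  have hAt : A = t / z := by rw [hte]; field_simp
  rw [← hze] at hz
  have lc' : Lim p.V (z * p.i c) 0 := by simpa using hz.mul lc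
  have lκ' : Lim p.V (z * p.i κ) 0 := by simpa using hz.mul lκ
  have lB' : Lim p.V (z ^ 2 * p.i B) 0 := by simpa using (hz.pow 2).mul lB
  have lμ' : Lim p.V (z ^ 2 * p.i μ) 0 := by simpa using (hz.pow 2).mul lμ
  have hF' : polyF (z * p.i c) (z * p.i κ) (z ^ 2 * p.i B) 1 t (z ^ 2 * p.i μ) = 0 := by
    rw [hCz, hAt, polyF, polyF₀, polyF₁, polyF₂, polyF₃] at hF
    rw [polyF, polyF₀, polyF₁, polyF₂, polyF₃]
    field_simp at hF
    linear_combination hF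
  have hR' : polyR (z * p.i c) (z * p.i κ) (z ^ 2 * p.i B) 1 t = 0 := by
    rw [hCz, hAt, polyR, polyR₀, polyR₁, polyR₂, polyR₃] at hR
    rw [polyR, polyR₀, polyR₁, polyR₂, polyR₃]
    field_simp at hR
    linear_combination hR
  have l1 : Lim p.V (1 : p.K) 1 := Lim.one
  rcases Lim.total p.V t with ⟨t₀, ht⟩ | ⟨-, ht⟩
  · have l2 := (((((ht.pow 3).mul (lc'.polyR₃ lκ' lB' l1)).add
      ((ht.pow 2).mul (lc'.polyR₂ lκ' lB' l1))).add (ht.mul (lc'.polyR₁ lκ' lB' l1))).add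
      (lc'.polyR₀ lκ' lB' l1)).eq_of_eq Lim.zero hR'
    rw [polyR₀, polyR₁, polyR₂, polyR₃] at l2
    have h2 : t₀ * (1 - t₀) = 0 := by linear_combination l2 / 2
    rcases mul_eq_zero.1 h2 with h3 | h3
    · rw [h3] at ht
      exact p.false_of_ratio_zero hκ hz0 hz hAt hF' hR' ht
    · rw [show t₀ = 1 by linear_combination -h3] at ht
      obtain ⟨r, hr⟩ := p.finite_of_ratio_one hz0 hz hR' ht
      rw [← hCz, ← hAt] at hr
      exact hr.not_infinite hδ0 hδ
  · have l2 := ((((lc'.polyF₃ lB' l1).add (ht.mul (lc'.polyF₂ lκ' lB' l1))).add ((ht.pow 2).mul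
      ((lc'.polyF₁ lκ' lB' l1).sub (lμ'.mul (l1.mul (l1.sub ((Lim.ofNat 2).mul lκ'))))))).add
      ((ht.pow 3).mul (lc'.polyF₀ lκ' lB' l1))).eq_of_eq Lim.zero (by
        rw [polyF] at hF'
        field_simp
        linear_combination hF')
    rw [polyF₀, polyF₁, polyF₂, polyF₃] at l2
    have : (1 : IsLocalRing.ResidueField p.V) = 0 := by linear_combination -l2
    exact one_ne_zero this

end FunctionPlace

end G2Fluid
end

noncomputable section

namespace G2Fluid

open Filter Topology

variable {b c κ m l κ₀ K : ℝ} {I J I' J' : Set ℝ} {q f h e A C lam η : ℝ → ℝ}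

theorem LinearBranch.false_of_κ_zero (H : Flow b c I J q A C h e)
    (B : LinearBranch b c 0 m I J q A C lam h e) : False := by
  obtain ⟨x, hx⟩ := H.hI.isConnected.nonempty
  obtain ⟨u, hu⟩ := H.hJ.isConnected.nonempty
  have hq := H.q_ne x hx
  refine (H.fluid x hx u hu _ rfl).2 (mul_left_cancel₀ (pow_ne_zero 2 hq) ?_)
  rw [redJet_Y hq, redJet_Z hq, redJet_X hq]
  have h1 := B.flow_E x hx
  have h2 := B.flow_C x hx
  have h3 := B.lin x hx
  have h4 := B.ode u hu
  rw [coeffT, coeffQδ, coeffX]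
  generalize flowE c (q x) (C x) (q x * deriv A x) (q x * deriv C x) = Φ at *
  generalize q x * deriv C x = d at *
  simp only [mul_zero, sub_zero, zero_add] at h2 h3 h4
  linear_combination -h1 + (1 + q x ^ 2) / 2 * h2 + 2 * (q x ^ 2 - 1) * h4 +
    (q x ^ 2 - 1) / 2 * h3

theorem Branch.C_sub_A_const (H : Flow b c I J q A C h e) (B : Branch b c κ I q A C lam η)
    (G : Generic κ I A C) {k k' : ℝ} (hd : ∀ x ∈ I, C x - A x = k) (hC : ∀ x ∈ I, C x = k') :
    LocalOutcome b c I J q (adaptedF c q A C) h e := by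
  have hA : ∀ x ∈ I, A x = k' - k := fun x hx => by linarith [hd x hx, hC x hx]
  refine H.outcome_of_const hA hC
    (k'' := (k' - k) * (k' - k + 2 * κ) / (k' * (k' - 2 * κ))) fun x hx => ?_
  rw [B.sq_eq G hx, hA x hx, hC x hx]

theorem Branch.sq_eq_of_A_eq (B : Branch b c κ I q A C lam η) (G : Generic κ I A C)
    (hA : ∀ x ∈ I, A x = C x - 4 * κ) {x : ℝ} (hx : x ∈ I) :
    q x ^ 2 = (C x - 4 * κ) / C x := by
  obtain ⟨h1, h2, h3⟩ := G x hx
  rw [B.sq_eq G hx, hA x hx, div_eq_div_iff (by positivity) h2]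
  ring

/-- The coefficients of the compatibility condition as a polynomial in `C`, if `A = C - δ`. -/
def coeffR (c κ B δ : ℝ) (i : ℕ) : ℝ :=
  [-16 * B ^ 2 * κ ^ 4 + 28 * B ^ 2 * κ ^ 3 * δ - 16 * B ^ 2 * κ ^ 2 * δ ^ 2 + 3 * B ^ 2 * κ
      * δ ^ 3, 16 * c * B * κ ^ 3 * δ - 18 * c * B * κ ^ 2 * δ ^ 2 + 5 * c * B * κ * δ ^ 3 - 16
      * B ^ 2 * κ ^ 3 + 12 * B ^ 2 * κ ^ 2 * δ + 2 * B ^ 2 * κ * δ ^ 2 - 2 * B ^ 2 * δ ^ 3, -24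
      * c * B * κ ^ 3 + 30 * c * B * κ ^ 2 * δ - 2 * c * B * κ * δ ^ 2 - 4 * c * B * δ ^ 3 + 4 *
      B ^ 2 * κ ^ 2 - 13 * B ^ 2 * κ * δ + 6 * B ^ 2 * δ ^ 2 - 16 * B * κ ^ 4 + 12 * B * κ ^ 3 *
      δ - B * κ * δ ^ 3, -8 * c ^ 2 * κ ^ 2 * δ + 3 * c ^ 2 * κ * δ ^ 2 - c ^ 2 * δ ^ 3 - 4 * c
      * B * κ ^ 2 - 19 * c * B * κ * δ + 14 * c * B * δ ^ 2 - 16 * c * κ ^ 3 * δ + 6 * c * κ ^ 2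
      * δ ^ 2 + c * κ * δ ^ 3 + 8 * B ^ 2 * κ - 6 * B ^ 2 * δ + 8 * B * κ ^ 3 - 14 * B * κ ^ 2 *
      δ + 3 * B * κ * δ ^ 2 + B * δ ^ 3, 8 * c ^ 2 * κ ^ 2 - 2 * c ^ 2 * κ * δ + 4 * c ^ 2 * δ ^
      2 + 16 * c * B * κ - 16 * c * B * δ + 16 * c * κ ^ 3 + 20 * c * κ ^ 2 * δ - 12 * c * κ * δ
      ^ 2 + 2 * B ^ 2 + 8 * B * κ ^ 2 + 2 * B * κ * δ - 4 * B * δ ^ 2 + 16 * κ ^ 3 * δ - 8 * κ ^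
      2 * δ ^ 2, -7 * c ^ 2 * δ + 6 * c * B - 24 * c * κ ^ 2 + 2 * c * κ * δ + 2 * c * δ ^ 2 - 4
      * B * κ + 5 * B * δ - 16 * κ ^ 3 - 8 * κ ^ 2 * δ + 8 * κ * δ ^ 2, 4 * c ^ 2 + 8 * c * κ -
      2 * B + 16 * κ ^ 2 - 4 * κ * δ - 2 * δ ^ 2, -2 * c - 4 * κ + 2 * δ].getD i 0

theorem coeffR_eq_zero {B δ : ℝ} (hR : ∀ x ∈ I, polyR c κ B (C x) (A x) = 0)
    (hA : ∀ x ∈ I, A x = C x - δ) (hC : (C '' I).Infinite) {i : ℕ} (hi : i < 8) :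
    coeffR c κ B δ i = 0 := by
  refine coeff_eq_zero_of_infinite hC (n := 8) ?_ hi
  rintro _ ⟨x, hx, rfl⟩
  have h1 := hR x hx
  rw [hA x hx, polyR, polyR₀, polyR₁, polyR₂, polyR₃] at h1
  simp only [Finset.sum_range_succ, Finset.sum_range_zero, coeffR, List.getD_cons_succ,
    List.getD_cons_zero]
  linear_combination h1

theorem LinearBranch.outcome_of_generic (H : Flow b c I J q A C h e) (hb : b ≠ 0)
    (B : LinearBranch b c κ m I J q A C lam h e) (G : Generic κ I A C) :
    LocalOutcome b c I J q (adaptedF c q A C) h e := by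
  rcases eq_or_ne κ 0 with rfl | hκ
  · exact (B.false_of_κ_zero H).elim
  have hF : ∀ x ∈ I, polyF c κ (b ^ 2 - c ^ 2) (C x) (A x) (4 * m) = 0 :=
    fun x hx => B.polyF_eq_zero H G hx
  have hR : ∀ x ∈ I, polyR c κ (b ^ 2 - c ^ 2) (C x) (A x) = 0 :=
    fun x hx => B.polyR_eq_zero H G hκ hx
  have hb2 : b ^ 2 - c ^ 2 + c ^ 2 ≠ 0 := by simpa using hb
  rcases const_or_infinite H.hI.isConnected (φ := C - A) (H.cont_C.sub H.cont_A) with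
    ⟨δ, hδ⟩ | hinf
  swap
  · obtain ⟨p, hp0, hp⟩ := exists_functionPlace hinf
    rw [map_sub] at hp0 hp
    have hF' := p.polyF_eq_zero hF
    have hR' := p.polyR_eq_zero hR
    have hC0 := p.ev_ne_zero C fun x hx => (G x hx).2.1
    have hA0 := p.ev_ne_zero A fun x hx => (G x hx).1
    rcases Lim.total p.V (p.ev C) with ⟨C₀, hC⟩ | ⟨-, hC⟩
    · rcases Lim.total p.V (p.ev A) with ⟨A₀, hA⟩ | ⟨-, hA⟩
      · exact ((hC.sub hA).not_infinite hp0 hp).elim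
      · exact (p.false_of_C_finite hκ hb2 hC0 hA0 hF' hR' hA hC).elim
    · exact (p.false_of_C_infinite hκ hC0 hA0 hF' hR' hp0 hp hC).elim
  have hA : ∀ x ∈ I, A x = C x - δ := fun x hx => by
    have : C x - A x = δ := hδ x hx
    linarith
  rcases const_or_infinite H.hI.isConnected H.cont_C with ⟨k, hk⟩ | hinf
  · exact B.toBranch.C_sub_A_const H G hδ hk
  obtain ⟨B', hB'⟩ : ∃ B', B' = b ^ 2 - c ^ 2 := ⟨_, rfl⟩
  rw [← hB'] at hb2
  have hR7 : δ = c + 2 * κ := by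
    have := coeffR_eq_zero hR hA hinf (i := 7) (by norm_num)
    simp only [coeffR, List.getD_cons_succ, List.getD_cons_zero] at this
    linarith
  have hR6 : B' = c ^ 2 - 2 * c * κ := by
    have := coeffR_eq_zero hR hA hinf (i := 6) (by norm_num)
    simp only [coeffR, List.getD_cons_succ, List.getD_cons_zero] at this
    rw [hR7, ← hB'] at this
    linarith
  have hR5 : c ^ 2 * (c - 2 * κ) = 0 := by
    have := coeffR_eq_zero hR hA hinf (i := 5) (by norm_num)
    simp only [coeffR, List.getD_cons_succ, List.getD_cons_zero] at this
    rw [hR7, ← hB', hR6] at this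
    linear_combination this / 6
  have hc : c ≠ 0 := by
    rintro rfl
    exact hb2 (by rw [hR6]; ring)
  have hcκ : c = 2 * κ := by
    have : c - 2 * κ = 0 := by simpa [hc] using hR5
    linarith
  have hB0 : b ^ 2 - c ^ 2 = 0 := by rw [← hB', hR6, hcκ]; ring
  have hA' : ∀ x ∈ I, A x = C x - 4 * κ := fun x hx => by rw [hA x hx, hR7, hcκ]; ring
  have hm : m = 0 := by
    obtain ⟨x, hx⟩ := H.hI.isConnected.nonempty
    have h1 := hF x hx
    obtain ⟨-, h2, h3⟩ := G x hx
    have h4 := (G x hx).1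
    rw [hB0, hA' x hx, polyF, polyF₀, polyF₁, polyF₂, polyF₃, hcκ] at h1
    rw [hA' x hx] at h4
    have h5 : -4 * m * ((C x - 4 * κ) * C x * (C x - 2 * κ)) = 0 := by linear_combination h1
    simpa [h2, h3, h4] using h5
  refine ⟨I, subset_rfl, J, subset_rfl, H.hI, H.hJ, .solD (c / 2) (by linarith)
    (fun h0 => hc (by linarith)) (fun x hx => ⟨?_, ?_⟩) fun u hu => ?_⟩
  · rw [(H.dq x hx).deriv, B.toBranch.sq_eq_of_A_eq G hA' hx, hcκ]
    have := (G x hx).2.1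
    field_simp
    ring
  · have hq := H.q_ne x hx
    have h1 := B.toBranch.sq_eq_of_A_eq G hA' hx
    have h2 := (G x hx).2.1
    rw [eq_div_iff h2] at h1
    rw [adaptedF, hA' x hx]
    field_simp
    linear_combination -h1
  · have := B.ode u hu
    rw [hm] at this
    linear_combination h u * this - h u ^ 2 / 2 * hcκ

end G2Fluid
end

noncomputable section

namespace G2Fluid

open Filter Topology

variable {b c κ m l κ₀ K : ℝ} {I J I' J' : Set ℝ} {q f h e A C lam η : ℝ → ℝ}

/-! ### The generic case of the quadratic branch -/

section Polynomials

variable {R S : Type*} [CommRing R] [CommRing S] (φ : R →+* S) (c κ B l κ₀ C A η K : R)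

/-- The numerator of `η`. -/
def polyN : R := (l - 3 * c + 2 * C) * (A * (C * (C - 2 * κ))) - (A + 2 * κ) *
  ((C ^ 2 - 3 * c * C - 2 * B) * A + C ^ 3 - c * C ^ 2 - 2 * κ * C ^ 2 - 2 * κ * B)

/-- The relation between `A` and `C` obtained by elimination of `η`. -/
def polyQ : R := (C - A - 2 * κ) * polyN c κ B l C A ^ 2 -
  8 * κ₀ * (C ^ 2 * (C - 2 * κ)) * (A + 2 * κ) * (A + C) ^ 2

theorem map_polyQ :
    φ (polyQ c κ B l κ₀ C A) = polyQ (φ c) (φ κ) (φ B) (φ l) (φ κ₀) (φ C) (φ A) := by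
  simp only [polyQ, polyN, map_add, map_sub, map_mul, map_pow, map_ofNat]

/-- The equation for the coefficient of `h`. -/
def polyL : R := c * A * C * (C - A - 4 * κ) - B * A * (A + 2 * κ) +
  l * C * (C - 2 * κ) * (C - A - 2 * κ) + η * (C - A - 2 * κ) * (C - A - 4 * κ) -
  K * (C * (C - 2 * κ))

/-- The equation determining `η²`. -/
def polyS : R := (A + 2 * κ) * (C - A - 2 * κ) * η ^ 2 - 8 * κ₀ * (C ^ 2 * (C - 2 * κ))

/-- The equation determining `η`. -/
def polyT : R := (A + 2 * κ) * (A + C) * η - polyN c κ B l C A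

theorem map_polyL : φ (polyL c κ B l C A η K) =
    polyL (φ c) (φ κ) (φ B) (φ l) (φ C) (φ A) (φ η) (φ K) := by
  simp only [polyL, map_add, map_sub, map_mul, map_ofNat]

theorem map_polyS : φ (polyS κ κ₀ C A η) = polyS (φ κ) (φ κ₀) (φ C) (φ A) (φ η) := by
  simp only [polyS, map_add, map_sub, map_mul, map_pow, map_ofNat]

theorem map_polyT :
    φ (polyT c κ B l C A η) = polyT (φ c) (φ κ) (φ B) (φ l) (φ C) (φ A) (φ η) := by
  simp only [polyT, polyN, map_add, map_sub, map_mul, map_pow, map_ofNat]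

end Polynomials

namespace FunctionPlace

variable (p : FunctionPlace I) {B : ℝ}

theorem polyQ_eq_zero (h : ∀ x ∈ I, polyQ c κ B l κ₀ (C x) (A x) = 0) :
    polyQ (p.i c) (p.i κ) (p.i B) (p.i l) (p.i κ₀) (p.ev C) (p.ev A) = 0 :=
  (map_polyQ p.ev (Pi.constRingHom ℝ ℝ c) (Pi.constRingHom ℝ ℝ κ) (Pi.constRingHom ℝ ℝ B)
    (Pi.constRingHom ℝ ℝ l) (Pi.constRingHom ℝ ℝ κ₀) C A).symm.trans
    (p.ev_zero _ fun x hx => (map_polyQ (Pi.evalRingHom (fun _ : ℝ => ℝ) x) _ _ _ _ _ _ _).trans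
      (h x hx))

theorem polyL_eq_zero (h : ∀ x ∈ I, polyL c κ B l (C x) (A x) (η x) K = 0) :
    polyL (p.i c) (p.i κ) (p.i B) (p.i l) (p.ev C) (p.ev A) (p.ev η) (p.i K) = 0 :=
  (map_polyL p.ev (Pi.constRingHom ℝ ℝ c) (Pi.constRingHom ℝ ℝ κ) (Pi.constRingHom ℝ ℝ B)
    (Pi.constRingHom ℝ ℝ l) C A η (Pi.constRingHom ℝ ℝ K)).symm.trans
    (p.ev_zero _ fun x hx => (map_polyL (Pi.evalRingHom (fun _ : ℝ => ℝ) x)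
      _ _ _ _ _ _ _ _).trans (h x hx))

theorem polyS_eq_zero (h : ∀ x ∈ I, polyS κ κ₀ (C x) (A x) (η x) = 0) :
    polyS (p.i κ) (p.i κ₀) (p.ev C) (p.ev A) (p.ev η) = 0 :=
  (map_polyS p.ev (Pi.constRingHom ℝ ℝ κ) (Pi.constRingHom ℝ ℝ κ₀) C A η).symm.trans
    (p.ev_zero _ fun x hx => (map_polyS (Pi.evalRingHom (fun _ : ℝ => ℝ) x) _ _ _ _ _).trans
      (h x hx))

theorem polyT_eq_zero (h : ∀ x ∈ I, polyT c κ B l (C x) (A x) (η x) = 0) :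
    polyT (p.i c) (p.i κ) (p.i B) (p.i l) (p.ev C) (p.ev A) (p.ev η) = 0 :=
  (map_polyT p.ev (Pi.constRingHom ℝ ℝ c) (Pi.constRingHom ℝ ℝ κ) (Pi.constRingHom ℝ ℝ B)
    (Pi.constRingHom ℝ ℝ l) C A η).symm.trans
    (p.ev_zero _ fun x hx => (map_polyT (Pi.evalRingHom (fun _ : ℝ => ℝ) x)
      _ _ _ _ _ _ _).trans (h x hx))

end FunctionPlace

namespace QuadraticBranch

theorem eta_sq_generic (B : QuadraticBranch b c κ l κ₀ K I J q A C η h e) (G : Generic κ I A C)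
    {x : ℝ} (hx : x ∈ I) :
    polyS κ κ₀ (C x) (A x) (η x) = 0 := by
  obtain ⟨h1, h2, h3⟩ := G x hx
  have h4 := B.toBranch.A_add_C_ne G hx
  have h5 := B.eta_sq x hx
  have h6 := B.toBranch.sq_eq G hx
  rw [h6] at h5
  field_simp at h5
  apply mul_left_cancel₀ h4
  rw [polyS]
  linear_combination h5

theorem lin_generic (B : QuadraticBranch b c κ l κ₀ K I J q A C η h e)
    {x : ℝ} (hx : x ∈ I) :
    polyL c κ (b ^ 2 - c ^ 2) l (C x) (A x) (η x) K = 0 := by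
  have h4 := B.lin x hx
  have h5 := B.quad x hx
  rw [polyL]
  linear_combination (C x - 2 * κ) * h4 -
    (b ^ 2 - c ^ 2 + c * C x + η x - 2 * η x) * h5

theorem eta_mul (H : Flow b c I J q A C h e)
    (B : QuadraticBranch b c κ l κ₀ K I J q A C η h e) (G : Generic κ I A C) {x : ℝ} (hx : x ∈ I) :
    polyT c κ (b ^ 2 - c ^ 2) l (C x) (A x) (η x) = 0 := by
  rw [polyT, polyN]
  linear_combination B.toBranch.second_generic H G hx

theorem polyQ_eq_zero (H : Flow b c I J q A C h e)
    (B : QuadraticBranch b c κ l κ₀ K I J q A C η h e) (G : Generic κ I A C) {x : ℝ} (hx : x ∈ I) :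
    polyQ c κ (b ^ 2 - c ^ 2) l κ₀ (C x) (A x) = 0 := by
  have h1 := B.eta_mul H G hx
  have h2 := B.eta_sq_generic G hx
  rw [polyT, sub_eq_zero] at h1
  rw [polyS] at h2
  rw [polyQ, ← h1]
  linear_combination (A x + 2 * κ) * (A x + C x) ^ 2 * h2

end QuadraticBranch

/-! #### The case `κ = 0` -/

/-- Impossibility of `A / C → 0`. -/
theorem FunctionPlace.false_of_ratio (p : FunctionPlace I) {B : ℝ} (hκ₀ : κ₀ ≠ 0)
    (hB : B + c ^ 2 ≠ 0) {C r : p.K} (hC0 : C ≠ 0) (hr0 : r ≠ 0) (hr : Lim p.V r 0)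
    (h1 : r * (1 - r) * ((1 - r) * C ^ 2 + (p.i l - 2 * p.i c + 3 * p.i c * r) * C +
      2 * p.i B * r) ^ 2 = 8 * p.i κ₀ * C * (1 + r) ^ 2)
    (h2 : (1 - r) ^ 3 * C ^ 2 + 2 * (1 - r) * (p.i l - p.i c + 3 * p.i c * r - p.i c * r ^ 2) * C +
      2 * p.i B * r * (1 - r) ^ 2 - (1 + r) * (p.i B * r ^ 2 + p.i K) = 0) : False := by
  have lc := p.lim_const c
  have ll := p.lim_const l
  have lB := p.lim_const B
  have lK := p.lim_const K
  have lκ₀ := p.lim_const κ₀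
  have l1 : Lim p.V (1 : p.K) 1 := Lim.one
  have hκ' : p.j κ₀ ≠ 0 := (map_ne_zero p.j).2 hκ₀
  rcases Lim.total p.V C with ⟨C₀, hC⟩ | ⟨-, hz⟩
  swap
  · have e : (1 - r) ^ 3 + 2 * (1 - r) * (p.i l - p.i c + 3 * p.i c * r - p.i c * r ^ 2) * C⁻¹ +
      (2 * p.i B * r * (1 - r) ^ 2 - (1 + r) * (p.i B * r ^ 2 + p.i K)) * C⁻¹ ^ 2 = 0 := by
      field_simp
      linear_combination h2
    have : (1 - 0) ^ 3 + 2 * (1 - 0) * (p.j l - p.j c + 3 * p.j c * 0 - p.j c * 0 ^ 2) * 0 +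
      (2 * p.j B * 0 * (1 - 0) ^ 2 - (1 + 0) * (p.j B * 0 ^ 2 + p.j K)) * 0 ^ 2 = 0 := by
      refine Lim.eq_of_eq ?_ Lim.zero e
      repeat' first
        | assumption | exact Lim.ofNat _ | apply Lim.add | apply Lim.sub | apply Lim.mul
        | apply Lim.pow
    exact one_ne_zero (α := IsLocalRing.ResidueField p.V) (by linear_combination this)
  have hC₀ : C₀ = 0 := by
    have h3 : 0 * (1 - 0) * ((1 - 0) * C₀ ^ 2 + (p.j l - 2 * p.j c + 3 * p.j c * 0) * C₀ +
        2 * p.j B * 0) ^ 2 = 8 * p.j κ₀ * C₀ * (1 + 0) ^ 2 := by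
      refine Lim.eq_of_eq ?_ ?_ h1
      all_goals repeat' first
        | assumption | exact Lim.ofNat _ | apply Lim.add | apply Lim.sub | apply Lim.mul
        | apply Lim.pow
    have h4 : 8 * p.j κ₀ * C₀ = 0 := by linear_combination -h3
    simpa [hκ'] using h4
  rw [hC₀] at hC
  have hK : K = 0 := by
    refine (map_eq_zero p.j).1 ?_
    have h3 : (1 - 0) ^ 3 * 0 ^ 2 + 2 * (1 - 0) * (p.j l - p.j c + 3 * p.j c * 0 -
        p.j c * 0 ^ 2) * 0 + 2 * p.j B * 0 * (1 - 0) ^ 2 - (1 + 0) * (p.j B * 0 ^ 2 + p.j K) =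
        0 := by
      refine Lim.eq_of_eq ?_ Lim.zero h2
      repeat' first
        | assumption | exact Lim.ofNat _ | apply Lim.add | apply Lim.sub | apply Lim.mul
        | apply Lim.pow
    linear_combination -h3
  have hu : Lim p.V (C / r) 0 := by
    have h3 : Lim p.V ((1 - r) * ((1 - r) * C ^ 2 + (p.i l - 2 * p.i c + 3 * p.i c * r) * C +
      2 * p.i B * r) ^ 2) ((1 - 0) * ((1 - 0) * 0 ^ 2 + (p.j l - 2 * p.j c + 3 * p.j c * 0) * 0 +
      2 * p.j B * 0) ^ 2) := by
      repeat' first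
        | assumption | exact Lim.ofNat _ | apply Lim.add | apply Lim.sub | apply Lim.mul
        | apply Lim.pow
    have h4 : Lim p.V (8 * p.i κ₀ * (1 + r) ^ 2) (8 * p.j κ₀ * (1 + 0) ^ 2) := by
      repeat' first
        | assumption | exact Lim.ofNat _ | apply Lim.add | apply Lim.sub | apply Lim.mul
        | apply Lim.pow
    have hne : 8 * p.j κ₀ * (1 + 0) ^ 2 ≠ 0 := by simp [hκ']
    have h5 := h3.div h4 hne
    have h6 := h4.ne_zero hne
    have h7 : C / r = (1 - r) * ((1 - r) * C ^ 2 + (p.i l - 2 * p.i c + 3 * p.i c * r) * C +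
      2 * p.i B * r) ^ 2 / (8 * p.i κ₀ * (1 + r) ^ 2) := by
      rw [div_eq_div_iff hr0 h6]
      linear_combination -h1
    rw [h7]
    convert h5 using 1
    simp
  rw [hK, map_zero] at h2
  have hB0 : B = 0 := by
    refine (map_eq_zero p.j).1 ?_
    have e : (1 - r) ^ 3 * C * (C / r) + 2 * (1 - r) * (p.i l - p.i c + 3 * p.i c * r -
        p.i c * r ^ 2) * (C / r) + 2 * p.i B * (1 - r) ^ 2 - (1 + r) * (p.i B * r) = 0 := by
      field_simp
      linear_combination h2
    have h3 : (1 - 0) ^ 3 * 0 * 0 + 2 * (1 - 0) * (p.j l - p.j c + 3 * p.j c * 0 -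
        p.j c * 0 ^ 2) * 0 + 2 * p.j B * (1 - 0) ^ 2 - (1 + 0) * (p.j B * 0) = 0 := by
      refine Lim.eq_of_eq ?_ Lim.zero e
      repeat' first
        | assumption | exact Lim.ofNat _ | apply Lim.add | apply Lim.sub | apply Lim.mul
        | apply Lim.pow
    linear_combination h3 / 2
  rw [hB0, map_zero] at h2
  have e : (1 - r) ^ 3 * C + 2 * (1 - r) * (p.i l - p.i c + 3 * p.i c * r - p.i c * r ^ 2) = 0 := by
    apply mul_left_cancel₀ hC0
    linear_combination h2
  have hl : l = c := by
    refine p.j_eq ?_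
    have h3 : (1 - 0) ^ 3 * 0 + 2 * (1 - 0) * (p.j l - p.j c + 3 * p.j c * 0 - p.j c * 0 ^ 2) =
        0 := by
      refine Lim.eq_of_eq ?_ Lim.zero e
      repeat' first
        | assumption | exact Lim.ofNat _ | apply Lim.add | apply Lim.sub | apply Lim.mul
        | apply Lim.pow
    linear_combination h3 / 2
  have hc : c = 0 := by
    refine (map_eq_zero p.j).1 ?_
    have e' : (1 - r) ^ 3 * (C / r) + 2 * (1 - r) * (3 * p.i c - p.i c * r) = 0 := by
      rw [hl] at e
      field_simp
      linear_combination e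
    have h3 : (1 - 0) ^ 3 * 0 + 2 * (1 - 0) * (3 * p.j c - p.j c * 0) = 0 := by
      refine Lim.eq_of_eq ?_ Lim.zero e'
      repeat' first
        | assumption | exact Lim.ofNat _ | apply Lim.add | apply Lim.sub | apply Lim.mul
        | apply Lim.pow
    linear_combination h3 / 6
  exact hB (by rw [hB0, hc]; ring)

theorem QuadraticBranch.outcome_of_κ_zero (H : Flow b c I J q A C h e) (hb : b ≠ 0)
    (B : QuadraticBranch b c 0 l κ₀ K I J q A C η h e) (G : Generic 0 I A C) :
    LocalOutcome b c I J q (adaptedF c q A C) h e := by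
  rcases const_or_infinite H.hI.isConnected (φ := C / A)
    (H.cont_C.div H.cont_A fun x hx => (G x hx).1) with ⟨k, hk⟩ | hinf
  · have hk' : ∀ x ∈ I, C x = k * A x := by
      intro x hx
      have h1 := (G x hx).1
      have : C x / A x = k := hk x hx
      rw [← this]; field_simp
    have hs : ∀ x ∈ I, q x ^ 2 = (1 / k) ^ 2 := by
      intro x hx
      have h1 := G x hx
      rw [B.toBranch.sq_eq G hx]
      have h2 := hk' x hx
      have hk0 : k ≠ 0 := by rintro rfl; exact h1.2.1 (by rw [h2]; ring)
      have h3 := h1.1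
      rw [h2]
      simp only [mul_zero, add_zero, sub_zero]
      field_simp
    obtain ⟨q₀, hq₀⟩ := const_of_sq_const H.hI.isConnected H.cont_q hs
    have hC : ∀ x ∈ I, C x = c := by
      intro x hx
      have := H.hI.hasDerivAt_zero hx hq₀ (H.dq x hx)
      have := (mul_eq_zero.1 this).resolve_left (H.q_sq_ne x hx)
      linarith
    refine H.outcome_of_const (k := c / k) (fun x hx => ?_) hC hs
    have h2 := hk' x hx
    have h1 := G x hx
    have hk0 : k ≠ 0 := by rintro rfl; exact h1.2.1 (by rw [h2]; ring)
    rw [← hC x hx, h2]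
    field_simp
  · exfalso
    obtain ⟨p, hp0, hp⟩ := exists_functionPlace hinf
    have hA0 := p.ev_ne_zero A fun x hx => (G x hx).1
    have hC0 := p.ev_ne_zero C fun x hx => (G x hx).2.1
    have hdiv : p.ev (C / A) = p.ev C / p.ev A := by
      rw [eq_div_iff hA0, ← map_mul]
      refine p.ev_eq fun x hx => ?_
      have := (G x hx).1
      simp only [Pi.mul_apply, Pi.div_apply]
      field_simp
    rw [hdiv, inv_div] at hp
    have hQ := p.polyQ_eq_zero fun x hx => B.polyQ_eq_zero H G hx
    have hL := p.polyL_eq_zero fun x hx => B.lin_generic hx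
    have hT := p.polyT_eq_zero fun x hx => B.eta_mul H G hx
    have hAC := p.ev_ne_zero (A + C) fun x hx => B.toBranch.A_add_C_ne G hx
    rw [map_add] at hAC
    generalize p.ev η = η' at *
    obtain ⟨r, hr⟩ : ∃ r, r = p.ev A / p.ev C := ⟨_, rfl⟩
    rw [← hr] at hp
    have hA : p.ev A = r * p.ev C := by rw [hr]; field_simp
    have hr0 : r ≠ 0 := by rw [hr]; exact div_ne_zero hA0 hC0
    rw [hA] at hQ hL hT hAC
    generalize p.ev C = C' at *
    have hr1 : 1 + r ≠ 0 := by
      intro h0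
      exact hAC (by linear_combination C' * h0)
    rw [map_zero] at hQ hL hT
    have hη : (1 + r) * η' = (1 - r) * C' ^ 2 + (p.i l - 2 * p.i c + 3 * p.i c * r) * C' +
        2 * p.i (b ^ 2 - c ^ 2) * r := by
      apply mul_left_cancel₀ (mul_ne_zero hr0 (pow_ne_zero 2 hC0))
      rw [polyT, polyN] at hT
      linear_combination hT
    refine p.false_of_ratio (B := b ^ 2 - c ^ 2) (c := c) (K := K) (l := l) B.κ₀_ne
      (by simpa using hb)
      hC0 hr0 hp ?_ ?_
    · rw [polyQ, polyN] at hQ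
      apply mul_left_cancel₀ (mul_ne_zero hr0 (pow_ne_zero 5 hC0))
      linear_combination hQ
    · rw [polyL] at hL
      apply mul_left_cancel₀ (pow_ne_zero 2 hC0)
      linear_combination (1 + r) * hL - (C' ^ 2 * (1 - r) ^ 2) * hη

end G2Fluid
end

noncomputable section

namespace G2Fluid

open Filter Topology

variable {b c κ m l κ₀ K : ℝ} {I J I' J' : Set ℝ} {q f h e A C lam η : ℝ → ℝ}

/-! #### The case `κ ≠ 0` -/

section Polynomials

variable {R S : Type*} [CommRing R] [CommRing S] (φ : R →+* S) (c κ B l κ₀ C A η s a d : R)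

/-- The equation for `d = q C'`. -/
def polyFlowC : R := 2 * d - ((3 * c - l - 2 * C) * (A + s * C) -
  (1 - s) * (η + C * (l - 2 * c + C)))

/-- The equation for `a = q A'`. -/
def polyFlowE : R := a + 2 * s * (1 - s) * (c - C) * C + s * d -
  ((3 * c - l - 2 * C) * (A + s * C) - s * (1 - s) * (C ^ 2 + B))

/-- The derivative of the numerator of `η`. -/
def polyDN : R := ((l - 3 * c + 2 * C) * (C * (C - 2 * κ)) -
  ((C ^ 2 - 3 * c * C - 2 * B) * A + C ^ 3 - c * C ^ 2 - 2 * κ * C ^ 2 - 2 * κ * B) -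
  (A + 2 * κ) * (C ^ 2 - 3 * c * C - 2 * B)) * a +
  (2 * A * (C * (C - 2 * κ)) + (l - 3 * c + 2 * C) * (A * (2 * C - 2 * κ)) - (A + 2 * κ) *
    ((2 * C - 3 * c) * A + 3 * C ^ 2 - 2 * c * C - 4 * κ * C)) * d

/-- The derivative of the relation between `A` and `C`. -/
def polyDQ : R := (d - a) * polyN c κ B l C A ^ 2 +
  2 * (C - A - 2 * κ) * polyN c κ B l C A * polyDN c κ B l C A a d -
  8 * κ₀ * ((3 * C ^ 2 - 4 * κ * C) * d * (A + 2 * κ) * (A + C) ^ 2 + C ^ 2 * (C - 2 * κ) *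
    (a * (A + C) ^ 2 + 2 * (A + 2 * κ) * (A + C) * (a + d)))

theorem map_polyFlowC : φ (polyFlowC c l C A η s d) =
    polyFlowC (φ c) (φ l) (φ C) (φ A) (φ η) (φ s) (φ d) := by
  simp only [polyFlowC, map_add, map_sub, map_mul, map_one, map_ofNat]

theorem map_polyFlowE : φ (polyFlowE c B l C A s a d) =
    polyFlowE (φ c) (φ B) (φ l) (φ C) (φ A) (φ s) (φ a) (φ d) := by
  simp only [polyFlowE, map_add, map_sub, map_mul, map_pow, map_one, map_ofNat]

theorem map_polyDQ : φ (polyDQ c κ B l κ₀ C A a d) =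
    polyDQ (φ c) (φ κ) (φ B) (φ l) (φ κ₀) (φ C) (φ A) (φ a) (φ d) := by
  simp only [polyDQ, polyDN, polyN, map_add, map_sub, map_mul, map_pow, map_ofNat]

end Polynomials

namespace FunctionPlace

variable (p : FunctionPlace I) {B : ℝ}

theorem polyFlowC_eq_zero {s d : ℝ → ℝ}
    (h : ∀ x ∈ I, polyFlowC c l (C x) (A x) (η x) (s x) (d x) = 0) :
    polyFlowC (p.i c) (p.i l) (p.ev C) (p.ev A) (p.ev η) (p.ev s) (p.ev d) = 0 :=
  (map_polyFlowC p.ev (Pi.constRingHom ℝ ℝ c) (Pi.constRingHom ℝ ℝ l) C A η s d).symm.trans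
    (p.ev_zero _ fun x hx => (map_polyFlowC (Pi.evalRingHom (fun _ : ℝ => ℝ) x)
      _ _ _ _ _ _ _).trans (h x hx))

theorem polyFlowE_eq_zero {s a d : ℝ → ℝ}
    (h : ∀ x ∈ I, polyFlowE c B l (C x) (A x) (s x) (a x) (d x) = 0) :
    polyFlowE (p.i c) (p.i B) (p.i l) (p.ev C) (p.ev A) (p.ev s) (p.ev a) (p.ev d) = 0 :=
  (map_polyFlowE p.ev (Pi.constRingHom ℝ ℝ c) (Pi.constRingHom ℝ ℝ B) (Pi.constRingHom ℝ ℝ l)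
    C A s a d).symm.trans
    (p.ev_zero _ fun x hx => (map_polyFlowE (Pi.evalRingHom (fun _ : ℝ => ℝ) x)
      _ _ _ _ _ _ _ _).trans (h x hx))

theorem polyDQ_eq_zero {a d : ℝ → ℝ}
    (h : ∀ x ∈ I, polyDQ c κ B l κ₀ (C x) (A x) (a x) (d x) = 0) :
    polyDQ (p.i c) (p.i κ) (p.i B) (p.i l) (p.i κ₀) (p.ev C) (p.ev A) (p.ev a) (p.ev d) = 0 :=
  (map_polyDQ p.ev (Pi.constRingHom ℝ ℝ c) (Pi.constRingHom ℝ ℝ κ) (Pi.constRingHom ℝ ℝ B)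
    (Pi.constRingHom ℝ ℝ l) (Pi.constRingHom ℝ ℝ κ₀) C A a d).symm.trans
    (p.ev_zero _ fun x hx => (map_polyDQ (Pi.evalRingHom (fun _ : ℝ => ℝ) x)
      _ _ _ _ _ _ _ _ _).trans (h x hx))

variable {A C η s a d : p.K}

/-- The case of a finite limit of `C`. -/
theorem false_of_C_finite' (hB : B + c ^ 2 ≠ 0) (hC0 : C ≠ 0) (hA0 : A ≠ 0)
    (hS : polyS (p.i κ) (p.i κ₀) C A η = 0)
    (hL : polyL (p.i c) (p.i κ) (p.i B) (p.i l) C A η (p.i K) = 0)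
    (hT : polyT (p.i c) (p.i κ) (p.i B) (p.i l) C A η = 0) (ha : Lim p.V A⁻¹ 0)
    {C₀ : IsLocalRing.ResidueField p.V} (hC : Lim p.V C C₀) : False := by
  have lc := p.lim_const c
  have lκ := p.lim_const κ
  have lB := p.lim_const B
  have ll := p.lim_const l
  have lK := p.lim_const K
  have lκ₀ := p.lim_const κ₀
  have l1 : Lim p.V (1 : p.K) 1 := Lim.one
  rw [polyS] at hS
  rw [polyL] at hL
  rw [polyT, polyN] at hT
  obtain ⟨g, hg⟩ : ∃ g, g = A⁻¹ := ⟨_, rfl⟩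
  have hAg : A = g⁻¹ := by rw [hg, inv_inv]
  have hg0 : g ≠ 0 := hg ▸ inv_ne_zero hA0
  rw [← hg] at ha
  rw [hAg] at hS hL hT
  field_simp at hS hL hT
  have lη : Lim p.V η (3 * p.j c * C₀ - C₀ ^ 2 + 2 * p.j B) := by
    have h1 : Lim p.V ((p.i l - 3 * p.i c + 2 * C) * (C * (C - 2 * p.i κ)) * g -
        (1 + 2 * p.i κ * g) * ((C ^ 2 - 3 * p.i c * C - 2 * p.i B) + g * (C ^ 3 - p.i c * C ^ 2 -
        2 * p.i κ * C ^ 2 - 2 * p.i κ * p.i B)))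
        ((p.j l - 3 * p.j c + 2 * C₀) * (C₀ * (C₀ - 2 * p.j κ)) * 0 -
        (1 + 2 * p.j κ * 0) * ((C₀ ^ 2 - 3 * p.j c * C₀ - 2 * p.j B) + 0 * (C₀ ^ 3 -
        p.j c * C₀ ^ 2 - 2 * p.j κ * C₀ ^ 2 - 2 * p.j κ * p.j B))) := by
      repeat' first
        | assumption | exact Lim.ofNat _ | apply Lim.add | apply Lim.sub | apply Lim.mul
        | apply Lim.pow
    have h2 : Lim p.V ((1 + 2 * p.i κ * g) * (1 + C * g)) ((1 + 2 * p.j κ * 0) * (1 + C₀ * 0)) := by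
      repeat' first
        | assumption | exact Lim.ofNat _ | apply Lim.add | apply Lim.sub | apply Lim.mul
    have h3 : (1 + 2 * p.j κ * 0) * (1 + C₀ * 0) ≠ 0 := by simp
    have h4 := h1.div h2 h3
    have h5 := h2.ne_zero h3
    have h6 : η = ((p.i l - 3 * p.i c + 2 * C) * (C * (C - 2 * p.i κ)) * g -
        (1 + 2 * p.i κ * g) * ((C ^ 2 - 3 * p.i c * C - 2 * p.i B) + g * (C ^ 3 - p.i c * C ^ 2 -
        2 * p.i κ * C ^ 2 - 2 * p.i κ * p.i B))) / ((1 + 2 * p.i κ * g) * (1 + C * g)) := by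
      rw [eq_div_iff h5]
      linear_combination hT
    rw [h6]
    convert h4 using 1
    rw [eq_div_iff h3]
    ring
  obtain ⟨η₀, hη₀⟩ : ∃ y, y = 3 * p.j c * C₀ - C₀ ^ 2 + 2 * p.j B := ⟨_, rfl⟩
  rw [← hη₀] at lη
  have h1 : (1 + 2 * p.j κ * 0) * (C₀ * 0 - 1 - 2 * p.j κ * 0) * η₀ ^ 2 -
      8 * p.j κ₀ * (C₀ ^ 2 * (C₀ - 2 * p.j κ)) * 0 ^ 2 = 0 := by
    refine Lim.eq_of_eq (a := (1 + 2 * p.i κ * g) * (C * g - 1 - 2 * p.i κ * g) * η ^ 2 -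
      8 * p.i κ₀ * (C ^ 2 * (C - 2 * p.i κ)) * g ^ 2) ?_ Lim.zero (by linear_combination hS)
    repeat' first
        | assumption | exact Lim.ofNat _ | apply Lim.add | apply Lim.sub | apply Lim.mul
        | apply Lim.pow
  have h2 : η₀ = 0 := by
    have : η₀ ^ 2 = 0 := by linear_combination -h1
    simpa using this
  rw [h2] at lη hη₀
  have h3 : p.j c * C₀ * (C₀ * 0 - 1 - 4 * p.j κ * 0) - p.j B * (1 + 2 * p.j κ * 0) +
      p.j l * C₀ * (C₀ - 2 * p.j κ) * (C₀ * 0 - 1 - 2 * p.j κ * 0) * 0 +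
      0 * (C₀ * 0 - 1 - 2 * p.j κ * 0) * (C₀ * 0 - 1 - 4 * p.j κ * 0) -
      p.j K * (C₀ * (C₀ - 2 * p.j κ)) * 0 ^ 2 = 0 := by
    refine Lim.eq_of_eq (a := p.i c * C * (C * g - 1 - 4 * p.i κ * g) -
      p.i B * (1 + 2 * p.i κ * g) +
      p.i l * C * (C - 2 * p.i κ) * (C * g - 1 - 2 * p.i κ * g) * g +
      η * (C * g - 1 - 2 * p.i κ * g) * (C * g - 1 - 4 * p.i κ * g) -
      p.i K * (C * (C - 2 * p.i κ)) * g ^ 2) ?_ Lim.zero (by linear_combination hL)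
    repeat' first
        | assumption | exact Lim.ofNat _ | apply Lim.add | apply Lim.sub | apply Lim.mul
        | apply Lim.pow
  have h4 : p.j B = -(p.j c * C₀) := by linear_combination -h3
  have h5 : C₀ * (p.j c - C₀) = 0 := by
    rw [h4] at hη₀
    linear_combination -hη₀
  have hne : C₀ ≠ p.j c := by
    intro h0
    refine hB ((map_eq_zero p.j).1 ?_)
    rw [map_add, map_pow, h4, h0]; ring
  have hC₀ : C₀ = 0 := (mul_eq_zero.1 h5).resolve_right fun h0 => hne (by linear_combination -h0)
  have hB0 : B = 0 := (map_eq_zero p.j).1 (by rw [h4, hC₀]; ring)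
  rw [hB0, map_zero] at hL hT
  obtain ⟨y, hy⟩ : ∃ y, y = η / C := ⟨_, rfl⟩
  have hηy : η = C * y := by rw [hy]; field_simp
  rw [hηy] at hL hT
  have ly : Lim p.V y (3 * p.j c) := by
    have h1 : Lim p.V ((p.i l - 3 * p.i c + 2 * C) * (C - 2 * p.i κ) * g -
        (1 + 2 * p.i κ * g) * ((C - 3 * p.i c) + g * (C ^ 2 - p.i c * C - 2 * p.i κ * C)))
        ((p.j l - 3 * p.j c + 2 * C₀) * (C₀ - 2 * p.j κ) * 0 -
        (1 + 2 * p.j κ * 0) * ((C₀ - 3 * p.j c) + 0 * (C₀ ^ 2 - p.j c * C₀ - 2 * p.j κ * C₀))) := by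
      repeat' first
        | assumption | exact Lim.ofNat _ | apply Lim.add | apply Lim.sub | apply Lim.mul
        | apply Lim.pow
    have h2 : Lim p.V ((1 + 2 * p.i κ * g) * (1 + C * g)) ((1 + 2 * p.j κ * 0) * (1 + C₀ * 0)) := by
      repeat' first
        | assumption | exact Lim.ofNat _ | apply Lim.add | apply Lim.sub | apply Lim.mul
    have h3 : (1 + 2 * p.j κ * 0) * (1 + C₀ * 0) ≠ 0 := by simp
    have h4 := h1.div h2 h3
    have h5 := h2.ne_zero h3
    have h6 : y = ((p.i l - 3 * p.i c + 2 * C) * (C - 2 * p.i κ) * g -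
        (1 + 2 * p.i κ * g) * ((C - 3 * p.i c) + g * (C ^ 2 - p.i c * C - 2 * p.i κ * C))) /
        ((1 + 2 * p.i κ * g) * (1 + C * g)) := by
      rw [eq_div_iff h5]
      apply mul_left_cancel₀ hC0
      linear_combination hT
    rw [h6]
    convert h4 using 1
    rw [eq_div_iff h3, hC₀]
    ring
  have h6 : p.j c * (C₀ * 0 - 1 - 4 * p.j κ * 0) +
      p.j l * (C₀ - 2 * p.j κ) * (C₀ * 0 - 1 - 2 * p.j κ * 0) * 0 +
      3 * p.j c * (C₀ * 0 - 1 - 2 * p.j κ * 0) * (C₀ * 0 - 1 - 4 * p.j κ * 0) -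
      p.j K * (C₀ - 2 * p.j κ) * 0 ^ 2 = 0 := by
    refine Lim.eq_of_eq (a := p.i c * (C * g - 1 - 4 * p.i κ * g) +
      p.i l * (C - 2 * p.i κ) * (C * g - 1 - 2 * p.i κ * g) * g +
      y * (C * g - 1 - 2 * p.i κ * g) * (C * g - 1 - 4 * p.i κ * g) -
      p.i K * (C - 2 * p.i κ) * g ^ 2) ?_ Lim.zero (by
        apply mul_left_cancel₀ hC0
        linear_combination hL)
    repeat' first
        | assumption | exact Lim.ofNat _ | apply Lim.add | apply Lim.sub | apply Lim.mul
        | apply Lim.pow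
  exact hne (by rw [hC₀]; linear_combination -h6 / 2)

set_option maxHeartbeats 1000000 in
/-- The case in which `C` is infinite and `A → 2κ`. -/
theorem false_of_A_finite' {z y : p.K} {y₀ : IsLocalRing.ResidueField p.V} (hκ : κ ≠ 0)
    (hz0 : z ≠ 0) (hz : Lim p.V z 0) (hA : Lim p.V A (2 * p.j κ)) (hy : Lim p.V y y₀)
    (hy₀ : y₀ ≠ 0) (hT : polyT (p.i c) (p.i κ) (p.i B) (p.i l) z⁻¹ A (y / z) = 0)
    (hs : A ^ 2 + 2 * p.i κ * A = s * z⁻¹ * (z⁻¹ - 2 * p.i κ))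
    (hd : polyFlowC (p.i c) (p.i l) z⁻¹ A (y / z) s d = 0)
    (ha : polyFlowE (p.i c) (p.i B) (p.i l) z⁻¹ A s a d = 0)
    (hD : polyDQ (p.i c) (p.i κ) (p.i B) (p.i l) (p.i κ₀) z⁻¹ A a d = 0) : False := by
  have lc := p.lim_const c
  have lκ := p.lim_const κ
  have lB := p.lim_const B
  have ll := p.lim_const l
  have lκ₀ := p.lim_const κ₀
  have l1 : Lim p.V (1 : p.K) 1 := Lim.one
  have hκ' : p.j κ ≠ 0 := (map_ne_zero p.j).2 hκ
  obtain ⟨s', hs'⟩ : ∃ y, y = s / z ^ 2 := ⟨_, rfl⟩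
  obtain ⟨a', ha'⟩ : ∃ y, y = a * z := ⟨_, rfl⟩
  obtain ⟨d', hd'⟩ : ∃ y, y = d * z ^ 2 := ⟨_, rfl⟩
  have es : s = s' * z ^ 2 := by rw [hs']; field_simp
  have ea : a = a' / z := by rw [ha']; field_simp
  have ed : d = d' / z ^ 2 := by rw [hd']; field_simp
  have ls : Lim p.V s' (8 * p.j κ ^ 2) := by
    have h1 : Lim p.V (A ^ 2 + 2 * p.i κ * A) ((2 * p.j κ) ^ 2 + 2 * p.j κ * (2 * p.j κ)) := by
      repeat' first
        | assumption | exact Lim.ofNat _ | apply Lim.add | apply Lim.mul | apply Lim.pow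
    have h2 : Lim p.V (1 - 2 * p.i κ * z) (1 - 2 * p.j κ * 0) := by
      repeat' first
        | assumption | exact Lim.ofNat _ | apply Lim.sub | apply Lim.mul
    have h3 : 1 - 2 * p.j κ * 0 ≠ 0 := by simp
    have h4 := h1.div h2 h3
    have h5 : s' = (A ^ 2 + 2 * p.i κ * A) / (1 - 2 * p.i κ * z) := by
      rw [eq_div_iff (h2.ne_zero h3), hs, es]
      field_simp
    rw [h5]
    convert h4 using 1
    rw [eq_div_iff h3]
    ring
  have ld : ∃ r, Lim p.V d' r := by
    have h1 : 2 * d' = (3 * p.i c * z - p.i l * z - 2) * (A + s' * z) * z -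
        (1 - s' * z ^ 2) * (y * z + (p.i l * z - 2 * p.i c * z + 1)) := by
      rw [polyFlowC, es, ed] at hd
      field_simp at hd
      linear_combination hd
    have h2 : Lim p.V ((3 * p.i c * z - p.i l * z - 2) * (A + s' * z) * z -
        (1 - s' * z ^ 2) * (y * z + (p.i l * z - 2 * p.i c * z + 1)))
        ((3 * p.j c * 0 - p.j l * 0 - 2) * (2 * p.j κ + 8 * p.j κ ^ 2 * 0) * 0 -
        (1 - 8 * p.j κ ^ 2 * 0 ^ 2) * (y₀ * 0 + (p.j l * 0 - 2 * p.j c * 0 + 1))) := by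
      repeat' first
        | assumption | exact Lim.ofNat _ | apply Lim.add | apply Lim.sub | apply Lim.mul
        | apply Lim.pow
    have h3 := h2.div (Lim.ofNat 2) two_ne_zero
    have h4 : d' = 2 * d' / OfNat.ofNat 2 := by
      rw [eq_div_iff ((Lim.ofNat (V := p.V) 2).ne_zero two_ne_zero)]; ring
    rw [h4, h1]
    exact ⟨_, h3⟩
  obtain ⟨d₀, ld⟩ := ld
  have la : Lim p.V a' (-4 * p.j κ) := by
    have h1 : a' = (3 * p.i c * z - p.i l * z - 2) * (A + s' * z) -
        s' * (1 - s' * z ^ 2) * (1 + p.i B * z ^ 2) * z -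
        2 * s' * (1 - s' * z ^ 2) * (p.i c * z - 1) * z - s' * d' * z := by
      rw [polyFlowE, es, ed, ea] at ha
      field_simp at ha
      linear_combination ha
    have h2 : Lim p.V ((3 * p.i c * z - p.i l * z - 2) * (A + s' * z) -
        s' * (1 - s' * z ^ 2) * (1 + p.i B * z ^ 2) * z -
        2 * s' * (1 - s' * z ^ 2) * (p.i c * z - 1) * z - s' * d' * z)
        ((3 * p.j c * 0 - p.j l * 0 - 2) * (2 * p.j κ + 8 * p.j κ ^ 2 * 0) -
        8 * p.j κ ^ 2 * (1 - 8 * p.j κ ^ 2 * 0 ^ 2) * (1 + p.j B * 0 ^ 2) * 0 -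
        2 * (8 * p.j κ ^ 2) * (1 - 8 * p.j κ ^ 2 * 0 ^ 2) * (p.j c * 0 - 1) * 0 -
        8 * p.j κ ^ 2 * d₀ * 0) := by
      repeat' first
        | assumption | exact Lim.ofNat _ | apply Lim.add | apply Lim.sub | apply Lim.mul
        | apply Lim.pow
    rw [h1]
    convert h2 using 1
    ring
  have lN : Lim p.V ((A + 2 * p.i κ) * (A * z + 1) * y) (4 * p.j κ * y₀) := by
    have h2 : Lim p.V ((A + 2 * p.i κ) * (A * z + 1) * y)
      ((2 * p.j κ + 2 * p.j κ) * (2 * p.j κ * 0 + 1) * y₀) := by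
      repeat' first
        | assumption | exact Lim.ofNat _ | apply Lim.add | apply Lim.mul
    convert h2 using 1
    ring
  have eN : polyN (p.i c) (p.i κ) (p.i B) (p.i l) z⁻¹ A =
      (A + 2 * p.i κ) * (A * z + 1) * y / z ^ 2 := by
    rw [polyT, sub_eq_zero] at hT
    rw [← hT]
    field_simp
  rw [polyDQ, eN] at hD
  generalize (A + 2 * p.i κ) * (A * z + 1) * y = N at *
  have eDN : polyDN (p.i c) (p.i κ) (p.i B) (p.i l) z⁻¹ A a d = (((p.i l * z - 3 * p.i c * z + 2) *
      (1 - 2 * p.i κ * z) - ((1 - 3 * p.i c * z - 2 * p.i B * z ^ 2) * A * z + 1 - p.i c * z -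
      2 * p.i κ * z - 2 * p.i κ * p.i B * z ^ 3) - (A + 2 * p.i κ) * z * (1 - 3 * p.i c * z -
      2 * p.i B * z ^ 2)) * a' + (2 * A * (1 - 2 * p.i κ * z) + (p.i l * z - 3 * p.i c * z + 2) *
      (A * (2 - 2 * p.i κ * z)) - (A + 2 * p.i κ) * ((2 - 3 * p.i c * z) * A * z + 3 -
      2 * p.i c * z - 4 * p.i κ * z)) * d') / z ^ 4 := by
    rw [polyDN, ea, ed]
    field_simp
  have lDN : Lim p.V (((p.i l * z - 3 * p.i c * z + 2) *
      (1 - 2 * p.i κ * z) - ((1 - 3 * p.i c * z - 2 * p.i B * z ^ 2) * A * z + 1 - p.i c * z -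
      2 * p.i κ * z - 2 * p.i κ * p.i B * z ^ 3) - (A + 2 * p.i κ) * z * (1 - 3 * p.i c * z -
      2 * p.i B * z ^ 2)) * a' + (2 * A * (1 - 2 * p.i κ * z) + (p.i l * z - 3 * p.i c * z + 2) *
      (A * (2 - 2 * p.i κ * z)) - (A + 2 * p.i κ) * ((2 - 3 * p.i c * z) * A * z + 3 -
      2 * p.i c * z - 4 * p.i κ * z)) * d') (-4 * p.j κ) := by
    have h2 : Lim p.V (((p.i l * z - 3 * p.i c * z + 2) *
      (1 - 2 * p.i κ * z) - ((1 - 3 * p.i c * z - 2 * p.i B * z ^ 2) * A * z + 1 - p.i c * z -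
      2 * p.i κ * z - 2 * p.i κ * p.i B * z ^ 3) - (A + 2 * p.i κ) * z * (1 - 3 * p.i c * z -
      2 * p.i B * z ^ 2)) * a' + (2 * A * (1 - 2 * p.i κ * z) + (p.i l * z - 3 * p.i c * z + 2) *
      (A * (2 - 2 * p.i κ * z)) - (A + 2 * p.i κ) * ((2 - 3 * p.i c * z) * A * z + 3 -
      2 * p.i c * z - 4 * p.i κ * z)) * d') (((p.j l * 0 - 3 * p.j c * 0 + 2) *
      (1 - 2 * p.j κ * 0) - ((1 - 3 * p.j c * 0 - 2 * p.j B * 0 ^ 2) * (2 * p.j κ) * 0 + 1 -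
      p.j c * 0 - 2 * p.j κ * 0 - 2 * p.j κ * p.j B * 0 ^ 3) - (2 * p.j κ + 2 * p.j κ) * 0 *
      (1 - 3 * p.j c * 0 - 2 * p.j B * 0 ^ 2)) * (-4 * p.j κ) + (2 * (2 * p.j κ) *
      (1 - 2 * p.j κ * 0) + (p.j l * 0 - 3 * p.j c * 0 + 2) * (2 * p.j κ * (2 - 2 * p.j κ * 0)) -
      (2 * p.j κ + 2 * p.j κ) * ((2 - 3 * p.j c * 0) * (2 * p.j κ) * 0 + 3 -
      2 * p.j c * 0 - 4 * p.j κ * 0)) * d₀) := by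
      repeat' first
        | assumption | exact Lim.ofNat _ | apply Lim.add | apply Lim.sub | apply Lim.mul
        | apply Lim.pow
    convert h2 using 1
    ring
  rw [eDN] at hD
  generalize (((p.i l * z - 3 * p.i c * z + 2) *
      (1 - 2 * p.i κ * z) - ((1 - 3 * p.i c * z - 2 * p.i B * z ^ 2) * A * z + 1 - p.i c * z -
      2 * p.i κ * z - 2 * p.i κ * p.i B * z ^ 3) - (A + 2 * p.i κ) * z * (1 - 3 * p.i c * z -
      2 * p.i B * z ^ 2)) * a' + (2 * A * (1 - 2 * p.i κ * z) + (p.i l * z - 3 * p.i c * z + 2) *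
      (A * (2 - 2 * p.i κ * z)) - (A + 2 * p.i κ) * ((2 - 3 * p.i c * z) * A * z + 3 -
      2 * p.i c * z - 4 * p.i κ * z)) * d') = DN at *
  have e : (d' - a' * z) * N ^ 2 * z + 2 * (1 - A * z - 2 * p.i κ * z) * N * DN -
      8 * p.i κ₀ * ((3 - 4 * p.i κ * z) * d' * (A + 2 * p.i κ) * (A * z + 1) ^ 2 +
      (1 - 2 * p.i κ * z) * (a' * (A * z + 1) ^ 2 + 2 * (A + 2 * p.i κ) * (A * z + 1) *
      (a' * z + d'))) * z = 0 := by
    rw [ea, ed] at hD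
    field_simp at hD
    linear_combination hD
  have l := Lim.eq_of_eq (r := (d₀ - -4 * p.j κ * 0) * (4 * p.j κ * y₀) ^ 2 * 0 +
      2 * (1 - 2 * p.j κ * 0 - 2 * p.j κ * 0) * (4 * p.j κ * y₀) * (-4 * p.j κ) -
      8 * p.j κ₀ * ((3 - 4 * p.j κ * 0) * d₀ * (2 * p.j κ + 2 * p.j κ) * (2 * p.j κ * 0 + 1) ^ 2 +
      (1 - 2 * p.j κ * 0) * (-4 * p.j κ * (2 * p.j κ * 0 + 1) ^ 2 + 2 * (2 * p.j κ + 2 * p.j κ) *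
      (2 * p.j κ * 0 + 1) * (-4 * p.j κ * 0 + d₀))) * 0) (by
    repeat' first
        | assumption | exact Lim.ofNat _ | apply Lim.add | apply Lim.sub | apply Lim.mul
        | apply Lim.pow) Lim.zero e
  have : 32 * p.j κ ^ 2 * y₀ = 0 := by linear_combination -l
  simp [hκ', hy₀] at this

end FunctionPlace

end G2Fluid
end

noncomputable section

namespace G2Fluid

open Filter Topology

variable {b c κ m l κ₀ K : ℝ} {I J I' J' : Set ℝ} {q f h e A C lam η : ℝ → ℝ}

section RestN

variable {F : Type*} [Field F] {V : ValuationSubring F}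

/-- `(N z⁴ - t (1 - t)) / z`, where `N` is the numerator of `η` and `z = 1 / C`, `t = A / C`. -/
def restN {R : Type*} [CommRing R] (c κ B l z t : R) : R := (l - 3 * c) * (t * (1 - 2 * κ * z)) -
  4 * κ * t + t * ((3 * c + 2 * z * B) * t + c + 2 * κ + 2 * κ * B * z ^ 2) -
  2 * κ * ((1 - 3 * c * z - 2 * B * z ^ 2) * t + 1 - c * z - 2 * κ * z - 2 * κ * B * z ^ 3)

theorem polyN_inv {c κ B l z t : F} (hz : z ≠ 0) :
    polyN c κ B l z⁻¹ (t / z) = (t * (1 - t) + z * restN c κ B l z t) / z ^ 4 := by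
  rw [polyN, restN]
  field_simp
  ring

theorem polyQ_inv {c κ B l κ₀ z t : F} (hz : z ≠ 0) (h : polyQ c κ B l κ₀ z⁻¹ (t / z) = 0) :
    (1 - t - 2 * κ * z) * (t * (1 - t) + z * restN c κ B l z t) ^ 2 =
      8 * κ₀ * z ^ 3 * (1 - 2 * κ * z) * (t + 2 * κ * z) * (t + 1) ^ 2 := by
  rw [polyQ, polyN_inv hz] at h
  field_simp at h
  linear_combination h

theorem Lim.restN {c κ B l z t : F} {c₀ κ₀ B₀ l₀ z₀ t₀ : IsLocalRing.ResidueField V}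
    (hc : Lim V c c₀) (hκ : Lim V κ κ₀) (hB : Lim V B B₀) (hl : Lim V l l₀) (hz : Lim V z z₀)
    (ht : Lim V t t₀) : Lim V (restN c κ B l z t) (restN c₀ κ₀ B₀ l₀ z₀ t₀) := by
  have l1 : Lim V (1 : F) 1 := Lim.one
  simp only [G2Fluid.restN]
  repeat' first
    | assumption | exact Lim.ofNat _ | apply Lim.add | apply Lim.sub | apply Lim.mul
    | apply Lim.pow

theorem Lim.of_sq {a : F} {r : IsLocalRing.ResidueField V} (h : Lim V (a ^ 2) r) :
    ∃ r, Lim V a r := by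
  rcases Lim.total V a with h1 | ⟨h0, h1⟩
  · exact h1
  · have h2 := h1.pow 2
    rw [inv_pow, zero_pow two_ne_zero] at h2
    exact (h.not_infinite (pow_ne_zero 2 h0) h2).elim

end RestN

namespace FunctionPlace

variable (p : FunctionPlace I) {B : ℝ} {A C η s a d : p.K}

set_option maxHeartbeats 1000000 in
/-- The case of an infinite limit of `C`. -/
theorem false_of_C_infinite' (hκ : κ ≠ 0) (hκ₀ : κ₀ ≠ 0) (hC0 : C ≠ 0) (hA0 : A ≠ 0)
    (hQ : polyQ (p.i c) (p.i κ) (p.i B) (p.i l) (p.i κ₀) C A = 0)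
    (hS : polyS (p.i κ) (p.i κ₀) C A η = 0)
    (hT : polyT (p.i c) (p.i κ) (p.i B) (p.i l) C A η = 0)
    (hs : A ^ 2 + 2 * p.i κ * A = s * C * (C - 2 * p.i κ))
    (hd : polyFlowC (p.i c) (p.i l) C A η s d = 0)
    (ha : polyFlowE (p.i c) (p.i B) (p.i l) C A s a d = 0)
    (hD : polyDQ (p.i c) (p.i κ) (p.i B) (p.i l) (p.i κ₀) C A a d = 0)
    (hδ0 : C - A ≠ 0) (hδ : Lim p.V (C - A)⁻¹ 0) (hz : Lim p.V C⁻¹ 0) : False := by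
  have lc := p.lim_const c
  have lκ := p.lim_const κ
  have lB := p.lim_const B
  have ll := p.lim_const l
  have lκ₀ := p.lim_const κ₀
  have l1 : Lim p.V (1 : p.K) 1 := Lim.one
  have hκ' : p.j κ ≠ 0 := (map_ne_zero p.j).2 hκ
  have hκ₀' : p.j κ₀ ≠ 0 := (map_ne_zero p.j).2 hκ₀
  obtain ⟨z, hze⟩ : ∃ z, z = C⁻¹ := ⟨_, rfl⟩
  obtain ⟨t, hte⟩ : ∃ t, t = A * z := ⟨_, rfl⟩
  have hz0 : z ≠ 0 := hze ▸ inv_ne_zero hC0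
  have ht0 : t ≠ 0 := hte ▸ mul_ne_zero hA0 hz0
  have hCz : C = z⁻¹ := by rw [hze, inv_inv]
  have hAt : A = t / z := by rw [hte]; field_simp
  rw [← hze] at hz
  have hQ' : polyQ (p.i c) (p.i κ) (p.i B) (p.i l) (p.i κ₀) z⁻¹ (t / z) = 0 := by
    rw [← hCz, ← hAt]; exact hQ
  replace hQ' := polyQ_inv hz0 hQ'
  rcases Lim.total p.V t with ⟨t₀, ht⟩ | ⟨-, hw⟩
  swap
  · obtain ⟨w, hwe⟩ : ∃ w, w = t⁻¹ := ⟨_, rfl⟩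
    have hw0 : w ≠ 0 := hwe ▸ inv_ne_zero ht0
    have htw : t = w⁻¹ := by rw [hwe, inv_inv]
    rw [← hwe] at hw
    have e : (w - 1 - 2 * p.i κ * z * w) * (w - 1 + z * ((p.i l - 3 * p.i c) *
        (w * (1 - 2 * p.i κ * z)) - 4 * p.i κ * w + ((3 * p.i c + 2 * z * p.i B) + (p.i c +
        2 * p.i κ + 2 * p.i κ * p.i B * z ^ 2) * w) - 2 * p.i κ * ((1 - 3 * p.i c * z -
        2 * p.i B * z ^ 2) * w + (1 - p.i c * z - 2 * p.i κ * z - 2 * p.i κ * p.i B * z ^ 3) *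
        w ^ 2))) ^ 2 - 8 * p.i κ₀ * z ^ 3 * (1 - 2 * p.i κ * z) * (1 + 2 * p.i κ * z * w) *
        (1 + w) ^ 2 * w ^ 2 = 0 := by
      rw [htw, restN] at hQ'
      field_simp at hQ'
      linear_combination hQ'
    have h := Lim.eq_of_eq (r := (0 - 1 - 2 * p.j κ * 0 * 0) * (0 - 1 + 0 * ((p.j l - 3 * p.j c) *
        (0 * (1 - 2 * p.j κ * 0)) - 4 * p.j κ * 0 + ((3 * p.j c + 2 * 0 * p.j B) + (p.j c +
        2 * p.j κ + 2 * p.j κ * p.j B * 0 ^ 2) * 0) - 2 * p.j κ * ((1 - 3 * p.j c * 0 -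
        2 * p.j B * 0 ^ 2) * 0 + (1 - p.j c * 0 - 2 * p.j κ * 0 - 2 * p.j κ * p.j B * 0 ^ 3) *
        0 ^ 2))) ^ 2 - 8 * p.j κ₀ * 0 ^ 3 * (1 - 2 * p.j κ * 0) * (1 + 2 * p.j κ * 0 * 0) *
        (1 + 0) ^ 2 * 0 ^ 2) (by
      repeat' first
        | assumption | exact Lim.ofNat _ | apply Lim.add | apply Lim.sub | apply Lim.mul
        | apply Lim.pow) Lim.zero e
    exact one_ne_zero (α := IsLocalRing.ResidueField p.V) (by linear_combination -h)
  have ln := lc.restN lκ lB ll hz ht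
  have h1 : (1 - t₀) ^ 3 * t₀ ^ 2 = 0 := by
    have h2 := Lim.eq_of_eq (r := (1 - t₀ - 2 * p.j κ * 0) * (t₀ * (1 - t₀) + 0 *
      restN (p.j c) (p.j κ) (p.j B) (p.j l) 0 t₀) ^ 2) (r' := 8 * p.j κ₀ * 0 ^ 3 *
      (1 - 2 * p.j κ * 0) * (t₀ + 2 * p.j κ * 0) * (t₀ + 1) ^ 2) (by
      repeat' first
        | assumption | exact Lim.ofNat _ | apply Lim.add | apply Lim.sub | apply Lim.mul
        | apply Lim.pow) (by
      repeat' first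
        | assumption | exact Lim.ofNat _ | apply Lim.add | apply Lim.sub | apply Lim.mul
        | apply Lim.pow) hQ'
    linear_combination h2
  rcases mul_eq_zero.1 h1 with h2 | h2
  · have h3 : t₀ = 1 := by
      have : 1 - t₀ = 0 := by simpa using h2
      linear_combination -this
    obtain ⟨g, hge⟩ : ∃ g, g = (C - A)⁻¹ := ⟨_, rfl⟩
    rw [← hge] at hδ
    have hg0 : g ≠ 0 := hge ▸ inv_ne_zero hδ0
    have hzt : z = g * (1 - t) := by
      have h4 : 1 - t = (C - A) * z := by rw [hte, sub_mul, hze, mul_inv_cancel₀ hC0]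
      rw [hge, h4, inv_mul_cancel_left₀ hδ0]
    have h1t : 1 - t ≠ 0 := by
      intro h0; rw [h0, mul_zero] at hzt; exact hz0 hzt
    have e : (1 - 2 * p.i κ * g) * (t + g * restN (p.i c) (p.i κ) (p.i B) (p.i l) z t) ^ 2 -
        8 * p.i κ₀ * g ^ 3 * (1 - 2 * p.i κ * z) * (t + 2 * p.i κ * z) * (t + 1) ^ 2 = 0 := by
      apply mul_left_cancel₀ (pow_ne_zero 3 h1t)
      generalize restN (p.i c) (p.i κ) (p.i B) (p.i l) z t = n at *
      rw [hzt] at hQ' ⊢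
      linear_combination hQ'
    have h := Lim.eq_of_eq (r := (1 - 2 * p.j κ * 0) * (t₀ + 0 * restN (p.j c) (p.j κ) (p.j B)
      (p.j l) 0 t₀) ^ 2 - 8 * p.j κ₀ * 0 ^ 3 * (1 - 2 * p.j κ * 0) * (t₀ + 2 * p.j κ * 0) *
      (t₀ + 1) ^ 2) (by
      repeat' first
        | assumption | exact Lim.ofNat _ | apply Lim.add | apply Lim.sub | apply Lim.mul
        | apply Lim.pow) Lim.zero e
    rw [h3] at h
    exact one_ne_zero (α := IsLocalRing.ResidueField p.V) (by linear_combination h)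
  have h3 : t₀ = 0 := by simpa using h2
  rw [h3] at ht ln
  rcases Lim.total p.V A with ⟨A₀, lA⟩ | ⟨-, hg⟩
  swap
  · obtain ⟨g, hge⟩ : ∃ g, g = A⁻¹ := ⟨_, rfl⟩
    rw [← hge] at hg
    have hg0 : g ≠ 0 := hge ▸ inv_ne_zero hA0
    have hzt : z = g * t := by rw [hge, hte]; field_simp
    have e : (1 - t - 2 * p.i κ * z) * (1 - t + g * restN (p.i c) (p.i κ) (p.i B) (p.i l) z t) ^ 2 -
        8 * p.i κ₀ * g ^ 2 * z * (1 - 2 * p.i κ * z) * (t + 2 * p.i κ * z) * (t + 1) ^ 2 = 0 := by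
      apply mul_left_cancel₀ (pow_ne_zero 2 ht0)
      generalize restN (p.i c) (p.i κ) (p.i B) (p.i l) z t = n at *
      rw [hzt] at hQ' ⊢
      linear_combination hQ'
    have h := Lim.eq_of_eq (r := (1 - 0 - 2 * p.j κ * 0) * (1 - 0 + 0 * restN (p.j c) (p.j κ)
      (p.j B) (p.j l) 0 0) ^ 2 - 8 * p.j κ₀ * 0 ^ 2 * 0 * (1 - 2 * p.j κ * 0) *
      (0 + 2 * p.j κ * 0) * (0 + 1) ^ 2) (by
      repeat' first
        | assumption | exact Lim.ofNat _ | apply Lim.add | apply Lim.sub | apply Lim.mul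
        | apply Lim.pow) Lim.zero e
    exact one_ne_zero (α := IsLocalRing.ResidueField p.V) (by linear_combination h)
  obtain ⟨y, hye⟩ : ∃ y, y = η * z := ⟨_, rfl⟩
  have hηy : η = y / z := by rw [hye]; field_simp
  have eS : (A + 2 * p.i κ) * (1 - t - 2 * p.i κ * z) * y ^ 2 =
      8 * p.i κ₀ * (1 - 2 * p.i κ * z) := by
    rw [polyS, hCz, hηy] at hS
    rw [hte]
    field_simp at hS
    linear_combination hS
  have eT : (A + 2 * p.i κ) * (t + 1) * (y * z) =
      A * (1 - t) + restN (p.i c) (p.i κ) (p.i B) (p.i l) z t := by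
    have h4 : polyT (p.i c) (p.i κ) (p.i B) (p.i l) z⁻¹ (t / z) (y / z) = 0 := by
      rw [← hCz, ← hAt, ← hηy]; exact hT
    rw [polyT, polyN_inv hz0] at h4
    rw [hAt]
    field_simp at h4 ⊢
    linear_combination h4
  have lg : ∃ r, Lim p.V ((A + 2 * p.i κ) * y) r := by
    have h4 : Lim p.V (1 - t - 2 * p.i κ * z) (1 - 0 - 2 * p.j κ * 0) := by
      repeat' first
        | assumption | exact Lim.ofNat _ | apply Lim.sub | apply Lim.mul
    have h5 : Lim p.V (8 * p.i κ₀ * (1 - 2 * p.i κ * z) * (A + 2 * p.i κ))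
        (8 * p.j κ₀ * (1 - 2 * p.j κ * 0) * (A₀ + 2 * p.j κ)) := by
      repeat' first
        | assumption | exact Lim.ofNat _ | apply Lim.add | apply Lim.sub | apply Lim.mul
    have h6 : 1 - 0 - 2 * p.j κ * 0 ≠ 0 := by simp
    have h7 := h5.div h4 h6
    refine Lim.of_sq (r := 8 * p.j κ₀ * (1 - 2 * p.j κ * 0) * (A₀ + 2 * p.j κ) /
      (1 - 0 - 2 * p.j κ * 0)) ?_
    have h8 : ((A + 2 * p.i κ) * y) ^ 2 = 8 * p.i κ₀ * (1 - 2 * p.i κ * z) * (A + 2 * p.i κ) /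
        (1 - t - 2 * p.i κ * z) := by
      rw [eq_div_iff (h4.ne_zero h6)]
      linear_combination (A + 2 * p.i κ) * eS
    rw [h8]
    exact h7
  obtain ⟨g₀, lg⟩ := lg
  have hA₀ : A₀ = 2 * p.j κ := by
    have h4 := Lim.eq_of_eq (a := (A + 2 * p.i κ) * y * (t + 1) * z) (r := g₀ * (0 + 1) * 0)
      (r' := A₀ * (1 - 0) + restN (p.j c) (p.j κ) (p.j B) (p.j l) 0 0) (by
      repeat' first
        | assumption | exact Lim.ofNat _ | apply Lim.add | apply Lim.sub | apply Lim.mul) (by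
      repeat' first
        | assumption | exact Lim.ofNat _ | apply Lim.add | apply Lim.sub | apply Lim.mul)
      ((by ring : _ = (A + 2 * p.i κ) * (t + 1) * (y * z)).trans eT)
    rw [restN] at h4
    linear_combination -h4
  rw [hA₀] at lA
  have lA2 : Lim p.V (A + 2 * p.i κ) (2 * p.j κ + 2 * p.j κ) := by
    repeat' first
      | assumption | exact Lim.ofNat _ | apply Lim.add | apply Lim.mul
  have h4κ : 2 * p.j κ + 2 * p.j κ ≠ 0 := by
    intro h0
    have : 4 * p.j κ = 0 := by linear_combination h0
    simp [hκ'] at this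
  have ly : Lim p.V y (g₀ / (2 * p.j κ + 2 * p.j κ)) := by
    have h4 := lg.div lA2 h4κ
    rwa [mul_div_cancel_left₀ _ (lA2.ne_zero h4κ)] at h4
  generalize g₀ / (2 * p.j κ + 2 * p.j κ) = y₀ at ly
  have hy₀ : y₀ ≠ 0 := by
    rintro rfl
    have h4 := Lim.eq_of_eq (r := (2 * p.j κ + 2 * p.j κ) * (1 - 0 - 2 * p.j κ * 0) * 0 ^ 2)
      (r' := 8 * p.j κ₀ * (1 - 2 * p.j κ * 0)) (by
      repeat' first
        | assumption | exact Lim.ofNat _ | apply Lim.sub | apply Lim.mul | apply Lim.pow) (by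
      repeat' first
        | assumption | exact Lim.ofNat _ | apply Lim.sub | apply Lim.mul) eS
    have : 8 * p.j κ₀ = 0 := by linear_combination -h4
    simp [hκ₀'] at this
  rw [hCz, hηy] at hT hd
  rw [hCz] at hs ha hD
  exact p.false_of_A_finite' hκ hz0 hz lA ly hy₀ hT hs hd ha hD

end FunctionPlace

end G2Fluid
end

noncomputable section

namespace G2Fluid

open Filter Topology

variable {b c κ m l κ₀ K : ℝ} {I J I' J' : Set ℝ} {q f h e A C lam η : ℝ → ℝ}

namespace QuadraticBranch

theorem polyDQ_eq_zero (H : Flow b c I J q A C h e)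
    (B : QuadraticBranch b c κ l κ₀ K I J q A C η h e) (G : Generic κ I A C) {x : ℝ} (hx : x ∈ I) :
    polyDQ c κ (b ^ 2 - c ^ 2) l κ₀ (C x) (A x) (q x * deriv A x) (q x * deriv C x) = 0 := by
  have dA := H.hasDerivAt_A hx
  have dC := H.hasDerivAt_C hx
  have dN : HasDerivAt (fun x => polyN c κ (b ^ 2 - c ^ 2) l (C x) (A x))
      (polyDN c κ (b ^ 2 - c ^ 2) l (C x) (A x) (deriv A x) (deriv C x)) x := by
    simp only [polyN, polyDN]
    refine HasDerivAt.congr_deriv (by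
      repeat first
        | exact dA
        | exact dC
        | exact hasDerivAt_const _ _
        | apply HasDerivAt.fun_pow
        | apply HasDerivAt.fun_sub
        | apply HasDerivAt.fun_add
        | apply HasDerivAt.fun_mul) ?_
    push_cast
    ring
  have hD := H.hI.hasDerivAt_zero (k := 0) hx
    (φ := fun x => polyQ c κ (b ^ 2 - c ^ 2) l κ₀ (C x) (A x))
    (fun y hy => B.polyQ_eq_zero H G hy) (by
      simp only [polyQ]
      repeat first
        | exact dN
        | exact dA
        | exact dC
        | exact hasDerivAt_const _ _
        | apply HasDerivAt.fun_pow
        | apply HasDerivAt.fun_sub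
        | apply HasDerivAt.fun_add
        | apply HasDerivAt.fun_mul)
  push_cast at hD
  have hDN : polyDN c κ (b ^ 2 - c ^ 2) l (C x) (A x) (q x * deriv A x) (q x * deriv C x) =
      q x * polyDN c κ (b ^ 2 - c ^ 2) l (C x) (A x) (deriv A x) (deriv C x) := by
    rw [polyDN, polyDN]; ring
  rw [polyDQ, hDN]
  linear_combination q x * hD

theorem exists_C_sub_A_eq (H : Flow b c I J q A C h e) (hb : b ≠ 0) (hκ : κ ≠ 0)
    (B : QuadraticBranch b c κ l κ₀ K I J q A C η h e) (G : Generic κ I A C) :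
    ∃ δ, ∀ x ∈ I, C x - A x = δ := by
  have hb2 : b ^ 2 - c ^ 2 + c ^ 2 ≠ 0 := by simpa using hb
  refine (const_or_infinite H.hI.isConnected (φ := C - A) (H.cont_C.sub H.cont_A)).resolve_right
    fun hinf => ?_
  obtain ⟨p, hp0, hp⟩ := exists_functionPlace hinf
  rw [map_sub] at hp0 hp
  have hQ := p.polyQ_eq_zero fun x hx => B.polyQ_eq_zero H G hx
  have hL := p.polyL_eq_zero fun x hx => B.lin_generic hx
  have hT := p.polyT_eq_zero fun x hx => B.eta_mul H G hx
  have hS := p.polyS_eq_zero fun x hx => B.eta_sq_generic G hx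
  have hC0 := p.ev_ne_zero C fun x hx => (G x hx).2.1
  have hA0 := p.ev_ne_zero A fun x hx => (G x hx).1
  rcases Lim.total p.V (p.ev C) with ⟨C₀, hC⟩ | ⟨-, hC⟩
  · rcases Lim.total p.V (p.ev A) with ⟨A₀, hA⟩ | ⟨-, hA⟩
    · exact ((hC.sub hA).not_infinite hp0 hp).elim
    · exact (p.false_of_C_finite' hb2 hC0 hA0 hS hL hT hA hC).elim
  · have hD := p.polyDQ_eq_zero (a := q * deriv A) (d := q * deriv C)
      fun x hx => B.polyDQ_eq_zero H G hx
    have hd := p.polyFlowC_eq_zero (c := c) (l := l) (C := C) (A := A) (η := η) (s := q ^ 2)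
      (d := q * deriv C) fun x hx => by
        have := B.flow_C x hx
        simp only [polyFlowC, Pi.mul_apply, Pi.pow_apply]
        linear_combination this
    have ha := p.polyFlowE_eq_zero (c := c) (B := b ^ 2 - c ^ 2) (l := l) (C := C) (A := A)
      (s := q ^ 2) (a := q * deriv A) (d := q * deriv C) fun x hx => by
        have := B.flow_E x hx
        rw [flowE] at this
        simp only [polyFlowE, Pi.mul_apply, Pi.pow_apply]
        linear_combination this
    have hs : p.ev A ^ 2 + 2 * p.i κ * p.ev A =
        p.ev (q ^ 2) * p.ev C * (p.ev C - 2 * p.i κ) := by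
      have h1 := p.ev_eq (φ := A ^ 2 + 2 * Pi.constRingHom ℝ ℝ κ * A)
        (ψ := q ^ 2 * C * (C - 2 * Pi.constRingHom ℝ ℝ κ)) fun x hx => B.quad x hx
      simp only [map_add, map_sub, map_mul, map_pow, map_ofNat] at h1
      rw [map_pow]
      exact h1
    exact p.false_of_C_infinite' hκ B.κ₀_ne hC0 hA0 hQ hS hT hs hd ha hD hp0 hp hC

theorem C_sub_A_eq (H : Flow b c I J q A C h e) (hκ : κ ≠ 0)
    (B : QuadraticBranch b c κ l κ₀ K I J q A C η h e) (G : Generic κ I A C) {δ : ℝ}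
    (hδ : ∀ x ∈ I, C x - A x = δ) (hinf : (C '' I).Infinite) : δ = 4 * κ := by
  have hall : ∀ y : ℝ, polyQ c κ (b ^ 2 - c ^ 2) l κ₀ y (y - δ) = 0 := by
    set P : Polynomial ℝ := polyQ (Polynomial.C c) (Polynomial.C κ) (Polynomial.C (b ^ 2 - c ^ 2))
      (Polynomial.C l) (Polynomial.C κ₀) Polynomial.X (Polynomial.X - Polynomial.C δ) with hP
    have heval : ∀ y, P.eval y = polyQ c κ (b ^ 2 - c ^ 2) l κ₀ y (y - δ) := by
      intro y
      rw [hP, ← Polynomial.coe_evalRingHom, map_polyQ]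
      simp only [map_sub, Polynomial.coe_evalRingHom, Polynomial.eval_X, Polynomial.eval_C]
    have h0 : P = 0 := by
      refine Polynomial.eq_zero_of_infinite_isRoot P (hinf.mono ?_)
      rintro _ ⟨x, hx, rfl⟩
      rw [Set.mem_ofPred_eq, Polynomial.IsRoot, heval, ← B.polyQ_eq_zero H G hx, ← hδ x hx]
      ring_nf
    intro y
    rw [← heval, h0, Polynomial.eval_zero]
  obtain ⟨N, hN⟩ : ∃ N : ℝ → ℝ, ∀ y, N y = polyN c κ (b ^ 2 - c ^ 2) l y (y - δ) :=
    ⟨_, fun _ => rfl⟩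
  have hδκ : δ - 2 * κ ≠ 0 := by
    obtain ⟨x, hx⟩ := H.hI.isConnected.nonempty
    rw [← hδ x hx]
    exact B.toBranch.C_sub_A_ne H G hx
  have h1 : ∀ y, (δ - 2 * κ) * N y ^ 2 =
      (y - 2 * κ) * (8 * κ₀ * y ^ 2 * (y - δ + 2 * κ) * (2 * y - δ) ^ 2) := by
    intro y
    have := hall y
    rw [polyQ, ← hN] at this
    linear_combination this
  have h2 : N (2 * κ) = 0 := by
    have := h1 (2 * κ)
    rw [sub_self, zero_mul] at this
    simpa [hδκ] using this
  have dN : DifferentiableAt ℝ N (2 * κ) := by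
    have : N = fun y => polyN c κ (b ^ 2 - c ^ 2) l y (y - δ) := funext hN
    rw [this]
    simp only [polyN]
    fun_prop
  have d1 := (dN.hasDerivAt.fun_pow 2).const_mul (δ - 2 * κ)
  have d2 : HasDerivAt (fun y => (y - 2 * κ) * (8 * κ₀ * y ^ 2 * (y - δ + 2 * κ) * (2 * y - δ) ^ 2))
      (1 * (8 * κ₀ * (2 * κ) ^ 2 * (2 * κ - δ + 2 * κ) * (2 * (2 * κ) - δ) ^ 2) +
        (2 * κ - 2 * κ) * deriv (fun y => 8 * κ₀ * y ^ 2 * (y - δ + 2 * κ) * (2 * y - δ) ^ 2)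
          (2 * κ)) (2 * κ) := by
    refine HasDerivAt.fun_mul ((hasDerivAt_id _).sub_const _) (DifferentiableAt.hasDerivAt ?_)
    fun_prop
  have h3 := (funext h1 ▸ d1).unique d2
  rw [h2] at h3
  have h4 : 32 * κ₀ * κ ^ 2 * (4 * κ - δ) ^ 3 = 0 := by
    push_cast at h3
    linear_combination -h3
  have h5 : 32 * κ₀ * κ ^ 2 ≠ 0 := by
    have := B.κ₀_ne
    positivity
  have h6 : 4 * κ - δ = 0 := by simpa [h5] using h4
  linarith

theorem outcome_of_generic (H : Flow b c I J q A C h e) (hb : b ≠ 0)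
    (B : QuadraticBranch b c κ l κ₀ K I J q A C η h e) (G : Generic κ I A C) :
    LocalOutcome b c I J q (adaptedF c q A C) h e := by
  rcases eq_or_ne κ 0 with rfl | hκ
  · exact B.outcome_of_κ_zero H hb G
  obtain ⟨δ, hδ⟩ := B.exists_C_sub_A_eq H hb hκ G
  rcases const_or_infinite H.hI.isConnected H.cont_C with ⟨k, hk⟩ | hinf
  · exact B.toBranch.C_sub_A_const H G hδ hk
  have hδ' := B.C_sub_A_eq H hκ G hδ hinf
  have hA : ∀ x ∈ I, A x = C x - 4 * κ := fun x hx => by linarith [hδ x hx]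
  have hη2 : ∀ x ∈ I, κ * η x ^ 2 = 4 * κ₀ * C x ^ 2 := by
    intro x hx
    have h1 := B.eta_sq_generic G hx
    rw [polyS, hA x hx] at h1
    apply mul_left_cancel₀ (G x hx).2.2
    linear_combination h1 / 2
  have hL : 4 * κ * (b ^ 2 - c ^ 2) = 0 ∧ 2 * κ * l - K - (b ^ 2 - c ^ 2) = 0 ∧
      (0 : ℝ) = 0 ∧ (0 : ℝ) = 0 := by
    refine cubic_coeff_eq_zero hinf ?_
    rintro _ ⟨x, hx, rfl⟩
    have h1 := B.lin_generic hx
    rw [polyL, hA x hx] at h1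
    apply mul_left_cancel₀ (G x hx).2.2
    linear_combination h1
  have hB0 : b ^ 2 - c ^ 2 = 0 := by simpa [hκ] using hL.1
  have hK : K = 2 * κ * l := by linarith [hL.2.1]
  have hη : ∀ x ∈ I, 2 * (C x - 2 * κ) * η x = C x * ((l + c - 2 * κ) * C x - 4 * κ * l) := by
    intro x hx
    have h1 := B.eta_mul H G hx
    rw [polyT, polyN, hA x hx, hB0] at h1
    apply mul_left_cancel₀ (G x hx).2.2
    linear_combination h1
  have hc := cubic_coeff_eq_zero hinf (a₀ := 64 * κ ^ 2 * κ₀ - 16 * κ ^ 3 * l ^ 2)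
    (a₁ := -64 * κ * κ₀ + 8 * κ ^ 2 * l * (l + c - 2 * κ))
    (a₂ := 16 * κ₀ - κ * (l + c - 2 * κ) ^ 2) (a₃ := 0) (by
      rintro _ ⟨x, hx, rfl⟩
      apply mul_left_cancel₀ (pow_ne_zero 2 (G x hx).2.1)
      linear_combination (2 * (C x - 2 * κ)) ^ 2 * hη2 x hx * (-1) + κ * (2 * (C x - 2 * κ) * η x +
        C x * ((l + c - 2 * κ) * C x - 4 * κ * l)) * hη x hx)
  have hκ₀ : κ₀ = κ * l ^ 2 / 4 := by
    apply mul_left_cancel₀ (pow_ne_zero 2 hκ)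
    linear_combination hc.1 / 64
  have hl0 : l ≠ 0 := by
    rintro rfl
    exact B.κ₀_ne (by rw [hκ₀]; ring)
  have hl : l = c - 2 * κ := by
    have h1 := hc.2.1
    rw [hκ₀] at h1
    have h2 : κ ^ 2 * l * (c - 2 * κ - l) = 0 := by linear_combination h1 / 8
    have : c - 2 * κ - l = 0 := by simpa [hκ, hl0] using h2
    linarith
  refine ⟨I, subset_rfl, J, subset_rfl, H.hI, H.hJ, .solD (c - κ) (by linarith)
    (fun h0 => hκ (by linarith)) (fun x hx => ⟨?_, ?_⟩) fun u hu => ?_⟩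
  · rw [(H.dq x hx).deriv, B.toBranch.sq_eq_of_A_eq G hA hx]
    have := (G x hx).2.1
    field_simp
    ring
  · have hq := H.q_ne x hx
    have h1 := B.toBranch.sq_eq_of_A_eq G hA hx
    rw [eq_div_iff (G x hx).2.1] at h1
    rw [adaptedF, hA x hx]
    field_simp
    linear_combination -h1
  · have h1 := B.ode u hu
    rw [hκ₀, hK, hl] at h1
    linear_combination h1

end QuadraticBranch

/-! ### The classification of the solutions of the reduced system -/

theorem Flow.outcome (H : Flow b c I J q A C h e) (hb : b ≠ 0) :
    LocalOutcome b c I J q (adaptedF c q A C) h e := by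
  have cA := H.cont_A
  have cC := H.cont_C
  have cq := H.cont_q
  rcases H.hI.zero_or_ne (φ := fun x => A x + q x ^ 2 * C x) (by fun_prop) with
    hE | ⟨I', hI', oI', hE⟩
  · exact H.outcome_of_E_zero hE
  have H' := H.mono hI' subset_rfl oI' H.hJ
  refine LocalOutcome.mono hI' subset_rfl ?_
  rcases H'.branch hE with h1 | ⟨J', hJ', oJ', κ, m, lam, B⟩ | ⟨κ, l, κ₀, K, η, B⟩
  · exact h1
  · refine LocalOutcome.mono subset_rfl hJ' ?_
    have H'' := H'.mono subset_rfl hJ' oI' oJ'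
    rcases B.outcome_or_generic H'' hb with h1 | ⟨I'', hI'', oI'', G⟩
    · exact h1
    · exact ((B.mono hI'' subset_rfl).outcome_of_generic (H''.mono hI'' subset_rfl oI'' oJ') hb
        G).mono hI'' subset_rfl
  · rcases B.outcome_or_generic H' with h1 | ⟨I'', hI'', oI'', G⟩
    · exact h1
    · exact ((B.mono hI'' subset_rfl).outcome_of_generic (H'.mono hI'' subset_rfl oI'' H.hJ) hb
        G).mono hI'' subset_rfl

theorem Outcome.congr {f g : ℝ → ℝ} (hfg : ∀ x ∈ I, f x = g x) (H : Outcome b c I J q f h e) :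
    Outcome b c I J q g h e := by
  cases H with
  | const_h k hk => exact .const_h k hk
  | const_q k l hk => exact .const_q k l fun x hx => by rw [← hfg x hx]; exact hk x hx
  | flrw hb hx => exact .flrw hb fun x h => by rw [← hfg x h]; exact hx x h
  | solA n hn hx hu => exact .solA n hn (fun x h => by rw [← hfg x h]; exact hx x h) hu
  | solB k hb hk hx hu => exact .solB k hb hk (fun x h => by rw [← hfg x h]; exact hx x h) hu
  | solC k hc hk hx hu => exact .solC k hc hk (fun x h => by rw [← hfg x h]; exact hx x h) hu
  | solD k hb hk hx hu => exact .solD k hb hk (fun x h => by rw [← hfg x h]; exact hx x h) hu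

theorem Reduced.outcome (H : Reduced b c I J q f h e) (hb : b ≠ 0) :
    LocalOutcome b c I J q f h e := by
  obtain ⟨I', hI', A, C, H', hf⟩ := H.exists_flow
  obtain ⟨I'', h1, J', h2, o1, o2, h3⟩ := H'.outcome hb
  exact ⟨I'', h1.trans hI', J', h2, o1, o2, h3.congr fun x hx => (hf x (h1 hx)).symm⟩

end G2Fluid
end

noncomputable section

namespace G2Fluid

open Filter Topology

variable {σ b c : ℝ} {F P : ℝ → ℝ} {S : ℝ → ℝ → ℝ} {U V : Set (ℝ × ℝ)} {G H K : ℝ → ℝ}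
  {I J I' J' : Set ℝ}

/-! ### Separation of the conformal factor -/

theorem Regular.mono (hR : Regular F P S U) (hV : V ⊆ U) (ho : IsOpen V) : Regular F P S V where
  isOpen := ho
  smooth_S := fun w hw => hR.smooth_S w (hV hw)
  smooth_F := fun w hw => hR.smooth_F w (hV hw)
  smooth_P := fun w hw => hR.smooth_P w (hV hw)
  S_ne_zero := fun w hw => hR.S_ne_zero w (hV hw)
  F_pos := fun w hw => hR.F_pos w (hV hw)
  P_pos := fun w hw => hR.P_pos w (hV hw)

theorem Separated.mono (hS : Separated b P S U G H K) (hV : V ⊆ U) : Separated b P S V G H K where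
  deriv_P_ne := fun w hw => hS.deriv_P_ne w (hV hw)
  hasDerivAt_K := fun w hw => hS.hasDerivAt_K w (hV hw)
  smooth_G := fun w hw => hS.smooth_G w (hV hw)
  smooth_H := fun w hw => hS.smooth_H w (hV hw)
  S_eq := fun w hw => hS.S_eq w (hV hw)

theorem OpenInterval.const_of_hasDerivAt_zero (hI : OpenInterval I) {φ : ℝ → ℝ}
    (h : ∀ x ∈ I, HasDerivAt φ 0 x) {x y : ℝ} (hx : x ∈ I) (hy : y ∈ I) : φ x = φ y :=
  hI.isOpen.is_const_of_deriv_eq_zero hI.isConnected.isPreconnected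
    (fun z hz => (h z hz).differentiableAt.differentiableWithinAt) (fun z hz => (h z hz).deriv)
    hx hy

/-- A smooth function on an open interval has a smooth primitive. -/
theorem OpenInterval.exists_primitive (hI : OpenInterval I) {γ : ℝ → ℝ} {x₀ : ℝ} (hx₀ : x₀ ∈ I)
    (hγ : ∀ x ∈ I, ContDiffAt ℝ ∞ γ x) :
    ∃ Γ : ℝ → ℝ, Γ x₀ = 0 ∧ ∀ x ∈ I, HasDerivAt Γ (γ x) x ∧ ContDiffAt ℝ ∞ Γ x := by
  have hc : ContinuousOn γ I := fun x hx => (hγ x hx).continuousAt.continuousWithinAt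
  have hd : ∀ x ∈ I, HasDerivAt (fun u => ∫ y in x₀..u, γ y) (γ x) x := fun x hx =>
    intervalIntegral.integral_hasDerivAt_right
      ((hc.mono (hI.isConnected.isPreconnected.ordConnected.uIcc_subset hx₀ hx)).intervalIntegrable)
      (hc.stronglyMeasurableAtFilter hI.isOpen x hx) (hγ x hx).continuousAt
  refine ⟨fun u => ∫ y in x₀..u, γ y, by simp, fun x hx => ⟨hd x hx, ?_⟩⟩
  have h1 : ContDiffOn ℝ ∞ (fun u => ∫ y in x₀..u, γ y) I := by
    rw [contDiffOn_infty_iff_deriv_of_isOpen hI.isOpen]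
    refine ⟨fun y hy => (hd y hy).differentiableAt.differentiableWithinAt, ?_⟩
    exact ContDiffOn.congr (fun y hy => (hγ y hy).contDiffWithinAt) fun y hy => (hd y hy).deriv
  exact h1.contDiffAt (hI.isOpen.mem_nhds hx)

/-- The set of `(t, x)` with `x ∈ I` and `t + b K(x) ∈ J`. -/
def box (b : ℝ) (K : ℝ → ℝ) (I J : Set ℝ) : Set (ℝ × ℝ) := {w | w.2 ∈ I ∧ w.1 + b * K w.2 ∈ J}

theorem mem_box {x u : ℝ} (hx : x ∈ I) (hu : u ∈ J) : (u - b * K x, x) ∈ box b K I J :=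
  ⟨hx, by simpa using hu⟩

theorem box_mono (hI : I' ⊆ I) (hJ : J' ⊆ J) : box b K I' J' ⊆ box b K I J :=
  fun _ hw => ⟨hI hw.1, hJ hw.2⟩

theorem isOpen_box (hI : IsOpen I) (hJ : IsOpen J) (hK : ContinuousOn K I) :
    IsOpen (box b K I J) := by
  have h1 : ContinuousOn (fun w : ℝ × ℝ => w.1 + b * K w.2) {w | w.2 ∈ I} :=
    continuousOn_fst.add (continuousOn_const.mul
      (hK.comp continuousOn_snd fun w hw => hw))
  exact h1.isOpen_inter_preimage (hI.preimage continuous_snd) hJ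

/-- A region over which the conformal factor separates and the metric is a perfect fluid. -/
structure FluidBox (σ b c : ℝ) (F P : ℝ → ℝ) (S : ℝ → ℝ → ℝ) (G H K : ℝ → ℝ) (I J : Set ℝ) :
    Prop where
  hI : OpenInterval I
  hJ : OpenInterval J
  cont_K : ContinuousOn K I
  reg : Regular F P S (box b K I J)
  fluid : ∀ w ∈ box b K I J, ∃ m wt wx, FluidEq σ b c (jetAt F P S w) m wt wx
  sep : Separated b P S (box b K I J) G H K
  gam_eq : ∀ x ∈ I, logDeriv G x = gam c (qFun b P) (logDeriv F) x

theorem FluidBox.mono (hB : FluidBox σ b c F P S G H K I J) (hI : I' ⊆ I) (hJ : J' ⊆ J)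
    (hI' : OpenInterval I') (hJ' : OpenInterval J') : FluidBox σ b c F P S G H K I' J' where
  hI := hI'
  hJ := hJ'
  cont_K := hB.cont_K.mono hI
  reg := hB.reg.mono (box_mono hI hJ) (isOpen_box hI'.isOpen hJ'.isOpen (hB.cont_K.mono hI))
  fluid := fun w hw => hB.fluid w (box_mono hI hJ hw)
  sep := hB.sep.mono (box_mono hI hJ)
  gam_eq := fun x hx => hB.gam_eq x (hI hx)

theorem FluidBox.reduced (hB : FluidBox σ b c F P S G H K I J) (hb : b ≠ 0) :
    Reduced b c I J (qFun b P) (logDeriv F) (dotLog H) (ddotLog H) where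
  hI := hB.hI
  hJ := hB.hJ
  smooth_q := fun x hx => by
    obtain ⟨u, hu⟩ := hB.hJ.isConnected.nonempty
    exact hB.reg.contDiffAt_qFun (mem_box hx hu)
  smooth_f := fun x hx => by
    obtain ⟨u, hu⟩ := hB.hJ.isConnected.nonempty
    exact contDiffAt_logDeriv (hB.reg.smooth_F _ (mem_box hx hu))
      (hB.reg.F_pos _ (mem_box hx hu)).ne'
  cont_h := fun u hu => by
    obtain ⟨x, hx⟩ := hB.hI.isConnected.nonempty
    have h1 := hB.sep.smooth_H _ (mem_box hx hu)
    have h2 := (hB.sep.factors_ne hB.reg (mem_box hx hu)).2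
    rw [sub_add_cancel] at h1 h2
    exact ((contDiffAt_deriv h1).continuousAt.div h1.continuousAt h2).continuousWithinAt
  q_ne := fun x hx => by
    obtain ⟨u, hu⟩ := hB.hJ.isConnected.nonempty
    exact hB.sep.qFun_ne hB.reg hb (mem_box hx hu)
  fluid := fun x hx u hu j hj => by
    have hw := mem_box (b := b) (K := K) hx hu
    have h1 := hB.sep.jetAt_eq hB.reg hb hw
    obtain ⟨m, wt, wx, hf⟩ := hB.fluid _ hw
    have h2 : deriv (logDeriv G) x = deriv (gam c (qFun b P) (logDeriv F)) x := by
      refine Filter.EventuallyEq.deriv_eq ?_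
      filter_upwards [hB.hI.eventually hx] with y hy using hB.gam_eq y hy
    simp only [sub_add_cancel] at h1
    rw [hB.gam_eq x hx, h2, ← hj] at h1
    rw [h1] at hf
    refine ⟨by rw [hf.Y_eq, hf.Z_eq, hf.X_eq]; ring, fun h => ?_⟩
    rw [hf.Y_eq, hf.Z_eq] at h
    have := hf.timelike
    rw [mul_left_cancel₀ hf.m_ne h, sub_self, mul_zero] at this
    exact lt_irrefl _ this

/-- A perfect fluid separates near a point with `P' ≠ 0`. -/
theorem Regular.exists_fluidBox (hR : Regular F P S U) (hb : b ≠ 0)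
    (hF : ∀ w ∈ U, ∃ m wt wx, FluidEq σ b c (jetAt F P S w) m wt wx) {w₀ : ℝ × ℝ} (hw₀ : w₀ ∈ U)
    (hq₀ : qFun b P w₀.2 ≠ 0) :
    ∃ G H K I J, box b K I J ⊆ U ∧ FluidBox σ b c F P S G H K I J := by
  obtain ⟨t₀, x₀⟩ := w₀
  simp only at hq₀
  have hev : ∀ᶠ w in 𝓝 (t₀, x₀), w ∈ U ∧ qFun b P w.2 ≠ 0 := by
    refine Filter.Eventually.and (hR.isOpen.mem_nhds hw₀) ?_
    have h1 : ContinuousAt (fun w : ℝ × ℝ => qFun b P w.2) (t₀, x₀) :=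
      ContinuousAt.comp (g := qFun b P) (hR.contDiffAt_qFun hw₀).continuousAt continuousAt_snd
    exact h1.eventually_ne hq₀
  obtain ⟨δ, hδ, hball⟩ := Metric.eventually_nhds_iff_ball.1 hev
  have hin : ∀ {t x : ℝ}, |t - t₀| < δ → |x - x₀| < δ → (t, x) ∈ U ∧ qFun b P x ≠ 0 := by
    intro t x ht hx
    refine hball (t, x) ?_
    rw [Metric.mem_ball, Prod.dist_eq, max_lt_iff]
    exact ⟨ht, hx⟩
  have ht₀ : |t₀ - t₀| < δ := by simpa using hδ
  set B := Metric.ball x₀ δ with hB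
  have hBI : OpenInterval B :=
    ⟨Metric.isOpen_ball, (convex_ball x₀ δ).isConnected (Metric.nonempty_ball.2 hδ)⟩
  have hxB : x₀ ∈ B := Metric.mem_ball_self hδ
  have sq : ∀ x ∈ B, ContDiffAt ℝ ∞ (qFun b P) x := fun x hx =>
    hR.contDiffAt_qFun (hin ht₀ hx).1
  have sf : ∀ x ∈ B, ContDiffAt ℝ ∞ (logDeriv F) x := fun x hx =>
    contDiffAt_logDeriv (hR.smooth_F _ (hin ht₀ hx).1) (hR.F_pos _ (hin ht₀ hx).1).ne'
  have q0 : ∀ x ∈ B, qFun b P x ≠ 0 := fun x hx => (hin ht₀ hx).2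
  obtain ⟨K, hK0, hK⟩ := hBI.exists_primitive hxB (γ := fun x => 1 / (b * qFun b P x))
    fun x hx => contDiffAt_const.div (contDiffAt_const.mul (sq x hx)) (mul_ne_zero hb (q0 x hx))
  obtain ⟨Γ, hΓ0, hΓ⟩ := hBI.exists_primitive hxB (γ := gam c (qFun b P) (logDeriv F))
    fun x hx => (((contDiffAt_deriv (sq x hx)).add contDiffAt_const).add
      ((sq x hx).mul (sf x hx))).div (contDiffAt_const.mul (sq x hx))
        (mul_ne_zero two_ne_zero (q0 x hx))
  have hKev : ∀ᶠ x in 𝓝 x₀, x ∈ B ∧ |b * K x| < δ / 2 := by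
    refine (hBI.eventually hxB).and ?_
    have h1 : ContinuousAt (fun x => |b * K x|) x₀ :=
      ((hK x₀ hxB).1.continuousAt.const_mul b).abs
    refine h1.eventually_lt_const ?_
    simp [hK0, hδ]
  obtain ⟨A, hA, hAo, hxA⟩ := mem_nhds_iff.1 hKev
  obtain ⟨I, hIA, hI, hxI⟩ := exists_openInterval_subset hAo hxA
  have hIB : ∀ x ∈ I, x ∈ B := fun x hx => (hA (hIA hx)).1
  set J := Metric.ball t₀ (δ / 2) with hJ
  have hJI : OpenInterval J :=
    ⟨Metric.isOpen_ball, (convex_ball t₀ _).isConnected (Metric.nonempty_ball.2 (by positivity))⟩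
  have hsub : box b K I J ⊆ U := by
    rintro ⟨t, x⟩ ⟨hx, hu⟩
    have h1 := (hA (hIA hx)).2
    have h2 : |t + b * K x - t₀| < δ / 2 := hu
    refine (hin ?_ (hIB x hx)).1
    rw [abs_lt] at h1 h2 ⊢
    constructor <;> linarith
  have cK : ContinuousOn K I := fun x hx => (hK x (hIB x hx)).1.continuousAt.continuousWithinAt
  have dG : ∀ x ∈ B, HasDerivAt (fun x => Real.exp (Γ x))
      (Real.exp (Γ x) * gam c (qFun b P) (logDeriv F) x) x := fun x hx => (hΓ x hx).1.exp
  have hS : ∀ w ∈ box b K I J,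
      S w.1 w.2 = Real.exp (Γ w.2) * S (w.1 + b * K w.2) x₀ := by
    rintro ⟨t, x⟩ ⟨hx, hu⟩
    simp only at hx hu ⊢
    set u := t + b * K x with hu'
    have h0 : ∀ y ∈ I, HasDerivAt (fun y => S (u - b * K y) y / Real.exp (Γ y)) 0 y := by
      intro y hy
      have hw := hsub (mem_box (b := b) (K := K) hy hu)
      have hpl := ((hR.contDiffAt_plane hw).differentiableAt (by simp)).hasFDerivAt
      have hKy := (hK y (hIB y hy)).1
      have h1 : HasDerivAt (fun y => ((u - b * K y, y) : ℝ × ℝ))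
          (-(b * (1 / (b * qFun b P y))), 1) y := by
        refine HasDerivAt.prodMk ?_ (hasDerivAt_id y)
        simpa using (hKy.const_mul b).const_sub u
      have h2 := (HasFDerivAt.comp_hasDerivAt (f := fun y => (u - b * K y, y)) y hpl h1).fun_div
        (dG y (hIB y hy)) (Real.exp_ne_zero _)
      refine h2.congr_deriv ?_
      have hdec : fderiv ℝ (plane S) (u - b * K y, y) (-(b * (1 / (b * qFun b P y))), 1) =
          -(1 / qFun b P y) * dt (plane S) (u - b * K y, y) + dx (plane S) (u - b * K y, y) := by
        have h3 : ((-(b * (1 / (b * qFun b P y))), 1) : ℝ × ℝ) =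
            (-(1 / qFun b P y)) • ((1 : ℝ), (0 : ℝ)) + ((0 : ℝ), (1 : ℝ)) := by
          simp; field_simp
        rw [h3, map_add, map_smul, smul_eq_mul, dt, dx]
      obtain ⟨m, wt, wx, hf⟩ := hF _ hw
      have ha := hf.aniso
      have hp := hR.plane_ne hw
      have hq := q0 y (hIB y hy)
      have hl : deriv (logDeriv P) y = b * deriv (qFun b P) y := by
        rw [logDeriv_eq_mul_qFun hb]
        exact ((((sq y (hIB y hy)).differentiableAt (by simp)).hasDerivAt).const_mul b).deriv
      have hl' : logDeriv P y = b * qFun b P y := by rw [logDeriv_eq_mul_qFun hb]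
      simp only [Jet.aniso, jetAt, hl, hl'] at ha
      rw [hdec]
      simp only [Function.comp, gam]
      rw [div_eq_zero_iff]
      left
      generalize dt (plane S) (u - b * K y, y) = D at *
      generalize dx (plane S) (u - b * K y, y) = E at *
      generalize plane S (u - b * K y, y) = p at *
      generalize Real.exp (Γ y) = g at *
      generalize deriv (qFun b P) y = q' at *
      generalize qFun b P y = q at *
      field_simp at ha ⊢
      rw [mul_zero, mul_eq_zero, or_iff_right hb] at ha
      linear_combination -g * ha
    have h1 := hI.const_of_hasDerivAt_zero h0 hx hxI
    simp only [hK0, hΓ0, mul_zero, sub_zero, Real.exp_zero, div_one] at h1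
    rw [← h1, hu']
    field_simp
    rw [add_sub_cancel_right]
  refine ⟨fun x => Real.exp (Γ x), fun u => S u x₀, K, I, J, hsub, hI, hJI, cK,
    hR.mono hsub (isOpen_box hI.isOpen hJI.isOpen cK), fun w hw => hF w (hsub hw), ?_, ?_⟩
  · refine ⟨fun w hw h => ?_, fun w hw => ?_, fun w hw => ?_, fun w hw => ?_, hS⟩
    · refine q0 w.2 (hIB _ hw.1) ?_
      simp [qFun, logDeriv_apply, h]
    · refine (hK w.2 (hIB _ hw.1)).1.congr_deriv ?_
      simp only [qFun, logDeriv_apply]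
      field_simp
    · exact (hΓ w.2 (hIB _ hw.1)).2.exp
    · have h1 : (w.1 + b * K w.2, x₀) ∈ U := by
        have := hsub (mem_box (b := b) (K := K) hxI hw.2)
        rwa [hK0, mul_zero, sub_zero] at this
      exact ContDiffAt.comp (g := plane S) (w.1 + b * K w.2) (hR.contDiffAt_plane h1)
        (contDiffAt_id.prodMk contDiffAt_const)
  · intro x hx
    rw [logDeriv_apply, (dG x (hIB x hx)).deriv]
    field_simp

end G2Fluid
end

noncomputable section

namespace G2Fluid

open Filter Topology

variable {σ b c : ℝ} {F P : ℝ → ℝ} {S : ℝ → ℝ → ℝ} {U : Set (ℝ × ℝ)} {G H K : ℝ → ℝ}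
  {I J : Set ℝ}

/-! ### Homothetic metrics and the four families over a box -/

theorem Regular.isHomothetic_of_st (hR : Regular F P S U) {k : ℝ}
    (h : ∀ w ∈ U, (jetAt F P S w).st = k) :
    IsHomotheticSpacetime (metricA σ b c F P S) (cylinder U) := by
  refine ⟨1, 0, (c + b) / 2, (c - b) / 2, -k, Or.inl one_ne_zero, fun X hX i j => ?_⟩
  have h1 := hR.isConformalKilling_ckv (σ := σ) (b := b) (c := c) X hX i j
  have h2 := scaleFactor_eq hR hX
  have h3 : dt (plane S) (X 0, X 1) / plane S (X 0, X 1) = k := h _ hX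
  simp only [confT, h3] at h2
  simpa only [h2, ckv] using h1

theorem Regular.isHomothetic_of_qFun (hR : Regular F P S U) (hb : b ≠ 0)
    (hF : ∀ w ∈ U, ∃ m wt wx, FluidEq σ b c (jetAt F P S w) m wt wx)
    (hq : ∀ w ∈ U, qFun b P w.2 = 0) :
    IsHomotheticSpacetime (metricA σ b c F P S) (cylinder U) := by
  refine hR.isHomothetic_of_st (k := -(c / 2)) fun w hw => ?_
  obtain ⟨m, wt, wx, hf⟩ := hF w hw
  have hl : ∀ w ∈ U, logDeriv P w.2 = 0 := fun w hw => by
    rw [logDeriv_eq_mul_qFun hb]; simp [hq w hw]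
  have hl' : deriv (logDeriv P) w.2 = 0 := by
    have h1 : logDeriv P =ᶠ[𝓝 w.2] fun _ => 0 := by
      filter_upwards [IsOpen.eventually_snd hR.isOpen hw] with y hy using hl _ hy
    rw [h1.deriv_eq, deriv_const]
  have ha := hf.aniso
  have e1 : (jetAt F P S w).l = 0 := hl w hw
  have e2 : (jetAt F P S w).l₁ = 0 := hl'
  rw [Jet.aniso, e1, e2] at ha
  apply mul_left_cancel₀ hb
  linear_combination ha / 2

theorem FluidBox.jet_st (hB : FluidBox σ b c F P S G H K I J) (hb : b ≠ 0) {w : ℝ × ℝ}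
    (hw : w ∈ box b K I J) : (jetAt F P S w).st = dotLog H (w.1 + b * K w.2) := by
  rw [hB.sep.jetAt_eq hB.reg hb hw, sepJet]

theorem FluidBox.jet_sx (hB : FluidBox σ b c F P S G H K I J) (hb : b ≠ 0) {w : ℝ × ℝ}
    (hw : w ∈ box b K I J) : (jetAt F P S w).sx =
      gam c (qFun b P) (logDeriv F) w.2 + (jetAt F P S w).st / qFun b P w.2 := by
  rw [hB.sep.jetAt_eq hB.reg hb hw, sepJet, ← hB.gam_eq _ hw.1]

theorem FluidBox.isHomothetic_of_dotLog (hB : FluidBox σ b c F P S G H K I J) (hb : b ≠ 0)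
    {k : ℝ} (hk : ∀ u ∈ J, dotLog H u = k) :
    IsHomotheticSpacetime (metricA σ b c F P S) (cylinder (box b K I J)) :=
  hB.reg.isHomothetic_of_st fun _ hw => (hB.jet_st hb hw).trans (hk _ hw.2)

theorem FluidBox.isHomothetic_of_const (hB : FluidBox σ b c F P S G H K I J) (hb : b ≠ 0)
    {k l : ℝ} (hk : ∀ x ∈ I, qFun b P x = k ∧ logDeriv F x = l) :
    IsHomotheticSpacetime (metricA σ b c F P S) (cylinder (box b K I J)) := by
  refine ⟨-(1 / k), 1, -((b + c) / (2 * k)) - (l - b * k) / 2, (b - c) / (2 * k) - (l + b * k) / 2,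
    -((c + k * l) / (2 * k)), Or.inr one_ne_zero, fun X hX i j => ?_⟩
  have hX1 : X 1 ∈ I := hX.1
  have h1 := hB.jet_sx hb hX
  have dq : deriv (qFun b P) (X 1) = 0 := by
    have h1 : qFun b P =ᶠ[𝓝 (X 1)] fun _ => k := by
      filter_upwards [hB.hI.eventually hX1] with y hy using (hk y hy).1
    rw [h1.deriv_eq, deriv_const]
  have hq := hB.sep.qFun_ne hB.reg hb hX
  simp only at h1 hq
  rw [gam, dq, (hk _ hX1).1, (hk _ hX1).2] at h1
  rw [(hk _ hX1).1] at hq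
  have h2 : confX S (X 0, X 1) = -(jetAt F P S (X 0, X 1)).sx := rfl
  have h3 : confT S (X 0, X 1) = -(jetAt F P S (X 0, X 1)).st := rfl
  have h4 : logDeriv P (X 1) = b * k := by
    rw [logDeriv_eq_mul_qFun hb]; simp [(hk _ hX1).1]
  rw [lieDerivMetric_linField hB.reg hX]
  congr 2
  fin_cases i <;> simp [logGrad, grad2, h2, h3, h1, h4, (hk _ hX1).2] <;> field_simp <;> ring

theorem exists_sign (hb : b ^ 2 = c ^ 2) : ∃ s : ℝ, (s = 1 ∨ s = -1) ∧ c = s * b := by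
  rcases sq_eq_sq_iff_eq_or_eq_neg.1 hb with h | h
  · exact ⟨1, Or.inl rfl, by rw [h]; ring⟩
  · exact ⟨-1, Or.inr rfl, by rw [h]; ring⟩

theorem FluidBox.solutionA (hB : FluidBox σ b c F P S G H K I J) (hb : b ≠ 0) {n : ℝ}
    (hn : n ^ 2 - 2 * c * n + b ^ 2 ≠ 0)
    (hx : ∀ x ∈ I, 1 - qFun b P x ^ 2 ≠ 0 ∧ deriv (qFun b P) x = n * (1 - qFun b P x ^ 2) ∧
      logDeriv F x = (2 * n - c) * qFun b P x)
    (hu : ∀ u ∈ J, (c ^ 2 - n ^ 2) * (c ^ 2 - 2 * c * n + b ^ 2) +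
      4 * ((n - c) ^ 3 + 3 * c * (n - c) ^ 2 + c * (b ^ 2 - c ^ 2)) * dotLog H u +
      4 * (c - n) ^ 2 * dotLog H u ^ 2 + 4 * (n ^ 2 - 2 * c * n + b ^ 2) * ddotLog H u = 0) :
    SolutionA b c F P S (box b K I J) := by
  refine ⟨n, _, _, _, G, H, K, hn, rfl, rfl, rfl, hB.sep, fun w hw => ?_⟩
  obtain ⟨h1, h2, h3⟩ := hx _ hw.1
  have hq := hB.sep.qFun_ne hB.reg hb hw
  refine ⟨fun h => h1 (by rw [h, sub_self]), h2, h3, ?_, ?_⟩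
  · rw [hB.gam_eq _ hw.1, gam, h2, h3]
    field_simp
    ring
  · have h4 := hu _ hw.2
    generalize n ^ 2 - 2 * c * n + b ^ 2 = N at *
    field_simp
    linear_combination h4

theorem FluidBox.solutionB (hB : FluidBox σ b c F P S G H K I J) (hb : b ≠ 0) {k : ℝ}
    (hbc : b ^ 2 = c ^ 2) (hk : k ≠ c)
    (hx : ∀ x ∈ I, 1 - qFun b P x ^ 2 ≠ 0 ∧ deriv (qFun b P) x = c * (1 - qFun b P x ^ 2) ∧
      logDeriv F x = (2 * (k - c) + c * qFun b P x ^ 2) / qFun b P x)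
    (hu : ∀ u ∈ J, -(3 * c ^ 2 / 4) * (c - k) + c / 2 * (-c + 4 * k) * dotLog H u +
      k * dotLog H u ^ 2 + dotLog H u * ddotLog H u + 3 / 2 * c * ddotLog H u = 0) :
    SolutionB b c F P S (box b K I J) := by
  obtain ⟨s, hs, hc⟩ := exists_sign hbc
  refine ⟨s, k, G, H, K, hs, hc, hk, hB.sep, fun w hw => ?_⟩
  obtain ⟨h1, h2, h3⟩ := hx _ hw.1
  have hq := hB.sep.qFun_ne hB.reg hb hw
  refine ⟨fun h => h1 (by rw [h, sub_self]), h2, h3, ?_, ?_⟩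
  · rw [hB.gam_eq _ hw.1, gam, h2, h3]
    field_simp
    ring
  · have h4 := hu _ hw.2
    have hs2 : s ^ 2 = 1 := by rcases hs with rfl | rfl <;> norm_num
    rw [hc] at h4
    unfold quadraticODE
    linear_combination h4 + (3 / 4 * b ^ 2 * (s * b - k) +
      b ^ 2 / 2 * dotLog H (w.1 + b * K w.2)) * hs2

theorem FluidBox.solutionC (hB : FluidBox σ b c F P S G H K I J) (hb : b ≠ 0) {k : ℝ}
    (hc : c ≠ 0) (hk : b ^ 2 + c ^ 2 - 2 * c * k = 0)
    (hx : ∀ x ∈ I, 1 - qFun b P x ^ 2 ≠ 0 ∧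
      deriv (qFun b P) x = b ^ 2 / c * (1 - qFun b P x ^ 2) ∧
      logDeriv F x = b ^ 2 / c * qFun b P x)
    (hu : ∀ u ∈ J, k * dotLog H u + ddotLog H u = 0) :
    SolutionC b c F P S (box b K I J) := by
  refine ⟨k, G, H, K, hc, hk, hB.sep, fun w hw => ?_⟩
  obtain ⟨h1, h2, h3⟩ := hx _ hw.1
  have hq := hB.sep.qFun_ne hB.reg hb hw
  refine ⟨fun h => h1 (by rw [h, sub_self]), h2, h3, ?_, hu _ hw.2⟩
  rw [hB.gam_eq _ hw.1, gam, h2, h3]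
  field_simp
  linear_combination hk

theorem FluidBox.solutionD (hB : FluidBox σ b c F P S G H K I J) (hb : b ≠ 0) {k : ℝ}
    (hbc : b ^ 2 = c ^ 2) (hk : k ≠ c)
    (hx : ∀ x ∈ I, deriv (qFun b P) x = 4 * k - 3 * c - c * qFun b P x ^ 2 ∧
      logDeriv F x = c * qFun b P x)
    (hu : ∀ u ∈ J, c / 2 * (2 * k - c) * dotLog H u + k * dotLog H u ^ 2 +
      dotLog H u * ddotLog H u + (k - c / 2) * ddotLog H u = 0) :
    SolutionD b c F P S (box b K I J) := by
  obtain ⟨s, hs, hc⟩ := exists_sign hbc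
  refine ⟨s, k, G, H, K, hs, hc, hk, hB.sep, fun w hw => ?_⟩
  obtain ⟨h2, h3⟩ := hx _ hw.1
  have hq := hB.sep.qFun_ne hB.reg hb hw
  refine ⟨h2, h3, ?_, ?_⟩
  · rw [hB.gam_eq _ hw.1, gam, h2, h3]
    field_simp
    ring
  · have h4 := hu _ hw.2
    have hs2 : s ^ 2 = 1 := by rcases hs with rfl | rfl <;> norm_num
    rw [hc] at h4
    unfold quadraticODE
    linear_combination h4 + b ^ 2 / 2 * dotLog H (w.1 + b * K w.2) * hs2

end G2Fluid
end

noncomputable section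

namespace G2Fluid

open Filter Topology

variable {σ b c : ℝ} {F P : ℝ → ℝ} {S : ℝ → ℝ → ℝ} {U : Set (ℝ × ℝ)} {G H K : ℝ → ℝ}
  {I J : Set ℝ}

/-! ### The FLRW case -/

/-- The Jacobian of `(η, R cos ψ, R sin ψ, p)` in terms of the derivatives of `η`, `R`, `ψ`
and `p`. -/
def polarJacobian (ηt ηx Rt Rx R C s ν₂ ν₃ μ₂ μ₃ : ℝ) : Matrix (Fin 4) (Fin 4) ℝ :=
  !![ηt, ηx, 0, 0;
    Rt * C, Rx * C, -(R * s * ν₂), -(R * s * ν₃);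
    Rt * s, Rx * s, R * C * ν₂, R * C * ν₃;
    0, 0, μ₂, μ₃]

theorem polarJacobian_pullback {ηt ηx Rt Rx R C s ν₂ ν₃ μ₂ μ₃ A e d₂ d₃ : ℝ}
    (hC : C ^ 2 + s ^ 2 = 1) (htt : -ηt ^ 2 + Rt ^ 2 = -e * σ) (hxx : -ηx ^ 2 + Rx ^ 2 = e * σ)
    (htx : -(ηt * ηx) + Rt * Rx = 0) (h₂ : R ^ 2 * ν₂ ^ 2 + μ₂ ^ 2 = e * d₂)
    (h₃ : R ^ 2 * ν₃ ^ 2 + μ₃ ^ 2 = e * d₃) (h₂₃ : R ^ 2 * ν₂ * ν₃ + μ₂ * μ₃ = 0) :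
    (polarJacobian ηt ηx Rt Rx R C s ν₂ ν₃ μ₂ μ₃)ᵀ *
      (A • Matrix.diagonal ![-1, 1, 1, 1]) *
      polarJacobian ηt ηx Rt Rx R C s ν₂ ν₃ μ₂ μ₃ =
    (A * e) • Matrix.diagonal ![-σ, σ, d₂, d₃] := by
  ext i j
  simp only [Matrix.mul_apply, Matrix.smul_apply, Matrix.transpose_apply, Fin.sum_univ_four,
    polarJacobian, Matrix.diagonal_apply, smul_eq_mul]
  fin_cases i <;> fin_cases j <;> simp
  · linear_combination A * htt + A * Rt ^ 2 * hC
  · linear_combination A * htx + A * Rt * Rx * hC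
  · ring
  · ring
  · linear_combination A * htx + A * Rt * Rx * hC
  · linear_combination A * hxx + A * Rx ^ 2 * hC
  · ring
  · ring
  · ring
  · ring
  · linear_combination A * h₂ + A * R ^ 2 * ν₂ ^ 2 * hC
  · linear_combination A * h₂₃ + A * R ^ 2 * ν₂ * ν₃ * hC
  · ring
  · ring
  · linear_combination A * h₂₃ + A * R ^ 2 * ν₂ * ν₃ * hC
  · linear_combination A * h₃ + A * R ^ 2 * ν₃ ^ 2 * hC

/-- The map `(η, R cos ψ, R sin ψ, p)` with `η = e^{ct} u(x)`, `R = e^{ct} v(x)`,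
`ψ = ν₂ y + ν₃ z` and `p = μ₂ y + μ₃ z`. -/
def polarMap (c : ℝ) (u v : ℝ → ℝ) (ν₂ ν₃ μ₂ μ₃ : ℝ) (X : Coord) : Coord :=
  ![Real.exp (c * X 0) * u (X 1),
    Real.exp (c * X 0) * v (X 1) * Real.cos (ν₂ * X 2 + ν₃ * X 3),
    Real.exp (c * X 0) * v (X 1) * Real.sin (ν₂ * X 2 + ν₃ * X 3),
    μ₂ * X 2 + μ₃ * X 3]

theorem contDiffAt_polarMap {u v : ℝ → ℝ} {ν₂ ν₃ μ₂ μ₃ : ℝ} {X : Coord}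
    (hu : ContDiffAt ℝ ∞ u (X 1)) (hv : ContDiffAt ℝ ∞ v (X 1)) :
    ContDiffAt ℝ ∞ (polarMap c u v ν₂ ν₃ μ₂ μ₃) X := by
  have hp : ∀ i : Fin 4, ContDiffAt ℝ ∞ (fun Y : Coord => Y i) X := fun i =>
    (contDiff_apply ℝ ℝ i).contDiffAt
  have hu' : ContDiffAt ℝ ∞ (fun Y : Coord => u (Y 1)) X := ContDiffAt.comp (g := u) X hu (hp 1)
  have hv' : ContDiffAt ℝ ∞ (fun Y : Coord => v (Y 1)) X := ContDiffAt.comp (g := v) X hv (hp 1)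
  have he : ContDiffAt ℝ ∞ (fun Y : Coord => Real.exp (c * Y 0)) X :=
    (contDiffAt_const.mul (hp 0)).exp
  have hψ : ContDiffAt ℝ ∞ (fun Y : Coord => ν₂ * Y 2 + ν₃ * Y 3) X :=
    (contDiffAt_const.mul (hp 2)).add (contDiffAt_const.mul (hp 3))
  rw [contDiffAt_pi]
  intro i
  fin_cases i
  · exact he.mul hu'
  · exact (he.mul hv').mul hψ.cos
  · exact (he.mul hv').mul hψ.sin
  · exact (contDiffAt_const.mul (hp 2)).add (contDiffAt_const.mul (hp 3))

theorem toMatrix_fderiv_polarMap {u v : ℝ → ℝ} {u' v' ν₂ ν₃ μ₂ μ₃ : ℝ} {X : Coord}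
    (hu : HasDerivAt u u' (X 1)) (hv : HasDerivAt v v' (X 1)) :
    LinearMap.toMatrix' (fderiv ℝ (polarMap c u v ν₂ ν₃ μ₂ μ₃) X).toLinearMap =
      polarJacobian (c * Real.exp (c * X 0) * u (X 1)) (Real.exp (c * X 0) * u')
        (c * Real.exp (c * X 0) * v (X 1)) (Real.exp (c * X 0) * v')
        (Real.exp (c * X 0) * v (X 1)) (Real.cos (ν₂ * X 2 + ν₃ * X 3))
        (Real.sin (ν₂ * X 2 + ν₃ * X 3)) ν₂ ν₃ μ₂ μ₃ := by
  set M := polarJacobian (c * Real.exp (c * X 0) * u (X 1)) (Real.exp (c * X 0) * u')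
        (c * Real.exp (c * X 0) * v (X 1)) (Real.exp (c * X 0) * v')
        (Real.exp (c * X 0) * v (X 1)) (Real.cos (ν₂ * X 2 + ν₃ * X 3))
        (Real.sin (ν₂ * X 2 + ν₃ * X 3)) ν₂ ν₃ μ₂ μ₃ with hM
  have hp : ∀ i : Fin 4, HasFDerivAt (fun Y : Coord => Y i)
      (ContinuousLinearMap.proj (R := ℝ) (φ := fun _ : Fin 4 => ℝ) i) X := fun i =>
    (ContinuousLinearMap.proj (R := ℝ) (φ := fun _ : Fin 4 => ℝ) i).hasFDerivAt
  have hu' := HasDerivAt.comp_hasFDerivAt (h₂ := u) X hu (hp 1)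
  have hv' := HasDerivAt.comp_hasFDerivAt (h₂ := v) X hv (hp 1)
  have he := ((hp 0).const_mul c).exp
  have hψ := ((hp 2).const_mul ν₂).add ((hp 3).const_mul ν₃)
  have key : HasFDerivAt (polarMap c u v ν₂ ν₃ μ₂ μ₃)
      (LinearMap.toContinuousLinearMap (Matrix.toLin' M)) X := by
    rw [hasFDerivAt_pi']
    intro i
    fin_cases i
    · refine (he.mul hu').congr_fderiv ?_
      ext Y
      simp [hM, polarJacobian, dotProduct, Fin.sum_univ_four]
      ring
    · refine ((he.mul hv').mul hψ.cos).congr_fderiv ?_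
      ext Y
      simp [hM, polarJacobian, dotProduct, Fin.sum_univ_four]
      ring
    · refine ((he.mul hv').mul hψ.sin).congr_fderiv ?_
      ext Y
      simp [hM, polarJacobian, dotProduct, Fin.sum_univ_four]
      ring
    · refine (((hp 2).const_mul μ₂).add ((hp 3).const_mul μ₃)).congr_fderiv ?_
      ext Y
      simp [hM, polarJacobian, dotProduct, Fin.sum_univ_four]
  rw [key.fderiv]
  simp

theorem robertsonWalker_flat (a : ℝ → ℝ) (X : Coord) :
    robertsonWalker 0 a X = a (X 0) ^ 2 • Matrix.diagonal ![-1, 1, 1, 1] := by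
  unfold robertsonWalker
  congr 2
  funext i
  fin_cases i <;> simp <;> rfl

/-- Flatness of the metric conformal to `metricA`, in the form of a polar map. -/
theorem isFLRW_of_polarMap {u v a : ℝ → ℝ} {ν₂ ν₃ μ₂ μ₃ : ℝ}
    (hu : ∀ w ∈ U, ContDiffAt ℝ ∞ u w.2) (hv : ∀ w ∈ U, ContDiffAt ℝ ∞ v w.2)
    (ha : ∀ w ∈ U, ContDiffAt ℝ ∞ a (Real.exp (c * w.1) * u w.2) ∧
      0 < a (Real.exp (c * w.1) * u w.2) ∧
      a (Real.exp (c * w.1) * u w.2) ^ 2 * Real.exp (c * w.1) ^ 2 = 1 / S w.1 w.2 ^ 2)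
    (hu' : ∀ w ∈ U, deriv u w.2 = c * v w.2) (hv' : ∀ w ∈ U, deriv v w.2 = c * u w.2)
    (huv : ∀ w ∈ U, c ^ 2 * (u w.2 ^ 2 - v w.2 ^ 2) = σ)
    (h₂ : ∀ w ∈ U, (Real.exp (c * w.1) * v w.2) ^ 2 * ν₂ ^ 2 + μ₂ ^ 2 =
      Real.exp (c * w.1) ^ 2 * (F w.2 / P w.2 * Real.exp (-(b + c) * w.1)))
    (h₃ : ∀ w ∈ U, (Real.exp (c * w.1) * v w.2) ^ 2 * ν₃ ^ 2 + μ₃ ^ 2 =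
      Real.exp (c * w.1) ^ 2 * (F w.2 * P w.2 * Real.exp ((b - c) * w.1)))
    (hν : ν₂ * ν₃ = 0) (hμ : μ₂ * μ₃ = 0) :
    IsFLRW (metricA σ b c F P S) (cylinder U) := by
  refine ⟨0, a, polarMap c u v ν₂ ν₃ μ₂ μ₃, fun X hX =>
    (contDiffAt_polarMap (hu _ hX) (hv _ hX)).contDiffWithinAt, fun X hX => ?_⟩
  obtain ⟨ha₁, ha₂, ha₃⟩ := ha _ hX
  have du := ((hu _ hX).differentiableAt (by simp)).hasDerivAt
  have dv := ((hv _ hX).differentiableAt (by simp)).hasDerivAt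
  rw [hu' _ hX] at du
  rw [hv' _ hX] at dv
  have h := huv _ hX
  refine ⟨ha₁, ha₂, by norm_num, ?_⟩
  rw [toMatrix_fderiv_polarMap du dv, robertsonWalker_flat,
    polarJacobian_pullback (σ := σ) (Real.cos_sq_add_sin_sq _) ?_ ?_ ?_ (h₂ _ hX) (h₃ _ hX) ?_]
  · rw [metricA]
    congr 1
    exact ha₃.symm
  · simp only at h ⊢; linear_combination -Real.exp (c * X 0) ^ 2 * h
  · simp only at h ⊢; linear_combination Real.exp (c * X 0) ^ 2 * h
  · simp only; ring
  · linear_combination (Real.exp (c * X 0) * v (X 1)) ^ 2 * hν + hμ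

theorem FluidBox.isFLRW (hB : FluidBox σ b c F P S G H K I J) (hb : b ≠ 0)
    (hσ : σ = 1 ∨ σ = -1) (hbc : b ^ 2 = c ^ 2)
    (hx : ∀ x ∈ I, 1 - qFun b P x ^ 2 ≠ 0 ∧ deriv (qFun b P) x = c * (1 - qFun b P x ^ 2) ∧
      logDeriv F x = c * qFun b P x) :
    IsFLRW (metricA σ b c F P S) (cylinder (box b K I J)) := by
  set q := qFun b P with hq
  obtain ⟨u₀, hu₀⟩ := hB.hJ.isConnected.nonempty
  obtain ⟨x₀, hx₀⟩ := hB.hI.isConnected.nonempty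
  have hc : c ≠ 0 := by
    rintro rfl
    exact hb (by simpa using hbc)
  have hσ2 : σ * σ = 1 := by rcases hσ with h | h <;> norm_num [h]
  have mem : ∀ {x}, x ∈ I → (u₀ - b * K x, x) ∈ box b K I J := fun hx => mem_box hx hu₀
  have q0 : ∀ x ∈ I, q x ≠ 0 := fun x hx => hB.sep.qFun_ne hB.reg hb (mem hx)
  have F0 : ∀ x ∈ I, 0 < F x := fun x hx => hB.reg.F_pos _ (mem hx)
  have P0 : ∀ x ∈ I, 0 < P x := fun x hx => hB.reg.P_pos _ (mem hx)
  have sq : ∀ x ∈ I, ContDiffAt ℝ ∞ q x := fun x hx => hB.reg.contDiffAt_qFun (mem hx)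
  have sF : ∀ x ∈ I, ContDiffAt ℝ ∞ F x := fun x hx => hB.reg.smooth_F _ (mem hx)
  have dq : ∀ x ∈ I, HasDerivAt q (c * (1 - q x ^ 2)) x := fun x hx' => by
    rw [← (hx x hx').2.1]; exact ((sq x hx').differentiableAt (by simp)).hasDerivAt
  have dF : ∀ x ∈ I, HasDerivAt F (c * q x * F x) x := fun x hx' => by
    rw [← (hx x hx').2.2]; exact hasDerivAt_logDeriv_self (sF x hx') (F0 x hx').ne'
  have dP : ∀ x ∈ I, HasDerivAt P (b * q x * P x) x := fun x hx' => by
    have := hasDerivAt_logDeriv_self (hB.reg.smooth_P _ (mem hx')) (P0 x hx').ne'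
    rwa [logDeriv_eq_mul_qFun hb] at this
  have dqF : ∀ x ∈ I, HasDerivAt (fun x => q x * F x) (c * F x) x := fun x hx' =>
    ((dq x hx').fun_mul (dF x hx')).congr_deriv (by ring)
  obtain ⟨E, hE, dE⟩ : ∃ E : ℝ → ℝ, (∀ x, E x = Real.exp (c * (b * K x))) ∧
      ∀ x ∈ I, HasDerivAt E (E x * (c / q x)) x := by
    refine ⟨fun x => Real.exp (c * (b * K x)), fun _ => rfl, fun x hx' => ?_⟩
    have h1 := (((hB.sep.hasDerivAt_K _ (mem hx')).const_mul b).const_mul c).exp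
    refine h1.congr_deriv ?_
    have := hB.sep.deriv_P_ne _ (mem hx')
    simp only [hq, qFun, logDeriv_apply] at this ⊢
    field_simp
  have E0 : ∀ x, E x ≠ 0 := fun x => by rw [hE]; exact Real.exp_ne_zero _
  have hγ : ∀ y ∈ I, logDeriv G y = c / q y := fun y hy => by
    have := q0 y hy
    rw [hB.gam_eq y hy, gam, ← hq, (hx y hy).2.1, (hx y hy).2.2]
    field_simp
    ring
  obtain ⟨d, hd⟩ : ∃ d, ∀ x ∈ I, q x * F x = d * E x := by
    refine ⟨q x₀ * F x₀ / E x₀, fun x hx' => ?_⟩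
    rw [← hB.hI.const_of_hasDerivAt_zero (φ := fun x => q x * F x / E x) (fun y hy => ?_) hx' hx₀]
    · field_simp [E0 x]
    · refine ((dqF y hy).fun_div (dE y hy) (E0 y)).congr_deriv ?_
      have := q0 y hy
      field_simp
      ring
  obtain ⟨g, hg⟩ : ∃ g, ∀ x ∈ I, G x = g * E x := by
    refine ⟨G x₀ / E x₀, fun x hx' => ?_⟩
    rw [← hB.hI.const_of_hasDerivAt_zero (φ := fun x => G x / E x) (fun y hy => ?_) hx' hx₀]
    · field_simp [E0 x]
    · have dG := hasDerivAt_logDeriv_self (hB.sep.smooth_G _ (mem hy))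
        (hB.sep.factors_ne hB.reg (mem hy)).1
      simp only [hγ y hy] at dG
      refine (dG.fun_div (dE y hy) (E0 y)).congr_deriv ?_
      ring
  obtain ⟨Δ, hΔ⟩ : ∃ Δ, ∀ x ∈ I, F x ^ 2 * (q x ^ 2 - 1) = Δ := by
    refine ⟨F x₀ ^ 2 * (q x₀ ^ 2 - 1), fun x hx' => ?_⟩
    refine hB.hI.const_of_hasDerivAt_zero (φ := fun x => F x ^ 2 * (q x ^ 2 - 1))
      (fun y hy => ?_) hx' hx₀
    exact (((dF y hy).fun_pow 2).fun_mul (((dq y hy).fun_pow 2).sub_const 1)).congr_deriv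
      (by ring)
  have hσΔ : 0 < σ * Δ := by
    obtain ⟨m, wt, wx, hf⟩ := hB.fluid _ (mem hx₀)
    have hjet := hB.sep.jetAt_eq hB.reg hb (mem hx₀)
    simp only [sub_add_cancel] at hjet
    have hγ' : deriv (logDeriv G) x₀ = -c / q x₀ ^ 2 * (c * (1 - q x₀ ^ 2)) := by
      refine HasDerivAt.deriv ?_
      refine ((hasDerivAt_const_div c (q0 x₀ hx₀)).comp x₀ (dq x₀ hx₀)).congr_of_eventuallyEq ?_
      filter_upwards [hB.hI.eventually hx₀] with y hy using hγ y hy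
    have hf' : deriv (logDeriv F) x₀ = c * (c * (1 - q x₀ ^ 2)) := by
      refine HasDerivAt.deriv ?_
      refine ((dq x₀ hx₀).const_mul c).congr_of_eventuallyEq ?_
      filter_upwards [hB.hI.eventually hx₀] with y hy using (hx y hy).2.2
    rw [hγ x₀ hx₀, hγ', hf', ← hq, (hx x₀ hx₀).2.1, (hx x₀ hx₀).2.2] at hjet
    rw [hjet] at hf
    have hYZ := hf.Z_eq
    have hY := hf.Y_eq
    have hq0 := q0 x₀ hx₀
    have hrel : wt ^ 2 = q x₀ ^ 2 * wx ^ 2 := by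
      apply mul_left_cancel₀ hf.m_ne
      rw [← hY, show m * (q x₀ ^ 2 * wx ^ 2) = q x₀ ^ 2 * (m * wx ^ 2) by ring, ← hYZ]
      simp only [Jet.Y, Jet.Z, Jet.press, sepJet, hbc]
      field_simp
      linear_combination q x₀ ^ 4 * hbc
    have ht := hf.timelike
    rw [hrel] at ht
    have h1 : 0 < σ * (q x₀ ^ 2 - 1) * wx ^ 2 := by linarith [ht]
    have h2 : 0 < σ * (q x₀ ^ 2 - 1) := pos_of_mul_pos_left h1 (sq_nonneg wx)
    rw [← hΔ x₀ hx₀]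
    have := mul_pos h2 (pow_pos (F0 x₀ hx₀) 2)
    linarith [this]
  set ρ := Real.sqrt (σ * Δ) with hρ
  have hρ0 : 0 < ρ := Real.sqrt_pos.2 hσΔ
  have hρ2 : ρ ^ 2 = σ * Δ := Real.sq_sqrt hσΔ.le
  have d0 : d ≠ 0 := fun h => by
    have := hd x₀ hx₀
    rw [h, zero_mul] at this
    exact mul_ne_zero (q0 x₀ hx₀) (F0 x₀ hx₀).ne' this
  have g0 : g ≠ 0 := fun h => by
    have := hg x₀ hx₀
    rw [h, zero_mul] at this
    exact (hB.sep.factors_ne hB.reg (mem hx₀)).1 this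
  set u : ℝ → ℝ := fun x => q x * F x / (c * ρ) with hu
  set v : ℝ → ℝ := fun x => F x / (c * ρ) with hv
  set arg : ℝ → ℝ := fun s => Real.log (c * ρ / d * s) / c with harg
  set a : ℝ → ℝ := fun s => |1 / (g * Real.exp (c * arg s) * H (arg s))| with ha
  have arg_eq : ∀ w ∈ box b K I J, c * ρ / d * (Real.exp (c * w.1) * u w.2) =
      Real.exp (c * (w.1 + b * K w.2)) := by
    intro w hw
    rw [mul_add, Real.exp_add]
    simp only [hu]
    rw [hd _ hw.1, ← hE]
    field_simp
  have arg_eq' : ∀ w ∈ box b K I J, arg (Real.exp (c * w.1) * u w.2) = w.1 + b * K w.2 := by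
    intro w hw
    simp only [harg]
    rw [arg_eq w hw, Real.log_exp]
    field_simp
  have hua : ∀ w ∈ box b K I J, ContDiffAt ℝ ∞ a (Real.exp (c * w.1) * u w.2) ∧
      0 < a (Real.exp (c * w.1) * u w.2) ∧
      a (Real.exp (c * w.1) * u w.2) ^ 2 * Real.exp (c * w.1) ^ 2 = 1 / S w.1 w.2 ^ 2 := by
    intro w hw
    have hH0 := (hB.sep.factors_ne hB.reg hw).2
    have hH := hB.sep.smooth_H w hw
    rw [← arg_eq' w hw] at hH hH0
    have hne : g * Real.exp (c * arg (Real.exp (c * w.1) * u w.2)) *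
        H (arg (Real.exp (c * w.1) * u w.2)) ≠ 0 :=
      mul_ne_zero (mul_ne_zero g0 (Real.exp_ne_zero _)) hH0
    have hsm : ContDiffAt ℝ ∞ arg (Real.exp (c * w.1) * u w.2) := by
      refine ContDiffAt.div_const (ContDiffAt.log (contDiffAt_const.mul contDiffAt_id) ?_) c
      change c * ρ / d * (Real.exp (c * w.1) * u w.2) ≠ 0
      rw [arg_eq w hw]
      exact Real.exp_ne_zero _
    refine ⟨?_, abs_pos.2 (one_div_ne_zero hne), ?_⟩
    · exact ContDiffAt.abs (contDiffAt_const.div ((contDiffAt_const.mul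
        (contDiffAt_const.mul hsm).exp).mul (ContDiffAt.comp (g := H) _ hH hsm)) hne)
        (one_div_ne_zero hne)
    · simp only [ha, sq_abs]
      rw [arg_eq' w hw] at hne hH0 ⊢
      rw [hB.sep.S_eq w hw, hg _ hw.1, hE, mul_add, Real.exp_add]
      field_simp
  have hu' : ∀ w ∈ box b K I J, deriv u w.2 = c * v w.2 := fun w hw => by
    rw [((dqF w.2 hw.1).div_const (c * ρ)).deriv]
    simp only [hv]; ring
  have hv' : ∀ w ∈ box b K I J, deriv v w.2 = c * u w.2 := fun w hw => by
    rw [((dF w.2 hw.1).div_const (c * ρ)).deriv]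
    simp only [hu]; ring
  have huv : ∀ w ∈ box b K I J, c ^ 2 * (u w.2 ^ 2 - v w.2 ^ 2) = σ := fun w hw => by
    have h1 := hΔ w.2 hw.1
    simp only [hu, hv]
    field_simp
    rw [hρ2]
    linear_combination h1 - Δ * hσ2
  have su : ∀ w ∈ box b K I J, ContDiffAt ℝ ∞ u w.2 := fun w hw =>
    ((sq _ hw.1).mul (sF _ hw.1)).div_const _
  have sv : ∀ w ∈ box b K I J, ContDiffAt ℝ ∞ v w.2 := fun w hw => (sF _ hw.1).div_const _
  rcases sq_eq_sq_iff_eq_or_eq_neg.1 hbc with h | h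
  · obtain ⟨k, hk⟩ : ∃ k, ∀ x ∈ I, P x = k * F x := by
      refine ⟨P x₀ / F x₀, fun x hx' => ?_⟩
      rw [← hB.hI.const_of_hasDerivAt_zero (φ := fun x => P x / F x) (fun y hy => ?_) hx' hx₀]
      · have := (F0 x hx').ne'
        field_simp
      · refine ((dP y hy).fun_div (dF y hy) (F0 y hy).ne').congr_deriv ?_
        rw [h]; ring
    have hk0 : 0 < k := pos_of_mul_pos_left (hk x₀ hx₀ ▸ P0 x₀ hx₀) (F0 x₀ hx₀).le
    have hs := Real.sq_sqrt hk0.le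
    have hs0 := Real.sqrt_pos.2 hk0
    refine isFLRW_of_polarMap (ν₂ := 0) (ν₃ := c * ρ * Real.sqrt k) (μ₂ := 1 / Real.sqrt k)
      (μ₃ := 0) su sv hua hu' hv' huv (fun w hw => ?_) (fun w hw => ?_) (by ring) (by ring)
    · have hF := (F0 _ hw.1).ne'
      have he : Real.exp (c * w.1) ^ 2 * Real.exp (-(b + c) * w.1) = 1 := by
        rw [← Real.exp_nat_mul, ← Real.exp_add, h]
        simp; ring
      rw [hk _ hw.1, div_pow, hs]
      generalize Real.exp (-(b + c) * w.1) = e at *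
      field_simp
      linear_combination -he
    · have he : Real.exp ((b - c) * w.1) = 1 := by rw [h]; simp
      rw [hk _ hw.1, he, mul_pow (c * ρ), hs]
      simp only [hv]
      field_simp
      ring
  · obtain ⟨k, hk⟩ : ∃ k, ∀ x ∈ I, P x = k / F x := by
      refine ⟨P x₀ * F x₀, fun x hx' => ?_⟩
      rw [← hB.hI.const_of_hasDerivAt_zero (φ := fun x => P x * F x) (fun y hy => ?_) hx' hx₀]
      · have := (F0 x hx').ne'
        field_simp
      · refine ((dP y hy).fun_mul (dF y hy)).congr_deriv ?_
        rw [h]; ring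
    have hk0 : 0 < k := by
      have := hk x₀ hx₀ ▸ P0 x₀ hx₀
      exact (div_pos_iff_of_pos_right (F0 x₀ hx₀)).1 this
    have hs := Real.sq_sqrt hk0.le
    have hs0 := Real.sqrt_pos.2 hk0
    refine isFLRW_of_polarMap (ν₂ := c * ρ / Real.sqrt k) (ν₃ := 0) (μ₂ := 0)
      (μ₃ := Real.sqrt k) su sv hua hu' hv' huv (fun w hw => ?_) (fun w hw => ?_)
      (by ring) (by ring)
    · have hF := (F0 _ hw.1).ne'
      have he : Real.exp (-(b + c) * w.1) = 1 := by rw [h]; simp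
      rw [hk _ hw.1, he, div_pow (c * ρ), hs]
      simp only [hv]
      field_simp
      ring
    · have hF := (F0 _ hw.1).ne'
      have he : Real.exp (c * w.1) ^ 2 * Real.exp ((b - c) * w.1) = 1 := by
        rw [← Real.exp_nat_mul, ← Real.exp_add, h]
        simp; ring
      rw [hk _ hw.1, hs]
      generalize Real.exp ((b - c) * w.1) = e at *
      field_simp
      linear_combination -k * he

/-- Every perfect fluid is locally FLRW, homothetic, or belongs to one of the four families. -/
theorem Regular.exists_classification (hR : Regular F P S U) (hσ : σ = 1 ∨ σ = -1) (hb : b ≠ 0)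
    (hF : ∀ X ∈ cylinder U, IsPerfectFluidAt (metricA σ b c F P S) X) (hU : U.Nonempty) :
    ∃ W ⊆ U, IsOpen W ∧ W.Nonempty ∧ (IsFLRW (metricA σ b c F P S) (cylinder W) ∨
      IsHomotheticSpacetime (metricA σ b c F P S) (cylinder W) ∨
      ∃ f : Family, f.Holds b c F P S W) := by
  have hF' : ∀ w ∈ U, ∃ m wt wx, FluidEq σ b c (jetAt F P S w) m wt wx := fun w hw =>
    hR.fluidEq hσ (X := ![w.1, w.2, 0, 0]) hw (hF _ hw)
  by_cases hq : ∀ w ∈ U, qFun b P w.2 = 0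
  · exact ⟨U, subset_rfl, hR.isOpen, hU, Or.inr (Or.inl (hR.isHomothetic_of_qFun hb hF' hq))⟩
  push Not at hq
  obtain ⟨w₀, hw₀, hq₀⟩ := hq
  obtain ⟨G, H, K, I, J, hsub, hB⟩ := hR.exists_fluidBox hb hF' hw₀ hq₀
  obtain ⟨I', hI', J', hJ', hI'o, hJ'o, hout⟩ := (hB.reduced hb).outcome hb
  have hB' := hB.mono hI' hJ' hI'o hJ'o
  obtain ⟨x, hx⟩ := hI'o.isConnected.nonempty
  obtain ⟨u, hu⟩ := hJ'o.isConnected.nonempty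
  refine ⟨box b K I' J', (box_mono hI' hJ').trans hsub, hB'.reg.isOpen, ⟨_, mem_box hx hu⟩, ?_⟩
  cases hout with
  | const_h k hk => exact Or.inr (Or.inl (hB'.isHomothetic_of_dotLog hb hk))
  | const_q k l hk => exact Or.inr (Or.inl (hB'.isHomothetic_of_const hb hk))
  | flrw hbc hx => exact Or.inl (hB'.isFLRW hb hσ hbc hx)
  | solA n hn hx hu => exact Or.inr (Or.inr ⟨.A, hB'.solutionA hb hn hx hu⟩)
  | solB k hbc hk hx hu => exact Or.inr (Or.inr ⟨.B, hB'.solutionB hb hbc hk hx hu⟩)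
  | solC k hc hk hx hu => exact Or.inr (Or.inr ⟨.C, hB'.solutionC hb hc hk hx hu⟩)
  | solD k hbc hk hx hu => exact Or.inr (Or.inr ⟨.D, hB'.solutionD hb hbc hk hx hu⟩)

end G2Fluid
end

open G2Fluid in
theorem mainTheorem5 :
    -- `k` is a conformal Killing vector with scale factor `-S_{,t}/S`
    (∀ (σ b c : ℝ) (F P : ℝ → ℝ) (S : ℝ → ℝ → ℝ) (U : Set (ℝ × ℝ)),
      (σ = 1 ∨ σ = -1) → Regular F P S U →
      IsConformalKilling (metricA σ b c F P S) (cylinder U) (ckv b c)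
        (fun X => scaleFactor S (X 0) (X 1))) ∧
    -- every perfect fluid with `b ≠ 0` is locally FLRW, homothetic, or in one of the families
    (∀ (σ b c : ℝ) (F P : ℝ → ℝ) (S : ℝ → ℝ → ℝ) (U : Set (ℝ × ℝ)),
      (σ = 1 ∨ σ = -1) → b ≠ 0 → Regular F P S U →
      (∀ X ∈ cylinder U, IsPerfectFluidAt (metricA σ b c F P S) X) →
      ∀ V ⊆ U, IsOpen V → V.Nonempty → ∃ W ⊆ V, IsOpen W ∧ W.Nonempty ∧
        (IsFLRW (metricA σ b c F P S) (cylinder W) ∨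
          IsHomotheticSpacetime (metricA σ b c F P S) (cylinder W) ∨
          ∃ f : Family, f.Holds b c F P S W)) ∧
    -- conversely, every member of the families solves the field equations
    (∀ (σ b c : ℝ) (F P : ℝ → ℝ) (S : ℝ → ℝ → ℝ) (U : Set (ℝ × ℝ)) (f : Family),
      (σ = 1 ∨ σ = -1) → b ≠ 0 → Regular F P S U → f.Holds b c F P S U →
      ∀ X ∈ cylinder U, IsFluidFormAt (metricA σ b c F P S) X) ∧
    -- the families are mutually exclusive
    (∀ (b c : ℝ) (F P : ℝ → ℝ) (S : ℝ → ℝ → ℝ) (U : Set (ℝ × ℝ)) (f f' : Family),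
      b ≠ 0 → Regular F P S U → U.Nonempty →
      f.Holds b c F P S U → f'.Holds b c F P S U → f = f') ∧
    -- each family contains perfect fluids for which `k` is proper
    (∀ f : Family, ∃ (σ b c : ℝ) (F P : ℝ → ℝ) (S : ℝ → ℝ → ℝ) (U : Set (ℝ × ℝ)),
      (σ = 1 ∨ σ = -1) ∧ b ≠ 0 ∧ Regular F P S U ∧ IsConnected U ∧ f.Holds b c F P S U ∧
      (∀ X ∈ cylinder U, IsPerfectFluidAt (metricA σ b c F P S) X) ∧ IsProper S U) := by
  refine ⟨fun σ b c F P S U _ hR => hR.isConformalKilling_ckv,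
    fun σ b c F P S U hσ hb hR hF V hV ho hne =>
      (hR.mono hV ho).exists_classification hσ hb (fun X hX => hF X (hV hX)) hne,
    fun σ b c F P S U f hσ hb hR h X hX => h.isFluidFormAt hσ hb hR hX,
    fun b c F P S U f f' hb hR hU h h' => h.unique hb hR hU h', Family.exists_properFluid⟩
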